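/- Let $X$ be a topological space, $\mathcal A$ a sheaf of (associative, unital) rings on $X$ (for instance a sheaf of algebras over a commutative ring), and $\hbar$ a global section of $\mathcal A$ contained in the center of $\mathcal A$. "Module" means left module. Put $\mathcal A_0=\mathcal A/\hbar\mathcal A$. An $\mathcal A$-module $\mathcal M$ is $\hbar$-complete if the canonical morphism $\mathcal M\to\varprojlim_n \mathcal M/\hbar^n\mathcal M$ is an isomorphism. A module over a sheaf of rings $\mathcal R$ is coherent if it is locally finitely generated and the kernel of every locally defined morphism to it from a module locally of finite presentation is locally finitely generated. The sheaf of rings $\mathcal R$ is left Noetherian if it is coherent as a left module over itself, every stalk $\mathcal R_x$ is a left Noetherian ring, and for every open $U\subset X$, every filtrant family of coherent submodules of the left $\mathcal R|_U$-module $\mathcal R|_U$ is locally stationary. Assume: (a) $\mathcal A$ has no $\hbar$-torsion, i.e. $\hbar\colon\mathcal A\to\mathcal A$ is injective; (b) $\mathcal A$ is $\hbar$-complete; (c) $\mathcal A_0$ is a left Noetherian sheaf of rings; (d) $\mathfrak B$ is a base of open subsets of $X$ such that $H^n(U;\mathcal F)=0$ for every $U\in\mathfrak B$, every coherent $\mathcal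 A_0|_U$-module $\mathcal F$ and every $n>0$. Then: (i) $\mathcal A$ is a left Noetherian sheaf of rings. (ii) A locally finitely generated $\mathcal A$-module $\mathcal M$ is coherent if and only if $\hbar^n\mathcal M/\hbar^{n+1}\mathcal M$ is a coherent $\mathcal A_0$-module for every $n\ge 0$. (iii) Every coherent $\mathcal A$-module is $\hbar$-complete. (iv) An $\mathcal A$-module $\mathcal M$ is coherent if and only if it is $\hbar$-complete and $\hbar^n\mathcal M/\hbar^{n+1}\mathcal M$ is a coherent $\mathcal A_0$-module for every $n\ge 0$. (v) For every coherent $\mathcal A$-module $\mathcal M$, every $U\in\mathfrak B$ and every $j>0$, $H^j(U;\mathcal M)=0$. -/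

import Mathlib

open CategoryTheory CategoryTheory.Limits TopologicalSpace Opposite

universe u

noncomputable section

namespace FormalDeformation

section Coherence

variable {C : Type u} [SmallCategory C] {J : GrothendieckTopology C} {R : Sheaf J RingCat.{u}}

/-- A sheaf of (left) modules is coherent if it is locally finitely generated and pseudo-coherent:
the kernel of every locally defined morphism `v : N ⟶ M`, with `N` locally of finite presentation,
is locally finitely generated. -/
structure IsCoherent (M : SheafOfModules.{u} R) : Prop where
  isFiniteType : M.IsFiniteType
  pseudoCoherent : ∀ (U : C) (N : SheafOfModules.{u} (R.over U)) (v : N ⟶ M.over U),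
    N.IsFinitePresentation → (kernel v).IsFiniteType

end Coherence

variable {X : TopCat.{u}}

/-- A sheaf of rings `R` on `X` is left Noetherian if it is coherent as a left module over itself,
all its stalks are left Noetherian rings, and every filtrant family of coherent submodules of
`R` over an open set `U` (that is, of coherent left ideals) is locally stationary.
The submodules of a module over `U` form, up to bijection, a set in the universe `u`, so that it
suffices to consider families indexed by directed preorders in this universe. -/
structure IsLeftNoetherian (R : Sheaf (Opens.grothendieckTopology X) RingCat.{u}) : Prop where
  isCoherent : IsCoherent (SheafOfModules.unit R)
  isNoetherianRing_stalk : ∀ x : X, IsNoetherianRing (TopCat.Presheaf.stalk (C := RingCat.{u}) (X := X) R.obj x)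
  locally_stationary : ∀ (U : Opens X) (I : Type u) [Preorder I] [IsDirectedOrder I] [Nonempty I]
    (N : I →o Subobject ((SheafOfModules.unit R).over U)),
    (∀ i, IsCoherent (N i : SheafOfModules.{u} (R.over U))) →
    ∀ x ∈ U, ∃ (W : Opens X) (hW : W ≤ U), x ∈ W ∧ ∃ i₀ : I, ∀ (j : I) (hj : i₀ ≤ j),
      IsIso ((SheafOfModules.overMap R (homOfLE hW)).map
        (Subobject.ofLE (N i₀) (N j) (N.monotone hj)))

/-- The cohomology `Hⁿ(U; F)` of a sheaf of modules `F` on an open set `U`. -/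
abbrev cohomology {U : Opens X} {R : Sheaf (Opens.grothendieckTopology X) RingCat.{u}}
    (F : SheafOfModules.{u} (R.over U)) (n : ℕ) : Type u :=
  Sheaf.H ((SheafOfModules.toSheaf (R.over U)).obj F) n

/-- A global section of a sheaf of rings which belongs to its center. -/
structure CentralSection (A : Sheaf (Opens.grothendieckTopology X) RingCat.{u}) where
  /-- the section -/
  val : A.obj.obj (op ⊤)
  central : ∀ (U : Opens X) (a : A.obj.obj (op U)),
    A.obj.map (homOfLE le_top).op val * a = a * A.obj.map (homOfLE le_top).op val

namespace CentralSection

variable {A : Sheaf (Opens.grothendieckTopology X) RingCat.{u}} (ħ : CentralSection A)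

/-- The restriction of the section to an open set. -/
def res (U : (Opens X)ᵒᵖ) : A.obj.obj U :=
  A.obj.map (homOfLE (le_top : U.unop ≤ ⊤)).op ħ.val

lemma map_res {U V : (Opens X)ᵒᵖ} (f : U ⟶ V) : A.obj.map f (ħ.res U) = ħ.res V := by
  unfold res
  rw [← CategoryTheory.comp_apply, ← A.obj.map_comp]
  rfl

lemma res_commute (U : (Opens X)ᵒᵖ) (a : A.obj.obj U) : Commute (ħ.res U) a :=
  ħ.central U.unop a

/-- The ideal `ħ A(U)` of `A(U)`. -/
def ideal (U : (Opens X)ᵒᵖ) : Ideal (A.obj.obj U) := Ideal.span {ħ.res U}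

instance (U : (Opens X)ᵒᵖ) : (ħ.ideal U).IsTwoSided where
  mul_mem_of_left {a} b ha := by
    obtain ⟨c, rfl⟩ := Ideal.mem_span_singleton'.1 ha
    refine Ideal.mem_span_singleton'.2 ⟨c * b, ?_⟩
    rw [mul_assoc, mul_assoc, (ħ.res_commute U b).eq]

lemma ideal_le_comap {U V : (Opens X)ᵒᵖ} (f : U ⟶ V) :
    ħ.ideal U ≤ (ħ.ideal V).comap (A.obj.map f).hom := by
  refine Ideal.span_le.2 (Set.singleton_subset_iff.2 ?_)
  have h := ħ.map_res f
  change (A.obj.map f).hom (ħ.res U) ∈ ħ.ideal V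
  rw [h]
  exact Ideal.subset_span rfl

/-- The presheaf of rings `U ↦ A(U) / ħ A(U)`. -/
def quotientPresheaf : (Opens X)ᵒᵖ ⥤ RingCat.{u} where
  obj U := RingCat.of (A.obj.obj U ⧸ ħ.ideal U)
  map f := RingCat.ofHom (Ideal.quotientMap _ (A.obj.map f).hom (ħ.ideal_le_comap f))
  map_id U := by
    ext x
    simp
  map_comp f g := by
    ext x
    simp

/-- The sheaf of rings `A₀ = A / ħ A`. -/
def quotientSheaf : Sheaf (Opens.grothendieckTopology X) RingCat.{u} :=
  (presheafToSheaf (Opens.grothendieckTopology X) RingCat.{u}).obj ħ.quotientPresheaf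

/-- The projection `A ⟶ A₀`. -/
def toQuotientSheaf : A ⟶ ħ.quotientSheaf where
  hom := { app := fun U => RingCat.ofHom (Ideal.Quotient.mk (ħ.ideal U)) } ≫
    toSheafify (Opens.grothendieckTopology X) ħ.quotientPresheaf

variable (M : SheafOfModules.{u} A)

/-- Multiplication by `ħⁿ`, as an endomorphism of an `A`-module. -/
def mulPow (n : ℕ) : M ⟶ M where
  val := PresheafOfModules.homMk
    { app := fun U => AddCommGrpCat.ofHom
        (DistribSMul.toAddMonoidHom (M.val.obj U) (ħ.res U ^ n))
      naturality := fun U V f => by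
        ext m
        have h : A.obj.map f (ħ.res U ^ n) = ħ.res V ^ n := by rw [map_pow, ħ.map_res]
        have h' := M.val.map_smul f (ħ.res U ^ n) m
        rw [h] at h'
        exact h'.symm }
    (fun U r m => by
      change ħ.res U ^ n • r • m = r • ħ.res U ^ n • m
      rw [← mul_smul, ← mul_smul, ((ħ.res_commute U r).pow_left n).eq])

/-- The submodule `ħⁿ M` of `M`. -/
def powSub (n : ℕ) : Subobject M := imageSubobject (ħ.mulPow M n)

lemma mulPow_add (m n : ℕ) : ħ.mulPow M (m + n) = ħ.mulPow M m ≫ ħ.mulPow M n := by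
  ext U x
  change ħ.res U ^ (m + n) • x = ħ.res U ^ n • ħ.res U ^ m • x
  rw [← mul_smul, ← pow_add, add_comm]

lemma powSub_antitone {m n : ℕ} (h : m ≤ n) : ħ.powSub M n ≤ ħ.powSub M m := by
  obtain ⟨k, rfl⟩ := Nat.exists_eq_add_of_le' h
  have e := ħ.mulPow_add M k m
  unfold powSub
  simp only [e]
  exact imageSubobject_comp_le _ _

/-- The `A`-module `ħⁿ M / ħⁿ⁺¹ M`. -/
def gr (n : ℕ) : SheafOfModules.{u} A :=
  cokernel (Subobject.ofLE (ħ.powSub M (n + 1)) (ħ.powSub M n) (ħ.powSub_antitone M n.le_succ))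

/-- The projective system of the `A`-modules `M / ħⁿ M`. -/
def quotientSystem : ℕᵒᵖ ⥤ SheafOfModules.{u} A where
  obj n := cokernel (ħ.powSub M n.unop).arrow
  map {n m} f := cokernel.desc _ (cokernel.π (ħ.powSub M m.unop).arrow) (by
    rw [← Subobject.ofLE_arrow (ħ.powSub_antitone M (leOfHom f.unop)), Category.assoc,
      cokernel.condition, comp_zero])
  map_id n := by
    rw [← cancel_epi (cokernel.π (ħ.powSub M n.unop).arrow)]
    simp
  map_comp {n m l} f g := by
    rw [← cancel_epi (cokernel.π (ħ.powSub M n.unop).arrow)]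
    simp

/-- The `ħ`-completion of `M`, the limit of the `A`-modules `M / ħⁿ M`. -/
def completion : SheafOfModules.{u} A := limit (ħ.quotientSystem M)

/-- The canonical morphism from `M` to its `ħ`-completion. -/
def toCompletion : M ⟶ ħ.completion M :=
  limit.lift (ħ.quotientSystem M)
    { pt := M
      π := { app := fun n => cokernel.π (ħ.powSub M n.unop).arrow
             naturality := fun n m f => by simp [quotientSystem] } }

/-- `M` has no `ħ`-torsion: `ħ : M ⟶ M` is injective. -/
def HasNoTorsion : Prop := Mono (ħ.mulPow M 1)

/-- `M` is `ħ`-complete: it is isomorphic to its `ħ`-completion by the canonical morphism. -/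
def IsComplete : Prop := IsIso (ħ.toCompletion M)

/-- An `A`-module `N` annihilated by `ħ`, viewed as an `A₀`-module, is coherent: it comes by
restriction of scalars from a coherent `A₀`-module. (As `A ⟶ A₀` is an epimorphism of sheaves of
rings with kernel `ħ A`, such an `A₀`-module structure exists if and only if `ħ N = 0`,
and it is then unique.) -/
def IsCoherentOverQuotient (N : SheafOfModules.{u} A) : Prop :=
  ∃ N₀ : SheafOfModules.{u} ħ.quotientSheaf, IsCoherent N₀ ∧
    Nonempty ((SheafOfModules.restrictScalars ħ.toQuotientSheaf).obj N₀ ≅ N)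

end CentralSection

end FormalDeformation

end

/-! Each `M / ħⁿ M` is an iterated extension of modules over `A₀`, where everything is known; the
difficulty is to pass to the limit. The argument runs on stalks. A sheaf is a family of stalks
together with the families of elements that are sections near a given point, a subsheaf is a family
of submodules of the stalks that is open (`OpenAt`), and `Coh P₀ P₁ x` expresses that `P₁ / P₀` is
coherent near `x`.

Let `P ⊂ M` be such that all quotients `M / (ħⁿ M + P)` are coherent (`QC`). The submodules `{m | ħⁿ
m ∈ ħⁿ⁺¹ M + P}` increase with `n` and contain `ħ M`, so the Noetherian property of `A₀` makes them
locally stationary (`stationary_initial`). Hence, on `ħᴺ M` for some `N`, dividing by `ħ` modulo `P`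
costs only one power of `ħ` (`bounded`). This yields the Artin–Rees inclusion for closed `P`
(`artinRees`) and, if the `M / ħⁿ M` are coherent, the coherence of all `P / ħᵐ P` (`coh_pow`). The
vanishing of `H¹` on the base then allows successive approximation (`approx_step`, `approx`): if `M`
is moreover separated, generators of `P / ħ P` lift to generators of `P` (`ftm_of_coh_pow`,
`ftm_of_closed`).

Conversely, a finitely generated `I ⊂ M` is closed (`closed_of_ftm`). Its closure `J` is finitely
generated by the preceding step and satisfies `J = I + ħ J` (`cl_le`); as `1 - ħ a` is inverted by a
geometric series, `ħ` lies in the Jacobson radical of each stalk and Nakayama's lemma gives `J = I`.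

Applied to free modules and to kernels of maps from them, these facts identify the coherent modules
with the separated modules all of whose quotients `M / ħⁿ M` are coherent (`coh_iff_good`); for
finitely generated modules separatedness is automatic (`Good.of_ftm`), and approximation also gives
completeness (`complete_of_coh`). The Noetherian property of `A` follows by comparing ideals of
initial terms, which contain `ħ` and hence come from `A₀` (`stationary_ideals`,
`isNoetherianRing_stalk`). For cohomology, `M` is the limit of the `M / ħⁿ M`, whose transition maps
are surjective on sections over the base; hence `0 ⟶ M ⟶ ∏ M / ħⁿ M ⟶ ∏ M / ħⁿ M ⟶ 0` is exact, and
countable products of sheaves acyclic on the base are again acyclic there (`acyclic_pi`,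
`acyclic_of_tower`).

The remainder is a dictionary: `Model` links a sheaf of modules to its description by stalks, and
finite generation, coherence, quotients, completeness and change of rings are translated through it.
-/

noncomputable section

namespace FormalDeformation

/-! ### Sheaves described by stalks: finite generation, relations, and coherence of subquotients. -/

section Germs

open Topology Filter

/-- A sheaf of rings on `X`, given by its stalks and by the predicate `IsGerm x s` expressing that
the family `s` of elements of the stalks is a section in a neighbourhood of `x`. -/
structure RGerms (X : Type u) [TopologicalSpace X] where
  /-- the stalks -/
  stalk : X → Type u
  [ring : ∀ x, Ring (stalk x)]
  /-- the families which are sections near a point -/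
  IsGerm : X → (∀ x, stalk x) → Prop
  eventually {x s} : IsGerm x s → ∀ᶠ y in 𝓝 x, IsGerm y s
  exists_germ (x) (a : stalk x) : ∃ s, IsGerm x s ∧ s x = a
  unique {x s t} : IsGerm x s → IsGerm x t → s x = t x → ∀ᶠ y in 𝓝 x, s y = t y
  congr {x s t} : IsGerm x s → (∀ᶠ y in 𝓝 x, s y = t y) → IsGerm x t
  zero (x) : IsGerm x 0
  one (x) : IsGerm x 1
  add {x s t} : IsGerm x s → IsGerm x t → IsGerm x (s + t)
  neg {x s} : IsGerm x s → IsGerm x (-s)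
  mul {x s t} : IsGerm x s → IsGerm x t → IsGerm x (s * t)

attribute [instance] RGerms.ring

variable {X : Type u} [TopologicalSpace X]

/-- A sheaf of left modules over a sheaf of rings, given by its stalks and its local sections. -/
structure MGerms (R : RGerms X) where
  /-- the stalks -/
  stalk : X → Type u
  [grp : ∀ x, AddCommGroup (stalk x)]
  [mod : ∀ x, Module (R.stalk x) (stalk x)]
  /-- the families which are sections near a point -/
  IsGerm : X → (∀ x, stalk x) → Prop
  eventually {x s} : IsGerm x s → ∀ᶠ y in 𝓝 x, IsGerm y s
  exists_germ (x) (a : stalk x) : ∃ s, IsGerm x s ∧ s x = a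
  unique {x s t} : IsGerm x s → IsGerm x t → s x = t x → ∀ᶠ y in 𝓝 x, s y = t y
  congr {x s t} : IsGerm x s → (∀ᶠ y in 𝓝 x, s y = t y) → IsGerm x t
  zero (x) : IsGerm x 0
  add {x s t} : IsGerm x s → IsGerm x t → IsGerm x (s + t)
  smul {x a s} : R.IsGerm x a → IsGerm x s → IsGerm x (fun y => a y • s y)

attribute [instance] MGerms.grp MGerms.mod

variable {R : RGerms X}

lemma RGerms.pow {x : X} {s : ∀ x, R.stalk x} (hs : R.IsGerm x s) (n : ℕ) :
    R.IsGerm x (fun y => s y ^ n) := by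
  induction n with
  | zero =>
    simp only [pow_zero]
    exact R.one x
  | succ n ih =>
    simp only [pow_succ]
    exact R.mul ih hs

/-- A sheaf of rings as a module over itself. -/
@[reducible]
def RGerms.unit (R : RGerms X) : MGerms R where
  stalk := R.stalk
  IsGerm := R.IsGerm
  eventually := R.eventually
  exists_germ := R.exists_germ
  unique := R.unique
  congr := R.congr
  zero := R.zero
  add := R.add
  smul := R.mul

namespace MGerms

variable (E F : MGerms R)

/-- Families of submodules of the stalks. -/
abbrev Fam := ∀ y, Submodule (R.stalk y) (E.stalk y)

variable {E F}

lemma neg {x : X} {s : ∀ x, E.stalk x} (hs : E.IsGerm x s) : E.IsGerm x (-s) := by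
  have := E.smul (R.neg (R.one x)) hs
  simpa [Pi.neg_def] using this

lemma sub {x : X} {s t : ∀ x, E.stalk x} (hs : E.IsGerm x s) (ht : E.IsGerm x t) :
    E.IsGerm x (s - t) := by
  rw [sub_eq_add_neg]
  exact E.add hs (neg ht)

lemma sum {x : X} {ι : Type*} (I : Finset ι) {s : ι → ∀ x, E.stalk x}
    (hs : ∀ i, E.IsGerm x (s i)) : E.IsGerm x (fun y => ∑ i ∈ I, s i y) := by
  classical
  induction I using Finset.induction_on with
  | empty =>
    simp only [Finset.sum_empty]
    exact E.zero x
  | insert i I hi ih =>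
    simp only [Finset.sum_insert hi]
    exact E.add (hs i) ih

lemma comb {x : X} {ι : Type*} [Fintype ι] {c : ι → ∀ x, R.stalk x} {s : ι → ∀ x, E.stalk x}
    (hc : ∀ i, R.IsGerm x (c i)) (hs : ∀ i, E.IsGerm x (s i)) :
    E.IsGerm x (fun y => ∑ i, c i y • s i y) :=
  sum _ fun i => E.smul (hc i) (hs i)

lemma eventually_all {x : X} {ι : Type*} [Finite ι] {s : ι → ∀ x, E.stalk x}
    (hs : ∀ i, E.IsGerm x (s i)) : ∀ᶠ y in 𝓝 x, ∀ i, E.IsGerm y (s i) :=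
  Filter.eventually_all.2 fun i => E.eventually (hs i)

variable (E) in
/-- The module `E ^ ι`. -/
@[reducible]
def pi (ι : Type) [Fintype ι] : MGerms R where
  stalk x := ι → E.stalk x
  IsGerm x s := ∀ i, E.IsGerm x (fun y => s y i)
  eventually h := eventually_all (s := fun i y => _) h
  exists_germ x a := by
    choose s hs ha using fun i => E.exists_germ x (a i)
    exact ⟨fun y i => s i y, hs, funext ha⟩
  unique hs ht h := by
    filter_upwards [Filter.eventually_all.2 fun i => E.unique (hs i) (ht i) (congrFun h i)] with y hy
    exact funext hy
  congr hs h i := E.congr (hs i) (h.mono fun y hy => congrFun hy i)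
  zero x i := E.zero x
  add hs ht i := E.add (hs i) (ht i)
  smul ha hs i := E.smul ha (hs i)

/-- The family of submodules is open at `x`. -/
def OpenAt (P : E.Fam) (x : X) : Prop :=
  ∀ s, E.IsGerm x s → s x ∈ P x → ∀ᶠ y in 𝓝 x, s y ∈ P y

/-- The submodule `P₁` is generated near `x` by `P₀` and finitely many sections. -/
def FTm (P₀ P₁ : E.Fam) (x : X) : Prop :=
  ∃ (ι : Type) (_ : Fintype ι) (s : ι → ∀ y, E.stalk y), (∀ i, E.IsGerm x (s i)) ∧
    ∀ᶠ y in 𝓝 x, P₁ y = P₀ y ⊔ Submodule.span (R.stalk y) (Set.range fun i => s i y)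

/-- The relations modulo `P₀` between sections. -/
def rel (P₀ : E.Fam) {ι : Type} [Fintype ι] (s : ι → ∀ y, E.stalk y) : (R.unit.pi ι).Fam :=
  fun y => (P₀ y).comap (Fintype.linearCombination (R.stalk y) (fun i => s i y))

lemma mem_rel {P₀ : E.Fam} {ι : Type} [Fintype ι] {s : ι → ∀ y, E.stalk y} {y : X}
    {c : ι → R.stalk y} : c ∈ rel P₀ s y ↔ ∑ i, c i • s i y ∈ P₀ y := Iff.rfl

/-- Relations modulo `P₀` between sections of `P₁` near `x` are finitely generated near `x`. -/
def RelAt (P₀ P₁ : E.Fam) (x : X) : Prop :=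
  ∀ (ι : Type) [Fintype ι] (s : ι → ∀ y, E.stalk y), (∀ i, E.IsGerm x (s i)) →
    (∀ᶠ y in 𝓝 x, ∀ i, s i y ∈ P₁ y) → FTm ⊥ (rel P₀ s) x

/-- The subquotient `P₁ / P₀` is coherent near `x`. -/
def Coh (P₀ P₁ : E.Fam) (x : X) : Prop :=
  FTm P₀ P₁ x ∧ ∀ᶠ y in 𝓝 x, OpenAt P₀ y ∧ RelAt P₀ P₁ y

lemma mem_sup_span {A M ι : Type*} [Ring A] [AddCommGroup M] [Module A M] [Fintype ι]
    {P : Submodule A M} {s : ι → M} {m : M} :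
    m ∈ P ⊔ Submodule.span A (Set.range s) ↔ ∃ p ∈ P, ∃ c : ι → A, m = p + ∑ i, c i • s i := by
  rw [Submodule.mem_sup]
  constructor
  · rintro ⟨p, hp, z, hz, rfl⟩
    obtain ⟨c, rfl⟩ := Submodule.mem_span_range_iff_exists_fun A |>.1 hz
    exact ⟨p, hp, c, rfl⟩
  · rintro ⟨p, hp, c, rfl⟩
    exact ⟨p, hp, _, Submodule.mem_span_range_iff_exists_fun A |>.2 ⟨c, rfl⟩, rfl⟩

lemma mem_span_range {A M ι : Type*} [Ring A] [AddCommGroup M] [Module A M] [Fintype ι]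
    {s : ι → M} {m : M} :
    m ∈ Submodule.span A (Set.range s) ↔ ∃ c : ι → A, m = ∑ i, c i • s i := by
  rw [Submodule.mem_span_range_iff_exists_fun A]
  exact ⟨fun ⟨c, h⟩ => ⟨c, h.symm⟩, fun ⟨c, h⟩ => ⟨c, h.symm⟩⟩

/-- The coefficients of an identity at `x` extend to sections, and two sections that agree at `x`
agree nearby, so the identity persists near `x`. -/
lemma germ_mem_range {x : X} {ι : Type} [Fintype ι] {s : ι → ∀ y, E.stalk y} {t : ∀ y, E.stalk y}
    (hs : ∀ i, E.IsGerm x (s i)) (ht : E.IsGerm x t) {c : ι → R.stalk x}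
    (h : t x = ∑ i, c i • s i x) : ∃ d : ι → ∀ y, R.stalk y, (∀ i, R.IsGerm x (d i)) ∧
      (∀ i, d i x = c i) ∧ ∀ᶠ y in 𝓝 x, t y = ∑ i, d i y • s i y := by
  choose d hd hdx using fun i => R.exists_germ x (c i)
  refine ⟨d, hd, hdx, E.unique ht (comb hd hs) ?_⟩
  simp only [hdx, h]

lemma FTm.eventually {P₀ P₁ : E.Fam} {x : X} (h : FTm P₀ P₁ x) : ∀ᶠ y in 𝓝 x, FTm P₀ P₁ y := by
  obtain ⟨ι, _, s, hs, h⟩ := h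
  filter_upwards [eventually_all hs, h.eventually_nhds] with y h1 h2
  exact ⟨ι, ‹_›, s, h1, h2⟩

lemma FTm.le {P₀ P₁ : E.Fam} {x : X} (h : FTm P₀ P₁ x) : ∀ᶠ y in 𝓝 x, P₀ y ≤ P₁ y := by
  obtain ⟨ι, _, s, hs, h⟩ := h
  filter_upwards [h] with y hy
  exact hy ▸ le_sup_left

lemma Coh.le {P₀ P₁ : E.Fam} {x : X} (h : Coh P₀ P₁ x) : ∀ᶠ y in 𝓝 x, P₀ y ≤ P₁ y := h.1.le

lemma Coh.openAt {P₀ P₁ : E.Fam} {x : X} (h : Coh P₀ P₁ x) : OpenAt P₀ x := h.2.self_of_nhds.1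

lemma Coh.relAt {P₀ P₁ : E.Fam} {x : X} (h : Coh P₀ P₁ x) : RelAt P₀ P₁ x := h.2.self_of_nhds.2

lemma OpenAt.congr {P Q : E.Fam} {x : X} (h : OpenAt P x) (e : ∀ᶠ y in 𝓝 x, P y = Q y) :
    OpenAt Q x := fun s hs hx => by
  filter_upwards [h s hs (e.self_of_nhds ▸ hx), e] with y h1 h2
  exact h2 ▸ h1

lemma openAt_bot (x : X) : OpenAt (⊥ : E.Fam) x := fun _ hs hx =>
  E.unique hs (E.zero x) hx

lemma openAt_top (x : X) : OpenAt (⊤ : E.Fam) x :=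
  fun _ _ _ => Eventually.of_forall fun _ => trivial

lemma OpenAt.sup {P Q : E.Fam} {x : X} (hP : OpenAt P x) (hQ : OpenAt Q x) :
    OpenAt (P ⊔ Q) x := fun s hs hx => by
  obtain ⟨p, hp, q, hq, hpq⟩ := Submodule.mem_sup.1 hx
  obtain ⟨p', h1, rfl⟩ := E.exists_germ x p
  obtain ⟨q', h2, rfl⟩ := E.exists_germ x q
  filter_upwards [hP _ h1 hp, hQ _ h2 hq, E.unique hs (E.add h1 h2) hpq.symm] with y h3 h4 h5
  rw [h5]
  exact Submodule.add_mem_sup h3 h4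

lemma OpenAt.inf {P Q : E.Fam} {x : X} (hP : OpenAt P x) (hQ : OpenAt Q x) :
    OpenAt (P ⊓ Q) x := fun s hs hx => (hP s hs hx.1).and (hQ s hs hx.2)

lemma openAt_span {x : X} {ι : Type} [Fintype ι] {s : ι → ∀ y, E.stalk y}
    (hs : ∀ i, E.IsGerm x (s i)) :
    OpenAt (fun y => Submodule.span (R.stalk y) (Set.range fun i => s i y)) x := fun t ht hx => by
  obtain ⟨c, hc⟩ := mem_span_range.1 hx
  obtain ⟨d, -, -, hd⟩ := germ_mem_range hs ht hc
  filter_upwards [hd] with y hy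
  exact mem_span_range.2 ⟨_, hy⟩

lemma FTm.openAt {P₀ P₁ : E.Fam} {x : X} (h : FTm P₀ P₁ x) (h₀ : OpenAt P₀ x) : OpenAt P₁ x := by
  obtain ⟨ι, _, s, hs, h⟩ := h
  exact (h₀.sup (openAt_span hs)).congr (h.mono fun y hy => hy.symm)

lemma FTm.congr {P₀ P₁ Q₀ Q₁ : E.Fam} {x : X} (h : FTm P₀ P₁ x) (h₀ : ∀ᶠ y in 𝓝 x, P₀ y = Q₀ y)
    (h₁ : ∀ᶠ y in 𝓝 x, P₁ y = Q₁ y) : FTm Q₀ Q₁ x := by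
  obtain ⟨ι, _, s, hs, h⟩ := h
  refine ⟨ι, ‹_›, s, hs, ?_⟩
  filter_upwards [h, h₀, h₁] with y h h₀ h₁
  rw [← h₀, ← h₁, h]

lemma RelAt.congr {P₀ P₁ Q₀ Q₁ : E.Fam} {x : X} (h : RelAt P₀ P₁ x)
    (h₀ : ∀ᶠ y in 𝓝 x, P₀ y = Q₀ y) (h₁ : ∀ᶠ y in 𝓝 x, Q₁ y ≤ P₁ y) : RelAt Q₀ Q₁ x := by
  intro ι _ s hs hs₁
  refine (h ι s hs ?_).congr (Eventually.of_forall fun _ => rfl) ?_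
  · filter_upwards [hs₁, h₁] with y h1 h2 i using h2 (h1 i)
  · filter_upwards [h₀] with y hy
    simp only [rel, hy]

lemma Coh.congr {P₀ P₁ Q₀ Q₁ : E.Fam} {x : X} (h : Coh P₀ P₁ x) (h₀ : ∀ᶠ y in 𝓝 x, P₀ y = Q₀ y)
    (h₁ : ∀ᶠ y in 𝓝 x, P₁ y = Q₁ y) : Coh Q₀ Q₁ x := by
  refine ⟨h.1.congr h₀ h₁, ?_⟩
  filter_upwards [h.2, h₀.eventually_nhds, h₁.eventually_nhds] with y h h₀ h₁
  exact ⟨h.1.congr h₀, h.2.congr h₀ (h₁.mono fun _ h => h.ge)⟩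

lemma FTm.refl (P : E.Fam) (x : X) : FTm P P x :=
  ⟨Empty, inferInstance, fun i => i.elim, fun i => i.elim, Eventually.of_forall fun y => by
    simp [Set.range_eq_empty]⟩

lemma ftm_span {x : X} {ι : Type} [Fintype ι] {s : ι → ∀ y, E.stalk y}
    (hs : ∀ i, E.IsGerm x (s i)) (P : E.Fam) :
    FTm P (fun y => P y ⊔ Submodule.span (R.stalk y) (Set.range fun i => s i y)) x :=
  ⟨ι, inferInstance, s, hs, Eventually.of_forall fun _ => rfl⟩

lemma FTm.trans {P₀ P₁ P₂ : E.Fam} {x : X} (h : FTm P₀ P₁ x) (h' : FTm P₁ P₂ x) :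
    FTm P₀ P₂ x := by
  obtain ⟨ι, _, s, hs, h⟩ := h
  obtain ⟨κ, _, t, ht, h'⟩ := h'
  refine ⟨ι ⊕ κ, inferInstance, Sum.elim s t, by rintro (i | i); exacts [hs i, ht i], ?_⟩
  filter_upwards [h, h'] with y h h'
  have : (fun i : ι ⊕ κ => (Sum.elim s t i : ∀ y, E.stalk y) y) =
      Sum.elim (fun i => s i y) (fun i => t i y) := by
    ext (i | i) <;> rfl
  rw [this, Set.Sum.elim_range, Submodule.span_union, ← sup_assoc, ← h, ← h']

lemma FTm.of_le {P₀ P₁ P₂ : E.Fam} {x : X} (h : FTm P₀ P₂ x) (h₀ : ∀ᶠ y in 𝓝 x, P₀ y ≤ P₁ y)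
    (h₁ : ∀ᶠ y in 𝓝 x, P₁ y ≤ P₂ y) : FTm P₁ P₂ x := by
  obtain ⟨ι, _, s, hs, h⟩ := h
  refine ⟨ι, ‹_›, s, hs, ?_⟩
  filter_upwards [h, h₀, h₁] with y h h₀ h₁
  refine le_antisymm (h.le.trans (sup_le_sup_right h₀ _)) (sup_le h₁ (h ▸ le_sup_right))

lemma FTm.sup {P₀ P₁ : E.Fam} {x : X} (h : FTm P₀ P₁ x) (Q : E.Fam) :
    FTm (P₀ ⊔ Q) (P₁ ⊔ Q) x := by
  obtain ⟨ι, _, s, hs, h⟩ := h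
  refine ⟨ι, ‹_›, s, hs, ?_⟩
  filter_upwards [h] with y h
  simp only [Pi.sup_apply, h]
  rw [sup_assoc, sup_assoc, sup_comm (Q y)]

/-- The condition on relations concerns all families of sections, so it passes to any submodule;
only finite generation has to be assumed. -/
lemma Coh.sub {P₀ P₁ P₂ : E.Fam} {x : X} (h : Coh P₀ P₂ x) (h' : FTm P₀ P₁ x)
    (h₁ : ∀ᶠ y in 𝓝 x, P₁ y ≤ P₂ y) : Coh P₀ P₁ x := by
  refine ⟨h', ?_⟩
  filter_upwards [h.2, h₁.eventually_nhds] with y hy h₁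
  exact ⟨hy.1, hy.2.congr (Eventually.of_forall fun _ => rfl) h₁⟩

lemma OpenAt.exists_germs {P : E.Fam} {x : X} (h : OpenAt P x) {ι : Type} [Finite ι]
    (p : ι → E.stalk x) (hp : ∀ i, p i ∈ P x) : ∃ s : ι → ∀ y, E.stalk y,
      (∀ i, E.IsGerm x (s i)) ∧ (∀ i, s i x = p i) ∧ ∀ᶠ y in 𝓝 x, ∀ i, s i y ∈ P y := by
  choose s hs hsx using fun i => E.exists_germ x (p i)
  refine ⟨s, hs, hsx, Filter.eventually_all.2 fun i => h _ (hs i) ?_⟩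
  rw [hsx]
  exact hp i

lemma unique_all {x : X} {ι : Type*} [Finite ι] {s t : ι → ∀ y, E.stalk y}
    (hs : ∀ i, E.IsGerm x (s i)) (ht : ∀ i, E.IsGerm x (t i)) (h : ∀ i, s i x = t i x) :
    ∀ᶠ y in 𝓝 x, ∀ i, s i y = t i y :=
  Filter.eventually_all.2 fun i => E.unique (hs i) (ht i) (h i)

/-- If each generator of the relations is transformed by a family of linear maps, the image
is generated by the transformed generators. -/
lemma FTm.bot_iff {P : E.Fam} {x : X} : FTm ⊥ P x ↔
    ∃ (ι : Type) (_ : Fintype ι) (s : ι → ∀ y, E.stalk y), (∀ i, E.IsGerm x (s i)) ∧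
      ∀ᶠ y in 𝓝 x, P y = Submodule.span (R.stalk y) (Set.range fun i => s i y) := by
  simp [FTm]

/-- `f` sends sections to sections near `x`. -/
def GermMap (f : ∀ y, E.stalk y →ₗ[R.stalk y] F.stalk y) (x : X) : Prop :=
  ∀ᶠ y in 𝓝 x, ∀ s, E.IsGerm y s → F.IsGerm y (fun z => f z (s z))

lemma FTm.map {P₀ P₁ : E.Fam} {x : X} (h : FTm P₀ P₁ x)
    {f : ∀ y, E.stalk y →ₗ[R.stalk y] F.stalk y} (hf : GermMap f x) :
    FTm (fun y => (P₀ y).map (f y)) (fun y => (P₁ y).map (f y)) x := by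
  obtain ⟨ι, _, s, hs, h⟩ := h
  refine ⟨ι, ‹_›, fun i y => f y (s i y), fun i => hf.self_of_nhds _ (hs i), ?_⟩
  filter_upwards [h] with y h
  rw [h, Submodule.map_sup, Submodule.map_span, ← Set.range_comp]
  rfl

lemma OpenAt.comap {P : F.Fam} {x : X} (h : OpenAt P x)
    {f : ∀ y, E.stalk y →ₗ[R.stalk y] F.stalk y} (hf : GermMap f x) :
    OpenAt (fun y => (P y).comap (f y)) x := fun _ hs hx => h _ (hf.self_of_nhds _ hs) hx

lemma OpenAt.map {P : E.Fam} {x : X} (h : OpenAt P x)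
    {f : ∀ y, E.stalk y →ₗ[R.stalk y] F.stalk y} (hf : GermMap f x) :
    OpenAt (fun y => (P y).map (f y)) x := fun t ht hx => by
  obtain ⟨p, hp, hpx⟩ := hx
  obtain ⟨s, hs, rfl⟩ := E.exists_germ x p
  filter_upwards [h s hs hp, F.unique ht (hf.self_of_nhds _ hs) hpx.symm] with y h1 h2
  exact h2 ▸ ⟨_, h1, rfl⟩

/-- The linear map `R ^ ι → E` defined by sections. -/
def lin {ι : Type} [Fintype ι] (s : ι → ∀ y, E.stalk y) (y : X) :
    (R.unit.pi ι).stalk y →ₗ[R.stalk y] E.stalk y :=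
  Fintype.linearCombination (R.stalk y) (fun i => s i y)

lemma lin_apply {ι : Type} [Fintype ι] (s : ι → ∀ y, E.stalk y) (y : X)
    (c : ι → R.stalk y) : lin s y c = ∑ i, c i • s i y := rfl

lemma germMap_lin {ι : Type} [Fintype ι] {s : ι → ∀ y, E.stalk y} {x : X}
    (hs : ∀ i, E.IsGerm x (s i)) : GermMap (lin s) x := by
  filter_upwards [eventually_all hs] with y hy c hc
  exact comb (c := fun i y => c y i) hc hy

lemma range_lin {ι : Type} [Fintype ι] (s : ι → ∀ y, E.stalk y) (y : X) :
    LinearMap.range (lin s y) = Submodule.span (R.stalk y) (Set.range fun i => s i y) := by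
  ext m
  rw [mem_span_range]
  exact ⟨fun ⟨c, h⟩ => ⟨c, h.symm⟩, fun ⟨c, h⟩ => ⟨c, h.symm⟩⟩

/-- The kernel of a map from a finitely generated module to a coherent one. -/
lemma FTm.ker {P₀ P₁ P₂ : E.Fam} {x : X} (h : FTm P₀ P₂ x) (h' : RelAt P₁ P₂ x)
    (h₀ : ∀ᶠ y in 𝓝 x, P₀ y ≤ P₁ y) (h₁ : ∀ᶠ y in 𝓝 x, P₁ y ≤ P₂ y) : FTm P₀ P₁ x := by
  obtain ⟨ι, _, s, hs, h⟩ := h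
  obtain ⟨κ, _, r, hr, hr'⟩ := FTm.bot_iff.1 (h' ι s hs (by
    filter_upwards [h] with y h i
    rw [h]
    exact Submodule.mem_sup_right (Submodule.subset_span ⟨i, rfl⟩)))
  -- The `s i` generate `P₂` modulo `P₀`, and a combination of them lies in `P₁` exactly when its
  -- coefficients form a relation modulo `P₁`; the generating relations `r k` therefore produce
  -- generators of `P₁` modulo `P₀`.
  refine ⟨κ, inferInstance, fun k y => lin s y (r k y),
    fun k => (germMap_lin hs).self_of_nhds _ (hr k), ?_⟩
  filter_upwards [h, hr', h₀, h₁] with y h hr' h₀ h₁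
  have e : (Submodule.span (R.stalk y) (Set.range fun k => lin s y (r k y))) =
      (rel P₁ s y).map (lin s y) := by
    rw [hr', Submodule.map_span, ← Set.range_comp]
    rfl
  rw [e]
  apply le_antisymm
  · intro m hm
    have := h₁ hm
    rw [h] at this
    obtain ⟨p, hp, c, rfl⟩ := mem_sup_span.1 this
    refine Submodule.add_mem_sup hp ⟨c, ?_, rfl⟩
    exact mem_rel.2 ((Submodule.add_mem_iff_right _ (h₀ hp)).1 hm)
  · refine sup_le h₀ ?_
    rintro _ ⟨c, hc, rfl⟩
    exact hc

/-- A relation modulo `P₁` between the `s i` is the `s`-component of a relation modulo `P₀` between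
the `s i` and finitely many generators `p` of `P₁ / P₀`. The latter relations are finitely
generated, hence so are the former. -/
lemma Coh.quot {P₀ P₁ P₂ : E.Fam} {x : X} (h : Coh P₀ P₂ x) (h' : FTm P₀ P₁ x)
    (h₁ : ∀ᶠ y in 𝓝 x, P₁ y ≤ P₂ y) : Coh P₁ P₂ x := by
  refine ⟨h.1.of_le h'.le h₁, ?_⟩
  filter_upwards [h.2, h'.eventually, h₁.eventually_nhds] with y hy h' h₁
  refine ⟨h'.openAt hy.1, ?_⟩
  intro ι _ s hs hsP
  obtain ⟨κ, _, p, hp, hp'⟩ := h'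
  obtain ⟨L, _, r, hr, hr'⟩ := FTm.bot_iff.1 (hy.2 (ι ⊕ κ) (Sum.elim s p)
    (by rintro (i | i); exacts [hs i, hp i]) (by
      filter_upwards [hsP, hp', h₁] with z h1 h2 h3
      rintro (i | i)
      · exact h1 i
      · refine h3 ?_
        rw [h2]
        exact Submodule.mem_sup_right (Submodule.subset_span ⟨i, rfl⟩)))
  refine FTm.bot_iff.2 ⟨L, inferInstance, fun l z i => r l z (Sum.inl i), fun l i => hr l _, ?_⟩
  filter_upwards [hr', hp'] with z hr' hp'
  ext (c : _ → R.stalk z)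
  rw [mem_rel, hp', mem_sup_span, mem_span_range]
  constructor
  · rintro ⟨q, hq, d, e⟩
    have : (Sum.elim c (-d) : ι ⊕ κ → R.stalk z) ∈ rel P₀ (Sum.elim s p) z := by
      rw [mem_rel]
      simp only [Fintype.sum_sum_type, Sum.elim_inl, Sum.elim_inr, e, Pi.neg_apply, neg_smul,
        Finset.sum_neg_distrib, add_neg_cancel_right, hq]
    rw [hr', mem_span_range] at this
    obtain ⟨a, ha⟩ := this
    refine ⟨a, funext fun i => ?_⟩
    have := congrFun ha (Sum.inl i)
    simpa using this
  · rintro ⟨a, rfl⟩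
    have : ∑ l, a l • r l z ∈ rel P₀ (Sum.elim s p) z := by
      rw [hr', mem_span_range]
      exact ⟨a, rfl⟩
    rw [mem_rel] at this
    simp only [Fintype.sum_sum_type, Sum.elim_inl, Sum.elim_inr] at this
    refine ⟨_, this, fun i => - (∑ l, a l • r l z) (Sum.inr i), ?_⟩
    simp

/-- An extension of coherent modules is coherent. -/
lemma Coh.ext {P₀ P₁ P₂ : E.Fam} {x : X} (h : Coh P₀ P₁ x) (h' : Coh P₁ P₂ x) :
    Coh P₀ P₂ x := by
  refine ⟨h.1.trans h'.1, ?_⟩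
  filter_upwards [h.2, h'.2, h.le.eventually_nhds] with y h h' hle
  refine ⟨h.1, fun ι _ s hs hsP => ?_⟩
  obtain ⟨κ, _, r, hr, hr'⟩ := FTm.bot_iff.1 (h'.2 ι s hs hsP)
  -- The `r k` generate the relations modulo `P₁`, so the combinations `lin s (r k)` are sections of
  -- `P₁`. The relations `q l` between these modulo `P₀`, substituted into `r`, generate the
  -- relations between the `s i` modulo `P₀`.
  have ht k : E.IsGerm y (fun z => lin s z (r k z)) := (germMap_lin hs).self_of_nhds _ (hr k)
  obtain ⟨L, _, q, hq, hq'⟩ := FTm.bot_iff.1 (h.2 κ (fun k z => lin s z (r k z)) ht (by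
    filter_upwards [hr'] with z hz k
    change r k z ∈ rel P₁ s z
    rw [hz]
    exact Submodule.subset_span ⟨k, rfl⟩))
  refine FTm.bot_iff.2 ⟨L, inferInstance, fun l z => lin r z (q l z),
    fun l => (germMap_lin hr).self_of_nhds _ (hq l), ?_⟩
  filter_upwards [hr', hq', hle] with z hr' hq' hle
  have e : (Submodule.span (R.stalk z) (Set.range fun l => lin r z (q l z))) =
      (rel P₀ (fun k z => lin s z (r k z)) z).map (lin r z) := by
    rw [hq', Submodule.map_span, ← Set.range_comp]
    rfl
  have e' (d : κ → R.stalk z) : lin s z (lin r z d) = ∑ k, d k • lin s z (r k z) := by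
    rw [lin_apply r, map_sum]
    simp
  rw [e]
  ext (c : _ → R.stalk z)
  constructor
  · intro hc
    have : c ∈ rel P₁ s z := hle hc
    rw [hr', ← range_lin] at this
    obtain ⟨d, rfl⟩ := this
    refine ⟨d, ?_, rfl⟩
    change lin s z (lin r z d) ∈ P₀ z at hc
    rw [e'] at hc
    exact hc
  · rintro ⟨d, hd, rfl⟩
    change lin s z (lin r z d) ∈ P₀ z
    rw [e']
    exact hd

section iso

variable {f : ∀ y, E.stalk y →ₗ[R.stalk y] F.stalk y} {x : X} {P₀ P₁ : E.Fam} {Q₀ Q₁ : F.Fam}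

/-- Sections of `Q₁ = f(P₁) + Q₀` lift, modulo `Q₀`, to sections of `P₁`. This is the tool for
transporting generators and relations along an isomorphism of subquotients. -/
lemma exists_lift {y : X} (hf : GermMap f y) (hP : OpenAt P₁ y) (hQ : OpenAt Q₀ y)
    (h₁ : ∀ᶠ y in 𝓝 y, Q₁ y = (P₁ y).map (f y) ⊔ Q₀ y) {ι : Type} [Fintype ι]
    {t : ι → ∀ y, F.stalk y} (ht : ∀ i, F.IsGerm y (t i)) (htQ : ∀ᶠ y in 𝓝 y, ∀ i, t i y ∈ Q₁ y) :
    ∃ s : ι → ∀ y, E.stalk y, (∀ i, E.IsGerm y (s i)) ∧ (∀ᶠ z in 𝓝 y, ∀ i, s i z ∈ P₁ z) ∧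
      ∀ᶠ z in 𝓝 y, ∀ i, t i z - f z (s i z) ∈ Q₀ z := by
  have h2 := htQ.self_of_nhds
  rw [h₁.self_of_nhds] at h2
  choose a ha b hb hab using fun i => Submodule.mem_sup.1 (h2 i)
  choose a' ha' haa using ha
  obtain ⟨s, hs, hsy, hsP⟩ := hP.exists_germs a' ha'
  obtain ⟨q, hq, hqy, hqQ⟩ := hQ.exists_germs b hb
  refine ⟨s, hs, hsP, ?_⟩
  filter_upwards [hqQ, unique_all ht (fun i => F.add (hf.self_of_nhds _ (hs i)) (hq i)) (fun i => by
    simp [← hab, hsy, haa, hqy])] with z h3 h4 i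
  rw [h4 i]
  simpa using h3 i

lemma comap_comb {A M N ι : Type*} [Ring A] [AddCommGroup M] [Module A M] [AddCommGroup N]
    [Module A N] [Fintype ι] {f : M →ₗ[A] N} {Q : Submodule A N} {s : ι → M} {t : ι → N}
    (h : ∀ i, t i - f (s i) ∈ Q) (c : ι → A) : ∑ i, c i • t i - f (∑ i, c i • s i) ∈ Q := by
  rw [map_sum, ← Finset.sum_sub_distrib]
  refine Q.sum_mem fun i _ => ?_
  rw [map_smul, ← smul_sub]
  exact Q.smul_mem _ (h i)

/-- The hypotheses `h₀` and `h₁` say that `f` induces an isomorphism from `P₁ / P₀` to `Q₁ / Q₀`.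
Relations modulo `Q₀` between sections of `Q₁` coincide with relations modulo `P₀` between lifts of
them. -/
lemma Coh.iso (h : Coh P₀ P₁ x) (hf : GermMap f x) (hP : ∀ᶠ y in 𝓝 x, OpenAt P₁ y)
    (hQ : ∀ᶠ y in 𝓝 x, OpenAt Q₀ y) (h₀ : ∀ᶠ y in 𝓝 x, P₀ y = P₁ y ⊓ (Q₀ y).comap (f y))
    (h₁ : ∀ᶠ y in 𝓝 x, Q₁ y = (P₁ y).map (f y) ⊔ Q₀ y) : Coh Q₀ Q₁ x := by
  constructor
  · refine ((h.1.map hf).sup Q₀).congr ?_ (h₁.mono fun _ h => h.symm)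
    filter_upwards [h₀] with y h₀
    rw [Pi.sup_apply, h₀, sup_eq_right, Submodule.map_le_iff_le_comap]
    exact inf_le_right
  · filter_upwards [h.2, hf.eventually_nhds, hP, hQ, h₀.eventually_nhds, h₁.eventually_nhds] with
      y h hf hP hQ h₀ h₁
    refine ⟨hQ, fun ι _ t ht htQ => ?_⟩
    obtain ⟨s, hs, hsP, hst⟩ := exists_lift hf hP hQ h₁ ht htQ
    refine (h.2 ι s hs hsP).congr (Eventually.of_forall fun _ => rfl) ?_
    filter_upwards [hsP, hst, h₀] with z hsP hst h₀
    ext (c : _ → R.stalk z)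
    have := comap_comb hst c
    rw [mem_rel, mem_rel, h₀, Submodule.mem_inf, Submodule.mem_comap,
      ← sub_add_cancel (∑ i, c i • t i z) (f z (∑ i, c i • s i z)),
      Submodule.add_mem_iff_right _ this]
    exact ⟨fun h => h.2, fun h => ⟨Submodule.sum_mem _ fun i _ => Submodule.smul_mem _ _ (hsP i), h⟩⟩

/-- The converse transport: generators of `Q₁ / Q₀` are lifted, while the relations between sections
of `P₁` are those between their images. Openness of `P₀` is not assumed, since it follows from that
of `P₁` and `Q₀`. -/
lemma Coh.of_iso (h : Coh Q₀ Q₁ x) (hf : GermMap f x) (hP : ∀ᶠ y in 𝓝 x, OpenAt P₁ y)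
    (h₀ : ∀ᶠ y in 𝓝 x, P₀ y = P₁ y ⊓ (Q₀ y).comap (f y))
    (h₁ : ∀ᶠ y in 𝓝 x, Q₁ y = (P₁ y).map (f y) ⊔ Q₀ y) : Coh P₀ P₁ x := by
  constructor
  · obtain ⟨ι, _, t, ht, htQ⟩ := h.1
    have htQ' : ∀ᶠ y in 𝓝 x, ∀ i, t i y ∈ Q₁ y := by
      filter_upwards [htQ] with y h i
      rw [h]
      exact Submodule.mem_sup_right (Submodule.subset_span ⟨i, rfl⟩)
    obtain ⟨s, hs, hsP, hst⟩ := exists_lift hf hP.self_of_nhds h.openAt h₁ ht htQ'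
    refine ⟨ι, ‹_›, s, hs, ?_⟩
    filter_upwards [htQ, hsP, hst, h₀, h₁] with y htQ hsP hst h₀ h₁
    apply le_antisymm
    · intro m hm
      have h2 : f y m ∈ Q₁ y := by
        rw [h₁]
        exact Submodule.mem_sup_left ⟨m, hm, rfl⟩
      rw [htQ] at h2
      obtain ⟨q, hq, c, hc⟩ := mem_sup_span.1 h2
      refine mem_sup_span.2 ⟨m - ∑ i, c i • s i y, ?_, c, by simp⟩
      rw [h₀]
      refine ⟨sub_mem hm (Submodule.sum_mem _ fun i _ => Submodule.smul_mem _ _ (hsP i)), ?_⟩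
      change f y (m - ∑ i, c i • s i y) ∈ Q₀ y
      rw [map_sub, hc, add_sub_assoc]
      exact add_mem hq (comap_comb hst c)
    · refine sup_le (h₀.le.trans inf_le_left) (Submodule.span_le.2 ?_)
      rintro _ ⟨i, rfl⟩
      exact hsP i
  · filter_upwards [h.2, hf.eventually_nhds, hP, h₀.eventually_nhds, h₁.eventually_nhds] with
      y h hf hP h₀ h₁
    refine ⟨(hP.inf (h.1.comap hf)).congr (h₀.mono fun _ h => h.symm), fun ι _ s hs hsP => ?_⟩
    refine (h.2 ι (fun i z => f z (s i z)) (fun i => hf.self_of_nhds _ (hs i)) ?_).congr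
      (Eventually.of_forall fun _ => rfl) ?_
    · filter_upwards [hsP, h₁] with z hz h₁ i
      rw [h₁]
      exact Submodule.mem_sup_left ⟨_, hz i, rfl⟩
    · filter_upwards [hsP, h₀] with z hsP h₀
      ext (c : _ → R.stalk z)
      rw [mem_rel, mem_rel, h₀, Submodule.mem_inf, Submodule.mem_comap, map_sum]
      simp only [map_smul]
      exact ⟨fun h => ⟨Submodule.sum_mem _ fun i _ => Submodule.smul_mem _ _ (hsP i), h⟩,
        fun h => h.2⟩

end iso

end MGerms

end Germs

/-! ### The `ħ`-adic topology, stationarity of initial submodules, and the Artin–Rees lemma. -/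

section Germs

open Topology Filter

variable {X : Type u} [TopologicalSpace X] {R : RGerms X}

namespace MGerms

variable {E F : MGerms R}

/-- The family `t` is a section modulo `P` near `x`. -/
def GermMod (P : E.Fam) (x : X) (t : ∀ y, E.stalk y) : Prop :=
  ∃ s, E.IsGerm x s ∧ ∀ᶠ z in 𝓝 x, t z - s z ∈ P z

lemma GermMod.of_germ {P : E.Fam} {x : X} {t : ∀ y, E.stalk y} (h : E.IsGerm x t) :
    GermMod P x t := ⟨t, h, Eventually.of_forall fun z => by simp⟩

/-- Coherence of the inverse image of a submodule. -/
lemma Coh.comap {f : ∀ y, E.stalk y →ₗ[R.stalk y] F.stalk y} {x : X} {P : E.Fam} {Q₀ Q₁ : F.Fam}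
    (h : Coh Q₀ Q₁ x) (hf : GermMap f x) (hP : FTm P ⊤ x)
    (hPQ : ∀ᶠ y in 𝓝 x, (P y).map (f y) ≤ Q₀ y) (hQ : ∀ᶠ y in 𝓝 x, ∀ a, f y a ∈ Q₁ y) :
    Coh (fun y => (Q₀ y).comap (f y)) ⊤ x := by
  -- The quotient of `E` by the inverse image of `Q₀` is isomorphic to `(f(E) + Q₀) / Q₀`. The
  -- latter is finitely generated because `f` sends `P` into `Q₀`, and it is contained in the
  -- coherent `Q₁ / Q₀`.
  have h2 : FTm Q₀ (fun y => (⊤ : Submodule (R.stalk y) (E.stalk y)).map (f y) ⊔ Q₀ y) x := by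
    refine ((hP.map hf).sup Q₀).congr ?_ (Eventually.of_forall fun _ => rfl)
    filter_upwards [hPQ] with y hy using sup_eq_right.2 hy
  refine (h.sub h2 ?_).of_iso hf (Eventually.of_forall fun y => openAt_top y)
    (Eventually.of_forall fun y => top_inf_eq _ |>.symm) (Eventually.of_forall fun y => rfl)
  filter_upwards [hQ, h.le] with y hy hle
  refine sup_le ?_ hle
  rintro _ ⟨a, -, rfl⟩
  exact hy a

/-- `Q₁ / (Q₁ ∩ P)` embeds into `Q₂ / P`, so sections of `Q₁` have the same relations in both. -/
lemma RelAt.inf {P Q₁ Q₂ : E.Fam} {x : X} (h : RelAt P Q₂ x) (hQ : ∀ᶠ y in 𝓝 x, Q₁ y ≤ Q₂ y) :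
    RelAt (Q₁ ⊓ P) Q₁ x := by
  intro ι _ s hs hsQ
  refine (h ι s hs ?_).congr (Eventually.of_forall fun _ => rfl) ?_
  · filter_upwards [hsQ, hQ] with y h1 h2 i using h2 (h1 i)
  · filter_upwards [hsQ] with z hz
    ext (c : _ → R.stalk z)
    exact ⟨fun h => ⟨Submodule.sum_mem _ fun i _ => Submodule.smul_mem _ _ (hz i), h⟩, fun h => h.2⟩

lemma ftm_unit (x : X) : FTm (E := R.unit) ⊥ ⊤ x := by
  refine ⟨Unit, inferInstance, fun _ => 1, fun _ => R.one x, Eventually.of_forall fun y => ?_⟩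
  refine (eq_top_iff.2 fun a _ => ?_).symm
  refine Submodule.mem_sup_right (mem_span_range.2 ⟨fun _ => a, ?_⟩)
  simp

lemma ftm_free (ι : Type) [Fintype ι] (x : X) : FTm (E := R.unit.pi ι) ⊥ ⊤ x := by
  classical
  refine ⟨ι, inferInstance, fun i _ => Pi.single i 1, fun i j => ?_, Eventually.of_forall fun y => ?_⟩
  · by_cases h : j = i
    · subst h
      simp only [Pi.single_eq_same]
      exact R.one x
    · simp only [ne_eq, h, not_false_eq_true, Pi.single_eq_of_ne]
      exact R.zero x
  · refine (eq_top_iff.2 fun (a : ι → R.stalk y) _ => ?_).symm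
    refine Submodule.mem_sup_right (mem_span_range.2 ⟨a, ?_⟩)
    ext i
    simp [Pi.single_apply]

end MGerms

open MGerms

variable (R) in
/-- A central section of a sheaf of rings. -/
structure CentralGerm where
  /-- the germs of the section -/
  h : ∀ x, R.stalk x
  germ (x) : R.IsGerm x h
  central (x) (a : R.stalk x) : Commute (h x) a

namespace CentralGerm

variable (D : CentralGerm R) {E F : MGerms R}

/-- Multiplication by `ħⁿ`. -/
def mul (n : ℕ) (y : X) : E.stalk y →ₗ[R.stalk y] E.stalk y where
  toFun m := D.h y ^ n • m
  map_add' := smul_add _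
  map_smul' r m := by
    rw [← mul_smul, ← mul_smul, ((D.central y r).pow_left n).eq]
    rfl

lemma mul_apply (n : ℕ) (y : X) (m : E.stalk y) : D.mul n y m = D.h y ^ n • m := rfl

lemma germMap_mul (n : ℕ) (x : X) : GermMap (E := E) (D.mul n) x :=
  Eventually.of_forall fun y _ hs => E.smul (RGerms.pow (D.germ y) n) hs

lemma germ_mul (n : ℕ) {x : X} {s : ∀ y, E.stalk y} (hs : E.IsGerm x s) :
    E.IsGerm x (fun y => D.h y ^ n • s y) := E.smul (RGerms.pow (D.germ x) n) hs

/-- The submodule `ħⁿ P`. -/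
def pow (n : ℕ) (P : E.Fam) : E.Fam := fun y => (P y).map (D.mul n y)

lemma mem_pow {n : ℕ} {P : E.Fam} {y : X} {m : E.stalk y} :
    m ∈ D.pow n P y ↔ ∃ p ∈ P y, D.h y ^ n • p = m := Iff.rfl

lemma smul_mem_pow (n : ℕ) {P : E.Fam} {y : X} {m : E.stalk y} (h : m ∈ P y) :
    D.h y ^ n • m ∈ D.pow n P y := ⟨m, h, rfl⟩

lemma pow_pow (m n : ℕ) (P : E.Fam) : D.pow m (D.pow n P) = D.pow (m + n) P := by
  ext y a
  constructor
  · rintro ⟨_, ⟨p, hp, rfl⟩, rfl⟩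
    refine ⟨p, hp, ?_⟩
    simp only [mul_apply, pow_add, mul_smul]
  · rintro ⟨p, hp, rfl⟩
    refine ⟨_, ⟨p, hp, rfl⟩, ?_⟩
    simp only [mul_apply, pow_add, mul_smul]

@[simp]
lemma pow_zero (P : E.Fam) : D.pow 0 P = P := by
  ext y a
  simp [mem_pow]

lemma pow_le (n : ℕ) (P : E.Fam) (y : X) : D.pow n P y ≤ P y := by
  rintro _ ⟨p, hp, rfl⟩
  exact Submodule.smul_mem _ _ hp

lemma pow_mono (n : ℕ) {P Q : E.Fam} {y : X} (h : P y ≤ Q y) : D.pow n P y ≤ D.pow n Q y :=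
  Submodule.map_mono h

lemma pow_antitone {m n : ℕ} (h : m ≤ n) (P : E.Fam) (y : X) : D.pow n P y ≤ D.pow m P y := by
  obtain ⟨k, rfl⟩ := Nat.exists_eq_add_of_le h
  rw [← D.pow_pow]
  exact D.pow_mono m (D.pow_le k P y)

lemma openAt_pow (n : ℕ) {P : E.Fam} {x : X} (h : OpenAt P x) : OpenAt (D.pow n P) x :=
  h.map (D.germMap_mul n x)

lemma ftm_pow (n : ℕ) {P Q : E.Fam} {x : X} (h : FTm P Q x) : FTm (D.pow n P) (D.pow n Q) x :=
  h.map (D.germMap_mul n x)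

lemma map_pow {f : ∀ y, E.stalk y →ₗ[R.stalk y] F.stalk y} {n : ℕ} {P : E.Fam} {Q : F.Fam} {y : X}
    (h : ∀ a ∈ P y, f y a ∈ Q y) {a : E.stalk y} (ha : a ∈ D.pow n P y) :
    f y a ∈ D.pow n Q y := by
  obtain ⟨p, hp, rfl⟩ := ha
  refine ⟨f y p, h p hp, ?_⟩
  simp only [mul_apply, map_smul]

/-- The submodule `ħⁿ M + P`. -/
def adic (P : E.Fam) (n : ℕ) : E.Fam := fun y => D.pow n ⊤ y ⊔ P y

lemma adic_bot (n : ℕ) : D.adic (⊥ : E.Fam) n = D.pow n ⊤ := by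
  ext y
  simp [adic]

lemma le_adic (P : E.Fam) (n : ℕ) (y : X) : P y ≤ D.adic P n y := le_sup_right

lemma pow_le_adic (P : E.Fam) (n : ℕ) (y : X) : D.pow n ⊤ y ≤ D.adic P n y := le_sup_left

lemma mem_adic {P : E.Fam} {n : ℕ} {y : X} {a : E.stalk y} :
    a ∈ D.adic P n y ↔ ∃ b, ∃ p ∈ P y, a = D.h y ^ n • b + p := by
  rw [adic, Submodule.mem_sup]
  constructor
  · rintro ⟨_, ⟨b, -, rfl⟩, p, hp, rfl⟩
    exact ⟨b, p, hp, rfl⟩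
  · rintro ⟨b, p, hp, rfl⟩
    exact ⟨_, ⟨b, trivial, rfl⟩, p, hp, rfl⟩

lemma adic_antitone {m n : ℕ} (h : m ≤ n) (P : E.Fam) (y : X) : D.adic P n y ≤ D.adic P m y :=
  sup_le_sup_right (D.pow_antitone h ⊤ y) _

lemma smul_mem_adic {m n : ℕ} {P : E.Fam} {y : X} {a : E.stalk y} (h : a ∈ D.adic P n y) :
    D.h y ^ m • a ∈ D.adic P (m + n) y := by
  obtain ⟨b, p, hp, rfl⟩ := D.mem_adic.1 h
  exact D.mem_adic.2 ⟨b, D.h y ^ m • p, Submodule.smul_mem _ _ hp, by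
    rw [smul_add, pow_add, mul_smul]⟩

/-- The closure of `P` for the `ħ`-adic topology. -/
def cl (P : E.Fam) : E.Fam := fun y =>
  -- One neighbourhood has to serve all `n` simultaneously; membership of the germ at `y` in every
  -- `ħⁿ M + P` would be a weaker condition.
  { carrier := {a | ∃ s, E.IsGerm y s ∧ s y = a ∧ ∀ᶠ z in 𝓝 y, ∀ n, s z ∈ D.adic P n z}
    zero_mem' := ⟨0, E.zero y, rfl, Eventually.of_forall fun z n => zero_mem _⟩
    add_mem' := by
      rintro _ _ ⟨s, hs, rfl, hsP⟩ ⟨t, ht, rfl, htP⟩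
      refine ⟨s + t, E.add hs ht, rfl, ?_⟩
      filter_upwards [hsP, htP] with z h1 h2 n using add_mem (h1 n) (h2 n)
    smul_mem' := by
      rintro a _ ⟨s, hs, rfl, hsP⟩
      obtain ⟨a, ha, rfl⟩ := R.exists_germ y a
      refine ⟨_, E.smul ha hs, rfl, ?_⟩
      filter_upwards [hsP] with z h1 n using Submodule.smul_mem _ _ (h1 n) }

lemma mem_cl {P : E.Fam} {y : X} {s : ∀ y, E.stalk y} (hs : E.IsGerm y s)
    (h : ∀ᶠ z in 𝓝 y, ∀ n, s z ∈ D.adic P n z) : s y ∈ D.cl P y := ⟨s, hs, rfl, h⟩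

lemma eventually_adic {P : E.Fam} {y : X} {s : ∀ y, E.stalk y} (hs : E.IsGerm y s)
    (h : s y ∈ D.cl P y) : ∀ᶠ z in 𝓝 y, ∀ n, s z ∈ D.adic P n z := by
  obtain ⟨t, ht, hy, htP⟩ := h
  filter_upwards [htP, E.unique hs ht hy.symm] with z h1 h2
  rwa [h2]

lemma openAt_cl (P : E.Fam) (x : X) : OpenAt (D.cl P) x := fun s hs hx => by
  filter_upwards [E.eventually hs, (D.eventually_adic hs hx).eventually_nhds] with y h1 h2
  exact D.mem_cl h1 h2

lemma le_cl {P : E.Fam} {y : X} (h : OpenAt P y) : P y ≤ D.cl P y := by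
  intro a ha
  obtain ⟨s, hs, rfl⟩ := E.exists_germ y a
  refine D.mem_cl hs ?_
  filter_upwards [h s hs ha] with z hz n using D.le_adic P n z hz

lemma cl_le_adic (P : E.Fam) (n : ℕ) (y : X) : D.cl P y ≤ D.adic P n y := by
  rintro _ ⟨s, hs, rfl, h⟩
  exact h.self_of_nhds n

lemma adic_cl {P : E.Fam} {y : X} (h : OpenAt P y) (n : ℕ) :
    D.adic (D.cl P) n y = D.adic P n y :=
  le_antisymm (sup_le (D.pow_le_adic P n y) (D.cl_le_adic P n y))
    (sup_le_sup_left (D.le_cl h) _)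

/-- The closure depends on `P` only through the submodules `ħⁿ M + P`, which do not change when `P`
is replaced by its closure. Idempotence of the closure follows. -/
lemma cl_congr {P Q : E.Fam} {y : X} (h : ∀ᶠ z in 𝓝 y, ∀ n, D.adic P n z ≤ D.adic Q n z) :
    D.cl P y ≤ D.cl Q y := by
  rintro _ ⟨s, hs, rfl, hP⟩
  refine D.mem_cl hs ?_
  filter_upwards [h, hP] with z h1 h2 n using h1 n (h2 n)

lemma cl_cl {P : E.Fam} {y : X} (h : ∀ᶠ z in 𝓝 y, OpenAt P z) : D.cl (D.cl P) y = D.cl P y :=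
  le_antisymm (D.cl_congr (h.mono fun _ hz n => (D.adic_cl hz n).le)) (D.le_cl (D.openAt_cl P y))

/-- All the quotients of `M / P` by `ħⁿ` are coherent near `x`. -/
def QC (P : E.Fam) (x : X) : Prop := ∀ᶠ y in 𝓝 x, ∀ n, Coh (D.adic P n) ⊤ y

/-- The submodule `P` is closed near `x`. -/
def Closed (P : E.Fam) (x : X) : Prop := ∀ᶠ y in 𝓝 x, D.cl P y = P y

end CentralGerm

variable (R) in
/-- A formal deformation: the sheaf of rings `R` has no `ħ`-torsion, is `ħ`-complete, `R / ħ R` is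
Noetherian, and coherent `R / ħ R`-modules are acyclic on the members of a base. -/
structure Deformation extends CentralGerm R where
  torsion (x) (a : R.stalk x) : h x * a = 0 → a = 0
  -- The family `t n` represents a section of `R / ħⁿ R` over `V`; the second condition is the
  -- compatibility of these sections.
  complete (V : Set X) (hV : IsOpen V) (t : ℕ → ∀ y, R.stalk y)
    (ht : ∀ n, ∀ y ∈ V, GermMod (E := R.unit) (toCentralGerm.pow n ⊤) y (t n))
    (ht' : ∀ n, ∀ y ∈ V, t (n + 1) y - t n y ∈ toCentralGerm.pow (E := R.unit) n ⊤ y) :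
    ∃ s, ∀ y ∈ V, R.IsGerm y s ∧ ∀ n, s y - t n y ∈ toCentralGerm.pow (E := R.unit) n ⊤ y
  separated (x) : toCentralGerm.cl (E := R.unit) ⊥ x = ⊥
  coh (x) : Coh (E := R.unit) (toCentralGerm.pow 1 ⊤) ⊤ x
  -- Ideals containing `ħ` stand for ideals of `R / ħ R`, so that a single sheaf of rings is needed
  -- here.
  noeth (U : Set X) (hU : IsOpen U) (I : Type u) [Preorder I] [IsDirectedOrder I] [Nonempty I]
    (J : I → R.unit.Fam) (hJ : ∀ i j, i ≤ j → ∀ y ∈ U, J i y ≤ J j y)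
    (hJF : ∀ i, ∀ y ∈ U, FTm ⊥ (J i) y)
    (hJh : ∀ i, ∀ y ∈ U, toCentralGerm.pow (E := R.unit) 1 ⊤ y ≤ J i y) (x) (hx : x ∈ U) :
    ∃ i₀, ∀ᶠ y in 𝓝 x, ∀ j, i₀ ≤ j → J j y = J i₀ y
  /-- the base of open sets -/
  B : Set (Set X)
  basis (x) (U) (hU : U ∈ 𝓝 x) : ∃ V ∈ B, IsOpen V ∧ x ∈ V ∧ V ⊆ U
  -- Acyclicity in the form used for approximation: `K / K₀` is coherent over `V` and killed by `ħ`,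
  -- so that its `H¹` over `V` vanishes and sections of `E / K` lift to sections of `E / K₀`.
  lift (E : MGerms R) (K₀ K : E.Fam) (V) (hV : V ∈ B) (hK : ∀ y ∈ V, Coh K₀ K y)
    (hK' : ∀ y ∈ V, toCentralGerm.pow 1 K y ≤ K₀ y) (t) (ht : ∀ y ∈ V, GermMod K y t) :
    ∃ t', ∀ y ∈ V, GermMod K₀ y t' ∧ t' y - t y ∈ K y

namespace Deformation

variable (D : Deformation R) {E F : MGerms R}

/-- An increasing sequence of coherent submodules containing `ħ M` is locally stationary. -/
lemma stationary {κ : Type} {s : κ → ∀ y, E.stalk y} (S : Finset κ) (T : ℕ → E.Fam) (x : X)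
    (hs : ∀ i, E.IsGerm x (s i))
    (hT : ∀ᶠ y in 𝓝 x, ∀ n, Coh (T n) ⊤ y ∧ D.pow 1 ⊤ y ≤ T n y ∧ T n y ≤ T (n + 1) y)
    (hS : ∀ᶠ y in 𝓝 x, T 0 y ⊔ Submodule.span (R.stalk y) ((fun i => s i y) '' S) = ⊤) :
    ∃ N, ∀ᶠ y in 𝓝 x, ∀ n, N ≤ n → T n y = T N y := by
  classical
  induction S using Finset.induction_on generalizing T with
  | empty =>
    refine ⟨0, ?_⟩
    filter_upwards [hS, hT] with y h1 h2 n _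
    have : T 0 y = ⊤ := by simpa using h1
    have hm : Monotone (fun n => T n y) := monotone_nat_of_le_succ fun n => (h2 n).2.2
    rw [this]
    exact top_le_iff.1 (this ▸ hm (Nat.zero_le n))
  | insert i S hi ih =>
    -- Adding the generator `s i` to every `T n` gives a sequence `T'` to which the induction
    -- hypothesis applies. What is lost is measured by the ideals `L n` of scalars `c` with `c • s i
    -- ∈ T n`, which contain `ħ`.
    let a : (y : X) → R.unit.stalk y →ₗ[R.stalk y] E.stalk y :=
      fun y => LinearMap.toSpanSingleton _ _ (s i y)
    have ha : GermMap a x := by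
      filter_upwards [E.eventually (hs i)] with y hy c hc using E.smul hc hy
    let T' : ℕ → E.Fam := fun n y => T n y ⊔ Submodule.span (R.stalk y) (Set.range fun _ : Unit => s i y)
    obtain ⟨N, hN⟩ := ih T' (by
      filter_upwards [hT, E.eventually (hs i)] with y hy hsi n
      refine ⟨(hy n).1.quot (ftm_span (fun _ => hsi) _) (Eventually.of_forall fun _ => le_top),
        (hy n).2.1.trans le_sup_left, sup_le_sup_right (hy n).2.2 _⟩) (by
      filter_upwards [hS] with y hy
      rw [← hy]
      simp only [T', Finset.coe_insert, Set.image_insert_eq, Set.range_const, sup_assoc]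
      rw [Submodule.span_insert])
    let L : ℕ → R.unit.Fam := fun n y => (T n y).comap (a y)
    have hL : ∀ᶠ y in 𝓝 x, ∀ n, FTm ⊥ (L n) y ∧ D.pow (E := R.unit) 1 ⊤ y ≤ L n y ∧
        L n y ≤ L (n + 1) y := by
      have h3 : ∀ᶠ y in 𝓝 x, ∀ n, D.pow (E := R.unit) 1 ⊤ y ≤ L n y := by
        filter_upwards [hT] with y hy n c hc
        exact (hy n).2.1 (D.map_pow (Q := ⊤) (fun _ _ => trivial) hc)
      filter_upwards [hT, ha.eventually_nhds, h3.eventually_nhds] with y hy ha h3 n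
      have h1 : Coh (L n) ⊤ y := (hy n).1.comap ha (ftm_unit y)
        (Eventually.of_forall fun z => by simp) (Eventually.of_forall fun _ _ => trivial)
      have h2 : FTm (E := R.unit) ⊥ (D.pow 1 ⊤) y := (D.ftm_pow 1 (ftm_unit y)).congr
        (Eventually.of_forall fun z => Submodule.map_bot _) (Eventually.of_forall fun z => rfl)
      -- `L n` is finitely generated: `ħ R` is, and `L n / ħ R` is the kernel of the surjection from
      -- `R / ħ R` onto the coherent module `R / L n`.
      refine ⟨h2.trans ((D.coh y).1.ker h1.relAt (h3.mono fun z hz => hz n)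
        (Eventually.of_forall fun _ => le_top)), h3.self_of_nhds n,
        Submodule.comap_mono (hy n).2.2⟩
    obtain ⟨U, hU, hUo, hxU⟩ := eventually_nhds_iff.1 hL
    obtain ⟨M, hM⟩ := D.noeth U hUo (ULift.{u} ℕ) (fun n => L n.down)
      (fun i j hij y hy => (monotone_nat_of_le_succ (f := fun n => L n y)
        fun n => (hU y hy n).2.2) hij) (fun n y hy => (hU y hy _).1)
      (fun n y hy => (hU y hy _).2.1) x hxU
    refine ⟨max N M.down, ?_⟩
    -- An element of `T m` is `t + d • s i` with `t ∈ T n`, as `T' m = T' n`; then `d ∈ L m = L n`,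
    -- so the element already lies in `T n`.
    have key : ∀ᶠ y in 𝓝 x, ∀ n m, max N M.down ≤ n → n ≤ m → T m y ≤ T n y := by
      filter_upwards [hN, hM, hT] with y hN hM hT n m hn hnm c hc
      have hm : Monotone (fun n => T n y) := monotone_nat_of_le_succ fun n => (hT n).2.2
      have h1 : T' m y = T' n y := by
        rw [hN m (by omega), hN n (by omega)]
      have h2 : L m y = L n y :=
        (hM ⟨m⟩ (show M.down ≤ m by omega)).trans (hM ⟨n⟩ (show M.down ≤ n by omega)).symm
      have h3 : c ∈ T' n y := h1 ▸ Submodule.mem_sup_left hc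
      obtain ⟨t, ht, d, rfl⟩ := mem_sup_span.1 h3
      have h4 : d () ∈ L m y := by
        have := (Submodule.add_mem_iff_right _ (hm hnm ht)).1 hc
        simpa using! this
      rw [h2] at h4
      refine add_mem ht ?_
      simpa using! h4
    filter_upwards [key, hT] with y hy hT n hn
    have hm : Monotone (fun n => T n y) := monotone_nat_of_le_succ fun n => (hT n).2.2
    exact le_antisymm (hy _ _ le_rfl hn) (hm hn)

lemma stationary' (T : ℕ → E.Fam) (x : X)
    (hT : ∀ᶠ y in 𝓝 x, ∀ n, Coh (T n) ⊤ y ∧ D.pow 1 ⊤ y ≤ T n y ∧ T n y ≤ T (n + 1) y) :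
    ∃ N, ∀ᶠ y in 𝓝 x, ∀ n, N ≤ n → T n y = T N y := by
  obtain ⟨ι, _, s, hs, h⟩ := (hT.self_of_nhds 0).1.1
  refine D.stationary (s := s) Finset.univ T x hs hT ?_
  filter_upwards [h] with y hy
  simpa using hy.symm

/-- The elements `m` such that `ħⁿ m` belongs to `ħⁿ⁺¹ M + P`. -/
def initial (P : E.Fam) (n : ℕ) : E.Fam := fun y => (D.adic P (n + 1) y).comap (D.mul n y)

lemma mem_initial {P : E.Fam} {n : ℕ} {y : X} {a : E.stalk y} :
    a ∈ D.initial P n y ↔ D.h y ^ n • a ∈ D.adic P (n + 1) y := Iff.rfl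

lemma initial_succ (P : E.Fam) (n : ℕ) (y : X) : D.initial P n y ≤ D.initial P (n + 1) y := by
  intro a ha
  have := D.smul_mem_adic (m := 1) (D.mem_initial.1 ha)
  rwa [← mul_smul, ← pow_add, add_comm 1, add_comm 1] at this

lemma pow_le_initial (P : E.Fam) (n : ℕ) (y : X) : D.pow 1 ⊤ y ≤ D.initial P n y := by
  rintro _ ⟨a, -, rfl⟩
  refine D.pow_le_adic P _ _ ⟨a, trivial, ?_⟩
  simp only [CentralGerm.mul_apply, pow_add, mul_smul]

/-- Multiplication by `ħⁿ` embeds the quotient of `E` by `initial P n` into the coherent module `E /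
(ħⁿ⁺¹ E + P)`. -/
lemma coh_initial {P : E.Fam} {n : ℕ} {y : X} (h : Coh (D.adic P (n + 1)) ⊤ y) :
    Coh (D.initial P n) ⊤ y := by
  refine h.comap (D.germMap_mul n y) h.1 (Eventually.of_forall fun z => ?_)
    (Eventually.of_forall fun _ _ => trivial)
  rintro _ ⟨a, ha, rfl⟩
  exact Submodule.smul_mem _ _ ha

lemma stationary_initial {P : E.Fam} {x : X} (h : D.QC P x) :
    ∃ N, ∀ᶠ y in 𝓝 x, ∀ n, N ≤ n → D.initial P n y = D.initial P N y :=
  D.stationary' (D.initial P) x (by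
    filter_upwards [h] with y hy n
    exact ⟨D.coh_initial (hy _), D.pow_le_initial P n y, D.initial_succ P n y⟩)

/-- Take `N` beyond which the initial submodules are constant. If `c = ħʲ b + p` and `ħ c ∈ ħʲ⁺² M +
P`, then `b` lies in `initial P (j + 1)`, which for `j ≥ N` is `initial P j`, so `c ∈ ħʲ⁺¹ M + P`.
For exponents up to `N` the assumption `c ∈ ħᴺ M` suffices. The bound does not depend on `k`. -/
lemma bounded {P : E.Fam} {x : X} (h : D.QC P x) : ∃ N, ∀ᶠ y in 𝓝 x, ∀ k, ∀ c ∈ D.pow N ⊤ y,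
    D.h y • c ∈ D.adic P (k + 1) y → c ∈ D.adic P k y := by
  obtain ⟨N, hN⟩ := D.stationary_initial h
  refine ⟨N, ?_⟩
  filter_upwards [hN] with y hN k c hc
  induction k with
  | zero => exact fun _ => D.adic_antitone (Nat.zero_le N) P y (D.pow_le_adic P N y hc)
  | succ j ih =>
    intro h2
    by_cases hj : N ≤ j
    · obtain ⟨b, p, hp, rfl⟩ := D.mem_adic.1 (ih (D.adic_antitone (Nat.le_succ _) P y h2))
      have h3 : D.h y ^ (j + 1) • b ∈ D.adic P (j + 1 + 1) y := by
        rw [smul_add, ← mul_smul, ← pow_succ'] at h2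
        exact (Submodule.add_mem_iff_left _ (D.le_adic P _ y (Submodule.smul_mem _ _ hp))).1 h2
      have h4 : b ∈ D.initial P (j + 1) y := h3
      rw [hN _ (by omega), ← hN j hj] at h4
      exact add_mem h4 (D.le_adic P _ y hp)
    · exact D.adic_antitone (by omega : j + 1 ≤ N) P y (D.pow_le_adic P N y hc)

/-- The closure of `P` is equal to `P` up to `ħ`. -/
lemma cl_le {P : E.Fam} {x : X} (h : D.QC P x) (hP : ∀ᶠ y in 𝓝 x, OpenAt P y) :
    ∀ᶠ y in 𝓝 x, D.cl P y ≤ P y ⊔ D.pow 1 (D.cl P) y := by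
  obtain ⟨N, hN⟩ := D.bounded h
  filter_upwards [hN.eventually_nhds, hP] with y hN hP a ha
  obtain ⟨s, hs, rfl, hsP⟩ := ha
  -- The exponent `N + 1` makes the quotient by `ħ`, namely `ħᴺ b`, an element of `ħᴺ M`, where
  -- `bounded` applies; it then belongs to the closure of `P`.
  obtain ⟨b, p, hp, hbp⟩ := D.mem_adic.1 (hsP.self_of_nhds (N + 1))
  obtain ⟨b', hb, rfl⟩ := E.exists_germ y b
  obtain ⟨p', hp', rfl⟩ := E.exists_germ y p
  have hc := D.germ_mul N hb
  have e : ∀ᶠ z in 𝓝 y, s z = D.h z • (D.h z ^ N • b' z) + p' z := by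
    refine E.unique hs (E.add (E.smul (D.germ y) hc) hp') ?_
    rw [hbp, pow_succ', mul_smul]
  refine Submodule.mem_sup.2 ⟨p' y, hp, D.h y ^ 1 • (D.h y ^ N • b' y), D.smul_mem_pow 1 ?_, ?_⟩
  · refine D.mem_cl hc ?_
    filter_upwards [e, hsP, hN, hP _ hp' hp] with z e hsP hN hp k
    refine hN k _ ⟨_, trivial, rfl⟩ ?_
    have := hsP (k + 1)
    rw [e] at this
    exact (Submodule.add_mem_iff_left _ (D.le_adic P _ z hp)).1 this
  · rw [e.self_of_nhds, pow_one, add_comm]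

/-- A form of the Artin–Rees lemma. -/
lemma artinRees {P : E.Fam} {x : X} (h : D.QC P x) (hP : ∀ᶠ y in 𝓝 x, OpenAt P y)
    (hc : D.Closed P x) : ∃ N, ∀ᶠ y in 𝓝 x, ∀ m, P y ⊓ D.pow (m + N) ⊤ y ≤ D.pow m P y := by
  obtain ⟨N, hN⟩ := D.bounded h
  refine ⟨N, ?_⟩
  filter_upwards [hN.eventually_nhds, hP, hc] with y hN hP hc m
  -- If `ħ c ∈ P` with `c ∈ ħᴺ M`, then `bounded` places `c` in every `ħᵏ M + P` on a common
  -- neighbourhood, hence in the closure of `P`, which is `P`.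
  have key : ∀ c ∈ D.pow N ⊤ y, D.h y • c ∈ P y → c ∈ P y := by
    rintro _ ⟨b, -, rfl⟩ h2
    obtain ⟨b', hb, rfl⟩ := E.exists_germ y b
    rw [← hc]
    refine D.mem_cl (D.germ_mul N hb) ?_
    filter_upwards [hN, hP _ (E.smul (D.germ y) (D.germ_mul N hb)) h2] with z hN hz k
    exact hN k _ ⟨_, trivial, rfl⟩ (D.le_adic P _ z hz)
  have key2 (c) (hcN : c ∈ D.pow N ⊤ y) (m : ℕ) : D.h y ^ m • c ∈ P y → c ∈ P y := by
    induction m with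
    | zero => simp
    | succ m ih =>
      intro h
      refine ih (key _ (Submodule.smul_mem _ _ hcN) ?_)
      rwa [← mul_smul, ← pow_succ']
  rintro _ ⟨h1, b, -, rfl⟩
  have e : D.mul (m + N) y b = D.h y ^ m • D.h y ^ N • b := by
    simp only [CentralGerm.mul_apply, pow_add, mul_smul]
  rw [e]
  refine D.smul_mem_pow m (key2 _ ⟨b, trivial, rfl⟩ m ?_)
  rw [← e]
  exact h1

/-- With `n = m + N`, Artin–Rees gives `P ∩ ħⁿ E ⊂ ħᵐ P`. The module `P / (P ∩ ħⁿ E)` is isomorphic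
to `(P + ħⁿ E) / ħⁿ E`, a finitely generated submodule of a coherent module, and `P / ħᵐ P` is its
quotient by a finitely generated submodule. -/
lemma coh_pow {P : E.Fam} {x : X} (h₀ : D.QC (⊥ : E.Fam) x) (h : D.QC P x)
    (hP : ∀ᶠ y in 𝓝 x, OpenAt P y) (hc : D.Closed P x) :
    ∀ᶠ y in 𝓝 x, ∀ m, Coh (D.pow m P) P y := by
  obtain ⟨N, hN⟩ := D.artinRees h hP hc
  filter_upwards [hN.eventually_nhds, h₀, h, hP.eventually_nhds] with y hN h₀ h hP m
  set n := m + N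
  have h₀ : Coh (D.pow n (⊤ : E.Fam)) ⊤ y := by simpa only [D.adic_bot] using h₀ n
  have h1 : FTm (D.pow n ⊤) (D.adic P n) y := h₀.1.ker (h n).relAt
    (Eventually.of_forall fun z => D.pow_le_adic P n z) (Eventually.of_forall fun _ => le_top)
  have h2 : Coh (P ⊓ D.pow n ⊤) P y :=
    (h₀.sub h1 (Eventually.of_forall fun _ => le_top)).of_iso (f := fun y => LinearMap.id)
      (Eventually.of_forall fun z s hs => hs) hP
      (Eventually.of_forall fun z => by simp) (Eventually.of_forall fun z => by
        simp [CentralGerm.adic, sup_comm])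
  refine h2.quot ((D.ftm_pow m h2.1).of_le (P₁ := P ⊓ D.pow n ⊤) (Eventually.of_forall fun z => ?_)
    (hN.mono fun z hz => hz m)) (Eventually.of_forall fun z => D.pow_le m P z)
  rintro _ ⟨a, ha, rfl⟩
  exact ⟨Submodule.smul_mem _ _ ha.1, Submodule.smul_mem _ _ ha.2⟩

end Deformation

end Germs

/-! ### Free modules, successive approximation, Nakayama's lemma, and closed submodules. -/

section Germs

open Topology Filter MGerms

variable {X : Type u} [TopologicalSpace X] {R : RGerms X}

namespace MGerms

variable {E : MGerms R}

end MGerms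

namespace Deformation

variable (D : Deformation R) {E F : MGerms R}

section free

variable {ι : Type} [Fintype ι]

lemma mem_pow_free {n : ℕ} {y : X} {c : ι → R.stalk y} :
    c ∈ D.pow (E := R.unit.pi ι) n ⊤ y ↔ ∀ i, c i ∈ D.pow (E := R.unit) n ⊤ y := by
  constructor
  · rintro ⟨d, -, rfl⟩ i
    exact ⟨(d : ι → R.stalk y) i, trivial, rfl⟩
  · intro h
    choose d _ hd using h
    exact ⟨d, trivial, funext hd⟩

lemma torsion_pow (n : ℕ) (y : X) (a : R.stalk y) (h : D.h y ^ n * a = 0) : a = 0 := by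
  induction n with
  | zero => simpa using h
  | succ n ih =>
    rw [pow_succ', mul_assoc] at h
    exact ih (D.torsion y _ h)

lemma coh_free_one (x : X) : Coh (D.pow (E := R.unit.pi ι) 1 ⊤) ⊤ x := by
  classical
  -- The vectors whose coordinates outside `S` are divisible by `ħ`. Enlarging `S` by one index
  -- gives a subquotient isomorphic to `R / ħ R`, so coherence follows by iterated extensions from
  -- `P ∅` to `P univ`.
  let P (S : Finset ι) : (R.unit.pi ι).Fam := fun y =>
    { carrier := {c | ∀ i, i ∉ S → (c i : R.stalk y) ∈ D.pow (E := R.unit) 1 ⊤ y}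
      zero_mem' := fun i _ => zero_mem _
      add_mem' := fun ha hb i hi => add_mem (ha i hi) (hb i hi)
      smul_mem' := fun r c hc i hi => Submodule.smul_mem (D.pow (E := R.unit) 1 ⊤ y) r (hc i hi) }
  have hP (S : Finset ι) : ∀ y, Coh (P ∅) (P S) y := by
    induction S using Finset.induction_on with
    | empty =>
      intro y
      refine ⟨FTm.refl _ _, Eventually.of_forall fun z => ⟨?_, ?_⟩⟩
      · refine (D.openAt_pow (E := R.unit.pi ι) 1 (openAt_top z)).congr
          (Eventually.of_forall fun w => ?_)
        ext (c : ι → R.stalk w)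
        rw [mem_pow_free]
        simp [P]
      · intro κ _ s hs hsP
        refine (ftm_free κ z).congr (Eventually.of_forall fun _ => rfl) ?_
        filter_upwards [hsP] with w hw
        refine (eq_top_iff.2 fun c _ => ?_).symm
        exact Submodule.sum_mem _ fun i _ => Submodule.smul_mem _ _ (hw i)
    | insert i S hi ih =>
      intro y
      refine (ih y).ext ?_
      let f : (y : X) → R.unit.stalk y →ₗ[R.stalk y] (R.unit.pi ι).stalk y :=
        fun y => LinearMap.single (R.stalk y) (fun _ => R.stalk y) i
      refine (D.coh y).iso (f := f) (Eventually.of_forall fun z s hs j => ?_)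
        (Eventually.of_forall fun z => openAt_top z)
        (Eventually.of_forall fun z => ((ih z).1.openAt (ih z).openAt))
        (Eventually.of_forall fun z => ?_) (Eventually.of_forall fun z => ?_)
      · by_cases h : j = i
        · subst h
          simpa [f] using hs
        · simp only [f, LinearMap.coe_single, ne_eq, h, not_false_eq_true, Pi.single_eq_of_ne]
          exact R.zero z
      · ext (a : R.stalk z)
        rw [Pi.top_apply, top_inf_eq]
        constructor
        · intro ha j hj
          by_cases h : j = i
          · subst h
            simpa [f] using ha
          · have : (f z a : ι → R.stalk z) j = 0 := by simp [f, h]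
            rw [this]
            exact zero_mem _
        · intro h
          have := h i hi
          simpa [f] using this
      · ext (c : ι → R.stalk z)
        rw [Submodule.mem_sup]
        constructor
        · intro hc
          refine ⟨f z (c i), ⟨c i, trivial, rfl⟩, c - Pi.single i (c i), fun j hj => ?_, ?_⟩
          · by_cases h : j = i
            · subst h
              have : (c - Pi.single j (c j) : ι → R.stalk z) j = 0 := by simp
              rw [this]
              exact zero_mem _
            · have : (c - Pi.single i (c i) : ι → R.stalk z) j = c j := by simp [h]
              rw [this]
              exact hc j (by simp [h, hj])
          · simp [f]
        · rintro ⟨_, ⟨a, -, rfl⟩, p, hp, rfl⟩ j hj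
          rw [Finset.mem_insert, not_or] at hj
          have : (f z a + p : ι → R.stalk z) j = p j := by simp [f, hj.1]
          rw [this]
          exact hp j hj.2
  refine (hP Finset.univ x).congr (Eventually.of_forall fun y => ?_)
    (Eventually.of_forall fun y => ?_)
  · ext (c : ι → R.stalk y)
    rw [mem_pow_free]
    simp [P]
  · exact eq_top_iff.2 fun c _ i hi => (hi (Finset.mem_univ i)).elim

/-- By absence of torsion, `ħⁿ` identifies `Rᶥ / ħ Rᶥ` with `ħⁿ Rᶥ / ħⁿ⁺¹ Rᶥ`; the quotient by
`ħⁿ⁺¹` is then an extension of coherent modules. -/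
lemma coh_free (n : ℕ) (x : X) : Coh (D.pow (E := R.unit.pi ι) n ⊤) ⊤ x := by
  induction n generalizing x with
  | zero =>
    rw [D.pow_zero]
    refine ⟨FTm.refl _ _, Eventually.of_forall fun y => ⟨openAt_top y, fun κ _ s _ _ => ?_⟩⟩
    exact (ftm_free κ y).congr (Eventually.of_forall fun _ => rfl) (Eventually.of_forall fun z => rfl)
  | succ n ih =>
    refine Coh.ext ?_ (ih x)
    refine (D.coh_free_one x).iso (D.germMap_mul n x) (Eventually.of_forall fun z => openAt_top z)
      (Eventually.of_forall fun z => D.openAt_pow _ (openAt_top z))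
      (Eventually.of_forall fun z => ?_) (Eventually.of_forall fun z => ?_)
    · rw [Pi.top_apply, top_inf_eq]
      ext (c : ι → R.stalk z)
      constructor
      · rintro ⟨d, -, rfl⟩
        refine ⟨d, trivial, ?_⟩
        change D.h z ^ (n + 1) • d = D.h z ^ n • D.h z ^ 1 • d
        rw [← mul_smul, ← pow_add]
      · rintro ⟨d, -, hd⟩
        refine ⟨d, trivial, funext fun i => ?_⟩
        have h1 := congrFun hd i
        have h2 : D.h z ^ n * (D.h z ^ 1 * (d : ι → R.stalk z) i - c i) = 0 := by
          rw [mul_sub, sub_eq_zero, ← mul_assoc, ← pow_add]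
          exact h1
        exact sub_eq_zero.1 (D.torsion_pow n z _ h2)
    · exact (sup_eq_left.2 (D.pow_antitone (Nat.le_succ n) ⊤ z)).symm

lemma qc_free (x : X) : D.QC (⊥ : (R.unit.pi ι).Fam) x :=
  Eventually.of_forall fun y n => by simpa only [D.adic_bot] using D.coh_free n y

lemma closed_free (x : X) : D.Closed (⊥ : (R.unit.pi ι).Fam) x := by
  refine Eventually.of_forall fun y => eq_bot_iff.2 ?_
  rintro _ ⟨s, hs, rfl, h⟩
  refine funext fun i => ?_
  have : s y i ∈ D.cl (E := R.unit) ⊥ y := by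
    refine D.mem_cl (E := R.unit) (hs i) ?_
    filter_upwards [h] with z hz n
    have := hz n
    rw [D.adic_bot] at this ⊢
    exact D.mem_pow_free.1 this i
  rw [D.separated] at this
  exact this

end free

/-- Successive approximation over a member of the base. -/
lemma approx_step {V : Set X} (hV : V ∈ D.B) {ι : Type} [Fintype ι] {s : ι → ∀ y, E.stalk y}
    (hVo : IsOpen V) (hs : ∀ y ∈ V, ∀ i, E.IsGerm y (s i)) {P : E.Fam}
    (hP : ∀ y ∈ V, OpenAt P y) (hPc : ∀ n, ∀ y ∈ V, Coh (D.pow n P) P y)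
    (hPs : ∀ y ∈ V, P y = D.pow 1 P y ⊔ Submodule.span (R.stalk y) (Set.range fun i => s i y))
    {t t' : ∀ y, E.stalk y} {n : ℕ} (ht' : ∀ y ∈ V, GermMod (D.pow (n + 1) P) y t')
    (htt' : ∀ y ∈ V, t' y - t y ∈ D.pow n P y) {b : ∀ y, ι → R.stalk y}
    (hb : ∀ y ∈ V, GermMod (E := R.unit.pi ι) (D.pow n ⊤) y b)
    (hbt : ∀ y ∈ V, lin s y (b y) - t y ∈ D.pow n P y) :
    ∃ b' : ∀ y, ι → R.stalk y,
      (∀ y ∈ V, GermMod (E := R.unit.pi ι) (D.pow (n + 1) ⊤) y b') ∧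
      (∀ y ∈ V, lin s y (b' y) - t' y ∈ D.pow (n + 1) P y) ∧
      ∀ y ∈ V, b' y - b y ∈ D.pow (E := R.unit.pi ι) n ⊤ y := by
  have hsP (y) (hy : y ∈ V) (c : ι → R.stalk y) : lin s y c ∈ P y := by
    refine Submodule.sum_mem _ fun i _ => Submodule.smul_mem _ _ ?_
    rw [hPs y hy]
    exact Submodule.mem_sup_right (Submodule.subset_span ⟨i, rfl⟩)
  have hlin (m : ℕ) (y) (hy : y ∈ V) (c : ι → R.stalk y)
      (hc : c ∈ D.pow (E := R.unit.pi ι) m ⊤ y) : lin s y c ∈ D.pow m P y :=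
    D.map_pow (P := (⊤ : (R.unit.pi ι).Fam)) (fun a _ => hsP y hy a) hc
  have hnhds (y) (hy : y ∈ V) : ∀ᶠ z in 𝓝 y, z ∈ V := hVo.mem_nhds hy
  -- the correction of an approximate solution
  have hsolve (y) (hy : y ∈ V) (e : E.stalk y) (he : e ∈ D.pow n P y) :
      ∃ c : ι → R.stalk y, ∃ p ∈ P y, e = lin s y (D.h y ^ n • c) + D.h y ^ (n + 1) • p := by
    obtain ⟨p, hp, rfl⟩ := he
    rw [hPs y hy] at hp
    obtain ⟨_, ⟨q, hq, rfl⟩, c, rfl⟩ := mem_sup_span.1 hp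
    refine ⟨c, q, hq, ?_⟩
    rw [map_smul, add_comm (D.h y ^ n • lin s y c), CentralGerm.mul_apply, CentralGerm.mul_apply,
      smul_add, ← mul_smul, ← pow_add]
    rfl
  -- `K / K₀` is the kernel of the map from `ħⁿ Rᶥ / ħⁿ⁺¹ Rᶥ` to `ħⁿ P / ħⁿ⁺¹ P` defined by the
  -- generators `s`. It is coherent and killed by `ħ`, and it measures the indeterminacy of the
  -- correction to `b`.
  set K₀ : (R.unit.pi ι).Fam := D.pow (n + 1) ⊤
  set K : (R.unit.pi ι).Fam := D.pow n ⊤ ⊓ fun y => (D.pow (n + 1) P y).comap (lin s y) with hKdef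
  have hK₀K (y) (hy : y ∈ V) : K₀ y ≤ K y := fun c hc =>
    ⟨D.pow_antitone (Nat.le_succ n) ⊤ y hc, hlin _ y hy c hc⟩
  have hexists (y : X) : ∃ d : ι → R.stalk y, y ∈ V →
      d - b y ∈ D.pow (E := R.unit.pi ι) n ⊤ y ∧ lin s y d - t' y ∈ D.pow (n + 1) P y := by
    by_cases hy : y ∈ V
    · obtain ⟨c, p, hp, e⟩ := hsolve y hy (lin s y (b y) - t' y) (by
        have := sub_mem (hbt y hy) (htt' y hy)
        rwa [sub_sub_sub_cancel_right] at this)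
      refine ⟨b y - D.h y ^ n • c, fun _ => ⟨?_, ?_⟩⟩
      · rw [sub_sub_cancel_left]
        exact neg_mem ⟨c, trivial, rfl⟩
      · rw [map_sub, sub_right_comm, e, add_sub_cancel_left]
        exact D.smul_mem_pow _ hp
    · exact ⟨0, fun h => (hy h).elim⟩
  -- A solution chosen separately in each stalk. Two solutions at a point differ by an element of
  -- `K`, so `τ` is automatically a section modulo `K`; the lifting property then turns it into a
  -- section modulo `K₀ = ħⁿ⁺¹ Rᶥ`.
  choose τ hτ using hexists
  obtain ⟨b', hb'⟩ := D.lift (R.unit.pi ι) K₀ K V hV (fun y hy => by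
      have h1 : FTm K₀ (D.pow n ⊤) y := by
        refine ((D.ftm_pow n (ftm_free ι y)).of_le (Eventually.of_forall fun z => ?_)
          (Eventually.of_forall fun z => D.pow_antitone (Nat.le_succ n) ⊤ z))
        rintro _ ⟨a, rfl, rfl⟩
        rw [map_zero]
        exact zero_mem _
      have h2 : Coh (fun y => (D.pow (n + 1) P y).comap (lin s y)) ⊤ y := by
        refine (hPc (n + 1) y hy).comap (germMap_lin (hs y hy)) (ftm_free ι y)
          (Eventually.of_forall fun z => by simp) ((hnhds y hy).mono fun z hz a => hsP z hz a)
      refine (D.coh_free (n + 1) y).sub (h1.ker (h2.relAt.inf (Eventually.of_forall fun _ => le_top))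
        ((hnhds y hy).mono hK₀K) (Eventually.of_forall fun _ => inf_le_left))
        (Eventually.of_forall fun _ => le_top)) (fun y hy => by
      refine (D.pow_mono 1 (inf_le_left : K y ≤ D.pow n ⊤ y)).trans ?_
      rw [D.pow_pow, add_comm]) τ (fun y hy => by
      -- To see that `τ` is a section modulo `K`, a true local section with the same properties is
      -- produced: `β` and `θ` represent `b` and `t'`, and `γ` corrects `β`.
      obtain ⟨β, hβ, hbβ⟩ := hb y hy
      obtain ⟨θ, hθ, htθ⟩ := ht' y hy
      obtain ⟨c, p, hp, e⟩ := hsolve y hy (lin s y (β y) - θ y) (by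
        have h1 := hlin n y hy _ hbβ.self_of_nhds
        have h2 := D.pow_antitone (Nat.le_succ n) P y htθ.self_of_nhds
        have := add_mem (sub_mem (sub_mem (hbt y hy) (htt' y hy)) h1) h2
        rw [map_sub] at this
        convert this using 1
        abel)
      obtain ⟨γ, hγ, rfl⟩ := (R.unit.pi ι).exists_germ y c
      obtain ⟨p', hp', rfl⟩ := E.exists_germ y p
      have hγ' := D.germ_mul n hγ
      refine ⟨_, MGerms.sub hβ hγ', ?_⟩
      have h1 : ∀ᶠ z in 𝓝 y, lin s z (β z) - θ z =
          lin s z (D.h z ^ n • γ z) + D.h z ^ (n + 1) • p' z :=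
        E.unique (MGerms.sub ((germMap_lin (hs y hy)).self_of_nhds _ hβ) hθ)
          (E.add ((germMap_lin (hs y hy)).self_of_nhds _ hγ') (D.germ_mul _ hp')) e
      filter_upwards [hbβ, htθ, h1, hP y hy _ hp' hp, hnhds y hy] with z hbβ htθ h1 hp hz
      have h3 : τ z - (β z - D.h z ^ n • γ z) ∈ D.pow (E := R.unit.pi ι) n ⊤ z := by
        have := add_mem (add_mem (hτ z hz).1 hbβ)
          (D.smul_mem_pow n (P := (⊤ : (R.unit.pi ι).Fam)) (m := γ z) trivial)
        convert this using 1
        abel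
      refine ⟨h3, ?_⟩
      change lin s z (τ z - (β z - D.h z ^ n • γ z)) ∈ D.pow (n + 1) P z
      have := sub_mem (add_mem (hτ z hz).2 htθ) (D.smul_mem_pow (n + 1) hp)
      rw [map_sub, map_sub]
      rw [← sub_eq_iff_eq_add'] at h1
      rw [← h1] at this
      convert this using 1
      abel)
  refine ⟨b', fun y hy => (hb' y hy).1, fun y hy => ?_, fun y hy => ?_⟩
  · have h1 : lin s y (b' y - τ y) ∈ D.pow (n + 1) P y := (hb' y hy).2.2
    have := add_mem h1 (hτ y hy).2
    rw [map_sub] at this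
    convert this using 1
    abel
  · have h1 : b' y - τ y ∈ D.pow n ⊤ y := (hb' y hy).2.1
    have := add_mem h1 (hτ y hy).1
    convert this using 1
    abel

/-- A compatible system of sections of the quotients `P / ħⁿ P` over a member of the base comes
from a combination of given generators. -/
lemma approx {V : Set X} (hV : V ∈ D.B) {ι : Type} [Fintype ι] {s : ι → ∀ y, E.stalk y}
    (hVo : IsOpen V) (hs : ∀ y ∈ V, ∀ i, E.IsGerm y (s i)) {P : E.Fam}
    (hP : ∀ y ∈ V, OpenAt P y) (hPc : ∀ n, ∀ y ∈ V, Coh (D.pow n P) P y)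
    (hPs : ∀ y ∈ V, P y = D.pow 1 P y ⊔ Submodule.span (R.stalk y) (Set.range fun i => s i y))
    {t : ℕ → ∀ y, E.stalk y} (ht : ∀ n, ∀ y ∈ V, GermMod (D.pow n P) y (t n))
    (ht0 : ∀ n, ∀ y ∈ V, t n y ∈ P y)
    (htt : ∀ n, ∀ y ∈ V, t (n + 1) y - t n y ∈ D.pow n P y) :
    ∃ b : ι → ∀ y, R.stalk y, ∀ y ∈ V, (∀ i, R.IsGerm y (b i)) ∧
      ∀ n, ∑ i, b i y • s i y - t n y ∈ D.pow n P y := by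
  have hsP (y) (hy : y ∈ V) (c : ι → R.stalk y) : lin s y c ∈ P y := by
    refine Submodule.sum_mem _ fun i _ => Submodule.smul_mem _ _ ?_
    rw [hPs y hy]
    exact Submodule.mem_sup_right (Submodule.subset_span ⟨i, rfl⟩)
  -- At stage `n` the coefficients are known as a section modulo `ħⁿ`, and give `t n` modulo `ħⁿ P`.
  -- At stage `0` there is no condition modulo `ħ⁰`, so the zero vector starts the recursion.
  let Inv (n : ℕ) (b : ∀ y, ι → R.stalk y) : Prop :=
    (∀ y ∈ V, GermMod (E := R.unit.pi ι) (D.pow n ⊤) y b) ∧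
      ∀ y ∈ V, lin s y (b y) - t n y ∈ D.pow n P y
  have hstep (n : ℕ) (b : {b // Inv n b}) : ∃ b' : {b // Inv (n + 1) b},
      ∀ y ∈ V, b'.1 y - b.1 y ∈ D.pow (E := R.unit.pi ι) n ⊤ y := by
    obtain ⟨b', h1, h2, h3⟩ := D.approx_step hV hVo hs hP hPc hPs (ht (n + 1)) (htt n) b.2.1 b.2.2
    exact ⟨⟨b', h1, h2⟩, h3⟩
  choose step hstep using hstep
  let b (n : ℕ) : {b // Inv n b} := Nat.rec ⟨0, fun y _ => .of_germ ((R.unit.pi ι).zero y),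
    fun y hy => by
      rw [D.pow_zero]
      exact sub_mem (hsP y hy _) (ht0 0 y hy)⟩ step n
  have hbb (n : ℕ) (y) (hy : y ∈ V) :
      (b (n + 1)).1 y - (b n).1 y ∈ D.pow (E := R.unit.pi ι) n ⊤ y := hstep n (b n) y hy
  -- The successive coefficients form a compatible system in each coordinate, so completeness of `R`
  -- provides a limit.
  choose c hc using fun i : ι => D.complete V hVo (fun n y => (b n).1 y i) (fun n y hy => by
      obtain ⟨β, hβ, h⟩ := (b n).2.1 y hy
      exact ⟨fun z => β z i, hβ i, h.mono fun z hz => D.mem_pow_free.1 hz i⟩)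
    (fun n y hy => D.mem_pow_free.1 (hbb n y hy) i)
  refine ⟨c, fun y hy => ⟨fun i => (hc i y hy).1, fun n => ?_⟩⟩
  have h1 : lin s y ((fun i => c i y) - (b n).1 y) ∈ D.pow n P y :=
    D.map_pow (P := (⊤ : (R.unit.pi ι).Fam)) (fun a _ => hsP y hy a)
      (D.mem_pow_free.2 fun i => (hc i y hy).2 n)
  have := add_mem h1 ((b n).2.2 y hy)
  rw [map_sub, sub_add_sub_cancel] at this
  exact this

lemma eq_zero_of_closed {y : X} (h : D.cl (⊥ : E.Fam) y = ⊥) {s : ∀ y, E.stalk y}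
    (hs : E.IsGerm y s) (h' : ∀ᶠ z in 𝓝 y, ∀ n, s z ∈ D.pow n ⊤ z) : s y = 0 := by
  have : s y ∈ D.cl (⊥ : E.Fam) y := D.mem_cl hs (by simpa only [D.adic_bot] using h')
  rw [h] at this
  exact this

/-- A submodule of a separated module with coherent quotients is locally finitely generated. -/
lemma ftm_of_coh_pow {P : E.Fam} {x : X} (h₀ : D.Closed (⊥ : E.Fam) x)
    (hP : ∀ᶠ y in 𝓝 x, OpenAt P y) (hPc : ∀ᶠ y in 𝓝 x, ∀ n, Coh (D.pow n P) P y) :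
    FTm ⊥ P x := by
  obtain ⟨ι, _, s, hs, hsP⟩ := (hPc.self_of_nhds 1).1
  have hall := h₀.and (hP.and (hPc.and ((eventually_all hs).and hsP)))
  obtain ⟨U, hU, hUo, hxU⟩ := eventually_nhds_iff.1 hall
  refine FTm.bot_iff.2 ⟨ι, ‹_›, s, hs, ?_⟩
  filter_upwards [hUo.mem_nhds hxU] with y hy
  apply le_antisymm
  · intro m hm
    obtain ⟨m, hmg, rfl⟩ := E.exists_germ y m
    obtain ⟨W, hW, hWo, hyW⟩ := eventually_nhds_iff.1
      ((E.eventually hmg).and ((hU y hy).2.1 m hmg hm))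
    obtain ⟨V, hVB, hVo, hyV, hVU⟩ := D.basis y (U ∩ W) ((hUo.inter hWo).mem_nhds ⟨hy, hyW⟩)
    -- The constant system equal to `m` is approximated by a combination of the generators of `P / ħ
    -- P`. The difference lies in every `ħⁿ E` over `V`, hence vanishes because `E` is separated.
    obtain ⟨b, hb⟩ := D.approx hVB (t := fun _ => m) hVo (fun y hy => (hU y (hVU hy).1).2.2.2.1)
      (fun y hy => (hU y (hVU hy).1).2.1) (fun n y hy => (hU y (hVU hy).1).2.2.1 n)
      (fun y hy => (hU y (hVU hy).1).2.2.2.2) (fun n y hy => .of_germ (hW y (hVU hy).2).1)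
      (fun n y hy => (hW y (hVU hy).2).2) (fun n y hy => by
        rw [sub_self]
        exact zero_mem _)
    have := D.eq_zero_of_closed (hU y hy).1 (MGerms.sub (comb (hb y hyV).1 (hU y hy).2.2.2.1) hmg) (by
      filter_upwards [hVo.mem_nhds hyV] with z hz n
      exact D.pow_mono n le_top ((hb z hz).2 n))
    exact mem_span_range.2 ⟨_, (sub_eq_zero.1 this).symm⟩
  · rw [(hU y hy).2.2.2.2]
    exact le_sup_right

/-- Completeness of separated modules with coherent quotients. -/
lemma complete_of_coh {V : Set X} (hVo : IsOpen V) (h₀ : ∀ y ∈ V, D.cl (⊥ : E.Fam) y = ⊥)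
    (hc : ∀ y ∈ V, D.QC (⊥ : E.Fam) y) {t : ℕ → ∀ y, E.stalk y}
    (ht : ∀ n, ∀ y ∈ V, GermMod (D.pow n ⊤) y (t n))
    (htt : ∀ n, ∀ y ∈ V, t (n + 1) y - t n y ∈ D.pow n ⊤ y) :
    ∃ s, ∀ y ∈ V, E.IsGerm y s ∧ ∀ n, s y - t n y ∈ D.pow n ⊤ y := by
  have hc' (y) (hy : y ∈ V) : ∀ᶠ z in 𝓝 y, ∀ n, Coh (D.pow n ⊤) (⊤ : E.Fam) z := by
    simpa only [CentralGerm.QC, D.adic_bot] using hc y hy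
  -- Locally, a limit is given by `approx` with `P = ⊤` and generators of `E / ħ E`.
  have hloc (y) (hy : y ∈ V) : ∃ s, E.IsGerm y s ∧ ∀ᶠ z in 𝓝 y, ∀ n, s z - t n z ∈ D.pow n ⊤ z := by
    obtain ⟨ι, _, s, hs, hsP⟩ := ((hc' y hy).self_of_nhds 1).1
    have hall := (hc' y hy).and ((eventually_all hs).and (hsP.and (hVo.mem_nhds hy)))
    obtain ⟨U, hU, hUo, hxU⟩ := eventually_nhds_iff.1 hall
    obtain ⟨V, hVB, hVo, hyV, hVU⟩ := D.basis y U (hUo.mem_nhds hxU)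
    obtain ⟨b, hb⟩ := D.approx hVB (t := t) hVo (fun y hy => (hU y (hVU hy)).2.1)
      (fun y _ => openAt_top y) (fun n y hy => (hU y (hVU hy)).1 n)
      (fun y hy => (hU y (hVU hy)).2.2.1) (fun n y hy => ht n y (hU y (hVU hy)).2.2.2)
      (fun n y hy => trivial) (fun n y hy => htt n y (hU y (hVU hy)).2.2.2)
    exact ⟨_, comb (hb y hyV).1 hs, by
      filter_upwards [hVo.mem_nhds hyV] with z hz n using (hb z hz).2 n⟩
  -- Local limits are unique by separatedness, so values chosen point by point form a section.
  have hex (y : X) : ∃ a : E.stalk y, y ∈ V → ∃ s, s y = a ∧ E.IsGerm y s ∧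
      ∀ᶠ z in 𝓝 y, ∀ n, s z - t n z ∈ D.pow n ⊤ z := by
    by_cases hy : y ∈ V
    · obtain ⟨s, hs, hs'⟩ := hloc y hy
      exact ⟨s y, fun _ => ⟨s, rfl, hs, hs'⟩⟩
    · exact ⟨0, fun h => (hy h).elim⟩
  choose σ hσ using hex
  refine ⟨σ, fun y hy => ?_⟩
  obtain ⟨s, hs, hsg, hst⟩ := hσ y hy
  refine ⟨E.congr hsg ?_, fun n => hs ▸ hst.self_of_nhds n⟩
  filter_upwards [hVo.mem_nhds hy, E.eventually hsg, hst.eventually_nhds] with z hz hsz hst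
  obtain ⟨s', hs', hsg', hst'⟩ := hσ z hz
  rw [← hs', ← sub_eq_zero]
  refine D.eq_zero_of_closed (h₀ z hz) (MGerms.sub hsz hsg') ?_
  filter_upwards [hst, hst'] with w h1 h2 n
  have := sub_mem (h1 n) (h2 n)
  rwa [sub_sub_sub_cancel_right] at this

/-- `1 - ħ a` is invertible. -/
lemma exists_inv (x : X) (a : R.stalk x) : ∃ c, c * (1 - D.h x * a) = 1 := by
  obtain ⟨a, ha, rfl⟩ := R.exists_germ x a
  obtain ⟨V, hV, hVo, hxV⟩ := eventually_nhds_iff.1 (R.eventually ha)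
  have hg (y) (hy : y ∈ V) : R.IsGerm y (fun z => D.h z * a z) := R.mul (D.germ y) (hV y hy)
  have hmem (y) (n : ℕ) : (D.h y * a y) ^ n ∈ D.pow (E := R.unit) n ⊤ y :=
    ⟨a y ^ n, trivial, ((D.central y (a y)).mul_pow n).symm⟩
  -- The partial sums of the geometric series in `ħ a` converge to a section `c`; then `c * (1 - ħ
  -- a) - 1` lies in every `ħⁿ R` and vanishes.
  obtain ⟨c, hc⟩ := D.complete V hVo (fun n y => ∑ k ∈ Finset.range n, (D.h y * a y) ^ k)
    (fun n y hy => .of_germ (MGerms.sum (E := R.unit) _ fun k => RGerms.pow (hg y hy) k))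
    (fun n y hy => by
      rw [Finset.sum_range_succ, add_sub_cancel_left]
      exact hmem y n)
  refine ⟨c x, ?_⟩
  rw [← sub_eq_zero]
  refine D.eq_zero_of_closed (E := R.unit) (s := fun y => c y * (1 - D.h y * a y) - 1)
    (D.separated x) (MGerms.sub (E := R.unit) (R.mul (hc x hxV).1
      (MGerms.sub (E := R.unit) (R.one x) (hg x hxV))) (R.one x)) ?_
  filter_upwards [hVo.mem_nhds hxV] with y hy n
  obtain ⟨d, -, hd⟩ := (hc y hy).2 n
  have h1 : (c y - ∑ k ∈ Finset.range n, (D.h y * a y) ^ k) * (1 - D.h y * a y) ∈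
      D.pow (E := R.unit) n ⊤ y := by
    refine ⟨d * (1 - D.h y * a y), trivial, ?_⟩
    rw [← hd]
    exact (mul_assoc (D.h y ^ n) d _).symm
  have := sub_mem h1 (hmem y n)
  rw [sub_mul, geom_sum_mul_neg] at this
  convert this using 1
  abel

lemma mem_jacobson (x : X) : D.h x ∈ Ring.jacobson (R.stalk x) := by
  rw [← Ideal.jacobson_bot, Ideal.mem_jacobson_iff]
  intro a
  obtain ⟨c, hc⟩ := D.exists_inv x (-a)
  refine ⟨c, ?_⟩
  rw [Ideal.mem_bot, ← hc, mul_neg, sub_neg_eq_add, mul_add, mul_one, (D.central x a).eq, mul_assoc]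
  abel

/-- Nakayama's lemma at a stalk. -/
lemma nakayama {x : X} {I J : Submodule (R.stalk x) (E.stalk x)}
    (hJ : ∃ S : Submodule (R.stalk x) (E.stalk x), S.FG ∧ J = I ⊔ S)
    (h : J ≤ I ⊔ J.map (D.mul 1 x)) : J ≤ I := by
  obtain ⟨S, hS, hIS⟩ := hJ
  -- Modulo `I`, the submodule `J` becomes finitely generated and is contained in its multiple by
  -- `ħ`, so the usual Nakayama lemma applies.
  have e : J.map I.mkQ = S.map I.mkQ := by
    rw [hIS, Submodule.map_sup, Submodule.mkQ_map_self, bot_sup_eq]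
  have h2 : J.map I.mkQ = ⊥ := by
    refine Submodule.FG.eq_bot_of_le_jacobson_smul (e ▸ hS.map _) ?_
    refine (Submodule.map_mono h).trans ?_
    rw [Submodule.map_sup, Submodule.mkQ_map_self, bot_sup_eq]
    rintro _ ⟨_, ⟨m, hm, rfl⟩, rfl⟩
    simp only [CentralGerm.mul_apply, pow_one, map_smul]
    exact Submodule.smul_mem_smul (D.mem_jacobson x) ⟨m, hm, rfl⟩
  intro m hm
  have : I.mkQ m ∈ J.map I.mkQ := ⟨m, hm, rfl⟩
  rw [h2, Submodule.mem_bot, Submodule.mkQ_apply, Submodule.Quotient.mk_eq_zero] at this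
  exact this

/-- `E / (ħⁿ E + I)` is the quotient of the coherent module `E / ħⁿ E` by the image of `I`, which is
finitely generated. -/
lemma qc_of_ftm {I : E.Fam} {x : X} (h₀ : D.QC (⊥ : E.Fam) x) (hI : FTm ⊥ I x) : D.QC I x := by
  filter_upwards [h₀, hI.eventually] with y h₀ hI n
  have h1 : Coh (D.pow n ⊤) (⊤ : E.Fam) y := by simpa only [D.adic_bot] using h₀ n
  refine h1.quot ?_ (Eventually.of_forall fun _ => le_top)
  refine (hI.sup (D.pow n ⊤)).congr (Eventually.of_forall fun z => by simp)
    (Eventually.of_forall fun z => ?_)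
  rw [Pi.sup_apply, sup_comm]
  rfl

lemma openAt_of_ftm {I : E.Fam} {x : X} (hI : FTm ⊥ I x) : ∀ᶠ y in 𝓝 x, OpenAt I y :=
  hI.eventually.mono fun y h => h.openAt (openAt_bot y)

/-- The main finiteness statement: Artin–Rees makes all `P / ħᵐ P` coherent, and successive
approximation then lifts generators of `P / ħ P` to generators of `P`. -/
lemma ftm_of_closed {P : E.Fam} {x : X} (h₀ : D.QC (⊥ : E.Fam) x) (h₀' : D.Closed (⊥ : E.Fam) x)
    (h : D.QC P x) (hP : ∀ᶠ y in 𝓝 x, OpenAt P y) (hc : D.Closed P x) : FTm ⊥ P x :=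
  D.ftm_of_coh_pow h₀' hP (D.coh_pow h₀ h hP hc)

lemma qc_cl {P : E.Fam} {x : X} (h : D.QC P x) (hP : ∀ᶠ y in 𝓝 x, OpenAt P y) :
    D.QC (D.cl P) x := by
  filter_upwards [h, hP.eventually_nhds] with y h hP n
  exact (h n).congr (hP.mono fun z hz => (D.adic_cl hz n).symm) (Eventually.of_forall fun _ => rfl)

/-- A finitely generated submodule is closed. -/
lemma closed_of_ftm {I : E.Fam} {x : X} (h₀ : D.QC (⊥ : E.Fam) x) (h₀' : D.Closed (⊥ : E.Fam) x)
    (hI : FTm ⊥ I x) : D.Closed I x := by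
  have hIo := openAt_of_ftm hI
  have hQ := D.qc_of_ftm h₀ hI
  -- The closure is closed and has the same submodules `ħⁿ E + P` as `I`, so it is finitely
  -- generated. This finiteness is what allows Nakayama's lemma to be applied to it.
  have hJ : FTm ⊥ (D.cl I) x := D.ftm_of_closed h₀ h₀' (D.qc_cl hQ hIo)
    (Eventually.of_forall fun y => D.openAt_cl I y)
    (hIo.eventually_nhds.mono fun y hy => D.cl_cl hy)
  obtain ⟨ι, _, s, hs, h⟩ := FTm.bot_iff.1 hJ
  filter_upwards [h, D.cl_le hQ hIo, hIo] with y h hle hIo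
  refine le_antisymm (D.nakayama ⟨_, Submodule.fg_span (Set.finite_range fun i => s i y), ?_⟩ hle)
    (D.le_cl hIo)
  rw [← h]
  exact (sup_eq_right.2 (D.le_cl hIo)).symm

end Deformation

end Germs

/-! ### Coherence as separatedness with coherent adic quotients, and the Noetherian property. -/

section Germs

open Topology Filter MGerms

variable {X : Type u} [TopologicalSpace X] {R : RGerms X}

namespace Deformation

variable (D : Deformation R) {E F : MGerms R}

/-- `M` is separated near `x` and its quotients by the powers of `ħ` are coherent. -/
def Good (E : MGerms R) (x : X) : Prop := D.QC (⊥ : E.Fam) x ∧ D.Closed (⊥ : E.Fam) x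

lemma good_free (ι : Type) [Fintype ι] (x : X) : D.Good (R.unit.pi ι) x :=
  ⟨D.qc_free x, D.closed_free x⟩

lemma good_unit (x : X) : D.Good R.unit x := by
  constructor
  · refine Eventually.of_forall fun y n => ?_
    rw [D.adic_bot]
    let f : (y : X) → R.unit.stalk y →ₗ[R.stalk y] (R.unit.pi Unit).stalk y :=
      fun y => LinearMap.single (R.stalk y) (fun _ => R.stalk y) ()
    refine (D.coh_free (ι := Unit) n y).of_iso (f := f) (Eventually.of_forall fun z s hs j => ?_)
      (Eventually.of_forall fun z => openAt_top z)
      (Eventually.of_forall fun z => ?_) (Eventually.of_forall fun z => ?_)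
    · simpa [f] using hs
    · ext (a : R.stalk z)
      rw [Pi.top_apply, top_inf_eq]
      constructor
      · exact fun h => D.mem_pow_free.2 fun i => by simpa [f] using h
      · exact fun h => by simpa [f] using D.mem_pow_free.1 h ()
    · have : Submodule.map (f z) ⊤ = ⊤ := by
        refine eq_top_iff.2 fun (c : Unit → R.stalk z) _ => ⟨c (), trivial, funext fun i => ?_⟩
        simp [f]
      rw [Pi.top_apply, Pi.top_apply, this, top_sup_eq]
  · exact Eventually.of_forall D.separated

/-- Coherence of the inverse image under a map from a free module of the powers `ħⁿ P`. -/
lemma qc_comap {ι : Type} [Fintype ι] {s : ι → ∀ y, E.stalk y} {x : X}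
    (hs : ∀ i, E.IsGerm x (s i)) {P Q : E.Fam}
    (hP : ∀ᶠ y in 𝓝 x, ∀ n, Coh (D.pow n P ⊔ Q) P y)
    (hPs : ∀ᶠ y in 𝓝 x, P y = Submodule.span (R.stalk y) (Set.range fun i => s i y) ⊔ Q y) :
    D.QC (E := R.unit.pi ι) (fun y => (Q y).comap (lin s y)) x := by
  filter_upwards [hP, hPs.eventually_nhds, eventually_all hs] with y hP hPs hs n
  have h1 : Coh (fun y => ((D.pow n P ⊔ Q) y).comap (lin s y)) ⊤ y :=
    (hP n).comap (germMap_lin hs) (ftm_free ι y) (Eventually.of_forall fun z => by simp) (by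
      filter_upwards [hPs] with z hz a
      rw [hz, ← range_lin]
      exact Submodule.mem_sup_left ⟨a, rfl⟩)
  -- Since the `s i` generate `P` modulo `Q`, the inverse image of `ħⁿ P + Q` is `ħⁿ Rᶥ` plus the
  -- inverse image of `Q`.
  refine h1.congr ?_ (Eventually.of_forall fun _ => rfl)
  filter_upwards [hPs] with z hz
  ext (c : ι → R.stalk z)
  rw [D.mem_adic]
  constructor
  · intro h
    obtain ⟨_, ⟨p, hp, rfl⟩, q, hq, e⟩ := Submodule.mem_sup.1 h
    change D.h z ^ n • p + q = lin s z c at e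
    rw [SetLike.mem_coe, hz, ← range_lin] at hp
    obtain ⟨_, ⟨b, rfl⟩, q', hq', rfl⟩ := Submodule.mem_sup.1 hp
    refine ⟨b, c - D.h z ^ n • b, ?_, by abel⟩
    rw [Submodule.mem_comap, map_sub, ← e, map_smul, smul_add]
    have := add_mem (Submodule.smul_mem _ (D.h z ^ n) hq') hq
    convert this using 1
    abel
  · rintro ⟨b, p, hp, rfl⟩
    rw [Submodule.mem_comap, map_add, map_smul]
    refine add_mem (Submodule.mem_sup_left (D.smul_mem_pow n ?_)) (Submodule.mem_sup_right hp)
    rw [hz, ← range_lin]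
    exact Submodule.mem_sup_left ⟨b, rfl⟩

/-- Relations between sections of a good module are finitely generated. -/
lemma Good.relAt {x : X} (h : D.Good E x) : RelAt (⊥ : E.Fam) ⊤ x := by
  intro ι _ s hs _
  set I : E.Fam := fun y => Submodule.span (R.stalk y) (Set.range fun i => s i y) with hIdef
  have hI : FTm ⊥ I x := FTm.bot_iff.2 ⟨ι, ‹_›, s, hs, Eventually.of_forall fun _ => rfl⟩
  have hIo := openAt_of_ftm hI
  have hIc := D.closed_of_ftm h.1 h.2 hI
  -- The span `I` of the sections is finitely generated, hence closed, so every `I / ħⁿ I` is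
  -- coherent. The quotients of the free module by `ħⁿ` and the relations are isomorphic to these.
  have hIp := D.coh_pow h.1 (D.qc_of_ftm h.1 hI) hIo hIc
  have hfree := D.good_free ι x
  refine D.ftm_of_closed hfree.1 hfree.2 (D.qc_comap hs (P := I) (Q := ⊥) (by simpa using hIp)
    (Eventually.of_forall fun y => by simp [I])) ?_ ?_
  · filter_upwards [eventually_all hs] with y hy
    exact (openAt_bot y).comap (germMap_lin hy)
  -- The module of relations is closed: a limit of relations has an image lying in every `ħⁿ E`,
  -- which vanishes by separatedness.
  · filter_upwards [eventually_all hs, h.2] with y hs hc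
    refine le_antisymm ?_ (D.le_cl ((openAt_bot y).comap (germMap_lin hs)))
    rintro _ ⟨c, hcg, rfl, hcc⟩
    change lin s y (c y) = 0
    refine D.eq_zero_of_closed hc ((germMap_lin hs).self_of_nhds _ hcg) ?_
    filter_upwards [hcc] with z hz n
    obtain ⟨b, p, hp, e⟩ := D.mem_adic.1 (hz n)
    have hp : lin s z p = 0 := hp
    rw [e, map_add, hp, add_zero, map_smul]
    exact D.smul_mem_pow n trivial

lemma Good.coh {x : X} (h : D.Good E x) : Coh (⊥ : E.Fam) ⊤ x := by
  refine ⟨D.ftm_of_coh_pow h.2 (Eventually.of_forall openAt_top) ?_, ?_⟩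
  · simpa only [CentralGerm.QC, D.adic_bot] using h.1
  · filter_upwards [h.1.eventually_nhds, h.2.eventually_nhds] with y h1 h2
    exact ⟨openAt_bot y, Good.relAt D ⟨h1, h2⟩⟩

/-- The kernel of a finite system of generators modulo a closed submodule. -/
lemma exists_generators {x : X} (hE : FTm (⊥ : E.Fam) ⊤ x) : ∃ (ι : Type) (_ : Fintype ι)
    (s : ι → ∀ y, E.stalk y), (∀ i, E.IsGerm x (s i)) ∧
      ∀ᶠ y in 𝓝 x, LinearMap.range (lin s y) = ⊤ := by
  obtain ⟨ι, _, s, hs, h⟩ := FTm.bot_iff.1 hE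
  refine ⟨ι, ‹_›, s, hs, h.mono fun y hy => ?_⟩
  rw [range_lin, ← hy]
  rfl

/-- Near `x`, present `E` as the quotient of a free module by a finitely generated module of
relations. That submodule is closed and has coherent adic quotients, and both facts descend: the
former to separatedness of `E`, the latter to coherence of the `E / ħⁿ E`. -/
lemma Good.of_coh {x : X} (h : Coh (⊥ : E.Fam) ⊤ x) : D.Good E x := by
  obtain ⟨ι, _, s, hs, hr⟩ := exists_generators h.1
  have hK := h.relAt ι s hs (Eventually.of_forall fun _ _ => trivial)
  have hfree := D.good_free ι x
  have hKc := D.closed_of_ftm hfree.1 hfree.2 hK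
  have hKq := D.qc_of_ftm hfree.1 hK
  constructor
  · filter_upwards [hKq, eventually_all hs, hr.eventually_nhds] with y hq hs hr n
    rw [D.adic_bot]
    refine (hq n).iso (germMap_lin hs) (Eventually.of_forall openAt_top)
      (Eventually.of_forall fun z => D.openAt_pow n (openAt_top z)) ?_ ?_
    · filter_upwards [hr] with z hz
      rw [Pi.top_apply, top_inf_eq]
      ext c
      rw [D.mem_adic]
      constructor
      · rintro ⟨b, p, hp, rfl⟩
        have hp : lin s z p = 0 := hp
        rw [Submodule.mem_comap, map_add, hp, add_zero, map_smul]
        exact D.smul_mem_pow n trivial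
      · rintro ⟨m, -, hm⟩
        obtain ⟨b, rfl⟩ := LinearMap.range_eq_top.1 hz m
        refine ⟨b, c - D.h z ^ n • b, ?_, by abel⟩
        change lin s z (c - D.h z ^ n • b) = 0
        rw [map_sub, ← hm, map_smul, sub_eq_zero]
        rfl
    · filter_upwards [hr] with z hz
      rw [Pi.top_apply, Pi.top_apply, Submodule.map_top, hz, top_sup_eq]
  · filter_upwards [hKc, eventually_all hs, hr.eventually_nhds] with y hc hs hr
    refine eq_bot_iff.2 ?_
    rintro _ ⟨m, hm, rfl, hmc⟩
    obtain ⟨c, hcy⟩ := LinearMap.range_eq_top.1 hr.self_of_nhds (m y)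
    obtain ⟨c, hcg, rfl⟩ := (R.unit.pi ι).exists_germ y c
    have e := E.unique hm ((germMap_lin hs).self_of_nhds _ hcg) hcy.symm
    have : c y ∈ D.cl (rel ⊥ s) y := by
      refine D.mem_cl hcg ?_
      filter_upwards [hmc, e, hr] with z hz e hr n
      have := hz n
      rw [D.adic_bot, e] at this
      obtain ⟨m', -, hm'⟩ := this
      obtain ⟨b, rfl⟩ := LinearMap.range_eq_top.1 hr m'
      refine D.mem_adic.2 ⟨b, c z - D.h z ^ n • b, ?_, by abel⟩
      change lin s z (c z - D.h z ^ n • b) = 0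
      rw [map_sub, ← hm', map_smul, sub_eq_zero]
      rfl
    rw [hc] at this
    change lin s y (c y) = 0 at this
    rw [← hcy, this]
    exact zero_mem _

/-- A finitely generated module whose quotients by the powers of `ħ` are coherent is separated. -/
lemma Good.of_ftm {x : X} (h : FTm (⊥ : E.Fam) ⊤ x) (h₀ : D.QC (⊥ : E.Fam) x) : D.Good E x := by
  refine ⟨h₀, ?_⟩
  obtain ⟨ι, _, s, hs, hr⟩ := exists_generators h
  have hfree := D.good_free ι x
  -- The obstruction to separatedness. Its inverse image in a free module is closed with coherent
  -- adic quotients, hence finitely generated, and therefore so is `N`.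
  set N : E.Fam := D.cl ⊥
  have hcN (y : X) : D.cl N y = N y := D.cl_cl (Eventually.of_forall openAt_bot)
  have hNpow (n : ℕ) (y : X) : N y ≤ D.pow n ⊤ y := by
    simpa only [D.adic_bot] using D.cl_le_adic (⊥ : E.Fam) n y
  set K : (R.unit.pi ι).Fam := fun y => (N y).comap (lin s y)
  have hK : FTm ⊥ K x := by
    refine D.ftm_of_closed hfree.1 hfree.2 (D.qc_comap hs (P := ⊤) (Q := N) ?_ ?_) ?_ ?_
    · filter_upwards [h₀] with y hy n
      refine (hy n).congr (Eventually.of_forall fun z => ?_) (Eventually.of_forall fun _ => rfl)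
      rw [D.adic_bot, Pi.sup_apply, sup_eq_left.2 (hNpow n z)]
    · filter_upwards [hr] with y hy
      rw [← range_lin, hy, top_sup_eq]
      rfl
    · filter_upwards [eventually_all hs] with y hy
      exact (D.openAt_cl _ y).comap (germMap_lin hy)
    · filter_upwards [eventually_all hs] with y hs
      refine le_antisymm ?_ (D.le_cl ((D.openAt_cl _ y).comap (germMap_lin hs)))
      rintro _ ⟨c, hcg, rfl, hcc⟩
      change lin s y (c y) ∈ N y
      refine D.mem_cl ((germMap_lin hs).self_of_nhds _ hcg) ?_
      filter_upwards [hcc] with z hz n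
      obtain ⟨b, p, hp, e⟩ := D.mem_adic.1 (hz n)
      rw [e, map_add, map_smul, D.adic_bot]
      exact add_mem (D.smul_mem_pow n trivial) (hNpow n z hp)
  have hN : FTm ⊥ N x := by
    refine (hK.map (germMap_lin hs)).congr (Eventually.of_forall fun y => Submodule.map_bot _) ?_
    filter_upwards [hr] with y hy
    rw [Submodule.map_comap_eq, hy, top_inf_eq]
  obtain ⟨κ, _, t, ht, hN⟩ := FTm.bot_iff.1 hN
  -- For the zero submodule, `cl_le` reads `N ≤ ħ N`, and Nakayama's lemma gives `N = 0`.
  filter_upwards [hN, D.cl_le h₀ (Eventually.of_forall openAt_bot)] with y hN hle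
  refine le_bot_iff.1 (D.nakayama (I := ⊥)
    ⟨_, Submodule.fg_span (Set.finite_range fun i => t i y), ?_⟩ hle)
  rw [← hN, bot_sup_eq]

lemma coh_iff_good {x : X} : Coh (⊥ : E.Fam) ⊤ x ↔ D.Good E x := ⟨Good.of_coh D, Good.coh D⟩

/-- The filtration by the powers of `ħ`. -/
lemma qc_bot_iff : (∀ x, D.QC (⊥ : E.Fam) x) ↔
    ∀ n x, Coh (D.pow (n + 1) ⊤) (D.pow n (⊤ : E.Fam)) x := by
  have h1 : (∀ x, D.QC (⊥ : E.Fam) x) ↔ ∀ n x, Coh (D.pow n ⊤) (⊤ : E.Fam) x := by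
    simp only [CentralGerm.QC, D.adic_bot]
    exact ⟨fun h n x => (h x).self_of_nhds n, fun h x => Eventually.of_forall fun y n => h n y⟩
  rw [h1]
  constructor
  · intro h n x
    -- `ħⁿ M / ħⁿ⁺¹ M` is the kernel of the surjection between the coherent modules `M / ħⁿ⁺¹ M` and
    -- `M / ħⁿ M`; in the other direction these quotients are built by extensions.
    refine (h (n + 1) x).sub ((h (n + 1) x).1.ker (h n x).relAt
      (Eventually.of_forall fun y => D.pow_antitone n.le_succ ⊤ y)
      (Eventually.of_forall fun y => le_top)) (Eventually.of_forall fun y => le_top)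
  · intro h n
    induction n with
    | zero =>
      intro x
      rw [D.pow_zero]
      refine ⟨FTm.refl _ _, Eventually.of_forall fun y => ⟨openAt_top y, fun κ _ s _ _ => ?_⟩⟩
      exact (ftm_free κ y).congr (Eventually.of_forall fun _ => rfl)
        (Eventually.of_forall fun z => rfl)
    | succ n ih => exact fun x => (h n x).ext (ih x)

/-- A directed family of finitely generated ideals is locally stationary. -/
lemma stationary_ideals (D : Deformation R) {U : Set X} (hU : IsOpen U) {I : Type u} [Preorder I] [IsDirectedOrder I]
    [Nonempty I] (J : I → R.unit.Fam) (hJ : ∀ i j, i ≤ j → ∀ y ∈ U, J i y ≤ J j y)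
    (hJF : ∀ i, ∀ y ∈ U, FTm ⊥ (J i) y) {x : X} (hx : x ∈ U) :
    ∃ i₀, ∀ᶠ y in 𝓝 x, ∀ j, i₀ ≤ j → J j y = J i₀ y := by
  have hgood (y : X) : D.Good R.unit y := D.good_unit y
  have hmono (i j : I) (m n : ℕ) (hij : i ≤ j) (hmn : m ≤ n) (y) (hy : y ∈ U) :
      D.initial (J i) m y ≤ D.initial (J j) n y := by
    refine (monotone_nat_of_le_succ (f := fun n => D.initial (J i) n y)
      (fun n => D.initial_succ _ n y) hmn).trans ?_
    exact Submodule.comap_mono (sup_le_sup_left (hJ i j hij y hy) _)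
  have hF (i : I) (n : ℕ) (y) (hy : y ∈ U) : FTm ⊥ (D.initial (J i) n) y := by
    have h1 : Coh (D.initial (J i) n) ⊤ y :=
      D.coh_initial ((D.qc_of_ftm (hgood y).1 (hJF i y hy)).self_of_nhds (n + 1))
    have h2 : FTm (E := R.unit) ⊥ (D.pow 1 ⊤) y := (D.ftm_pow 1 (ftm_unit y)).congr
      (Eventually.of_forall fun z => Submodule.map_bot _) (Eventually.of_forall fun z => rfl)
    exact h2.trans ((D.coh y).1.ker h1.relAt
      (Eventually.of_forall fun z => D.pow_le_initial (J i) n z)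
      (Eventually.of_forall fun _ => le_top))
  have : IsDirectedOrder (I × ℕ) := ⟨fun p q => by
    obtain ⟨k, h1, h2⟩ := exists_ge_ge p.1 q.1
    exact ⟨(k, max p.2 q.2), ⟨h1, le_max_left _ _⟩, ⟨h2, le_max_right _ _⟩⟩⟩
  -- The ideals of initial terms are directed in both the index and the degree. Stationarity over
  -- pairs settles all degrees at least `n₀` at once; the finitely many smaller degrees are treated
  -- separately.
  obtain ⟨⟨i₀, n₀⟩, h₀⟩ := D.noeth U hU (I × ℕ) (fun p => D.initial (J p.1) p.2)
    (fun p q (hpq : p.1 ≤ q.1 ∧ p.2 ≤ q.2) => hmono _ _ _ _ hpq.1 hpq.2) (fun p => hF p.1 p.2)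
    (fun p y _ => D.pow_le_initial _ _ y) x hx
  choose i hi using fun n => D.noeth U hU I (fun i => D.initial (J i) n)
    (fun p q hpq => hmono _ _ _ _ hpq le_rfl) (fun p => hF p n)
    (fun p y _ => D.pow_le_initial _ _ y) x hx
  classical
  obtain ⟨i₁, hi₁⟩ := Finset.exists_le (insert i₀ ((Finset.range n₀).image i))
  have hle : ∀ n < n₀, i n ≤ i₁ := fun n hn =>
    hi₁ _ (Finset.mem_insert_of_mem (Finset.mem_image_of_mem _ (Finset.mem_range.2 hn)))
  have hle0 : i₀ ≤ i₁ := hi₁ _ (Finset.mem_insert_self _ _)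
  refine ⟨i₁, ?_⟩
  have hst : ∀ᶠ y in 𝓝 x, ∀ n j, i₁ ≤ j → D.initial (J j) n y = D.initial (J i₁) n y := by
    have h3 : ∀ᶠ y in 𝓝 x, ∀ n : Fin n₀, ∀ j, i n ≤ j →
        D.initial (J j) n y = D.initial (J (i n)) n y :=
      Filter.eventually_all.2 fun n => hi n
    filter_upwards [h₀, h3] with y h₀ h3 n j hj
    by_cases hn : n < n₀
    · exact (h3 ⟨n, hn⟩ j ((hle n hn).trans hj)).trans (h3 ⟨n, hn⟩ i₁ (hle n hn)).symm
    · exact (h₀ (j, n) ⟨hle0.trans hj, not_lt.1 hn⟩).trans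
        (h₀ (i₁, n) ⟨hle0, not_lt.1 hn⟩).symm
  -- Equality of all ideals of initial terms gives `J j ⊂ ħⁿ R + J i₁` for every `n`, by induction
  -- on `n`. Since `J i₁` is finitely generated it is closed, whence `J j ⊂ J i₁`.
  have hcl := D.closed_of_ftm (hgood x).1 (hgood x).2 (hJF i₁ x hx)
  filter_upwards [hst.eventually_nhds, hcl, hU.mem_nhds hx] with y hst hcl hy j hj
  refine le_antisymm (fun a ha => ?_) (hJ _ _ hj y hy)
  obtain ⟨a, hag, rfl⟩ := R.unit.exists_germ y a
  rw [← hcl]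
  refine D.mem_cl (E := R.unit) hag ?_
  filter_upwards [hst, hU.mem_nhds hy, (hJF j y hy).openAt (openAt_bot y) a hag ha]
    with z hst hz ha n
  induction n with
  | zero => exact D.pow_le_adic (E := R.unit) _ _ _ (by rw [D.pow_zero]; trivial)
  | succ n ih =>
    obtain ⟨b, p, hp, e⟩ := D.mem_adic.1 ih
    have h4 : b ∈ D.initial (J j) n z := by
      rw [mem_initial]
      have : D.h z ^ n • b = a z - p := by rw [e]; abel
      rw [this]
      exact D.le_adic (E := R.unit) _ _ _ (sub_mem ha (hJ _ _ hj z hz hp))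
    rw [hst n j hj, mem_initial] at h4
    rw [e]
    exact add_mem h4 (D.le_adic (E := R.unit) _ _ _ hp)

/-- The stalks are Noetherian. -/
lemma isNoetherianRing_stalk (x : X)
    (h : ∀ J : Submodule (R.stalk x) (R.stalk x), D.pow (E := R.unit) 1 ⊤ x ≤ J → J.FG) :
    IsNoetherianRing (R.stalk x) := by
  have hgood := D.good_unit x
  rw [isNoetherianRing_iff, isNoetherian_def]
  intro I
  -- the ideals of initial terms
  let J (n : ℕ) : Submodule (R.stalk x) (R.stalk x) :=
    ((D.pow (E := R.unit) (n + 1) ⊤ x) ⊔ I).comap (D.mul (E := R.unit) n x)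
  have hJmem (n : ℕ) (a : R.stalk x) :
      a ∈ J n ↔ ∃ b, ∃ e ∈ I, D.h x ^ n * a = D.h x ^ (n + 1) * b + e := by
    change D.h x ^ n * a ∈ (D.pow (E := R.unit) (n + 1) ⊤ x) ⊔ I ↔ _
    rw [Submodule.mem_sup]
    constructor
    · rintro ⟨_, ⟨b, -, rfl⟩, e, he, h⟩
      exact ⟨b, e, he, h.symm⟩
    · rintro ⟨b, e, he, h⟩
      exact ⟨_, ⟨b, trivial, rfl⟩, e, he, h.symm⟩
  have hJh (n : ℕ) : D.pow (E := R.unit) 1 ⊤ x ≤ J n := by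
    rintro _ ⟨b, -, rfl⟩
    refine (hJmem _ _).2 ⟨b, 0, zero_mem _, ?_⟩
    rw [add_zero, pow_add, mul_assoc]
    rfl
  have hJs (n : ℕ) : J n ≤ J (n + 1) := by
    intro a ha
    obtain ⟨b, e, he, h⟩ := (hJmem _ _).1 ha
    refine (hJmem _ _).2 ⟨b, D.h x * e, I.smul_mem (D.h x) he, ?_⟩
    rw [pow_succ', mul_assoc, h, mul_add, ← mul_assoc, ← pow_succ']
  have hmono : Monotone J := monotone_nat_of_le_succ hJs
  -- The union of the chain contains `ħ`, hence is finitely generated by hypothesis, hence compact,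
  -- and so is reached at a finite stage.
  obtain ⟨N, hN⟩ : ∃ N, ∀ n, N ≤ n → J n = J N := by
    have hsup : (⨆ n, J n).FG := h _ ((hJh 0).trans (le_iSup J 0))
    obtain ⟨N, hN⟩ := CompleteLattice.IsCompactElement.exists_finset_of_le_iSup _
      ((Submodule.fg_iff_compact _).1 hsup) J le_rfl
    obtain ⟨M, hM⟩ := Finset.exists_le N
    refine ⟨M, fun n hn => le_antisymm ?_ (hmono hn)⟩
    refine (le_iSup J n).trans (hN.trans ?_)
    exact iSup₂_le fun i hi => hmono (hM i hi)
  -- finitely many elements of the ideal with enough initial terms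
  have hgen (n : ℕ) : ∃ G : Submodule (R.stalk x) (R.stalk x), G.FG ∧ G ≤ I ∧
      ∀ a ∈ J n, ∃ b, ∃ e ∈ G, D.h x ^ n * a = D.h x ^ (n + 1) * b + e := by
    obtain ⟨S, hS⟩ := h (J n) (hJh n)
    have hSJ : ∀ a : S, ∃ b, ∃ e ∈ I, D.h x ^ n * a.1 = D.h x ^ (n + 1) * b + e :=
      fun a => (hJmem _ _).1 (hS ▸ Submodule.subset_span a.2)
    choose b e he hbe using hSJ
    refine ⟨Submodule.span _ (Set.range e), Submodule.fg_span (Set.finite_range e),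
      Submodule.span_le.2 (by rintro _ ⟨i, rfl⟩; exact he i), fun a ha => ?_⟩
    rw [← hS] at ha
    induction ha using Submodule.span_induction with
    | mem a ha => exact ⟨b ⟨a, ha⟩, e ⟨a, ha⟩, Submodule.subset_span ⟨_, rfl⟩, hbe ⟨a, ha⟩⟩
    | zero => exact ⟨0, 0, zero_mem _, by simp⟩
    | add p q _ _ hp hq =>
      obtain ⟨b, e, he, h⟩ := hp
      obtain ⟨b', e', he', h'⟩ := hq
      exact ⟨b + b', e + e', add_mem he he', by rw [mul_add, h, h', mul_add]; abel⟩
    | smul r p _ hp =>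
      obtain ⟨b, e, he, h⟩ := hp
      refine ⟨r * b, r * e, Submodule.smul_mem _ r he, ?_⟩
      rw [smul_eq_mul, ← mul_assoc, ((D.central x r).pow_left n).eq, mul_assoc, h, mul_add,
        ← mul_assoc, ← mul_assoc, ((D.central x r).pow_left (n + 1)).eq]
  choose G hGfg hGI hG using hgen
  set I' : Submodule (R.stalk x) (R.stalk x) := ⨆ n : Fin (N + 1), G n
  have hI'fg : I'.FG := Submodule.fg_iSup _ fun n => hGfg n
  have hI'I : I' ≤ I := iSup_le fun n => hGI n
  have happrox (a) (ha : a ∈ I) (k : ℕ) : ∃ b, ∃ e ∈ I', a = D.h x ^ k * b + e := by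
    induction k with
    | zero => exact ⟨a, 0, zero_mem _, by simp⟩
    | succ k ih =>
      obtain ⟨b, e, he, hbe⟩ := ih
      -- `ħᵏ b = a - e` lies in `I`, so `b` is an initial term of degree `k`. For `k ≤ N` the term
      -- is removed by `G k`; for larger `k` the identity in degree `N` is multiplied by `ħ` to the
      -- power `k - N`.
      have hb : b ∈ J k := (hJmem _ _).2 ⟨0, a - e, sub_mem ha (hI'I he), by rw [hbe]; simp⟩
      by_cases hk : k ≤ N
      · obtain ⟨b', e', he', h'⟩ := hG k b hb
        refine ⟨b', e' + e, add_mem (le_iSup (fun n : Fin (N + 1) => G n)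
          ⟨k, Nat.lt_succ_of_le hk⟩ he') he, ?_⟩
        rw [hbe, h', add_assoc]
      · rw [hN k (by omega)] at hb
        obtain ⟨b', e', he', h'⟩ := hG N b hb
        refine ⟨b', D.h x ^ (k - N) * e' + e, add_mem (I'.smul_mem _
          (le_iSup (fun n : Fin (N + 1) => G n) ⟨N, Nat.lt_succ_self N⟩ he')) he, ?_⟩
        rw [hbe, ← add_assoc]
        congr 1
        have e1 : k = (k - N) + N := by omega
        have e2 : k + 1 = (k - N) + (N + 1) := by omega
        rw [e2, pow_add, mul_assoc, ← mul_add, ← h', ← mul_assoc, ← pow_add, ← e1]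
  have hII : I = I' := by
    refine le_antisymm (fun a ha => ?_) hI'I
    -- extend the ideals to a neighbourhood
    obtain ⟨S, hS⟩ := hI'fg
    choose σ hσ hσx using fun s : S => R.unit.exists_germ x s.1
    obtain ⟨α, hα, rfl⟩ := R.unit.exists_germ x a
    -- Artin–Rees is a statement on neighbourhoods, so it is applied to the ideal `P` spanned near
    -- `x` by sections extending generators of `I'` and the element `a`.
    let T : Option (Fin S.card) → ∀ y, R.stalk y := fun o => o.elim α fun i => σ (S.equivFin.symm i)
    have hT (o) : R.IsGerm x (T o) := by
      cases o with
      | none => exact hα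
      | some i => exact hσ _
    let P : R.unit.Fam := fun y => Submodule.span (R.stalk y) (Set.range fun o => T o y)
    have hP : FTm ⊥ P x := FTm.bot_iff.2 ⟨_, inferInstance, T, hT, Eventually.of_forall fun _ => rfl⟩
    obtain ⟨M, hM⟩ := D.artinRees (D.qc_of_ftm hgood.1 hP) (openAt_of_ftm hP)
      (D.closed_of_ftm hgood.1 hgood.2 hP)
    have hM := hM.self_of_nhds 1
    have hI'P : I' ≤ P x := by
      rw [← hS, Submodule.span_le]
      intro s hs
      refine Submodule.subset_span ⟨some (S.equivFin ⟨s, hs⟩), ?_⟩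
      simp [T, hσx]
    have hαP : α x ∈ P x := Submodule.subset_span ⟨none, rfl⟩
    -- With the exponent `1 + M`, Artin–Rees puts `ħ ^ (1 + M) * b` into `ħ P`. Thus `P ⊂ I' + ħ P`
    -- at `x`, and Nakayama's lemma gives `a ∈ I'`.
    obtain ⟨b, e, he, hbe⟩ := happrox (α x) ha (1 + M)
    have h5 : D.h x ^ (1 + M) * b ∈ D.pow 1 P x := by
      refine hM ⟨?_, b, trivial, rfl⟩
      have : D.h x ^ (1 + M) * b = α x - e := by rw [hbe]; abel
      rw [this]
      exact sub_mem hαP (hI'P he)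
    refine D.nakayama (E := R.unit) (I := I') (J := P x) ⟨P x, Submodule.fg_span
      (Set.finite_range _), (sup_eq_right.2 hI'P).symm⟩ (Submodule.span_le.2 ?_) hαP
    rintro _ ⟨o, rfl⟩
    cases o with
    | none =>
      change α x ∈ _
      rw [hbe]
      exact add_mem (Submodule.mem_sup_right h5) (Submodule.mem_sup_left he)
    | some i =>
      refine Submodule.mem_sup_left ?_
      rw [← hS]
      refine Submodule.subset_span ?_
      simp [T, hσx]
  rw [hII]
  exact hI'fg

end Deformation

end Germs

/-! ### Sections of sheaves of modules on a site: subsheaves, images, epimorphisms. -/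

section Site

variable {C : Type u} [SmallCategory C] {J : GrothendieckTopology C} {R : Sheaf J RingCat.{u}}

/-- The restriction of sections of a sheaf of modules. -/
def res {M : SheafOfModules.{u} R} {U V : C} (f : V ⟶ U) (m : M.val.obj (op U)) :
    M.val.obj (op V) := M.val.map f.op m

/-- The restriction of sections of a sheaf of rings. -/
def rres {U V : C} (f : V ⟶ U) (r : R.obj.obj (op U)) : R.obj.obj (op V) := R.obj.map f.op r

section res

variable {M N : SheafOfModules.{u} R} {U V W : C} (f : V ⟶ U) (g : W ⟶ V)

lemma res_add (m n : M.val.obj (op U)) : res f (m + n) = res f m + res f n :=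
  map_add (M.val.restrictₛₗ f.op) m n

lemma res_zero : res f (0 : M.val.obj (op U)) = 0 := map_zero (M.val.restrictₛₗ f.op)

lemma res_smul (r : R.obj.obj (op U)) (m : M.val.obj (op U)) :
    res f (r • m) = rres f r • res f m := M.val.map_smul f.op r m

lemma res_sum {ι : Type*} (I : Finset ι) (m : ι → M.val.obj (op U)) :
    res f (∑ i ∈ I, m i) = ∑ i ∈ I, res f (m i) := map_sum (M.val.restrictₛₗ f.op) m I

lemma res_comp (m : M.val.obj (op U)) : res (g ≫ f) m = res g (res f m) :=
  M.val.map_comp_apply f.op g.op m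

lemma rres_mul (m n : R.obj.obj (op U)) : rres f (m * n) = rres f m * rres f n :=
  map_mul (R.obj.map f.op).hom m n

lemma rres_sum {ι : Type*} (I : Finset ι) (m : ι → R.obj.obj (op U)) :
    rres f (∑ i ∈ I, m i) = ∑ i ∈ I, rres f (m i) := map_sum (R.obj.map f.op).hom m I

lemma rres_comp (m : R.obj.obj (op U)) : rres (g ≫ f) m = rres g (rres f m) := by
  change R.obj.map (f.op ≫ g.op) m = _
  rw [R.obj.map_comp]
  rfl

/-- The action of a morphism on sections. -/
def mapSec (φ : M ⟶ N) (U : C) : M.val.obj (op U) →ₗ[R.obj.obj (op U)] N.val.obj (op U) :=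
  (φ.val.app (op U)).hom

lemma mapSec_res (φ : M ⟶ N) (m : M.val.obj (op U)) :
    mapSec φ V (res f m) = res f (mapSec φ U m) :=
  PresheafOfModules.naturality_apply φ.val f.op m

lemma mapSec_comp {P : SheafOfModules.{u} R} (φ : M ⟶ N) (ψ : N ⟶ P) (m : M.val.obj (op U)) :
    mapSec (φ ≫ ψ) U m = mapSec ψ U (mapSec φ U m) := rfl

lemma mapSec_id (m : M.val.obj (op U)) : mapSec (𝟙 M) U m = m := rfl

lemma mapSec_zero (m : M.val.obj (op U)) : mapSec (0 : M ⟶ N) U m = 0 := rfl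

lemma hom_ext_sec {φ ψ : M ⟶ N} (h : ∀ U (m : M.val.obj (op U)), mapSec φ U m = mapSec ψ U m) :
    φ = ψ := by
  ext U m
  exact h U.unop m

lemma res_ext {S : Sieve U} (hS : S ∈ J U) {m n : M.val.obj (op U)}
    (h : ∀ ⦃V⦄ (f : V ⟶ U), S f → res f m = res f n) : m = n :=
  M.isSheaf.isSeparated U S hS m n h

lemma res_glue {S : Sieve U} (hS : S ∈ J U) (m : ∀ ⦃V⦄ (f : V ⟶ U), S f → M.val.obj (op V))
    (h : ∀ ⦃V W⦄ (f : V ⟶ U) (hf : S f) (g : W ⟶ V), res g (m f hf) =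
      m (g ≫ f) (S.downward_closed hf g)) :
    ∃ n : M.val.obj (op U), ∀ ⦃V⦄ (f : V ⟶ U) (hf : S f), res f n = m f hf := by
  have h1 := (isSheaf_iff_isSheaf_of_type J _).1
    ((Presheaf.isSheaf_iff_isSheaf_forget J _ (CategoryTheory.forget Ab.{u})).1 M.isSheaf)
  obtain ⟨n, hn, -⟩ := h1 S hS (fun V f hf => m f hf)
    ((Presieve.compatible_iff_sieveCompatible _).2 fun V W f g hf => (h f hf g).symm)
  exact ⟨n, hn⟩

end res

section subsheaf

variable {M : SheafOfModules.{u} R}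

/-- A submodule of a sheaf of modules is local if it is a subsheaf. -/
def IsLocalSub (T : M.val.Submodule) : Prop :=
  ∀ ⦃U : C⦄ (m : M.val.obj (op U)) (S : Sieve U), S ∈ J U →
    (∀ ⦃V⦄ (f : V ⟶ U), S f → res f m ∈ T.obj (op V)) → m ∈ T.obj (op U)

lemma res_mem (T : M.val.Submodule) {U V : C} (f : V ⟶ U) {m : M.val.obj (op U)}
    (hm : m ∈ T.obj (op U)) : res f m ∈ T.obj (op V) := T.map_mem f.op hm

/-- The sheaf of modules defined by a local submodule. -/
def subsheaf (T : M.val.Submodule) (hT : IsLocalSub T) : SheafOfModules.{u} R where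
  val := T.toPresheafOfModules
  isSheaf := by
    rw [Presheaf.isSheaf_iff_isSheaf_forget J _ (CategoryTheory.forget Ab.{u}),
      isSheaf_iff_isSheaf_of_type]
    intro U S hS x hx
    rw [Presieve.compatible_iff_sieveCompatible] at hx
    have hx' : ∀ ⦃V W⦄ (f : V ⟶ U) (hf : S f) (g : W ⟶ V),
        res g (x f hf : T.obj (op V)).1 = (x (g ≫ f) (S.downward_closed hf g) : T.obj (op W)).1 :=
      fun V W f hf g => (congrArg (fun y : T.obj (op W) => y.1) (hx f g hf)).symm
    obtain ⟨n, hn⟩ := res_glue hS (fun V f hf => (x f hf : T.obj (op V)).1) hx'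
    refine ⟨(⟨n, hT n S hS fun V f hf => ?_⟩ : T.obj (op U)), fun V f hf => ?_, fun y hy => ?_⟩
    · rw [hn f hf]
      exact (x f hf : T.obj (op V)).2
    · exact Subtype.ext (hn f hf)
    · refine Subtype.ext (res_ext hS fun V f hf => ?_)
      rw [hn f hf]
      exact congrArg (fun y : T.obj (op V) => y.1) (hy f hf)

/-- The inclusion of a subsheaf. -/
def subsheafι (T : M.val.Submodule) (hT : IsLocalSub T) : subsheaf T hT ⟶ M := ⟨T.ι⟩

variable (T : M.val.Submodule) (hT : IsLocalSub T)

instance : Mono (subsheafι T hT) := (SheafOfModules.forget R).mono_of_mono_map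
  (inferInstanceAs (Mono T.ι))

/-- A morphism with values in a subsheaf. -/
def subsheafLift {N : SheafOfModules.{u} R} (φ : N ⟶ M)
    (h : ∀ U (n : N.val.obj (op U)), mapSec φ U n ∈ T.obj (op U)) : N ⟶ subsheaf T hT where
  val := PresheafOfModules.homMk
    { app := fun U => AddCommGrpCat.ofHom
        ((mapSec φ U.unop).codRestrict (T.obj U) (h U.unop)).toAddMonoidHom
      naturality := fun U V f => by
        ext n
        exact Subtype.ext (mapSec_res f.unop φ n) }
    (fun U r n => Subtype.ext (map_smul (mapSec φ U.unop) r n))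

lemma subsheafLift_ι {N : SheafOfModules.{u} R} (φ : N ⟶ M)
    (h : ∀ U (n : N.val.obj (op U)), mapSec φ U n ∈ T.obj (op U)) :
    subsheafLift T hT φ h ≫ subsheafι T hT = φ := rfl

lemma surjective_of_isIso {N : SheafOfModules.{u} R} (φ : N ⟶ M) [IsIso φ] (U : C) :
    Function.Surjective (mapSec φ U) := fun m =>
  ⟨mapSec (inv φ) U m, by rw [← mapSec_comp, IsIso.inv_hom_id, mapSec_id]⟩

-- If an epimorphism factors through a subsheaf, the inclusion is both mono and epi, hence an
-- isomorphism. Applied to the subsheaf generated by an image, this turns epimorphisms into locally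
-- surjective maps.
variable {T hT} in
lemma eq_top_of_epi {N : SheafOfModules.{u} R} (φ : N ⟶ subsheaf T hT)
    [Epi (φ ≫ subsheafι T hT)] {U : C} (m : M.val.obj (op U)) : m ∈ T.obj (op U) := by
  have : Epi (subsheafι T hT) := epi_of_epi φ _
  have : IsIso (subsheafι T hT) := isIso_of_mono_of_epi _
  obtain ⟨n, rfl⟩ := surjective_of_isIso (subsheafι T hT) U m
  exact Subtype.prop (p := fun m => m ∈ T.obj (op U)) n

/-- The subsheaf generated by a submodule. -/
def locClosure (T : M.val.Submodule) : M.val.Submodule where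
  obj U :=
    { carrier := {m | ∃ S ∈ J U.unop, ∀ ⦃V⦄ (f : V ⟶ U.unop), S f → res f m ∈ T.obj (op V)}
      zero_mem' := ⟨⊤, J.top_mem _, fun V f _ => by
        rw [res_zero]
        exact zero_mem _⟩
      add_mem' := by
        rintro m n ⟨S, hS, h⟩ ⟨S', hS', h'⟩
        refine ⟨S ⊓ S', J.intersection_covering hS hS', fun V f hf => ?_⟩
        rw [res_add]
        exact add_mem (h f hf.1) (h' f hf.2)
      smul_mem' := by
        rintro r m ⟨S, hS, h⟩
        refine ⟨S, hS, fun V f hf => ?_⟩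
        rw [res_smul]
        exact Submodule.smul_mem _ _ (h f hf) }
  map {U V} g := by
    rintro m ⟨S, hS, h⟩
    refine ⟨S.pullback g.unop, J.pullback_stable _ hS, fun W f hf => ?_⟩
    change res f (res g.unop m) ∈ _
    rw [← res_comp]
    exact h _ hf

lemma le_locClosure {U : C} {m : M.val.obj (op U)} (h : m ∈ T.obj (op U)) :
    m ∈ (locClosure T).obj (op U) := ⟨⊤, J.top_mem _, fun _ f _ => res_mem T f h⟩

lemma isLocalSub_locClosure : IsLocalSub (locClosure T) := by
  intro U m S hS h
  choose S' hS' h' using h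
  refine ⟨Sieve.bind S S', J.bind_covering hS fun V f hf => hS' f hf, ?_⟩
  rintro W _ ⟨V, g, f, hf, hg, rfl⟩
  rw [res_comp]
  exact h' f hf g hg

/-- The image of a morphism, as a presheaf. -/
def rangeSub {N : SheafOfModules.{u} R} (φ : N ⟶ M) : M.val.Submodule where
  obj U := LinearMap.range (mapSec φ U.unop)
  map f := by
    rintro _ ⟨n, rfl⟩
    exact ⟨res f.unop n, mapSec_res f.unop φ n⟩

lemma exists_of_epi {N : SheafOfModules.{u} R} (φ : N ⟶ M) [Epi φ] {U : C}
    (m : M.val.obj (op U)) :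
    ∃ S ∈ J U, ∀ ⦃V⦄ (f : V ⟶ U), S f → ∃ n, mapSec φ V n = res f m := by
  let ψ : N ⟶ subsheaf (locClosure (rangeSub φ)) (isLocalSub_locClosure _) :=
    subsheafLift _ _ φ fun U n => le_locClosure _ ⟨n, rfl⟩
  have : Epi (ψ ≫ subsheafι _ (isLocalSub_locClosure _)) := by
    rw [subsheafLift_ι]
    infer_instance
  exact eq_top_of_epi ψ m

lemma epi_of_locally {N : SheafOfModules.{u} R} (φ : N ⟶ M)
    (h : ∀ U (m : M.val.obj (op U)), ∃ S ∈ J U, ∀ ⦃V⦄ (f : V ⟶ U), S f → ∃ n, mapSec φ V n = res f m) :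
    Epi φ := ⟨fun α β e => hom_ext_sec fun U m => by
  obtain ⟨S, hS, h⟩ := h U m
  refine res_ext hS fun V f hf => ?_
  obtain ⟨n, hn⟩ := h f hf
  rw [← mapSec_res, ← mapSec_res, ← hn, ← mapSec_comp, e, mapSec_comp]⟩

lemma mono_of_sec {N : SheafOfModules.{u} R} (φ : N ⟶ M)
    (h : ∀ U (n : N.val.obj (op U)), mapSec φ U n = 0 → n = 0) : Mono φ :=
  ⟨fun α β e => hom_ext_sec fun U m => by
    rw [← sub_eq_zero]
    apply h
    rw [map_sub, ← mapSec_comp, e, mapSec_comp, sub_self]⟩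

lemma injective_of_mono {N : SheafOfModules.{u} R} (φ : N ⟶ M) [Mono φ] (U : C) :
    Function.Injective (mapSec φ U) := by
  have : Mono φ.val := inferInstanceAs (Mono ((SheafOfModules.forget R).map φ))
  exact PresheafOfModules.injective_of_mono φ.val (X := op U)

/-- The value of a section. -/
def secVal (s : M.sections) (U : C) : M.val.obj (op U) := s.val (op U)

lemma res_secVal (s : M.sections) {U V : C} (f : V ⟶ U) : res f (secVal s U) = secVal s V :=
  s.2 f.op

/-- The submodule generated by global sections. -/
def spanSub {I : Type*} (s : I → M.sections) : M.val.Submodule where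
  obj U := Submodule.span _ (Set.range fun i => secVal (s i) U.unop)
  map f := by
    refine Submodule.span_le.2 ?_
    rintro _ ⟨i, rfl⟩
    refine Submodule.subset_span ⟨i, ?_⟩
    exact (res_secVal (s i) f.unop).symm

/-- One direction factors the map through the subsheaf generated by the sections; in the other, the
basis sections map to the given ones, so the map is locally surjective. -/
lemma epi_free_iff {I : Type u} (s : I → M.sections) : Epi (M.freeHomEquiv.symm s) ↔
    ∀ U (m : M.val.obj (op U)), m ∈ (locClosure (spanSub s)).obj (op U) := by
  constructor
  · intro h U m
    let t (i : I) : (subsheaf (locClosure (spanSub s)) (isLocalSub_locClosure _)).sections :=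
      PresheafOfModules.sectionsMk
        (fun U => (⟨secVal (s i) U.unop, le_locClosure _ (Submodule.subset_span ⟨i, rfl⟩)⟩ :
          (locClosure (spanSub s)).obj U)) (fun U V f => Subtype.ext ((s i).2 f))
    let ψ := (SheafOfModules.freeHomEquiv _).symm t
    have e : ψ ≫ subsheafι _ (isLocalSub_locClosure _) = M.freeHomEquiv.symm s := SheafOfModules.freeHomEquiv_symm_comp _ _
    rw [← e] at h
    exact eq_top_of_epi ψ m
  · intro h
    have hs (i : I) (U : C) : ∃ n, mapSec (M.freeHomEquiv.symm s) U n = secVal (s i) U :=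
      ⟨_, congrArg (fun t : M.sections => secVal t U)
        (SheafOfModules.sectionsMap_freeHomEquiv_symm_freeSection s i)⟩
    refine epi_of_locally _ fun U m => ?_
    obtain ⟨S, hS, hm⟩ := h U m
    refine ⟨S, hS, fun V f hf => ?_⟩
    change res f m ∈ LinearMap.range (mapSec (M.freeHomEquiv.symm s) V)
    refine Submodule.span_le.2 ?_ (hm f hf)
    rintro _ ⟨i, rfl⟩
    exact hs i V

end subsheaf

end Site

/-! ### Local properties, finite generation and kernels in terms of sections. -/

section Site

variable {C : Type u} [SmallCategory C] {J : GrothendieckTopology C} {R : Sheaf J RingCat.{u}}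

variable (J) in
/-- A property of morphisms to `U` holds locally on `U`. -/
def Loc (U : C) (P : ∀ ⦃V : C⦄, (V ⟶ U) → Prop) : Prop := ∃ S ∈ J U, ∀ ⦃V⦄ (f : V ⟶ U), S f → P f

lemma Loc.bind {U : C} {P Q : ∀ ⦃V : C⦄, (V ⟶ U) → Prop} (h : Loc J U P)
    (h' : ∀ ⦃V⦄ (f : V ⟶ U), P f → Loc J V fun _ g => Q (g ≫ f)) : Loc J U Q := by
  obtain ⟨S, hS, h⟩ := h
  choose S' hS' h' using fun V (f : V ⟶ U) (hf : S f) => h' f (h f hf)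
  refine ⟨Sieve.bind S fun V f hf => S' V f hf, J.bind_covering hS fun V f hf => hS' V f hf, ?_⟩
  rintro W _ ⟨V, g, f, hf, hg, rfl⟩
  exact h' V f hf g hg

lemma Loc.mono {U : C} {P Q : ∀ ⦃V : C⦄, (V ⟶ U) → Prop} (h : Loc J U P)
    (h' : ∀ ⦃V⦄ (f : V ⟶ U), P f → Q f) : Loc J U Q := by
  obtain ⟨S, hS, h⟩ := h
  exact ⟨S, hS, fun V f hf => h' f (h f hf)⟩

/-- Covering sieves of an object over `Y` correspond to covering sieves of its source, so statements
about the restriction of a sheaf can be checked on the original site. -/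
lemma loc_over {Y : C} {Z : Over Y} {P : ∀ ⦃V : C⦄, (V ⟶ Z.left) → Prop} :
    Loc (J.over Y) Z (fun _ f => P f.left) ↔ Loc J Z.left P := by
  constructor
  · rintro ⟨S, hS, h⟩
    refine ⟨Sieve.overEquiv Z S, (J.mem_over_iff S).1 hS, fun V f hf => ?_⟩
    rw [Sieve.overEquiv_iff] at hf
    exact h _ hf
  · rintro ⟨S, hS, h⟩
    refine ⟨(Sieve.overEquiv Z).symm S, J.overEquiv_symm_mem_over Z S hS, fun V f hf => ?_⟩
    exact h _ ((Sieve.overEquiv_symm_iff S f).1 hf)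

section free

variable {I : Type u}

/-- The coordinates on a free module. -/
def freeCoord (i : I) : SheafOfModules.free (R := R) I ⟶ SheafOfModules.unit R :=
  (SheafOfModules.freeHomEquiv _).symm fun j =>
    (open Classical in if i = j then (SheafOfModules.unit R).unitHomEquiv (𝟙 _) else
      (SheafOfModules.unit R).unitHomEquiv 0)

/-- The basis of a free module. -/
def freeBasis (i : I) (U : C) : (SheafOfModules.free (R := R) I).val.obj (op U) :=
  secVal (SheafOfModules.freeSection i) U

lemma res_freeBasis (i : I) {U V : C} (f : V ⟶ U) :
    res f (freeBasis (R := R) i U) = freeBasis i V := res_secVal _ f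

lemma freeHomEquiv_basis {M : SheafOfModules.{u} R} (s : I → M.sections) (i : I) (U : C) :
    mapSec (M.freeHomEquiv.symm s) U (freeBasis i U) = secVal (s i) U :=
  congrArg (fun t : M.sections => secVal t U)
    (SheafOfModules.sectionsMap_freeHomEquiv_symm_freeSection s i)

lemma freeCoord_self (i : I) (U : C) :
    mapSec (freeCoord (R := R) i) U (freeBasis i U) = (1 : R.obj.obj (op U)) := by
  rw [freeCoord, freeHomEquiv_basis, if_pos rfl]
  rfl

lemma freeCoord_ne {i j : I} (h : i ≠ j) (U : C) :
    mapSec (freeCoord (R := R) i) U (freeBasis j U) = 0 := by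
  rw [freeCoord, freeHomEquiv_basis, if_neg h]
  rfl

lemma freeBasis_independent [Fintype I] {U : C} {c : I → R.obj.obj (op U)}
    (h : ∑ i, c i • freeBasis (R := R) i U = 0) : c = 0 := by
  ext i
  have h1 := congrArg (mapSec (freeCoord (R := R) i) U) h
  rw [map_sum, map_zero, Finset.sum_eq_single i] at h1
  · rw [map_smul, freeCoord_self] at h1
    exact (mul_one (c i)).symm.trans h1
  · intro j _ hj
    rw [map_smul, freeCoord_ne hj.symm, smul_zero]
  · exact fun h => (h (Finset.mem_univ i)).elim

/-- The basis defines the identity of the free module, which is an epimorphism, so `epi_free_iff`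
applies. -/
lemma freeBasis_span {U : C} (m : (SheafOfModules.free (R := R) I).val.obj (op U)) :
    Loc J U fun V f => res f m ∈ Submodule.span (R.obj.obj (op V))
      (Set.range fun i => freeBasis i V) := by
  refine (epi_free_iff (R := R) (I := I) SheafOfModules.freeSection).1 ?_ U m
  have : (SheafOfModules.free (R := R) I).freeHomEquiv.symm SheafOfModules.freeSection = 𝟙 _ := by
    rw [Equiv.symm_apply_eq]
  rw [this]
  infer_instance

end free

section overSections

variable {M : SheafOfModules.{u} R}

/-- The section over `Y` attached to an element of `M(Y)`. -/
def overSec {Y : C} (m : M.val.obj (op Y)) : (M.over Y).sections :=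
  PresheafOfModules.sectionsMk (M := (M.over Y).val)
    (fun Z => (res Z.unop.hom m : M.val.obj (op Z.unop.left))) (fun Z Z' f => by
      change res f.unop.left (res Z.unop.hom m) = res Z'.unop.hom m
      rw [← res_comp, Over.w])

lemma secVal_overSec {Y : C} (m : M.val.obj (op Y)) (Z : Over Y) :
    secVal (overSec m) Z = (res Z.hom m : M.val.obj (op Z.left)) := rfl

end overSections

variable (M N : SheafOfModules.{u} R)

/-- Sections which generate a sheaf of modules over `U`. -/
def Spans {M : SheafOfModules.{u} R} {U : C} {k : ℕ} (s : Fin k → M.val.obj (op U)) : Prop :=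
  ∀ ⦃V⦄ (f : V ⟶ U) (m : M.val.obj (op V)), Loc J V fun W g =>
    res g m ∈ Submodule.span (R.obj.obj (op W)) (Set.range fun i => res (g ≫ f) (s i))

/-- Local finite generation in terms of sections. -/
def LocFG : Prop := ∀ U : C, Loc J U fun V _ => ∃ (k : ℕ) (s : Fin k → M.val.obj (op V)), Spans s

/-- Sections `r` which generate the relations between the sections `s` over `U`. -/
structure SpansRel {M : SheafOfModules.{u} R} {U : C} {k l : ℕ} (s : Fin k → M.val.obj (op U))
    (r : Fin l → Fin k → R.obj.obj (op U)) : Prop where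
  rel (j) : ∑ i, r j i • s i = 0
  span ⦃V⦄ (f : V ⟶ U) (c : Fin k → R.obj.obj (op V)) (hc : ∑ i, c i • res f (s i) = 0) :
    Loc J V fun W g => (fun i => rres g (c i)) ∈ Submodule.span (R.obj.obj (op W))
      (Set.range fun j i => rres (g ≫ f) (r j i))

/-- Local finite generation of relations in terms of sections. -/
def LocRel : Prop := ∀ (U : C) (k : ℕ) (s : Fin k → M.val.obj (op U)), Loc J U fun V f =>
  ∃ (l : ℕ) (r : Fin l → Fin k → R.obj.obj (op V)), SpansRel (fun i => res f (s i)) r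

variable {M N}

lemma isFiniteType_of_locFG (h : LocFG M) : M.IsFiniteType := by
  -- All finite spanning families over all objects are used as local generators. They form a type in
  -- the universe `u`, and the hypothesis says that their objects cover.
  let T := {p : Σ V : C, Σ k : ℕ, Fin k → M.val.obj (op V) // Spans p.2.2}
  let σ : M.LocalGeneratorsData :=
    { I := T
      X := fun t => t.1.1
      coversTop := fun U => by
        obtain ⟨S, hS, h⟩ := h U
        refine J.superset_covering (fun V f hf => ?_) hS
        obtain ⟨k, s, hs⟩ := h f hf
        exact (Sieve.mem_ofObjects_iff ..).2 ⟨⟨⟨V, k, s⟩, hs⟩, ⟨𝟙 _⟩⟩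
      generators := fun t =>
        { I := ULift (Fin t.1.2.1)
          s := fun i => overSec (t.1.2.2 i.down)
          epi := by
            rw [epi_free_iff]
            intro Z m
            have h := (loc_over (P := fun V f => (res f m : M.val.obj (op V)) ∈
              Submodule.span (R.obj.obj (op V)) (Set.range fun i : ULift.{u} (Fin t.1.2.1) =>
                res (f ≫ Z.hom) (t.1.2.2 i.down)))).2 ((t.2 Z.hom m).mono fun V f hf => by
              refine Submodule.span_mono ?_ hf
              rintro _ ⟨i, rfl⟩
              exact ⟨⟨i⟩, rfl⟩)
            change Loc (J.over _) Z fun V f => res f m ∈ (spanSub _).obj (op V)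
            refine h.mono fun V f hf => Submodule.span_mono ?_ hf
            rintro _ ⟨i, rfl⟩
            refine ⟨i, ?_⟩
            change res V.hom (t.1.2.2 i.down) = res (f.left ≫ Z.hom) (t.1.2.2 i.down)
            rw [Over.w] } }
  have hσ : σ.IsFiniteType := by
    constructor
    intro (i : T)
    constructor
    change Finite (ULift (Fin i.1.2.1))
    infer_instance
  constructor
  exact Exists.intro σ hσ

lemma locFG_of_isFiniteType (h : M.IsFiniteType) : LocFG M := by
  obtain ⟨σ, hσ⟩ := h.exists_localGeneratorsData
  intro U
  refine ⟨_, σ.coversTop U, fun V f hf => ?_⟩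
  obtain ⟨i, ⟨g⟩⟩ := (Sieve.mem_ofObjects_iff ..).1 hf
  have := (hσ.isFiniteType i).finite
  obtain ⟨k, ⟨e⟩⟩ := Finite.exists_equiv_fin (σ.generators i).I
  let Z : Over (σ.X i) := Over.mk g
  refine ⟨k, fun j => secVal ((σ.generators i).s (e.symm j)) Z, fun W a m => ?_⟩
  let Z' : Over (σ.X i) := Over.mk (a ≫ g)
  let a' : Z' ⟶ Z := Over.homMk a
  have h : Loc (J.over (σ.X i)) Z' _ := (epi_free_iff (σ.generators i).s).1 (σ.generators i).epi Z' m
  refine (loc_over (Z := Z') (P := fun W' b => (res b m : M.val.obj (op W')) ∈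
    Submodule.span (R.obj.obj (op W')) (Set.range fun j =>
      res (b ≫ a) (secVal ((σ.generators i).s (e.symm j)) Z : M.val.obj (op V))))).1 (h.mono ?_)
  intro W' b hb
  refine Submodule.span_mono ?_ hb
  rintro _ ⟨j, rfl⟩
  refine ⟨e j, ?_⟩
  dsimp only
  rw [Equiv.symm_apply_apply]
  exact res_secVal ((σ.generators i).s j) (b ≫ a')

lemma isFiniteType_iff : M.IsFiniteType ↔ LocFG M := ⟨locFG_of_isFiniteType, isFiniteType_of_locFG⟩

/-- The kernel of a morphism, as a presheaf. -/
def kerSub (φ : M ⟶ N) : M.val.Submodule where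
  obj U := LinearMap.ker (mapSec φ U.unop)
  map f := by
    intro m hm
    change mapSec φ _ (res f.unop m) = 0
    rw [mapSec_res, LinearMap.mem_ker.1 hm, res_zero]

lemma isLocalSub_kerSub (φ : M ⟶ N) : IsLocalSub (kerSub φ) := by
  intro U m S hS h
  refine res_ext hS fun V f hf => ?_
  rw [← mapSec_res, res_zero]
  exact h f hf

lemma exists_kernel_ι (φ : M ⟶ N) {U : C} {m : M.val.obj (op U)} :
    (∃ z, mapSec (kernel.ι φ) U z = m) ↔ mapSec φ U m = 0 := by
  constructor
  · rintro ⟨z, rfl⟩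
    rw [← mapSec_comp, kernel.condition, mapSec_zero]
  · intro h
    have h0 : subsheafι (kerSub φ) (isLocalSub_kerSub φ) ≫ φ = 0 := hom_ext_sec fun V n => by
      have : (n : (kerSub φ).obj (op V)).1 ∈ (kerSub φ).obj (op V) :=
        (n : (kerSub φ).obj (op V)).2
      exact this
    exact ⟨mapSec (kernel.lift φ _ h0) U (⟨m, h⟩ : (kerSub φ).obj (op U)), congrArg
      (fun ψ : subsheaf _ (isLocalSub_kerSub φ) ⟶ M => mapSec ψ U (⟨m, h⟩ : (kerSub φ).obj (op U)))
      (kernel.lift_ι φ _ h0)⟩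

end Site

/-! ### Coherence in terms of finite generation and finitely generated relations. -/

section Site

variable {C : Type u} [SmallCategory C] {J : GrothendieckTopology C} {R : Sheaf J RingCat.{u}}

lemma Loc.forall_finite {U : C} {ι : Type*} [Finite ι] {P : ι → ∀ ⦃V : C⦄, (V ⟶ U) → Prop}
    (h : ∀ i, Loc J U (P i)) : Loc J U fun _ f => ∀ i, P i f := by
  have := Fintype.ofFinite ι
  choose S hS h using h
  refine ⟨Finset.univ.inf S, ?_, fun V f hf i => h i f ?_⟩
  · exact Finset.inf_induction (J.top_mem U) (fun _ h _ h' => J.intersection_covering h h')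
      fun i _ => hS i
  · exact (Finset.inf_le (Finset.mem_univ i) : Finset.univ.inf S ≤ S i) _ hf

lemma Loc.ext {U : C} {M : SheafOfModules.{u} R} {m n : M.val.obj (op U)}
    (h : Loc J U fun _ f => res f m = res f n) : m = n := by
  obtain ⟨S, hS, h⟩ := h
  exact res_ext hS h

lemma res_freeComb {I : Type u} [Fintype I] {U V : C} (f : V ⟶ U) (c : I → R.obj.obj (op U)) :
    res f (∑ i, c i • freeBasis (R := R) i U) = ∑ i, rres f (c i) • freeBasis i V := by
  rw [res_sum]
  refine Finset.sum_congr rfl fun i _ => ?_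
  rw [res_smul, res_freeBasis]

lemma secVal_comb {M : SheafOfModules.{u} R} {I : Type u} [Fintype I] (s : I → M.sections) {U : C}
    (c : I → R.obj.obj (op U)) :
    mapSec (M.freeHomEquiv.symm s) U (∑ i, c i • freeBasis i U) = ∑ i, c i • secVal (s i) U := by
  rw [map_sum]
  refine Finset.sum_congr rfl fun i _ => ?_
  rw [map_smul, freeHomEquiv_basis]

/-- A section of a sheaf of rings, as a section of its restriction. -/
abbrev toOver {U : C} (Z : Over U) (r : R.obj.obj (op Z.left)) : (R.over U).obj.obj (op Z) := r

/-- A section of the restriction of a sheaf of rings, as a section of this sheaf. -/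
abbrev ofOverRing {U : C} {Z : Over U} (r : (R.over U).obj.obj (op Z)) : R.obj.obj (op Z.left) := r

/-- A section of the restriction of a sheaf of modules, as a section of this sheaf. -/
abbrev ofOver {M : SheafOfModules.{u} R} {U : C} {Z : Over U} (m : (M.over U).val.obj (op Z)) :
    M.val.obj (op Z.left) := m

/-- The restricted basis remains linearly independent, so the restricted free module has a
presentation with an empty set of relations. -/
lemma mono_overSec_freeBasis {I : Type u} [Finite I] (U : C) :
    Mono (((SheafOfModules.free (R := R) I).over U).freeHomEquiv.symm
      fun i : I => overSec (freeBasis i U)) := by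
  have := Fintype.ofFinite I
  refine mono_of_sec _ fun Z n hn => Loc.ext ((freeBasis_span n).mono fun V f hf => ?_)
  obtain ⟨c, hc⟩ := MGerms.mem_span_range.1 hf
  have h1 := secVal_comb (R := R.over U)
    (fun i : I => overSec (M := SheafOfModules.free (R := R) I) (freeBasis i U)) c
  rw [← hc, mapSec_res, hn, res_zero] at h1
  have h3 : ∑ i, ofOverRing (c i) • freeBasis (R := R) i V.left = 0 := by
    refine Eq.trans (Finset.sum_congr rfl fun i _ => ?_) h1.symm
    rw [secVal_overSec, res_freeBasis]
    rfl
  have h4 : c = 0 := freeBasis_independent (R := R) (U := V.left) h3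
  rw [hc, h4, res_zero]
  exact Finset.sum_eq_zero fun i _ => zero_smul _ _

/-- The tautological presentation of the restriction of a free module. -/
def freePresentation {I : Type u} [Finite I] (U : C) :
    ((SheafOfModules.free (R := R) I).over U).Presentation where
  generators :=
    { I := I
      s := fun i => overSec (freeBasis i U)
      epi := by
        rw [epi_free_iff]
        intro Z m
        have h := (loc_over (P := fun V f => (res f m :
          (SheafOfModules.free (R := R) I).val.obj (op V)) ∈
            Submodule.span (R.obj.obj (op V)) (Set.range fun i : I =>
              freeBasis i V))).2 (freeBasis_span (R := R) (I := I) (U := Z.left) m)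
        change Loc (J.over _) Z fun V f => res f m ∈ (spanSub _).obj (op V)
        refine h.mono fun V f hf => Submodule.span_mono ?_ hf
        rintro _ ⟨i, rfl⟩
        exact ⟨i, res_freeBasis i V.hom⟩ }
  relations :=
    { I := PEmpty
      s := fun i => i.elim
      epi := by
        have := mono_overSec_freeBasis (R := R) (I := I) U
        have hz := isZero_kernel_of_mono
          (((SheafOfModules.free (R := R) I).over U).freeHomEquiv.symm
            fun i : I => overSec (freeBasis i U))
        exact ⟨fun _ _ _ => hz.eq_of_src _ _⟩ }

instance {I : Type u} [Finite I] (U : C) : (freePresentation (R := R) (I := I) U).IsFinite where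
  isFiniteType_generators := ⟨inferInstanceAs (Finite I)⟩
  isFiniteType_relations := ⟨inferInstanceAs (Finite PEmpty)⟩

lemma isFinitePresentation_free (I : Type u) [Finite I] :
    (SheafOfModules.free (R := R) I).IsFinitePresentation := by
  let σ : (SheafOfModules.free (R := R) I).QuasicoherentData :=
    { I := C
      X := id
      coversTop := fun U => by
        refine J.superset_covering (fun V f _ => ?_) (J.top_mem U)
        exact (Sieve.mem_ofObjects_iff ..).2 ⟨V, ⟨𝟙 _⟩⟩
      presentation := fun U => freePresentation U }
  have hσ : σ.IsFinitePresentation := by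
    constructor
    intro (U : C)
    exact inferInstanceAs (freePresentation (R := R) (I := I) U).IsFinite
  constructor
  exact Exists.intro σ hσ

/-- Coordinates in a free module are unique, so an identity between elements of `K` yields one
between their coefficient vectors, over the open set to which everything is restricted. -/
lemma freeComb_relation {I : Type u} [Fintype I] {K : SheafOfModules.{u} R}
    (φ : K ⟶ SheafOfModules.free I) {l : ℕ} {V W W' B : C} (κ : Fin l → K.val.obj (op V)) (g : W ⟶ V)
    (r : Fin l → I → R.obj.obj (op W))
    (hr : ∀ j, ∑ i, r j i • freeBasis i W = res g (mapSec φ V (κ j))) (a : W' ⟶ W) (b : B ⟶ W')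
    (z : K.val.obj (op W')) (d : Fin l → R.obj.obj (op B))
    (hd : ∑ j, d j • res (b ≫ a ≫ g) (κ j) = res b z) (c : I → R.obj.obj (op W'))
    (hz : mapSec φ W' z = ∑ i, c i • freeBasis i W') (i : I) :
    ∑ j, d j * rres (b ≫ a) (r j i) = rres b (c i) := by
  have h4 := congrArg (mapSec φ B) hd
  rw [mapSec_res, hz, map_sum, res_freeComb] at h4
  have h5 : ∀ j, mapSec φ B (d j • res (b ≫ a ≫ g) (κ j)) =
      ∑ i : I, (d j * rres (b ≫ a) (r j i)) • freeBasis (R := R) i B := fun j => by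
    rw [map_smul, mapSec_res, ← Category.assoc, res_comp, ← hr j, res_freeComb, Finset.smul_sum]
    exact Finset.sum_congr rfl fun i _ => smul_smul _ _ _
  rw [Finset.sum_congr rfl fun j _ => h5 j, Finset.sum_comm, ← sub_eq_zero,
    ← Finset.sum_sub_distrib] at h4
  have h6 : ∑ i : I, (∑ j, d j * rres (b ≫ a) (r j i) - rres b (c i)) • freeBasis (R := R) i B = 0 := by
    rw [← h4]
    refine Finset.sum_congr rfl fun i _ => ?_
    rw [sub_smul, Finset.sum_smul]
  exact sub_eq_zero.1 (congrFun (freeBasis_independent h6) i)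

variable {M : SheafOfModules.{u} R}

/-- The sections `s` define a morphism from a finite free module, which is of finite presentation,
so pseudo-coherence makes its kernel finitely generated. Expressing generators of the kernel in the
basis, after a refinement, gives generating relations. -/
lemma locRel_of_isCoherent (h : IsCoherent M) : LocRel M := by
  intro U k s
  let I := ULift.{u} (Fin k)
  let v := (M.over U).freeHomEquiv.symm fun i : I => overSec (s i.down)
  have hv {Z : Over U} (c : I → R.obj.obj (op Z.left)) :
      ofOver (mapSec v Z (∑ i, toOver Z (c i) • freeBasis i Z)) = ∑ i : Fin k, c ⟨i⟩ • res Z.hom (s i) := by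
    refine (secVal_comb (R := R.over U) (fun i : I => overSec (s i.down)) c).trans ?_
    exact Fintype.sum_equiv Equiv.ulift _ _ fun i => rfl
  have hK := locFG_of_isFiniteType (h.pseudoCoherent U _ v (isFinitePresentation_free I))
  refine (loc_over (Z := Over.mk (𝟙 U)) (P := fun V (f : V ⟶ U) => ∃ (l : ℕ)
    (r : Fin l → Fin k → R.obj.obj (op V)), SpansRel (fun i => res f (s i)) r)).1 ?_
  refine (hK (Over.mk (𝟙 U))).bind fun V f => ?_
  rintro ⟨l, κ, hκ⟩
  refine (Loc.forall_finite fun j => freeBasis_span (mapSec (kernel.ι v) V (κ j))).mono ?_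
  intro W g hg
  choose r hr using fun j => MGerms.mem_span_range.1 (hg j)
  have hWf : W.hom = (g ≫ f).left := by
    have := Over.w (g ≫ f)
    exact this.symm.trans (Category.comp_id _)
  refine ⟨l, fun j i => r j ⟨i⟩, fun j => ?_, fun A a c hc => ?_⟩
  · have h1 := hv (Z := W) (r j)
    rw [← hr j, ← mapSec_res, (exists_kernel_ι v).1 ⟨_, rfl⟩] at h1
    rw [← hWf]
    exact h1.symm
  · let W' : Over U := Over.mk (a ≫ W.hom)
    let a' : W' ⟶ W := Over.homMk a
    have h2 := hv (Z := W') (fun i => c i.down)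
    have h3 : ∑ i : Fin k, c i • res W'.hom (s i) = 0 := by
      rw [← hc]
      refine Finset.sum_congr rfl fun i _ => ?_
      rw [← hWf, ← res_comp]
      rfl
    obtain ⟨z, hz⟩ := (exists_kernel_ι v).2 (h2.trans h3)
    refine (loc_over (Z := W') (P := fun B b => (fun i => rres b (c i)) ∈
      Submodule.span (R.obj.obj (op B)) (Set.range fun j i => rres (b ≫ a) (r j ⟨i⟩)))).1 ?_
    refine (hκ (a' ≫ g) z).mono fun B b hb => ?_
    obtain ⟨d, hd⟩ := MGerms.mem_span_range.1 hb
    refine MGerms.mem_span_range.2 ⟨d, ?_⟩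
    have h4 := freeComb_relation (R := R.over U) (kernel.ι v) κ g r (fun j => (hr j).symm) a' b z d hd.symm
      (fun i : I => (c i.down : (R.over U).obj.obj (op W'))) hz
    funext i
    have h5 := h4 ⟨i⟩
    rw [Finset.sum_apply]
    exact h5.symm

/-- Let `n` generate `N` locally. An element of the kernel of `v` is a combination of the `n i`
whose coefficients form a relation between the `v (n i)`; generators of these relations give
generators `κ` of the kernel. Only the finite generation of `N` is used. -/
lemma isCoherent_of_loc (hM : LocFG M) (hr : LocRel M) : IsCoherent M := by
  refine ⟨isFiniteType_of_locFG hM, fun U N v hN => isFiniteType_of_locFG fun Z => ?_⟩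
  have hN' : LocFG N := locFG_of_isFiniteType inferInstance
  refine (hN' Z).bind fun V f => ?_
  rintro ⟨k, n, hn⟩
  have h1 := (loc_over (Z := V)).2 (hr V.left k fun i => mapSec v V (n i))
  refine h1.mono fun W g => ?_
  rintro ⟨l, r, hr⟩
  have h2 (j : Fin l) : mapSec v W (∑ i, toOver W (r j i) • res g (n i)) = 0 := by
    rw [map_sum]
    refine Eq.trans (Finset.sum_congr rfl fun i _ => ?_) (hr.rel j)
    rw [map_smul, mapSec_res]
    rfl
  choose κ hκ using fun j => (exists_kernel_ι v).2 (h2 j)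
  refine ⟨l, κ, fun A a z => ?_⟩
  refine (hn (a ≫ g) (mapSec (kernel.ι v) A z)).bind fun B b hb => ?_
  obtain ⟨c, hc⟩ := MGerms.mem_span_range.1 hb
  have h3 : ∑ i, ofOverRing (c i) • res (b ≫ a).left
      (res g.left (ofOver (mapSec v V (n i)))) = 0 := by
    have h4 := congrArg (mapSec v B) hc
    rw [mapSec_res, (exists_kernel_ι v).1 ⟨_, rfl⟩, res_zero, map_sum] at h4
    refine Eq.trans (Finset.sum_congr rfl fun i _ => ?_) h4.symm
    rw [map_smul, mapSec_res, ← Category.assoc, res_comp]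
    rfl
  have h5 := (loc_over (Z := B)).2 (hr.span (b ≫ a).left c h3)
  refine h5.mono fun D e he => ?_
  obtain ⟨d, hd⟩ := MGerms.mem_span_range.1 he
  refine MGerms.mem_span_range.2 ⟨d, injective_of_mono (kernel.ι v) D ?_⟩
  rw [mapSec_res, res_comp, hc, res_sum, map_sum]
  have h6 : ∀ j, mapSec (kernel.ι v) D (toOver D (d j) • res ((e ≫ b) ≫ a) (κ j)) =
      ∑ i, toOver D (d j * rres (e ≫ b ≫ a).left (r j i)) • res (e ≫ b ≫ a ≫ g) (n i) := fun j => by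
    rw [map_smul, mapSec_res, hκ, res_sum, Finset.smul_sum]
    refine Finset.sum_congr rfl fun i _ => ?_
    rw [res_smul, smul_smul, ← res_comp]
    simp only [Category.assoc]
    rfl
  simp only [h6]
  rw [Finset.sum_comm]
  refine Finset.sum_congr rfl fun i _ => ?_
  rw [← Finset.sum_smul, res_smul, ← res_comp]
  congr 1
  have h7 := congrFun hd i
  rw [Finset.sum_apply] at h7
  exact h7

lemma isCoherent_iff : IsCoherent M ↔ LocFG M ∧ LocRel M :=
  ⟨fun h => ⟨locFG_of_isFiniteType h.isFiniteType, locRel_of_isCoherent h⟩,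
    fun h => isCoherent_of_loc h.1 h.2⟩

end Site

/-! ### Describing a sheaf of modules by its stalks. -/

section Realization

open Topology Filter MGerms

variable {X : TopCat.{u}} {A : Sheaf (Opens.grothendieckTopology X) RingCat.{u}}

variable (A) in
/-- The stalk of a sheaf of rings. -/
abbrev rStalk (x : X) : RingCat.{u} := TopCat.Presheaf.stalk (C := RingCat.{u}) (X := X) A.obj x

/-- The germs of a section of a sheaf of rings, extended by zero. -/
def rsec {U : Opens X} (a : A.obj.obj (op U)) (y : X) : rStalk A y :=
  open Classical in
  if h : y ∈ U then TopCat.Presheaf.germ (C := RingCat.{u}) (X := X) A.obj U y h a else 0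

section rsec

variable {U V : Opens X} {y : X}

lemma rsec_of_mem (a : A.obj.obj (op U)) (h : y ∈ U) :
    rsec a y = TopCat.Presheaf.germ (C := RingCat.{u}) (X := X) A.obj U y h a := dif_pos h

lemma rsec_of_notMem (a : A.obj.obj (op U)) (h : y ∉ U) : rsec a y = 0 := dif_neg h

lemma rsec_res (f : V ⟶ U) (a : A.obj.obj (op U)) (h : y ∈ V) : rsec (rres f a) y = rsec a y := by
  rw [rsec_of_mem _ h, rsec_of_mem _ (leOfHom f h)]
  exact TopCat.Presheaf.germ_res_apply (C := RingCat.{u}) (X := X) A.obj f y h a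

lemma rsec_add (a b : A.obj.obj (op U)) : rsec (a + b) y = rsec a y + rsec b y := by
  by_cases h : y ∈ U
  · simp only [rsec_of_mem _ h, map_add]
  · simp only [rsec_of_notMem _ h, add_zero]

lemma rsec_neg (a : A.obj.obj (op U)) : rsec (-a) y = -rsec a y := by
  by_cases h : y ∈ U
  · simp only [rsec_of_mem _ h, map_neg]
  · simp only [rsec_of_notMem _ h, neg_zero]

lemma rsec_mul (a b : A.obj.obj (op U)) : rsec (a * b) y = rsec a y * rsec b y := by
  by_cases h : y ∈ U
  · simp only [rsec_of_mem _ h, map_mul]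
  · simp only [rsec_of_notMem _ h, mul_zero]

lemma rsec_zero : rsec (0 : A.obj.obj (op U)) y = 0 := by
  by_cases h : y ∈ U
  · simp only [rsec_of_mem _ h, map_zero]
  · simp only [rsec_of_notMem _ h]

lemma rsec_one (h : y ∈ U) : rsec (1 : A.obj.obj (op U)) y = 1 := by
  simp only [rsec_of_mem _ h, map_one]

lemma rsec_sum {ι : Type*} (I : Finset ι) (a : ι → A.obj.obj (op U)) :
    rsec (∑ i ∈ I, a i) y = ∑ i ∈ I, rsec (a i) y :=
  map_sum (AddMonoidHom.mk' (fun a : A.obj.obj (op U) => rsec a y) fun _ _ => rsec_add _ _) a I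

lemma exists_rsec (x : X) (a : rStalk A x) : ∃ (U : Opens X) (_ : x ∈ U) (b : A.obj.obj (op U)), rsec b x = a := by
  obtain ⟨U, h, b, rfl⟩ := TopCat.Presheaf.exists_germ_eq (C := RingCat.{u}) (X := X) A.obj a
  exact ⟨U, h, b, rsec_of_mem b h⟩

lemma eventually_mem {x : X} (h : x ∈ U) : ∀ᶠ y in 𝓝 x, y ∈ U := U.isOpen.mem_nhds h

lemma eventually_rsec_eq {a : A.obj.obj (op U)} {b : A.obj.obj (op V)} {x : X} (hU : x ∈ U)
    (hV : x ∈ V) (h : rsec a x = rsec b x) : ∀ᶠ y in 𝓝 x, rsec a y = rsec b y := by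
  rw [rsec_of_mem a hU, rsec_of_mem b hV] at h
  obtain ⟨W, hW, f, g, e⟩ := TopCat.Presheaf.germ_eq (C := RingCat.{u}) (X := X) A.obj x hU hV _ _ h
  filter_upwards [eventually_mem hW] with y hy
  rw [← rsec_res f a hy, ← rsec_res g b hy]
  exact congrArg (fun c => rsec c y) e

end rsec

variable (A) in
/-- The sheaf of rings `A` in terms of its stalks. -/
def ringGerms : RGerms X where
  stalk x := rStalk A x
  IsGerm x s := ∃ (U : Opens X) (a : A.obj.obj (op U)), x ∈ U ∧ ∀ᶠ y in 𝓝 x, s y = rsec a y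
  eventually {x s} := by
    rintro ⟨U, a, hx, h⟩
    filter_upwards [h.eventually_nhds, eventually_mem hx] with y h hy using ⟨U, a, hy, h⟩
  exists_germ x a := by
    obtain ⟨U, h, b, rfl⟩ := exists_rsec x a
    exact ⟨rsec b, ⟨U, b, h, Eventually.of_forall fun _ => rfl⟩, rfl⟩
  unique {x s t} := by
    rintro ⟨U, a, hU, h⟩ ⟨V, b, hV, h'⟩ e
    rw [h.self_of_nhds, h'.self_of_nhds] at e
    filter_upwards [h, h', eventually_rsec_eq hU hV e] with y h h' e
    rw [h, h', e]
  congr {x s t} := by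
    rintro ⟨U, a, hx, h⟩ e
    exact ⟨U, a, hx, by filter_upwards [h, e] with y h e using e.symm.trans h⟩
  zero x := ⟨⊤, 0, trivial, Eventually.of_forall fun y => rsec_zero.symm⟩
  one x := ⟨⊤, 1, trivial, Eventually.of_forall fun y => (rsec_one (U := ⊤) trivial).symm⟩
  add {x s t} := by
    rintro ⟨U, a, hU, h⟩ ⟨V, b, hV, h'⟩
    refine ⟨U ⊓ V, rres (homOfLE inf_le_left) a + rres (homOfLE inf_le_right) b, ⟨hU, hV⟩, ?_⟩
    filter_upwards [h, h', eventually_mem (U := U ⊓ V) ⟨hU, hV⟩] with y h h' hy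
    rw [rsec_add, rsec_res _ _ hy, rsec_res _ _ hy, Pi.add_apply, h, h']
  neg {x s} := by
    rintro ⟨U, a, hU, h⟩
    exact ⟨U, -a, hU, h.mono fun y h => by rw [rsec_neg, Pi.neg_apply, h]⟩
  mul {x s t} := by
    rintro ⟨U, a, hU, h⟩ ⟨V, b, hV, h'⟩
    refine ⟨U ⊓ V, rres (homOfLE inf_le_left) a * rres (homOfLE inf_le_right) b, ⟨hU, hV⟩, ?_⟩
    filter_upwards [h, h', eventually_mem (U := U ⊓ V) ⟨hU, hV⟩] with y h h' hy
    rw [rsec_mul, rsec_res _ _ hy, rsec_res _ _ hy, Pi.mul_apply, h, h']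

/-- The germs of a section of a sheaf of rings, extended by zero. -/
def asec {U : Opens X} (a : A.obj.obj (op U)) (y : X) : (ringGerms A).stalk y := rsec a y

lemma isGerm_asec {U : Opens X} (a : A.obj.obj (op U)) {x : X} (h : x ∈ U) :
    (ringGerms A).IsGerm x (asec a) := ⟨U, a, h, Eventually.of_forall fun _ => rfl⟩

/-- A description of a sheaf of modules by its stalks. -/
structure Model (M : SheafOfModules.{u} A) (E : MGerms (ringGerms A)) where
  /-- the germs of a section, extended by zero -/
  ev {U : Opens X} : M.val.obj (op U) →+ ∀ y, E.stalk y
  smul {U : Opens X} (a : A.obj.obj (op U)) (m : M.val.obj (op U)) (y) : y ∈ U →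
    ev (a • m) y = asec a y • ev m y
  ev_res {U V : Opens X} (f : V ⟶ U) (m : M.val.obj (op U)) (y) : y ∈ V → ev (res f m) y = ev m y
  isGerm {U : Opens X} (m : M.val.obj (op U)) (y) : y ∈ U → E.IsGerm y (ev m)
  inj {U : Opens X} (m : M.val.obj (op U)) : (∀ y ∈ U, ev m y = 0) → m = 0
  ev_of_notMem {U : Opens X} (m : M.val.obj (op U)) (y) : y ∉ U → ev m y = 0
  glue {U : Opens X} (s) : (∀ y ∈ U, E.IsGerm y s) → ∃ m : M.val.obj (op U), ∀ y ∈ U, ev m y = s y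

/-- Gluing for local sections indexed by points: the open sets contained in the domain of one of
them form a covering sieve. -/
lemma res_glue_opens {M : SheafOfModules.{u} A} {U : Opens X} {s : ∀ x ∈ U, Σ V : Opens X, M.val.obj (op V)}
    (hs : ∀ x hx, x ∈ (s x hx).1)
    (h : ∀ x hx y hy (W : Opens X) (f : W ⟶ (s x hx).1) (g : W ⟶ (s y hy).1),
      res f (s x hx).2 = res g (s y hy).2) :
    ∃ m : M.val.obj (op U), ∀ x hx (W : Opens X) (f : W ⟶ (s x hx).1) (g : W ⟶ U),
      res g m = res f (s x hx).2 := by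
  let S : Sieve U :=
    { arrows := fun V _ => ∃ x hx, V ≤ (s x hx).1
      downward_closed := by
        rintro V W f ⟨x, hx, hV⟩ g
        exact ⟨x, hx, (leOfHom g).trans hV⟩ }
  have hS : S ∈ Opens.grothendieckTopology X U := fun x hx =>
    ⟨U ⊓ (s x hx).1, homOfLE inf_le_left, ⟨x, hx, inf_le_right⟩, hx, hs x hx⟩
  choose x hx hV using fun V (f : V ⟶ U) (hf : S f) => hf
  obtain ⟨m, hm⟩ := res_glue (M := M) hS (fun V f hf => res (homOfLE (hV V f hf)) (s _ (hx V f hf)).2)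
    (fun V W f hf g => by
      rw [← res_comp]
      exact h ..)
  refine ⟨m, fun z hz W f g => ?_⟩
  rw [hm g ⟨z, hz, leOfHom f⟩]
  exact h ..

section stalks

variable {M : SheafOfModules.{u} A}

/-- The germs of a section of a sheaf of modules, extended by zero. -/
def msec {U : Opens X} (a : M.val.obj (op U)) (y : X) : TopCat.Presheaf.stalk (C := Ab.{u}) (X := X) M.val.presheaf y :=
  open Classical in if h : y ∈ U then TopCat.Presheaf.germ (C := Ab.{u}) (X := X) M.val.presheaf U y h a else 0

variable {U V : Opens X} {y : X}

lemma msec_of_mem (a : M.val.obj (op U)) (h : y ∈ U) :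
    msec a y = TopCat.Presheaf.germ (C := Ab.{u}) (X := X) M.val.presheaf U y h a := dif_pos h

lemma msec_of_notMem (a : M.val.obj (op U)) (h : y ∉ U) : msec a y = 0 := dif_neg h

lemma msec_res (f : V ⟶ U) (a : M.val.obj (op U)) (h : y ∈ V) : msec (res f a) y = msec a y := by
  rw [msec_of_mem _ h, msec_of_mem _ (leOfHom f h)]
  exact TopCat.Presheaf.germ_res_apply (C := Ab.{u}) (X := X) M.val.presheaf f y h a

lemma msec_add (a b : M.val.obj (op U)) : msec (a + b) y = msec a y + msec b y := by
  by_cases h : y ∈ U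
  · simp only [msec_of_mem _ h]
    exact map_add (TopCat.Presheaf.germ (C := Ab.{u}) (X := X) M.val.presheaf U y h).hom a b
  · simp only [msec_of_notMem _ h, add_zero]

lemma msec_zero : msec (0 : M.val.obj (op U)) y = 0 := by
  by_cases h : y ∈ U
  · simp only [msec_of_mem _ h]
    exact map_zero (TopCat.Presheaf.germ (C := Ab.{u}) (X := X) M.val.presheaf U y h).hom
  · simp only [msec_of_notMem _ h]

lemma msec_smul (r : A.obj.obj (op U)) (a : M.val.obj (op U)) (h : y ∈ U) :
    msec (r • a) y = rsec r y • msec a y := by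
  simp only [msec_of_mem _ h, rsec_of_mem _ h]
  exact PresheafOfModules.germ_ringCat_smul M.val y U h r a

lemma exists_msec (x : X) (a : TopCat.Presheaf.stalk (C := Ab.{u}) (X := X) M.val.presheaf x) :
    ∃ (U : Opens X) (_ : x ∈ U) (b : M.val.obj (op U)), msec b x = a := by
  obtain ⟨U, h, b, rfl⟩ := TopCat.Presheaf.exists_germ_eq (C := Ab.{u}) (X := X) M.val.presheaf a
  exact ⟨U, h, b, msec_of_mem b h⟩

lemma exists_res_eq {a : M.val.obj (op U)} {b : M.val.obj (op V)} {x : X} (hU : x ∈ U)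
    (hV : x ∈ V) (h : msec a x = msec b x) :
    ∃ (W : Opens X) (_ : x ∈ W) (f : W ⟶ U) (g : W ⟶ V), res f a = res g b := by
  rw [msec_of_mem a hU, msec_of_mem b hV] at h
  exact TopCat.Presheaf.germ_eq (C := Ab.{u}) (X := X) M.val.presheaf x hU hV _ _ h

lemma eventually_msec_eq {a : M.val.obj (op U)} {b : M.val.obj (op V)} {x : X} (hU : x ∈ U)
    (hV : x ∈ V) (h : msec a x = msec b x) : ∀ᶠ y in 𝓝 x, msec a y = msec b y := by
  obtain ⟨W, hW, f, g, e⟩ := exists_res_eq hU hV h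
  filter_upwards [eventually_mem hW] with y hy
  rw [← msec_res f a hy, ← msec_res g b hy, e]

lemma msec_injective {a b : M.val.obj (op U)} (h : ∀ y ∈ U, msec a y = msec b y) : a = b := by
  refine Loc.ext (J := Opens.grothendieckTopology X) (R := A) ?_
  refine ⟨⟨fun W f => res f a = res f b, fun {W W'} f hf g => ?_⟩, fun x hx => ?_, fun V f hf => hf⟩
  · rw [res_comp, hf, res_comp]
  · obtain ⟨W, hW, f, g, e⟩ := exists_res_eq hx hx (h x hx)
    exact ⟨W, f, Subsingleton.elim g f ▸ e, hW⟩

variable (M) in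
/-- A sheaf of modules in terms of its stalks. -/
def modGerms : MGerms (ringGerms A) where
  stalk x := TopCat.Presheaf.stalk (C := Ab.{u}) (X := X) M.val.presheaf x
  mod x := inferInstanceAs (Module (rStalk A x) (TopCat.Presheaf.stalk (C := Ab.{u}) (X := X) M.val.presheaf x))
  IsGerm x s := ∃ (U : Opens X) (a : M.val.obj (op U)), x ∈ U ∧ ∀ᶠ y in 𝓝 x, s y = msec a y
  eventually {x s} := by
    rintro ⟨U, a, hx, h⟩
    filter_upwards [h.eventually_nhds, eventually_mem hx] with y h hy using ⟨U, a, hy, h⟩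
  exists_germ x a := by
    obtain ⟨U, h, b, rfl⟩ := exists_msec x a
    exact ⟨msec b, ⟨U, b, h, Eventually.of_forall fun _ => rfl⟩, rfl⟩
  unique {x s t} := by
    rintro ⟨U, a, hU, h⟩ ⟨V, b, hV, h'⟩ e
    rw [h.self_of_nhds, h'.self_of_nhds] at e
    filter_upwards [h, h', eventually_msec_eq hU hV e] with y h h' e
    rw [h, h', e]
  congr {x s t} := by
    rintro ⟨U, a, hx, h⟩ e
    exact ⟨U, a, hx, by filter_upwards [h, e] with y h e using e.symm.trans h⟩
  zero x := ⟨⊤, 0, trivial, Eventually.of_forall fun y => msec_zero.symm⟩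
  add {x s t} := by
    rintro ⟨U, a, hU, h⟩ ⟨V, b, hV, h'⟩
    refine ⟨U ⊓ V, res (homOfLE inf_le_left) a + res (homOfLE inf_le_right) b, ⟨hU, hV⟩, ?_⟩
    filter_upwards [h, h', eventually_mem (U := U ⊓ V) ⟨hU, hV⟩] with y h h' hy
    rw [msec_add, msec_res _ _ hy, msec_res _ _ hy, Pi.add_apply, h, h']
  smul {x s t} := by
    rintro ⟨U, a, hU, h⟩ ⟨V, b, hV, h'⟩
    refine ⟨U ⊓ V, (rres (homOfLE inf_le_left : U ⊓ V ⟶ U) a •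
      res (homOfLE inf_le_right : U ⊓ V ⟶ V) b : M.val.obj (op (U ⊓ V))), ⟨hU, hV⟩, ?_⟩
    filter_upwards [h, h', eventually_mem (U := U ⊓ V) ⟨hU, hV⟩] with y h h' hy
    rw [msec_smul _ _ hy, rsec_res _ _ hy, msec_res _ _ hy, h, h']
    rfl

variable (M) in
/-- The model of a sheaf of modules defined by its stalks. -/
def stalkModel : Model M (modGerms M) where
  ev {U} := AddMonoidHom.mk' (fun a y => msec a y) fun a b => funext fun y => msec_add a b
  smul a m y h := msec_smul a m h
  ev_res f m y h := msec_res f m h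
  isGerm {U} m y h := ⟨U, m, h, Eventually.of_forall fun _ => rfl⟩
  ev_of_notMem {U} m y h := msec_of_notMem m h
  inj {U} m h := msec_injective fun y hy => (h y hy).trans msec_zero.symm
  glue {U} s h := by
    have h1 : ∀ y (hy : y ∈ U), ∃ (V : Opens X) (a : M.val.obj (op V)), y ∈ V ∧
        ∀ z ∈ V, s z = msec a z := fun y hy => by
      obtain ⟨V, a, hV, h⟩ := h y hy
      obtain ⟨W, hW, hWo, hyW⟩ := eventually_nhds_iff.1 h
      refine ⟨V ⊓ ⟨W, hWo⟩, res (homOfLE inf_le_left) a, ⟨hV, hyW⟩, fun z hz => ?_⟩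
      rw [msec_res _ _ hz]
      exact hW z hz.2
    choose V a hV h2 using h1
    obtain ⟨m, hm⟩ := res_glue_opens (s := fun y hy => ⟨V y hy, a y hy⟩) hV
      (fun x hx y hy W f g => msec_injective fun z hz => by
        rw [msec_res _ _ hz, msec_res _ _ hz, ← h2 _ _ z (leOfHom f hz), ← h2 _ _ z (leOfHom g hz)])
    refine ⟨m, fun y hy => ?_⟩
    have h3 := hm y hy (V y hy ⊓ U) (homOfLE inf_le_left) (homOfLE inf_le_right)
    have h4 := congrArg (fun t => msec t y) h3
    have h5 : y ∈ V y hy ⊓ U := ⟨hV y hy, hy⟩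
    dsimp only at h4
    rw [msec_res _ _ h5, msec_res _ _ h5] at h4
    exact h4.trans (h2 y hy y (hV y hy)).symm

end stalks

lemma rsec_injective {U : Opens X} {a b : A.obj.obj (op U)} (h : ∀ y ∈ U, rsec a y = rsec b y) :
    a = b := by
  refine Loc.ext (J := Opens.grothendieckTopology X) (R := A) (M := SheafOfModules.unit A) (U := U) ?_
  refine ⟨⟨fun W f => rres f a = rres f b, fun {W W'} f hf g => ?_⟩, fun x hx => ?_, fun V f hf => hf⟩
  · rw [rres_comp, hf, rres_comp]
  · have h1 := h x hx
    rw [rsec_of_mem a hx, rsec_of_mem b hx] at h1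
    obtain ⟨W, hW, f, g, e⟩ := TopCat.Presheaf.germ_eq (C := RingCat.{u}) (X := X) A.obj x hx hx _ _ h1
    exact ⟨W, f, Subsingleton.elim g f ▸ e, hW⟩

variable (A) in
/-- The model of `A` as a module over itself. -/
def unitModel : Model (SheafOfModules.unit A) (ringGerms A).unit where
  ev {U} := AddMonoidHom.mk' (fun a y => rsec (U := U) a y) fun a b => funext fun y => rsec_add a b
  smul a m y h := rsec_mul a m
  ev_res f m y h := rsec_res f m h
  isGerm {U} m y h := isGerm_asec (U := U) m h
  ev_of_notMem {U} m y h := rsec_of_notMem (U := U) m h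
  inj {U} m h := rsec_injective (U := U) fun y hy => (h y hy).trans rsec_zero.symm
  glue {U} s h := by
    have h1 : ∀ y (hy : y ∈ U), ∃ (V : Opens X) (a : A.obj.obj (op V)), y ∈ V ∧
        ∀ z ∈ V, s z = rsec a z := fun y hy => by
      obtain ⟨V, a, hV, h⟩ := h y hy
      obtain ⟨W, hW, hWo, hyW⟩ := eventually_nhds_iff.1 h
      refine ⟨V ⊓ ⟨W, hWo⟩, rres (homOfLE inf_le_left) a, ⟨hV, hyW⟩, fun z hz => ?_⟩
      rw [rsec_res _ _ hz]
      exact hW z hz.2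
    choose V a hV h2 using h1
    obtain ⟨m, hm⟩ := res_glue_opens (M := SheafOfModules.unit A) (s := fun y hy => ⟨V y hy, a y hy⟩) hV
      (fun x hx y hy W f g => rsec_injective (U := W) fun z hz => by
        refine (rsec_res f _ hz).trans (Eq.trans ?_ (rsec_res g _ hz).symm)
        rw [← h2 _ _ z (leOfHom f hz), ← h2 _ _ z (leOfHom g hz)])
    refine ⟨m, fun y hy => ?_⟩
    have h3 := hm y hy (V y hy ⊓ U) (homOfLE inf_le_left) (homOfLE inf_le_right)
    have h4 := congrArg (fun t : A.obj.obj (op (V y hy ⊓ U)) => rsec t y) h3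
    refine (rsec_res (homOfLE inf_le_right) _ ⟨hV y hy, hy⟩).symm.trans (h4.trans ?_)
    exact (rsec_res (homOfLE inf_le_left) _ ⟨hV y hy, hy⟩).trans (h2 y hy y (hV y hy)).symm

end Realization

/-! ### Generating sections and generating relations tested on stalks. -/

section Realization

open Topology Filter MGerms

variable {X : TopCat.{u}} {A : Sheaf (Opens.grothendieckTopology X) RingCat.{u}}

/-- Requiring `P` on every open subset of the neighbourhood makes the resulting family a sieve, even
if `P` itself is not stable under restriction. -/
lemma loc_of_nhds {U : Opens X} {P : ∀ ⦃V : Opens X⦄, (V ⟶ U) → Prop}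
    (h : ∀ x ∈ U, ∃ (V : Opens X) (f : V ⟶ U), x ∈ V ∧ ∀ ⦃W⦄ (g : W ⟶ V), P (g ≫ f)) :
    Loc (Opens.grothendieckTopology X) U P := by
  refine ⟨⟨fun V f => ∀ ⦃W⦄ (g : W ⟶ V), P (g ≫ f), fun {V W} f hf g W' g' => ?_⟩, fun x hx => ?_,
    fun V f hf => ?_⟩
  · rw [← Category.assoc]
    exact hf _
  · obtain ⟨V, f, hV, hf⟩ := h x hx
    exact ⟨V, f, hf, hV⟩
  · have := hf (𝟙 V)
    rwa [Category.id_comp] at this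

lemma Loc.exists_mem {U : Opens X} {P : ∀ ⦃V : Opens X⦄, (V ⟶ U) → Prop}
    (h : Loc (Opens.grothendieckTopology X) U P) {x : X} (hx : x ∈ U) :
    ∃ (V : Opens X) (f : V ⟶ U), x ∈ V ∧ P f := by
  obtain ⟨S, hS, h⟩ := h
  obtain ⟨V, f, hf, hV⟩ := hS x hx
  exact ⟨V, f, hV, h f hf⟩

lemma exists_opens_of_eventually {U : Opens X} {x : X} (hx : x ∈ U) {p : X → Prop} (h : ∀ᶠ y in 𝓝 x, p y) :
    ∃ (V : Opens X) (_ : V ⟶ U), x ∈ V ∧ ∀ y ∈ V, p y := by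
  obtain ⟨W, hW, hWo, hx'⟩ := eventually_nhds_iff.1 (h.and (eventually_mem hx))
  exact ⟨⟨W, hWo⟩, homOfLE fun y hy => (hW y hy).2, hx', fun y hy => (hW y hy).1⟩

lemma asec_sum {U : Opens X} {y : X} {ι : Type*} (I : Finset ι) (a : ι → A.obj.obj (op U)) :
    asec (∑ i ∈ I, a i) y = ∑ i ∈ I, asec (a i) y := rsec_sum I a

lemma asec_res {U V : Opens X} {y : X} (f : V ⟶ U) (a : A.obj.obj (op U)) (h : y ∈ V) :
    asec (rres f a) y = asec a y := rsec_res f a h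

lemma asec_mul {U : Opens X} {y : X} (a b : A.obj.obj (op U)) :
    asec (a * b) y = asec a y * asec b y := rsec_mul a b

/-- Elements of a stalk extend to sections. -/
lemma exists_sections {ι : Type*} [Finite ι] {U : Opens X} {x : X} (hx : x ∈ U)
    (c : ι → (ringGerms A).stalk x) : ∃ (V : Opens X) (_ : V ⟶ U) (a : ι → A.obj.obj (op V)),
      x ∈ V ∧ ∀ i, asec (a i) x = c i := by
  choose s hs hc using fun i => (ringGerms A).exists_germ x (c i)
  obtain ⟨V, f, hV, h⟩ := exists_opens_of_eventually hx (eventually_all (E := (ringGerms A).unit) hs)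
  choose a ha using fun i => (unitModel A).glue (U := V) (s i) fun y hy => h y hy i
  exact ⟨V, f, a, hV, fun i => (ha i x hV).trans (hc i)⟩

namespace Model

variable {M N : SheafOfModules.{u} A} {E : MGerms (ringGerms A)} (μ : Model M E) {U V : Opens X}

include μ in
lemma ext {m n : M.val.obj (op U)} (h : ∀ y ∈ U, μ.ev m y = μ.ev n y) : m = n := by
  rw [← sub_eq_zero]
  refine μ.inj _ fun y hy => ?_
  rw [map_sub, Pi.sub_apply, h y hy, sub_self]

lemma ev_comb {ι : Type*} [Fintype ι] (a : ι → A.obj.obj (op U)) (m : ι → M.val.obj (op U)) {y : X}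
    (hy : y ∈ U) : μ.ev (∑ i, a i • m i) y = ∑ i, asec (a i) y • μ.ev (m i) y := by
  rw [map_sum, Finset.sum_apply]
  exact Finset.sum_congr rfl fun i _ => μ.smul _ _ _ hy

lemma exists_section {x : X} (hx : x ∈ U) {s : ∀ y, E.stalk y} (hs : E.IsGerm x s) :
    ∃ (V : Opens X) (_ : V ⟶ U) (m : M.val.obj (op V)), x ∈ V ∧ ∀ y ∈ V, μ.ev m y = s y := by
  obtain ⟨V, f, hV, h⟩ := exists_opens_of_eventually hx (E.eventually hs)
  obtain ⟨m, hm⟩ := μ.glue s h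
  exact ⟨V, f, m, hV, hm⟩

lemma exists_res_eq {m n : M.val.obj (op U)} {x : X} (hx : x ∈ U) (h : μ.ev m x = μ.ev n x) :
    ∃ (V : Opens X) (f : V ⟶ U), x ∈ V ∧ res f m = res f n := by
  obtain ⟨V, f, hV, h⟩ := exists_opens_of_eventually hx (E.unique (μ.isGerm m x hx) (μ.isGerm n x hx) h)
  refine ⟨V, f, hV, μ.ext fun y hy => ?_⟩
  rw [μ.ev_res f _ y hy, μ.ev_res f _ y hy, h y hy]

lemma mem_span_nhds {ι : Type*} [Finite ι] {s : ι → M.val.obj (op U)} {m : M.val.obj (op U)} {x : X}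
    (hx : x ∈ U)
    (h : μ.ev m x ∈ Submodule.span ((ringGerms A).stalk x) (Set.range fun i => μ.ev (s i) x)) :
    ∃ (V : Opens X) (f : V ⟶ U), x ∈ V ∧ ∀ ⦃W⦄ (g : W ⟶ V), res (g ≫ f) m ∈
      Submodule.span (A.obj.obj (op W)) (Set.range fun i => res (g ≫ f) (s i)) := by
  have := Fintype.ofFinite ι
  obtain ⟨c, hc⟩ := mem_span_range.1 h
  obtain ⟨V, f, a, hV, ha⟩ := exists_sections hx c
  obtain ⟨W, g, hW, e⟩ := μ.exists_res_eq (m := res f m)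
    (n := ∑ i, a i • res f (s i)) hV (by
      rw [μ.ev_res f _ x hV, μ.ev_comb _ _ hV, hc]
      exact Finset.sum_congr rfl fun i _ => by rw [ha, μ.ev_res f _ x hV])
  refine ⟨W, g ≫ f, hW, fun W' g' => mem_span_range.2 ⟨fun i => rres (g' ≫ g) (a i), ?_⟩⟩
  rw [res_comp, res_comp, e, ← res_comp, res_sum]
  refine Finset.sum_congr rfl fun i _ => ?_
  rw [res_smul, ← res_comp, Category.assoc]

lemma spans_iff {k : ℕ} {s : Fin k → M.val.obj (op U)} : Spans s ↔
    ∀ y ∈ U, Submodule.span ((ringGerms A).stalk y) (Set.range fun i => μ.ev (s i) y) = ⊤ := by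
  constructor
  · refine fun h y hy => eq_top_iff.2 fun e _ => ?_
    obtain ⟨t, ht, rfl⟩ := E.exists_germ y e
    obtain ⟨V, f, m, hV, hm⟩ := μ.exists_section hy ht
    obtain ⟨W, g, hW, hg⟩ := (h f m).exists_mem hV
    obtain ⟨c, hc⟩ := mem_span_range.1 hg
    refine mem_span_range.2 ⟨fun i => asec (c i) y, ?_⟩
    rw [← hm y hV, ← μ.ev_res g m y hW, hc, μ.ev_comb _ _ hW]
    exact Finset.sum_congr rfl fun i _ => by rw [μ.ev_res _ _ y hW]
  · intro h V f m
    refine loc_of_nhds fun x hx => ?_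
    have h1 : μ.ev m x ∈ Submodule.span ((ringGerms A).stalk x)
        (Set.range fun i => μ.ev (res f (s i)) x) := by
      simp only [μ.ev_res f _ x hx, h x (leOfHom f hx), Submodule.mem_top]
    obtain ⟨W, g, hW, hg⟩ := μ.mem_span_nhds hx h1
    refine ⟨W, g, hW, fun W' g' => ?_⟩
    simp only [res_comp] at hg ⊢
    exact hg g'

/-- A relation in a stalk extends to a relation between restricted sections on a neighbourhood, and
coefficients expressing it through the `r j` extend likewise; finitely many identities of germs hold
on one common neighbourhood. -/
lemma spansRel_iff {k l : ℕ} {s : Fin k → M.val.obj (op U)} {r : Fin l → Fin k → A.obj.obj (op U)} :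
    SpansRel s r ↔ ∀ y ∈ U, rel (⊥ : E.Fam) (fun i => μ.ev (s i)) y =
      Submodule.span ((ringGerms A).stalk y) (Set.range fun j i => asec (r j i) y) := by
  constructor
  · refine fun h y hy => le_antisymm (fun c hc => ?_) (Submodule.span_le.2 ?_)
    · obtain ⟨V, f, a, hV, rfl⟩ : ∃ (V : Opens X) (_ : V ⟶ U) (a : Fin k → A.obj.obj (op V)), y ∈ V ∧
          (fun i => asec (a i) y) = c := by
        obtain ⟨V, f, a, hV, ha⟩ := exists_sections hy c
        exact ⟨V, f, a, hV, funext ha⟩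
      obtain ⟨W, g, hW, e⟩ := μ.exists_res_eq (m := ∑ i, a i • res f (s i))
        (n := 0) hV (by
          rw [μ.ev_comb _ _ hV, map_zero]
          refine Eq.trans (Finset.sum_congr rfl fun i _ => ?_) hc
          rw [μ.ev_res f _ y hV])
      rw [res_sum, res_zero] at e
      simp only [res_smul, ← res_comp] at e
      obtain ⟨W', g', hW', h1⟩ := (h.span (g ≫ f) _ e).exists_mem hW
      obtain ⟨d, hd⟩ := mem_span_range.1 h1
      refine mem_span_range.2 ⟨fun j => asec (d j) y, funext fun i => ?_⟩
      have h2 := congrArg (fun b : A.obj.obj (op W') => asec b y) (congrFun hd i)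
      rw [Finset.sum_apply] at h2
      rw [asec_res _ _ hW', asec_res _ _ hW, asec_sum] at h2
      rw [h2, Finset.sum_apply]
      refine Finset.sum_congr rfl fun j _ => ?_
      exact (asec_mul _ _).trans (congrArg _ (asec_res _ _ hW'))
    · rintro _ ⟨j, rfl⟩
      have h1 := congrArg (fun m => μ.ev m y) (h.rel j)
      rw [μ.ev_comb _ _ hy, map_zero] at h1
      exact h1
  · intro h
    refine ⟨fun j => μ.inj _ fun y hy => ?_, fun V f c hc => loc_of_nhds fun x hx => ?_⟩
    · rw [μ.ev_comb _ _ hy]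
      exact (h y hy).ge (Submodule.subset_span ⟨j, rfl⟩)
    · have h1 : (fun i => asec (c i) x) ∈ rel (⊥ : E.Fam) (fun i => μ.ev (s i)) x := by
        have h2 := congrArg (fun m => μ.ev m x) hc
        rw [μ.ev_comb _ _ hx, map_zero] at h2
        rw [mem_rel]
        refine Eq.trans (Finset.sum_congr rfl fun i _ => ?_) h2
        rw [μ.ev_res f _ x hx]
      rw [h x (leOfHom f hx)] at h1
      obtain ⟨d, hd⟩ := mem_span_range.1 h1
      obtain ⟨W, g, a, hW, ha⟩ := exists_sections hx d
      have h3 (i : Fin k) : ∀ᶠ y in 𝓝 x, asec (c i) y =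
          asec (∑ j, a j * rres (g ≫ f) (r j i)) y := by
        refine (ringGerms A).unique (isGerm_asec _ hx) (isGerm_asec _ hW) ?_
        rw [asec_sum]
        refine (congrFun hd i).trans ?_
        rw [Finset.sum_apply]
        refine Finset.sum_congr rfl fun j _ => ?_
        rw [asec_mul, ha, asec_res _ _ hW]
        rfl
      obtain ⟨W', g', hW', h4⟩ := exists_opens_of_eventually hW (Filter.eventually_all.2 h3)
      refine ⟨W', g' ≫ g, hW', fun D e => mem_span_range.2 ⟨fun j => rres (e ≫ g') (a j), funext fun i => ?_⟩⟩
      rw [Finset.sum_apply]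
      refine rsec_injective fun y hy => ?_
      refine (rsec_res _ _ hy).trans ((h4 y (leOfHom e hy) i).trans ?_)
      refine (asec_res (e ≫ g') _ hy).symm.trans ?_
      rw [rres_sum]
      refine congrArg (fun b : A.obj.obj (op D) => asec b y) (Finset.sum_congr rfl fun j _ => ?_)
      rw [rres_mul, ← rres_comp, Category.assoc]
      rfl

end Model

section restriction

variable {C : Type u} [SmallCategory C] {J : GrothendieckTopology C} {R : Sheaf J RingCat.{u}}
  {M : SheafOfModules.{u} R} {U V : C}

lemma Spans.res {k : ℕ} {s : Fin k → M.val.obj (op U)} (h : Spans s) (f : V ⟶ U) :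
    Spans fun i => res f (s i) := by
  intro W g m
  refine (h (g ≫ f) m).mono fun W' g' h => ?_
  simp only [← res_comp, Category.assoc] at h ⊢
  exact h

lemma Spans.over {Z : Over U} {k : ℕ} {s : Fin k → M.val.obj (op Z.left)} (h : Spans s) :
    Spans (M := M.over U) (U := Z) s := fun _ f m => loc_over.2 (h f.left m)

lemma SpansRel.res {k l : ℕ} {s : Fin k → M.val.obj (op U)} {r : Fin l → Fin k → R.obj.obj (op U)}
    (h : SpansRel s r) (f : V ⟶ U) :
    SpansRel (fun i => res f (s i)) (fun j i => rres f (r j i)) where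
  rel j := by
    have := congrArg (FormalDeformation.res f) (h.rel j)
    rw [res_sum, res_zero] at this
    simpa only [res_smul] using this
  span W g c hc := by
    simp only [← res_comp] at hc
    refine (h.span (g ≫ f) c hc).mono fun W' g' h => ?_
    simp only [← rres_comp, Category.assoc] at h ⊢
    exact h

lemma SpansRel.over {Z : Over U} {k l : ℕ} {s : Fin k → M.val.obj (op Z.left)}
    {r : Fin l → Fin k → R.obj.obj (op Z.left)} (h : SpansRel s r) :
    SpansRel (M := M.over U) (U := Z) s r where
  rel j := h.rel j
  span _ f c hc := loc_over.2 (h.span f.left c hc)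

end restriction

end Realization

/-! ### Comparison of coherence of sheaves of modules with coherence on germs. -/

section Realization

open Topology Filter MGerms

variable {X : TopCat.{u}} {A : Sheaf (Opens.grothendieckTopology X) RingCat.{u}}
  {M N : SheafOfModules.{u} A} {E : MGerms (ringGerms A)} (μ : Model M E) {U V : Opens X}

lemma FTm.exists_fin {E : MGerms (ringGerms A)} {P₀ P₁ : E.Fam} {x : X} (h : FTm P₀ P₁ x) :
    ∃ (k : ℕ) (s : Fin k → ∀ y, E.stalk y), (∀ i, E.IsGerm x (s i)) ∧
      ∀ᶠ y in 𝓝 x, P₁ y = P₀ y ⊔ Submodule.span _ (Set.range fun i => s i y) := by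
  obtain ⟨ι, _, s, hs, h⟩ := h
  let e := (Fintype.equivFin ι).symm
  refine ⟨_, fun i => s (e i), fun i => hs _, h.mono fun y hy => ?_⟩
  rw [hy, ← e.surjective.range_comp]
  rfl

namespace Model

include μ

lemma ftm_iff {x : X} : FTm (⊥ : E.Fam) ⊤ x ↔
    ∃ (V : Opens X) (k : ℕ) (s : Fin k → M.val.obj (op V)), x ∈ V ∧ Spans s := by
  constructor
  · intro h
    obtain ⟨k, s, hs, h⟩ := FTm.exists_fin h
    obtain ⟨V, -, hV, h⟩ := exists_opens_of_eventually (U := ⊤) (x := x) trivial (h.and (eventually_all hs))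
    choose m hm using fun i => μ.glue (U := V) (s i) fun y hy => (h y hy).2 i
    refine ⟨V, k, m, hV, μ.spans_iff.2 fun y hy => ?_⟩
    simp only [hm _ y hy]
    exact (bot_sup_eq _).symm.trans (h y hy).1.symm
  · rintro ⟨V, k, s, hV, h⟩
    refine FTm.bot_iff.2 ⟨Fin k, inferInstance, fun i => μ.ev (s i), fun i => μ.isGerm _ x hV, ?_⟩
    filter_upwards [eventually_mem hV] with y hy
    exact (μ.spans_iff.1 h y hy).symm

lemma relAt_iff {x : X} : RelAt (⊥ : E.Fam) ⊤ x ↔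
    ∀ (U : Opens X) (k : ℕ) (s : Fin k → M.val.obj (op U)), x ∈ U → ∃ (V : Opens X) (f : V ⟶ U)
      (l : ℕ) (r : Fin l → Fin k → A.obj.obj (op V)), x ∈ V ∧ SpansRel (fun i => res f (s i)) r := by
  constructor
  · intro h U k s hx
    obtain ⟨l, r, hr, h⟩ := FTm.exists_fin (h (Fin k) (fun i => μ.ev (s i)) (fun i => μ.isGerm _ x hx)
      (Eventually.of_forall fun _ _ => trivial))
    obtain ⟨V, f, hV, h⟩ := exists_opens_of_eventually hx (h.and (eventually_all hr))
    choose a ha using fun j i => (unitModel A).glue (U := V) (fun y => r j y i) fun y hy => (h y hy).2 j i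
    refine ⟨V, f, l, a, hV, μ.spansRel_iff.2 fun y hy => ?_⟩
    have h1 := (h y hy).1
    have h2 : (fun j i => asec (a j i) y) = fun j => r j y := funext₂ fun j i => ha j i y hy
    have h3 : rel (⊥ : E.Fam) (fun i => μ.ev (res f (s i))) y =
        rel (⊥ : E.Fam) (fun i => μ.ev (s i)) y := by
      ext c
      rw [mem_rel, mem_rel]
      simp only [μ.ev_res f _ y hy]
    rw [h3, h1, h2]
    exact bot_sup_eq _
  · intro h ι _ s hs _
    let e := Fintype.equivFin ι
    obtain ⟨V, -, hV, h1⟩ := exists_opens_of_eventually (U := ⊤) (x := x) trivial (eventually_all hs)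
    choose m hm using fun i => μ.glue (U := V) (s (e.symm i)) fun y hy => h1 y hy _
    obtain ⟨W, f, l, r, hW, hr⟩ := h V _ m hV
    rw [μ.spansRel_iff] at hr
    refine FTm.bot_iff.2 ⟨Fin l, inferInstance, fun j y i => asec (r j (e i)) y,
      fun j i => isGerm_asec _ hW, ?_⟩
    filter_upwards [eventually_mem hW] with y hy
    ext c
    have h2 : c ∈ rel (⊥ : E.Fam) s y ↔ (fun i => c (e.symm i)) ∈
        rel (⊥ : E.Fam) (fun i => μ.ev (res f (m i))) y := by
      rw [mem_rel, mem_rel, ← e.symm.sum_comp]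
      simp only [μ.ev_res f _ y hy, hm _ y (leOfHom f hy)]
    rw [h2, hr y hy, mem_span_range, mem_span_range]
    refine exists_congr fun d => ?_
    constructor
    · intro h3
      funext i
      have := congrFun h3 (e i)
      rw [Finset.sum_apply] at this ⊢
      simpa using this
    · intro h3
      rw [h3]
      funext i
      rw [Finset.sum_apply, Finset.sum_apply]
      simp

lemma locFG_iff : LocFG M ↔ ∀ x, FTm (⊥ : E.Fam) ⊤ x := by
  constructor
  · intro h x
    obtain ⟨V, f, hV, k, s, hs⟩ := (h ⊤).exists_mem (x := x) trivial
    exact μ.ftm_iff.2 ⟨V, k, s, hV, hs⟩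
  · intro h U
    refine loc_of_nhds fun x hx => ?_
    obtain ⟨V, k, s, hV, hs⟩ := μ.ftm_iff.1 (h x)
    exact ⟨U ⊓ V, homOfLE inf_le_left, ⟨hx, hV⟩, fun W g => ⟨k, _, hs.res (g ≫ homOfLE inf_le_right)⟩⟩

lemma locRel_iff : LocRel M ↔ ∀ x, RelAt (⊥ : E.Fam) ⊤ x := by
  constructor
  · intro h x
    refine μ.relAt_iff.2 fun U k s hx => ?_
    obtain ⟨V, f, hV, l, r, hr⟩ := (h U k s).exists_mem hx
    exact ⟨V, f, l, r, hV, hr⟩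
  · intro h U k s
    refine loc_of_nhds fun x hx => ?_
    obtain ⟨V, f, l, r, hV, hr⟩ := μ.relAt_iff.1 (h x) U k s hx
    refine ⟨V, f, hV, fun W g => ⟨l, fun j i => rres g (r j i), ?_⟩⟩
    simpa only [← res_comp] using hr.res g

lemma isFiniteType_iff : M.IsFiniteType ↔ ∀ x, FTm (⊥ : E.Fam) ⊤ x :=
  FormalDeformation.isFiniteType_iff.trans μ.locFG_iff

lemma isCoherent_iff : IsCoherent M ↔ ∀ x, Coh (⊥ : E.Fam) ⊤ x := by
  rw [FormalDeformation.isCoherent_iff, μ.locFG_iff, μ.locRel_iff]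
  exact ⟨fun h x => ⟨h.1 x, Eventually.of_forall fun y => ⟨openAt_bot y, h.2 y⟩⟩,
    fun h => ⟨fun x => (h x).1, fun x => (h x).relAt⟩⟩

/-- The version over an open set, for modules known to be coherent only there, such as extensions by
zero. -/
lemma isCoherent_over (h : ∀ x ∈ U, Coh (⊥ : E.Fam) ⊤ x) : IsCoherent (M.over U) := by
  refine isCoherent_of_loc (fun Z => ?_) (fun Z k s => ?_)
  · refine ((loc_over (P := fun V _ => ∃ (k : ℕ) (s : Fin k → M.val.obj (op V)), Spans s)).2
      (loc_of_nhds fun x hx => ?_)).mono fun W g => ?_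
    · obtain ⟨V, k, s, hV, hs⟩ := μ.ftm_iff.1 (h x (leOfHom Z.hom hx)).1
      exact ⟨Z.left ⊓ V, homOfLE inf_le_left, ⟨hx, hV⟩,
        fun W g => ⟨k, _, hs.res (g ≫ homOfLE inf_le_right)⟩⟩
    · rintro ⟨k, s, hs⟩
      exact ⟨k, s, hs.over⟩
  · refine ((loc_over (P := fun V f => ∃ (l : ℕ) (r : Fin l → Fin k → A.obj.obj (op V)),
      SpansRel (fun i => res f (ofOver (s i))) r)).2 (loc_of_nhds fun x hx => ?_)).mono fun W g => ?_
    · obtain ⟨V, f, l, r, hV, hr⟩ := μ.relAt_iff.1 (h x (leOfHom Z.hom hx)).relAt Z.left k s hx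
      refine ⟨V, f, hV, fun W g => ⟨l, fun j i => rres g (r j i), ?_⟩⟩
      have h1 : (fun i => res (g ≫ f) (ofOver (s i))) =
        fun i => res g (res f (ofOver (s i))) := funext fun i => res_comp ..
      exact h1 ▸ hr.res g
    · rintro ⟨l, r, hr⟩
      exact ⟨l, r, hr.over⟩

omit μ in
/-- The model transported by an isomorphism. -/
def ofIso (μ : Model M E) (e : M ≅ N) : Model N E where
  ev {U} := μ.ev.comp (mapSec e.inv U).toAddMonoidHom
  smul {U} a m y hy := by
    have := μ.smul a (mapSec e.inv U m) y hy
    rwa [← map_smul] at this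
  ev_res f m y hy := by
    have := μ.ev_res f (mapSec e.inv _ m) y hy
    rwa [← mapSec_res] at this
  isGerm m y hy := μ.isGerm _ y hy
  ev_of_notMem m y hy := μ.ev_of_notMem _ y hy
  inj {U} m h := by
    have h1 := congrArg (mapSec e.hom U) (μ.inj _ h)
    rw [map_zero] at h1
    refine Eq.trans ?_ h1
    change mapSec (𝟙 N) U m = mapSec (e.inv ≫ e.hom) U m
    rw [e.inv_hom_id]
  glue {U} s h := by
    obtain ⟨m, hm⟩ := μ.glue s h
    refine ⟨mapSec e.hom U m, fun y hy => (hm y hy).symm.trans ?_ |>.symm⟩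
    change μ.ev (mapSec (𝟙 M) U m) y = μ.ev (mapSec (e.hom ≫ e.inv) U m) y
    rw [e.hom_inv_id]

end Model

end Realization

/-! ### Submodules, quotients and change of rings on the level of germs. -/

section Germs

open Topology Filter MGerms

variable {X : Type u} [TopologicalSpace X] {R R₀ : RGerms X}

namespace MGerms

variable {E : MGerms R}

/-- The submodule defined by an open family of submodules. -/
@[reducible]
def subGerms (P : E.Fam) (hP : ∀ x, OpenAt P x) : MGerms R where
  stalk y := P y
  IsGerm x s := E.IsGerm x fun y => (s y).1
  eventually h := E.eventually h
  exists_germ x a := by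
    classical
    obtain ⟨s, hs, hx⟩ := E.exists_germ x a.1
    -- Openness of `P` puts `s` in `P` near `x`; elsewhere the values do not matter and are set to
    -- zero.
    refine ⟨fun y => if h : s y ∈ P y then ⟨s y, h⟩ else 0, ?_, ?_⟩
    · refine E.congr hs ?_
      filter_upwards [hP x s hs (hx ▸ a.2)] with y hy
      rw [dif_pos hy]
    · have : s x ∈ P x := hx ▸ a.2
      dsimp only
      rw [dif_pos this]
      exact Subtype.ext hx
  unique hs ht h := by
    filter_upwards [E.unique hs ht (congrArg Subtype.val h)] with y hy
    exact Subtype.ext hy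
  congr hs h := E.congr hs (h.mono fun y hy => congrArg Subtype.val hy)
  zero x := E.zero x
  add hs ht := E.add hs ht
  smul ha hs := E.smul ha hs

/-- The quotient by an open family of submodules. -/
@[reducible]
def quotGerms (P : E.Fam) (hP : ∀ x, OpenAt P x) : MGerms R where
  stalk y := E.stalk y ⧸ P y
  IsGerm x s := ∃ t, E.IsGerm x t ∧ ∀ᶠ y in 𝓝 x, s y = (P y).mkQ (t y)
  eventually {x s} := by
    rintro ⟨t, ht, h⟩
    filter_upwards [E.eventually ht, h.eventually_nhds] with y h1 h2 using ⟨t, h1, h2⟩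
  exists_germ x a := by
    obtain ⟨a, rfl⟩ := (P x).mkQ_surjective a
    obtain ⟨s, hs, rfl⟩ := E.exists_germ x a
    exact ⟨fun y => (P y).mkQ (s y), ⟨s, hs, Eventually.of_forall fun _ => rfl⟩, rfl⟩
  unique {x s s'} := by
    rintro ⟨t, ht, h⟩ ⟨t', ht', h'⟩ e
    rw [h.self_of_nhds, h'.self_of_nhds] at e
    filter_upwards [h, h', hP x _ (E.sub ht ht') ((Submodule.Quotient.eq _).1 e)] with y h h' e
    rw [h, h']
    exact (Submodule.Quotient.eq _).2 e
  congr {x s s'} := by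
    rintro ⟨t, ht, h⟩ e
    exact ⟨t, ht, by filter_upwards [h, e] with y h e using e.symm.trans h⟩
  zero x := ⟨0, E.zero x, Eventually.of_forall fun y => rfl⟩
  add {x s s'} := by
    rintro ⟨t, ht, h⟩ ⟨t', ht', h'⟩
    exact ⟨t + t', E.add ht ht', by
      filter_upwards [h, h'] with y h h'
      rw [Pi.add_apply, h, h', ← map_add]
      rfl⟩
  smul {x a s} := by
    rintro ha ⟨t, ht, h⟩
    exact ⟨_, E.smul ha ht, h.mono fun y h => by
      dsimp only
      rw [h, map_smul]⟩

lemma germMap_subtype {P : E.Fam} (hP : ∀ x, OpenAt P x) (x : X) :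
    GermMap (E := subGerms P hP) (F := E) (fun y => (P y).subtype) x :=
  Eventually.of_forall fun _ _ hs => hs

lemma germMap_mkQ {P : E.Fam} (hP : ∀ x, OpenAt P x) (x : X) :
    GermMap (E := E) (F := quotGerms P hP) (fun y => (P y).mkQ) x :=
  Eventually.of_forall fun _ s hs => ⟨s, hs, Eventually.of_forall fun _ => rfl⟩

lemma coh_subGerms_iff {P₀ P : E.Fam} (hP₀ : ∀ x, OpenAt P₀ x) (hP : ∀ x, OpenAt P x)
    (hle : ∀ x, P₀ x ≤ P x) {x : X} :
    Coh (E := subGerms P hP) (fun y => (P₀ y).comap (P y).subtype) ⊤ x ↔ Coh P₀ P x := by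
  have h : ∀ᶠ y in 𝓝 x, P y = (⊤ : Submodule (R.stalk y) (P y)).map (P y).subtype ⊔ P₀ y :=
    Eventually.of_forall fun y => by
      rw [Submodule.map_subtype_top]
      exact (sup_eq_left.2 (hle y)).symm
  exact ⟨fun h' => h'.iso (germMap_subtype hP x) (Eventually.of_forall openAt_top)
      (Eventually.of_forall hP₀) (Eventually.of_forall fun y => (top_inf_eq _).symm) h,
    fun h' => h'.of_iso (germMap_subtype hP x) (Eventually.of_forall openAt_top)
      (Eventually.of_forall fun y => (top_inf_eq _).symm) h⟩

lemma coh_quotGerms_iff {P : E.Fam} (hP : ∀ x, OpenAt P x) {x : X} :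
    Coh (E := quotGerms P hP) ⊥ ⊤ x ↔ Coh P ⊤ x := by
  have h : ∀ᶠ y in 𝓝 x, (⊤ : Submodule (R.stalk y) (E.stalk y ⧸ P y)) =
      (⊤ : Submodule (R.stalk y) (E.stalk y)).map (P y).mkQ ⊔ ⊥ :=
    Eventually.of_forall fun y => by
      rw [Submodule.map_top, Submodule.range_mkQ, sup_bot_eq]
  have h' : ∀ᶠ y in 𝓝 x, P y = (⊤ : Submodule (R.stalk y) (E.stalk y)) ⊓
      (⊥ : Submodule (R.stalk y) (E.stalk y ⧸ P y)).comap (P y).mkQ :=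
    Eventually.of_forall fun y => by
      rw [top_inf_eq]
      exact (Submodule.ker_mkQ _).symm
  exact ⟨fun h'' => h''.of_iso (germMap_mkQ hP x) (Eventually.of_forall openAt_top) h' h,
    fun h'' => h''.iso (germMap_mkQ hP x) (Eventually.of_forall openAt_top)
      (Eventually.of_forall openAt_bot) h' h⟩

end MGerms

variable (R R₀) in
/-- A surjective morphism of sheaves of rings. -/
structure RMap where
  /-- the action on stalks -/
  φ : ∀ y, R.stalk y →+* R₀.stalk y
  germ {x s} : R.IsGerm x s → R₀.IsGerm x fun y => φ y (s y)
  surjective (y) : Function.Surjective (φ y)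

namespace RMap

variable (f : RMap R R₀) (E₀ : MGerms R₀) (E : MGerms R)

lemma exists_lift {x : X} {r : ∀ y, R₀.stalk y} (hr : R₀.IsGerm x r) :
    ∃ s, R.IsGerm x s ∧ ∀ᶠ y in 𝓝 x, f.φ y (s y) = r y := by
  obtain ⟨a, ha⟩ := f.surjective x (r x)
  obtain ⟨s, hs, rfl⟩ := R.exists_germ x a
  exact ⟨s, hs, R₀.unique (f.germ hs) hr ha⟩

/-- Restriction of scalars. -/
def restrict : MGerms R where
  stalk := E₀.stalk
  mod x := Module.compHom _ (f.φ x)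
  IsGerm := E₀.IsGerm
  eventually := E₀.eventually
  exists_germ := E₀.exists_germ
  unique := E₀.unique
  congr := E₀.congr
  zero := E₀.zero
  add := E₀.add
  smul ha hs := E₀.smul (f.germ ha) hs

variable {E} in
/-- Descent of scalars, for a module annihilated by the kernel. -/
def descend (h : ∀ y a, f.φ y a = 0 → ∀ m : E.stalk y, a • m = 0) : MGerms R₀ where
  stalk := E.stalk
  mod x :=
    -- A scalar acts through an arbitrary preimage; the choice is immaterial because the kernel
    -- annihilates `E`.
    letI : SMul (R₀.stalk x) (E.stalk x) := ⟨fun r m => (f.surjective x r).choose • m⟩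
    (f.surjective x).moduleLeft (f.φ x) fun a m => by
      change (f.surjective x (f.φ x a)).choose • m = a • m
      rw [← sub_eq_zero, ← sub_smul]
      exact h _ _ (by rw [map_sub, (f.surjective x (f.φ x a)).choose_spec, sub_self]) _
  IsGerm := E.IsGerm
  eventually := E.eventually
  exists_germ := E.exists_germ
  unique := E.unique
  congr := E.congr
  zero := E.zero
  add := E.add
  smul {x r s} hr hs := by
    obtain ⟨a, ha, hr⟩ := f.exists_lift hr
    refine E.congr (E.smul ha hs) (hr.mono fun y hy => ?_)
    change a y • s y = (f.surjective y (r y)).choose • s y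
    rw [← sub_eq_zero, ← sub_smul]
    exact h _ _ (by rw [map_sub, (f.surjective y (r y)).choose_spec, hy, sub_self]) _

lemma descend_smul (h : ∀ y a, f.φ y a = 0 → ∀ m : E.stalk y, a • m = 0) {y : X} (a : R.stalk y)
    (m : E.stalk y) :
    (HSMul.hSMul (α := R₀.stalk y) (β := (f.descend h).stalk y) (f.φ y a) m) = a • m := by
  change (f.surjective y (f.φ y a)).choose • m = a • m
  rw [← sub_eq_zero, ← sub_smul]
  exact h _ _ (by rw [map_sub, (f.surjective y (f.φ y a)).choose_spec, sub_self]) _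

variable {f E₀} {x : X}

lemma top_eq_span_iff {B M ι : Type*} [Ring B] [AddCommGroup M] [Module B M] [Fintype ι] {s : ι → M} :
    ⊤ = Submodule.span B (Set.range s) ↔ ∀ m, ∃ c : ι → B, m = ∑ i, c i • s i := by
  rw [eq_comm, Submodule.eq_top_iff']
  exact forall_congr' fun m => mem_span_range

lemma ftm_restrict_iff : FTm (⊥ : (f.restrict E₀).Fam) ⊤ x ↔ FTm (⊥ : E₀.Fam) ⊤ x := by
  refine FTm.bot_iff.trans (Iff.trans ?_ FTm.bot_iff.symm)
  refine exists_congr fun ι => exists_congr fun _ => exists_congr fun s => and_congr_right fun _ =>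
    eventually_congr (Eventually.of_forall fun y => ?_)
  refine top_eq_span_iff.trans (Iff.trans ?_ top_eq_span_iff.symm)
  refine forall_congr' fun m => ⟨?_, ?_⟩
  · rintro ⟨c, hc⟩
    exact ⟨fun i => f.φ y (c i), hc⟩
  · rintro ⟨c, hc⟩
    choose d hd using fun i => f.surjective y (c i)
    obtain rfl : (fun i => f.φ y (d i)) = c := funext hd
    exact ⟨d, hc⟩

/-- `P` is the inverse image of `Q` under the coordinatewise map with kernel `ħ Rᶥ`. Hence it is
generated by lifts of generators of `Q` together with the multiples by `ħ` of the basis vectors;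
conversely, generators of `P` map to generators of `Q`. -/
lemma ftm_comap_iff (D : CentralGerm R) (hf : ∀ y a, f.φ y a = 0 ↔ ∃ b, a = b * D.h y) {ι : Type}
    [Fintype ι] {P : (R.unit.pi ι).Fam} {Q : (R₀.unit.pi ι).Fam}
    (hPQ : ∀ y (c : ι → R.stalk y), c ∈ P y ↔ (fun i => f.φ y (c i)) ∈ Q y) :
    FTm ⊥ P x ↔ FTm ⊥ Q x := by
  classical
  rw [FTm.bot_iff, FTm.bot_iff]
  constructor
  · rintro ⟨κ, _, r, hr, h⟩
    refine ⟨κ, ‹_›, fun j y i => f.φ y (r j y i), fun j i => f.germ (hr j i), h.mono fun y hy => ?_⟩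
    ext c
    choose d hd using fun i => f.surjective y (c i)
    obtain rfl : (fun i => f.φ y (d i)) = c := funext hd
    rw [← hPQ, hy, mem_span_range, mem_span_range]
    constructor
    · rintro ⟨e, rfl⟩
      refine ⟨fun j => f.φ y (e j), funext fun i => ?_⟩
      simp [Finset.sum_apply, map_sum]
    · rintro ⟨e, he⟩
      choose e' he' using fun j => f.surjective y (e j)
      have h1 : d - ∑ j, e' j • r j y ∈ P y := by
        rw [hPQ]
        convert (Q y).zero_mem using 1
        funext i
        have := congrFun he i
        simp only [Finset.sum_apply, Pi.smul_apply, smul_eq_mul] at this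
        simp [Finset.sum_apply, map_sum, he', this]
        rfl
      rw [hy] at h1
      obtain ⟨e'', he''⟩ := mem_span_range.1 h1
      refine ⟨e'' + e', ?_⟩
      rw [← sub_add_cancel d (∑ j, e' j • r j y), he'', ← Finset.sum_add_distrib]
      simp [add_smul]
  · rintro ⟨κ, _, r, hr, h⟩
    choose t ht htr using fun j i => f.exists_lift (hr j i)
    refine ⟨κ ⊕ ι, inferInstance, Sum.elim (fun j y i => t j i y) (fun i y => Pi.single i (D.h y)), ?_, ?_⟩
    · rintro (j | i)
      · exact ht j
      · intro i'
        by_cases h : i' = i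
        · subst h
          simpa using D.germ x
        · simp only [Sum.elim_inr, ne_eq, h, not_false_eq_true, Pi.single_eq_of_ne]
          exact R.zero x
    · filter_upwards [h, Filter.eventually_all.2 fun j => Filter.eventually_all.2 (htr j)] with y hy htr
      ext c
      have hr : (fun j => r j y) = fun j i => f.φ y (t j i y) := funext₂ fun j i => (htr j i).symm
      rw [hPQ, hy, hr, mem_span_range, mem_span_range]
      simp only [Fintype.sum_sum_type, Sum.elim_inl, Sum.elim_inr]
      constructor
      · rintro ⟨e, he⟩
        choose e' he' using fun j => f.surjective y (e j)
        have h1 (i) : f.φ y (c i - ∑ j, e' j * t j i y) = 0 := by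
          have := congrFun he i
          simp only [Finset.sum_apply, Pi.smul_apply, smul_eq_mul] at this
          simp [map_sum, he', this]
        choose b hb using fun i => (hf y _).1 (h1 i)
        refine ⟨Sum.elim e' b, funext fun i => ?_⟩
        simp only [Sum.elim_inl, Sum.elim_inr, Pi.add_apply, Finset.sum_apply, Pi.smul_apply,
          smul_eq_mul]
        rw [Finset.sum_eq_single i (fun j _ hj => by simp [Pi.single_eq_of_ne hj.symm]) (by simp),
          Pi.single_eq_same, ← hb]
        simp
      · rintro ⟨e, rfl⟩
        refine ⟨fun j => f.φ y (e (Sum.inl j)), funext fun i => ?_⟩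
        have h0 : f.φ y (D.h y) = 0 := (hf y _).2 ⟨1, (one_mul _).symm⟩
        simp only [Pi.add_apply, Finset.sum_apply, Pi.smul_apply, smul_eq_mul, map_add, map_sum,
          map_mul]
        rw [Finset.sum_eq_zero (s := Finset.univ) (f := fun i' => f.φ y (e (Sum.inr i')) * _)
          (fun j _ => by
          by_cases h : i = j
          · subst h
            simp [h0]
          · simp [h]), add_zero]

lemma relAt_restrict_iff (D : CentralGerm R)
    (hf : ∀ y a, f.φ y a = 0 ↔ ∃ b, a = b * D.h y) :
    RelAt (⊥ : (f.restrict E₀).Fam) ⊤ x ↔ RelAt (⊥ : E₀.Fam) ⊤ x :=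
  forall_congr' fun _ => forall_congr' fun _ => forall_congr' fun _ => imp_congr_right fun _ =>
    imp_congr_right fun _ => ftm_comap_iff D hf fun _ _ => Iff.rfl

/-- Finite generation is unaffected since the scalars surject, and the relations over `R` are the
inverse image of those over `R₀`. -/
lemma coh_restrict_iff (D : CentralGerm R) (hf : ∀ y a, f.φ y a = 0 ↔ ∃ b, a = b * D.h y) :
    Coh (⊥ : (f.restrict E₀).Fam) ⊤ x ↔ Coh (⊥ : E₀.Fam) ⊤ x := by
  refine and_congr ftm_restrict_iff (eventually_congr (Eventually.of_forall fun y => ?_))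
  rw [relAt_restrict_iff D hf]
  exact ⟨fun h => ⟨openAt_bot y, h.2⟩, fun h => ⟨openAt_bot y, h.2⟩⟩

lemma coh_descend_iff {E : MGerms R} (D : CentralGerm R)
    (hf : ∀ y a, f.φ y a = 0 ↔ ∃ b, a = b * D.h y)
    (h : ∀ y a, f.φ y a = 0 → ∀ m : E.stalk y, a • m = 0) :
    Coh (⊥ : (f.descend h).Fam) ⊤ x ↔ Coh (⊥ : E.Fam) ⊤ x := by
  rw [← coh_restrict_iff D hf]
  let e (y : X) : (f.restrict (f.descend h)).stalk y →ₗ[R.stalk y] E.stalk y :=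
    { toFun := id
      map_add' := fun _ _ => rfl
      map_smul' := fun a m => f.descend_smul E h a m }
  have he : GermMap e x := Eventually.of_forall fun _ _ hs => hs
  have h0 : ∀ᶠ y in 𝓝 x, (⊥ : Submodule (R.stalk y) ((f.restrict (f.descend h)).stalk y)) =
      ⊤ ⊓ (⊥ : Submodule (R.stalk y) (E.stalk y)).comap (e y) := Eventually.of_forall fun y => by
    rw [top_inf_eq]
    rfl
  have h1 : ∀ᶠ y in 𝓝 x, (⊤ : Submodule (R.stalk y) (E.stalk y)) =
      (⊤ : Submodule (R.stalk y) ((f.restrict (f.descend h)).stalk y)).map (e y) ⊔ ⊥ :=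
    Eventually.of_forall fun y => by
      rw [sup_bot_eq]
      exact (eq_top_iff.2 fun m _ => ⟨m, trivial, rfl⟩).symm
  exact ⟨fun h' => h'.iso he (Eventually.of_forall openAt_top) (Eventually.of_forall openAt_bot) h0 h1,
    fun h' => h'.of_iso he (Eventually.of_forall openAt_top) h0 h1⟩

end RMap

end Germs

/-! ### The sheaf of modules attached to a family of germs. -/

section Realization

open Topology Filter MGerms

variable {X : TopCat.{u}} {A : Sheaf (Opens.grothendieckTopology X) RingCat.{u}}

namespace MGerms

variable (E : MGerms (ringGerms A))

/-- The sections on an open set, extended by zero. -/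
def sec (U : Opens X) : AddSubgroup (∀ y, E.stalk y) where
  carrier := {s | (∀ y ∉ U, s y = 0) ∧ ∀ y ∈ U, E.IsGerm y s}
  zero_mem' := ⟨fun _ _ => rfl, fun y _ => E.zero y⟩
  add_mem' := fun {s t} h h' => ⟨fun y hy => by rw [Pi.add_apply, h.1 y hy, h'.1 y hy, add_zero],
    fun y hy => E.add (h.2 y hy) (h'.2 y hy)⟩
  neg_mem' := fun {s} h => ⟨fun y hy => by rw [Pi.neg_apply, h.1 y hy, neg_zero],
    fun y hy => neg (h.2 y hy)⟩

variable {E}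

/-- The restriction of a family of elements of the stalks, extended by zero. -/
def cut (U : Opens X) : (∀ y, E.stalk y) →+ ∀ y, E.stalk y :=
  open Classical in
  { toFun s y := if y ∈ U then s y else 0
    map_zero' := by
      ext y
      simp
    map_add' s t := by
      ext y
      by_cases h : y ∈ U <;> simp [h] }

lemma cut_of_mem {U : Opens X} {s : ∀ y, E.stalk y} {y : X} (h : y ∈ U) : cut U s y = s y := if_pos h

lemma cut_of_notMem {U : Opens X} {s : ∀ y, E.stalk y} {y : X} (h : y ∉ U) : cut U s y = 0 := if_neg h

lemma cut_mem {U : Opens X} {s : ∀ y, E.stalk y} (h : ∀ y ∈ U, E.IsGerm y s) : cut U s ∈ E.sec U :=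
  ⟨fun _ hy => cut_of_notMem hy, fun y hy => E.congr (h y hy) (by
    filter_upwards [eventually_mem hy] with z hz using (cut_of_mem hz).symm)⟩

variable (E)

/-- The presheaf of sections. -/
def presheaf : (Opens X)ᵒᵖ ⥤ Ab.{u} where
  obj U := AddCommGrpCat.of (E.sec U.unop)
  map {U V} f := AddCommGrpCat.ofHom (((cut V.unop).comp (E.sec U.unop).subtype).codRestrict (E.sec V.unop)
    fun s => cut_mem fun y hy => s.2.2 y (leOfHom f.unop hy))
  map_id U := by
    ext s y
    by_cases h : y ∈ U.unop
    · exact cut_of_mem h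
    · exact (cut_of_notMem h).trans ((s : E.sec U.unop).2.1 y h).symm
  map_comp {U V W} f g := by
    ext s y
    by_cases h : y ∈ W.unop
    · refine (cut_of_mem h).trans (Eq.symm ((cut_of_mem h).trans (cut_of_mem (leOfHom g.unop h))))
    · exact (cut_of_notMem h).trans (cut_of_notMem h).symm

instance (U : (Opens X)ᵒᵖ) : Module (A.obj.obj U) (E.presheaf.obj U) where
  smul a s := (⟨fun y => asec (U := U.unop) a y • (s : E.sec U.unop).1 y,
    fun y hy => (congrArg _ ((s : E.sec U.unop).2.1 y hy)).trans (smul_zero _),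
    fun y hy => E.smul (isGerm_asec a hy) ((s : E.sec U.unop).2.2 y hy)⟩ : E.sec U.unop)
  one_smul s := Subtype.ext (funext fun y => by
    by_cases h : y ∈ U.unop
    · change asec (1 : A.obj.obj (op U.unop)) y • (s : E.sec U.unop).1 y = _
      rw [show asec (1 : A.obj.obj (op U.unop)) y = 1 from rsec_one h, one_smul]
    · change _ • (s : E.sec U.unop).1 y = (s : E.sec U.unop).1 y
      rw [(s : E.sec U.unop).2.1 y h, smul_zero])
  mul_smul a b s := Subtype.ext (funext fun y => by
    change asec (U := U.unop) (a * b) y • (s : E.sec U.unop).1 y = _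
    rw [asec_mul (U := U.unop), mul_smul]
    rfl)
  smul_zero a := Subtype.ext (funext fun y => smul_zero _)
  smul_add a s t := Subtype.ext (funext fun y => smul_add _ _ _)
  add_smul a b s := Subtype.ext (funext fun y => by
    change asec (U := U.unop) (a + b) y • (s : E.sec U.unop).1 y = _
    rw [show asec (U := U.unop) (a + b) y = asec (U := U.unop) a y + asec (U := U.unop) b y from rsec_add a b, add_smul]
    rfl)
  zero_smul s := Subtype.ext (funext fun y => by
    change asec (U := U.unop) 0 y • (s : E.sec U.unop).1 y = 0
    rw [show asec (U := U.unop) (0 : A.obj.obj (op U.unop)) y = 0 from rsec_zero, zero_smul])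

/-- The sheaf of modules of sections. -/
def sheaf : SheafOfModules.{u} A where
  val := PresheafOfModules.ofPresheaf E.presheaf (fun {U V} f a s => Subtype.ext (funext fun y => by
    by_cases h : y ∈ V.unop
    · refine (cut_of_mem h).trans ?_
      change asec (U := U.unop) a y • (s : E.sec U.unop).1 y =
        asec (U := V.unop) (rres f.unop a) y • cut V.unop (s : E.sec U.unop).1 y
      rw [asec_res _ _ h, cut_of_mem h]
    · refine (cut_of_notMem h).trans (Eq.symm ?_)
      change _ • cut V.unop (s : E.sec U.unop).1 y = 0
      rw [cut_of_notMem h, smul_zero]))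
  isSheaf := by
    change Presheaf.IsSheaf _ E.presheaf
    rw [Presheaf.isSheaf_iff_isSheaf_forget _ _ (CategoryTheory.forget Ab.{u}),
      isSheaf_iff_isSheaf_of_type]
    intro U S hS x hx
    rw [Presieve.compatible_iff_sieveCompatible] at hx
    have hx' : ∀ ⦃V W⦄ (f : V ⟶ U) (hf : S f) (g : W ⟶ V), ∀ y ∈ W,
        (x (g ≫ f) (S.downward_closed hf g) : E.sec W).1 y = (x f hf : E.sec V).1 y :=
      fun V W f hf g y hy => by
        have := congrArg (fun t : E.sec W => t.1 y) (hx f g hf)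
        exact this.trans (cut_of_mem hy)
    classical
    -- The glued section is defined stalk by stalk, from any member of the sieve containing the
    -- point; compatibility removes the dependence on the choice.
    let n (y : X) : E.stalk y := if h : ∃ (V : Opens X) (f : V ⟶ U), S f ∧ y ∈ V then
      (x h.choose_spec.choose h.choose_spec.choose_spec.1 : E.sec h.choose).1 y else 0
    have hn {V} (f : V ⟶ U) (hf : S f) (y) (hy : y ∈ V) : n y = (x f hf : E.sec V).1 y := by
      have h : ∃ (V : Opens X) (f : V ⟶ U), S f ∧ y ∈ V := ⟨V, f, hf, hy⟩
      have h1 : n y = (x h.choose_spec.choose h.choose_spec.choose_spec.1 : E.sec h.choose).1 y := dif_pos h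
      rw [h1]
      have hW : y ∈ h.choose ⊓ V := ⟨h.choose_spec.choose_spec.2, hy⟩
      refine (hx' h.choose_spec.choose h.choose_spec.choose_spec.1
        (homOfLE (inf_le_left : h.choose ⊓ V ≤ _)) y hW).symm.trans ?_
      exact hx' f hf (homOfLE (inf_le_right : h.choose ⊓ V ≤ _)) y hW
    have hnU : n ∈ E.sec U := by
      refine ⟨fun y hy => dif_neg ?_, fun y hy => ?_⟩
      · rintro ⟨V, f, -, hV⟩
        exact hy (leOfHom f hV)
      · obtain ⟨V, f, hf, hV⟩ := hS y hy
        refine E.congr ((x f hf : E.sec V).2.2 y hV) ?_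
        filter_upwards [eventually_mem hV] with z hz using (hn f hf z hz).symm
    refine ⟨(⟨n, hnU⟩ : E.sec U), fun V f hf => Subtype.ext (funext fun y => ?_), fun t ht => ?_⟩
    · by_cases h : y ∈ V
      · exact (cut_of_mem h).trans (hn f hf y h)
      · exact (cut_of_notMem h).trans ((x f hf : E.sec V).2.1 y h).symm
    · refine Subtype.ext (funext fun y => ?_)
      by_cases h : y ∈ U
      · obtain ⟨V, f, hf, hV⟩ := hS y h
        have := congrArg (fun t : E.sec V => t.1 y) (ht f hf)
        exact (cut_of_mem hV).symm.trans (this.trans (hn f hf y hV).symm)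
      · exact ((t : E.sec U).2.1 y h).trans (hnU.1 y h).symm

/-- The model of the sheaf of sections. -/
def model : Model E.sheaf E where
  ev {U} := (E.sec U).subtype
  smul a m y hy := rfl
  ev_res f m y hy := cut_of_mem hy
  isGerm {U} m y hy := (m : E.sec U).2.2 y hy
  ev_of_notMem {U} m y hy := (m : E.sec U).2.1 y hy
  inj {U} m h := Subtype.ext (funext fun y => by
    by_cases hy : y ∈ U
    · exact h y hy
    · exact (m : E.sec U).2.1 y hy)
  glue {U} s h := ⟨(⟨cut U s, cut_mem h⟩ : E.sec U), fun y hy => cut_of_mem hy⟩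

end MGerms

namespace Model

variable {M N : SheafOfModules.{u} A} {E F : MGerms (ringGerms A)} (μ : Model M E) (ν : Model N F)

/-- The morphism of sheaves of modules defined by a morphism on the stalks. -/
def hom (f : ∀ y, E.stalk y →ₗ[(ringGerms A).stalk y] F.stalk y) (hf : ∀ x, GermMap f x) : M ⟶ N where
  val := PresheafOfModules.homMk
    { app := fun U => AddCommGrpCat.ofHom (AddMonoidHom.mk'
        (fun m : M.val.obj (op U.unop) => (ν.glue (U := U.unop) (fun y => f y (μ.ev m y))
          fun y hy => (hf y).self_of_nhds _ (μ.isGerm _ y hy)).choose) fun m n => ν.ext fun y hy => by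
            have h (m : M.val.obj (op U.unop)) := (ν.glue (U := U.unop) (fun y => f y (μ.ev m y))
              fun y hy => (hf y).self_of_nhds _ (μ.isGerm _ y hy)).choose_spec y hy
            rw [h, map_add, map_add, Pi.add_apply, Pi.add_apply, h, h, map_add])
      naturality := fun U V i => by
        ext m
        refine ν.ext (U := V.unop) fun y hy => ?_
        have h (U) (hy : y ∈ U) (m : M.val.obj (op U)) := (ν.glue (U := U) (fun y => f y (μ.ev m y))
              fun y hy => (hf y).self_of_nhds _ (μ.isGerm _ y hy)).choose_spec y hy
        refine (h V.unop hy (res i.unop m)).trans ?_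
        refine Eq.trans ?_ (ν.ev_res i.unop _ y hy).symm
        refine Eq.trans ?_ (h U.unop (leOfHom i.unop hy) m).symm
        exact congrArg (f y) (μ.ev_res i.unop (U := U.unop) m y hy) }
    (fun U a m => ν.ext (U := U.unop) fun y hy => by
      have h (m : M.val.obj (op U.unop)) := (ν.glue (U := U.unop) (fun y => f y (μ.ev m y))
          fun y hy => (hf y).self_of_nhds _ (μ.isGerm _ y hy)).choose_spec y hy
      refine (h (a • m)).trans (Eq.trans ?_ (ν.smul (U := U.unop) a _ y hy).symm)
      refine Eq.trans ?_ (congrArg _ (h m).symm)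
      rw [μ.smul (U := U.unop) a m y hy, map_smul])

lemma ev_hom (f : ∀ y, E.stalk y →ₗ[(ringGerms A).stalk y] F.stalk y) (hf : ∀ x, GermMap f x)
    {U : Opens X} (m : M.val.obj (op U)) {y : X} (hy : y ∈ U) :
    ν.ev (mapSec (μ.hom ν f hf) U m) y = f y (μ.ev m y) :=
  (ν.glue (U := U) (fun y => f y (μ.ev m y))
    fun y hy => (hf y).self_of_nhds _ (μ.isGerm _ y hy)).choose_spec y hy

end Model

end Realization

/-! ### Sections of images and monomorphisms out of cokernels. -/

section Site

variable {C : Type u} [SmallCategory C] {J : GrothendieckTopology C} {R : Sheaf J RingCat.{u}}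
  {M N : SheafOfModules.{u} R}

/-- Local preimages under a monomorphism are unique, hence compatible, and glue. -/
lemma isLocalSub_rangeSub (φ : N ⟶ M) [Mono φ] : IsLocalSub (rangeSub φ) := by
  intro U m S hS h
  choose n hn using h
  obtain ⟨n', hn'⟩ := res_glue hS n fun V W f hf g => injective_of_mono φ W (by
    rw [mapSec_res, hn, hn, res_comp])
  refine ⟨n', res_ext hS fun V f hf => ?_⟩
  rw [← mapSec_res, hn' f hf]
  exact hn f hf

lemma exists_imageSubobject_arrow (φ : N ⟶ M) {U : C} (m : M.val.obj (op U)) :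
    (∃ z, mapSec (imageSubobject φ).arrow U z = m) ↔ Loc J U fun V f => ∃ n, mapSec φ V n = res f m := by
  constructor
  · rintro ⟨z, rfl⟩
    obtain ⟨S, hS, h⟩ := exists_of_epi (factorThruImageSubobject φ) z
    refine ⟨S, hS, fun V f hf => ?_⟩
    obtain ⟨n, hn⟩ := h f hf
    refine ⟨n, ?_⟩
    rw [← mapSec_res, ← hn, ← mapSec_comp, imageSubobject_arrow_comp]
  · rintro ⟨S, hS, h⟩
    refine isLocalSub_rangeSub (imageSubobject φ).arrow m S hS fun V f hf => ?_
    obtain ⟨n, hn⟩ := h f hf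
    refine ⟨mapSec (factorThruImageSubobject φ) V n, ?_⟩
    rw [← hn, ← mapSec_comp, imageSubobject_arrow_comp]

lemma mono_cokernel_desc {L : SheafOfModules.{u} R} (φ : N ⟶ M) (ψ : M ⟶ L) (h : φ ≫ ψ = 0)
    (h' : ∀ U (m : M.val.obj (op U)), mapSec ψ U m = 0 → ∃ n, mapSec φ U n = m) :
    Mono (cokernel.desc φ ψ h) := by
  refine mono_of_sec _ fun U z hz => ?_
  obtain ⟨S, hS, hm⟩ := exists_of_epi (cokernel.π φ) z
  refine res_ext hS fun V f hf => ?_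
  obtain ⟨m, hm⟩ := hm f hf
  have h1 : mapSec ψ V m = 0 := by
    rw [← cokernel.π_desc φ ψ h, mapSec_comp, hm, mapSec_res, hz, res_zero]
  obtain ⟨n, rfl⟩ := h' V m h1
  rw [← hm, ← mapSec_comp, cokernel.condition, mapSec_zero, res_zero]

end Site

/-! ### Stalks of cokernels, of `ħⁿ M`, and of the graded pieces. -/

section Realization

open Topology Filter MGerms

variable {X : TopCat.{u}} {A : Sheaf (Opens.grothendieckTopology X) RingCat.{u}}
  {M N : SheafOfModules.{u} A} {E : MGerms (ringGerms A)}

namespace Model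

variable (μ : Model M E)

/-- The model of a submodule. -/
def sub (φ : N ⟶ M) [Mono φ] {P : E.Fam} (hP : ∀ x, OpenAt P x)
    (h : ∀ (U : Opens X) (m : M.val.obj (op U)), (∃ n, mapSec φ U n = m) ↔ ∀ y ∈ U, μ.ev m y ∈ P y) :
    Model N (subGerms P hP) where
  ev {U} := AddMonoidHom.mk' (fun n y => ⟨μ.ev (mapSec φ U n) y, by
      by_cases hy : y ∈ U
      · exact (h U _).1 ⟨n, rfl⟩ y hy
      · rw [μ.ev_of_notMem _ y hy]
        exact zero_mem _⟩) fun n n' => by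
    ext y
    simp
  smul {U} a n y hy := Subtype.ext (by
    have := μ.smul a (mapSec φ U n) y hy
    rw [← map_smul] at this
    exact this)
  ev_res {U V} f n y hy := Subtype.ext (by
    have := μ.ev_res f (mapSec φ U n) y hy
    rwa [← mapSec_res] at this)
  isGerm n y hy := μ.isGerm (mapSec φ _ n) y hy
  ev_of_notMem n y hy := Subtype.ext (μ.ev_of_notMem (mapSec φ _ n) y hy)
  inj {U} n hn := injective_of_mono φ U (by
    rw [map_zero]
    exact μ.inj _ fun y hy => congrArg Subtype.val (hn y hy))
  glue {U} s hs := by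
    obtain ⟨m, hm⟩ := μ.glue (fun y => (s y).1) hs
    obtain ⟨n, rfl⟩ := (h U m).2 fun y hy => by
      rw [hm y hy]
      exact (s y).2
    exact ⟨n, fun y hy => Subtype.ext (hm y hy)⟩

variable (φ : N ⟶ M) {P : E.Fam} (hP : ∀ x, OpenAt P x)
    (h : ∀ (U : Opens X) (m : M.val.obj (op U)), (∃ n, mapSec φ U n = m) ↔ ∀ y ∈ U, μ.ev m y ∈ P y)

include h in
lemma comp_hom_eq_zero : φ ≫ μ.hom (quotGerms P hP).model (fun y => (P y).mkQ) (germMap_mkQ hP) = 0 :=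
  hom_ext_sec fun U n => (quotGerms P hP).model.ext fun y hy => by
    rw [mapSec_comp, μ.ev_hom _ _ _ _ hy, mapSec_zero, map_zero]
    exact (Submodule.Quotient.mk_eq_zero _).2 ((h U _).1 ⟨n, rfl⟩ y hy)

-- The abstract cokernel is compared with the explicit quotient of stalks: the comparison is mono
-- because the sections of `N` are exactly those with germs in `P`, and epi because sections of the
-- quotient lift locally.
include h in
lemma isIso_cokernel_desc : IsIso (cokernel.desc φ _ (μ.comp_hom_eq_zero φ hP h)) := by
  have : Mono (cokernel.desc φ _ (μ.comp_hom_eq_zero φ hP h)) := mono_cokernel_desc _ _ _ fun U m hm => by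
    refine (h U m).2 fun y hy => ?_
    have := congrArg (fun t => (quotGerms P hP).model.ev t y) hm
    dsimp only at this
    rw [μ.ev_hom _ _ _ _ hy, map_zero] at this
    exact (Submodule.Quotient.mk_eq_zero _).1 this
  have : Epi (μ.hom (quotGerms P hP).model (fun y => (P y).mkQ) (germMap_mkQ hP)) := by
    refine epi_of_locally _ fun U m => loc_of_nhds fun x hx => ?_
    obtain ⟨t, ht, he⟩ := (quotGerms P hP).model.isGerm m x hx
    obtain ⟨V, f, hV, he⟩ := exists_opens_of_eventually hx he
    obtain ⟨W, g, n, hW, hn⟩ := μ.exists_section hV ht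
    refine ⟨W, g ≫ f, hW, fun W' g' => ⟨res g' n, (quotGerms P hP).model.ext fun y hy => ?_⟩⟩
    rw [μ.ev_hom _ _ _ _ hy, ev_res _ _ _ y hy, ev_res _ _ _ y hy, hn y (leOfHom g' hy),
      he y (leOfHom (g' ≫ g) hy)]
  have : Epi (cokernel.desc φ _ (μ.comp_hom_eq_zero φ hP h)) := by
    rw [← cokernel.π_desc φ _ (μ.comp_hom_eq_zero φ hP h)] at this
    exact epi_of_epi (cokernel.π φ) _
  exact isIso_of_mono_of_epi _

/-- The model of a quotient module. -/
def quot : Model (cokernel φ) (quotGerms P hP) :=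
  have := μ.isIso_cokernel_desc φ hP h
  (quotGerms P hP).model.ofIso (asIso (cokernel.desc φ _ (μ.comp_hom_eq_zero φ hP h))).symm

lemma ev_quot {U : Opens X} (m : M.val.obj (op U)) {y : X} (hy : y ∈ U) :
    (μ.quot φ hP h).ev (mapSec (cokernel.π φ) U m) y = (P y).mkQ (μ.ev m y) := by
  rw [← μ.ev_hom (quotGerms P hP).model _ (germMap_mkQ hP) _ hy]
  change (quotGerms P hP).model.ev (mapSec (cokernel.π φ ≫ cokernel.desc φ _ _) U m) y = _
  rw [cokernel.π_desc]

end Model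

namespace CentralSection

variable (ħ : CentralSection A)

/-- The germs of a central section. -/
def germs : CentralGerm (ringGerms A) where
  h := asec ħ.val
  germ x := isGerm_asec _ trivial
  central x a := by
    obtain ⟨U, hx, b, hb⟩ := exists_rsec x a
    obtain rfl : asec b x = a := hb
    have h : asec (ħ.res (op U) * b) x = asec (b * ħ.res (op U)) x :=
      congrArg (fun c : A.obj.obj (op U) => asec c x) (ħ.res_commute (op U) b)
    rw [asec_mul, asec_mul] at h
    rw [show asec (ħ.res (op U)) x = asec ħ.val x from asec_res (homOfLE le_top) ħ.val hx] at h
    exact h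

lemma asec_hres {U : Opens X} {x : X} (hx : x ∈ U) : asec (ħ.res (op U)) x = ħ.germs.h x :=
  asec_res (homOfLE le_top) ħ.val hx

lemma asec_pow {U : Opens X} (a : A.obj.obj (op U)) (n : ℕ) {x : X} (hx : x ∈ U) :
    asec (a ^ n) x = asec a x ^ n := by
  induction n with
  | zero =>
    rw [pow_zero, pow_zero]
    exact rsec_one hx
  | succ n ih => rw [pow_succ, pow_succ, asec_mul, ih]

variable (μ : Model M E)

lemma ev_mulPow (n : ℕ) {U : Opens X} (m : M.val.obj (op U)) {y : X} (hy : y ∈ U) :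
    μ.ev (mapSec (ħ.mulPow M n) U m) y = ħ.germs.h y ^ n • μ.ev m y := by
  refine (μ.smul (ħ.res (op U) ^ n) m y hy).trans ?_
  rw [asec_pow _ _ hy, ħ.asec_hres hy]

lemma openAt_pow (n : ℕ) (x : X) : OpenAt (ħ.germs.pow n (⊤ : E.Fam)) x :=
  ħ.germs.openAt_pow n (openAt_top x)

/-- Sections of an image are local images, so lying in `ħⁿ M` is a condition on germs. -/
lemma exists_powSub_arrow (n : ℕ) (U : Opens X) (m : M.val.obj (op U)) :
    (∃ z, mapSec (ħ.powSub M n).arrow U z = m) ↔ ∀ y ∈ U, μ.ev m y ∈ ħ.germs.pow n (⊤ : E.Fam) y := by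
  refine (exists_imageSubobject_arrow _ m).trans ⟨fun h y hy => ?_, fun h => loc_of_nhds fun x hx => ?_⟩
  · obtain ⟨V, f, hV, m', hm⟩ := h.exists_mem hy
    refine ⟨μ.ev m' y, trivial, ?_⟩
    rw [← μ.ev_res f m y hV, ← hm, ħ.ev_mulPow μ n m' hV]
    rfl
  · obtain ⟨e, -, he⟩ := h x hx
    obtain ⟨s, hs, rfl⟩ := E.exists_germ x e
    obtain ⟨V, f, m', hV, hm⟩ := μ.exists_section hx hs
    obtain ⟨W, g, hW, e⟩ := μ.exists_res_eq (m := mapSec (ħ.mulPow M n) V m') (n := FormalDeformation.res f m) hV (by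
      rw [ħ.ev_mulPow μ n m' hV, hm x hV, μ.ev_res f m x hV]
      exact he)
    refine ⟨W, g ≫ f, hW, fun W' g' => ⟨FormalDeformation.res (g' ≫ g) m', ?_⟩⟩
    rw [mapSec_res, res_comp, e, ← res_comp, ← res_comp, Category.assoc]

/-- The model of `M / ħⁿ M`. -/
def quotModel (n : ℕ) : Model (cokernel (ħ.powSub M n).arrow) (quotGerms _ (ħ.openAt_pow (E := E) n)) :=
  μ.quot _ _ (ħ.exists_powSub_arrow μ n)

/-- The model of `ħⁿ M`. -/
def powModel (n : ℕ) : Model (ħ.powSub M n : SheafOfModules.{u} A) (subGerms _ (ħ.openAt_pow (E := E) n)) :=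
  μ.sub (ħ.powSub M n).arrow _ (ħ.exists_powSub_arrow μ n)

lemma openAt_comap_pow (n : ℕ) (x : X) : OpenAt (E := subGerms _ (ħ.openAt_pow (E := E) n))
    (fun y => (ħ.germs.pow (n + 1) (⊤ : E.Fam) y).comap (ħ.germs.pow n (⊤ : E.Fam) y).subtype) x :=
  (ħ.openAt_pow (n + 1) x).comap (germMap_subtype (ħ.openAt_pow n) x)

/-- The stalks of `ħⁿ M / ħⁿ⁺¹ M`. -/
abbrev grGerms (E : MGerms (ringGerms A)) (n : ℕ) : MGerms (ringGerms A) :=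
  quotGerms _ (ħ.openAt_comap_pow (E := E) n)

/-- The model of `ħⁿ M / ħⁿ⁺¹ M`. -/
def grModel (n : ℕ) : Model (ħ.gr M n) (ħ.grGerms E n) :=
  (ħ.powModel μ n).quot _ _ fun U m => by
    have h := ħ.exists_powSub_arrow μ (n + 1) U (mapSec (ħ.powSub M n).arrow U m)
    refine Iff.trans ⟨?_, ?_⟩ h
    · rintro ⟨z, rfl⟩
      refine ⟨z, ?_⟩
      rw [← mapSec_comp, Subobject.ofLE_arrow]
    · rintro ⟨z, hz⟩
      refine ⟨z, injective_of_mono (ħ.powSub M n).arrow U ?_⟩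
      rw [← mapSec_comp, Subobject.ofLE_arrow, hz]

lemma coh_grGerms_iff (n : ℕ) {x : X} : Coh (⊥ : (ħ.grGerms E n).Fam) ⊤ x ↔
    Coh (ħ.germs.pow (n + 1) (⊤ : E.Fam)) (ħ.germs.pow n ⊤) x :=
  (coh_quotGerms_iff (ħ.openAt_comap_pow n)).trans (coh_subGerms_iff (ħ.openAt_pow (n + 1)) (ħ.openAt_pow n)
    fun y => ħ.germs.pow_antitone n.le_succ ⊤ y)

lemma smul_grGerms (n : ℕ) (y : X) (m : (ħ.grGerms E n).stalk y) : ħ.germs.h y • m = 0 := by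
  obtain ⟨⟨_, e, -, rfl⟩, rfl⟩ := Submodule.mkQ_surjective _ m
  rw [← map_smul]
  refine (Submodule.Quotient.mk_eq_zero _).2 ⟨e, trivial, ?_⟩
  change ħ.germs.h y ^ (n + 1) • e = ħ.germs.h y • ħ.germs.h y ^ n • e
  rw [← mul_smul, pow_succ']

end CentralSection

end Realization

/-! ### The morphism `A ⟶ A₀` on stalks, and coherence over `A₀`. -/

section Realization

open Topology Filter MGerms

variable {X : TopCat.{u}} {A : Sheaf (Opens.grothendieckTopology X) RingCat.{u}}
  {M N : SheafOfModules.{u} A} {E F : MGerms (ringGerms A)}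

namespace Model

/-- The isomorphism of sheaves of modules defined by an isomorphism on the stalks. -/
def iso (μ : Model M E) (ν : Model N F) (f : ∀ y, E.stalk y →ₗ[(ringGerms A).stalk y] F.stalk y)
    (g : ∀ y, F.stalk y →ₗ[(ringGerms A).stalk y] E.stalk y) (hf : ∀ x, GermMap f x)
    (hg : ∀ x, GermMap g x) (hfg : ∀ y a, g y (f y a) = a) (hgf : ∀ y a, f y (g y a) = a) : M ≅ N where
  hom := μ.hom ν f hf
  inv := ν.hom μ g hg
  hom_inv_id := hom_ext_sec fun U m => μ.ext fun y hy => by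
    rw [mapSec_comp, ν.ev_hom μ g hg _ hy, μ.ev_hom ν f hf _ hy, hfg, mapSec_id]
  inv_hom_id := hom_ext_sec fun U m => ν.ext fun y hy => by
    rw [mapSec_comp, μ.ev_hom ν f hf _ hy, ν.ev_hom μ g hg _ hy, hgf, mapSec_id]

end Model

namespace CentralSection

variable (ħ : CentralSection A)

/-- The action of `A ⟶ A₀` on sections. -/
def toQ {U : Opens X} (a : A.obj.obj (op U)) : ħ.quotientSheaf.obj.obj (op U) :=
  ħ.toQuotientSheaf.hom.app (op U) a

lemma exists_toQ {U : Opens X} {x : X} (hx : x ∈ U) (b : ħ.quotientSheaf.obj.obj (op U)) :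
    ∃ (V : Opens X) (f : V ⟶ U) (a : A.obj.obj (op V)), x ∈ V ∧ ħ.toQ a = rres f b := by
  obtain ⟨V, f, ⟨c, hc⟩, hV⟩ := Presheaf.imageSieve_mem (Opens.grothendieckTopology X)
    (toSheafify (Opens.grothendieckTopology X) ħ.quotientPresheaf) (U := op U) b x hx
  obtain ⟨a, rfl⟩ := Ideal.Quotient.mk_surjective c
  exact ⟨V, f, a, hV, hc⟩

/-- `A₀` is the sheafification of `U ↦ A(U) / ħ A(U)`, so a section with zero image vanishes locally
in that presheaf, that is, becomes a multiple of `ħ`. -/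
lemma exists_eq_mul_of_toQ_eq_zero {U : Opens X} {x : X} (hx : x ∈ U) {a : A.obj.obj (op U)}
    (h : ħ.toQ a = 0) : ∃ (V : Opens X) (f : V ⟶ U) (b : A.obj.obj (op V)), x ∈ V ∧
      rres f a = b * ħ.res (op V) := by
  obtain ⟨V, f, hf, hV⟩ := Presheaf.equalizerSieve_mem (Opens.grothendieckTopology X)
    (toSheafify (Opens.grothendieckTopology X) ħ.quotientPresheaf) (X := op U)
    (Ideal.Quotient.mk (ħ.ideal (op U)) a) 0 (h.trans (map_zero _).symm) x hx
  have h1 : Ideal.Quotient.mk (ħ.ideal (op V)) (rres f a) = 0 := hf.trans (map_zero _)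
  have h2 : rres f a ∈ ħ.ideal (op V) := Ideal.Quotient.eq_zero_iff_mem.1 h1
  obtain ⟨b, hb⟩ := Ideal.mem_span_singleton'.1 h2
  exact ⟨V, f, b, hV, hb.symm⟩

lemma toQ_hres (U : Opens X) : ħ.toQ (ħ.res (op U)) = 0 := by
  have : Ideal.Quotient.mk (ħ.ideal (op U)) (ħ.res (op U)) = 0 :=
    Ideal.Quotient.eq_zero_iff_mem.2 (Ideal.subset_span rfl)
  refine Eq.trans (congrArg ((toSheafify (Opens.grothendieckTopology X) ħ.quotientPresheaf).app (op U)) this) ?_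
  exact map_zero ((toSheafify (Opens.grothendieckTopology X) ħ.quotientPresheaf).app (op U)).hom

/-- The action of `A ⟶ A₀` on stalks. -/
def stalkMap (y : X) : (ringGerms A).stalk y →+* (ringGerms ħ.quotientSheaf).stalk y :=
  ((TopCat.Presheaf.stalkFunctor RingCat.{u} y).map ħ.toQuotientSheaf.hom).hom

lemma stalkMap_asec {U : Opens X} (a : A.obj.obj (op U)) {y : X} (hy : y ∈ U) :
    ħ.stalkMap y (asec a y) = asec (ħ.toQ a) y := by
  rw [asec, asec, rsec_of_mem _ hy, rsec_of_mem _ hy]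
  exact TopCat.Presheaf.stalkFunctor_map_germ_apply (C := RingCat.{u}) (X := X) U y hy
    ħ.toQuotientSheaf.hom a

/-- The morphism `A ⟶ A₀` in terms of stalks. -/
def rmap : RMap (ringGerms A) (ringGerms ħ.quotientSheaf) where
  φ := ħ.stalkMap
  germ {x s} := by
    rintro ⟨U, a, hU, h⟩
    refine ⟨U, ħ.toQ a, hU, ?_⟩
    filter_upwards [h, eventually_mem hU] with y h hy
    rw [h]
    exact ħ.stalkMap_asec a hy
  surjective y b := by
    obtain ⟨U, hU, b, rfl⟩ := exists_rsec y b
    obtain ⟨V, f, a, hV, ha⟩ := ħ.exists_toQ hU b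
    refine ⟨asec a y, ?_⟩
    rw [ħ.stalkMap_asec a hV, ha]
    exact asec_res f b hV

lemma rmap_eq_zero_iff (y : X) (a : (ringGerms A).stalk y) :
    ħ.rmap.φ y a = 0 ↔ ∃ b, a = b * ħ.germs.h y := by
  constructor
  · intro h
    obtain ⟨U, hU, a, rfl⟩ := exists_rsec y a
    have h1 : asec (ħ.toQ a) y = asec (0 : ħ.quotientSheaf.obj.obj (op U)) y :=
      (ħ.stalkMap_asec a hU).symm.trans (h.trans rsec_zero.symm)
    obtain ⟨V, f, hV, h2⟩ := (unitModel ħ.quotientSheaf).exists_res_eq hU h1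
    obtain ⟨W, g, b, hW, h3⟩ := ħ.exists_eq_mul_of_toQ_eq_zero (a := rres f a) hV (by
      refine Eq.trans ?_ (h2.trans (res_zero (M := SheafOfModules.unit ħ.quotientSheaf) f))
      exact congrArg (fun φ => φ a) (ħ.toQuotientSheaf.hom.naturality f.op))
    refine ⟨asec b y, ?_⟩
    have h4 : asec (rres g (rres f a)) y = asec (b * ħ.res (op W)) y :=
      congrArg (fun c : A.obj.obj (op W) => asec c y) h3
    rw [asec_res g _ hW, asec_res f _ hV, asec_mul, ħ.asec_hres hW] at h4
    exact h4
  · rintro ⟨b, rfl⟩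
    have : ħ.rmap.φ y (ħ.germs.h y) = 0 := by
      refine (ħ.stalkMap_asec (U := ⊤) ħ.val trivial).trans ?_
      have h := ħ.toQ_hres ⊤
      have h' : ħ.res (op ⊤) = ħ.val := by
        change A.obj.map (𝟙 _) ħ.val = ħ.val
        rw [A.obj.map_id]
        rfl
      rw [h'] at h
      rw [h]
      exact rsec_zero
    rw [map_mul, this, mul_zero]

lemma smul_eq_zero_of_rmap (h : ∀ y (m : E.stalk y), ħ.germs.h y • m = 0) (y : X)
    (a : (ringGerms A).stalk y) (ha : ħ.rmap.φ y a = 0) (m : E.stalk y) : a • m = 0 := by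
  obtain ⟨b, rfl⟩ := (ħ.rmap_eq_zero_iff y a).1 ha
  rw [mul_smul, h, smul_zero]

/-- The model of a restriction of scalars. -/
def restrictModel {N₀ : SheafOfModules.{u} ħ.quotientSheaf} {E₀ : MGerms (ringGerms ħ.quotientSheaf)}
    (μ : Model N₀ E₀) :
    Model ((SheafOfModules.restrictScalars ħ.toQuotientSheaf).obj N₀) (ħ.rmap.restrict E₀) where
  ev {U} := μ.ev (U := U)
  smul {U} a m y hy := by
    refine (μ.smul (ħ.toQ a) m y hy).trans ?_
    rw [← ħ.stalkMap_asec a hy]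
    rfl
  ev_res f m y hy := μ.ev_res f m y hy
  isGerm m y hy := μ.isGerm m y hy
  ev_of_notMem m y hy := μ.ev_of_notMem m y hy
  inj {U} m h := μ.inj m h
  glue {U} s h := μ.glue s h

lemma isCoherent_of_isCoherentOverQuotient (h : ħ.IsCoherentOverQuotient N) : IsCoherent N := by
  obtain ⟨N₀, h, ⟨e⟩⟩ := h
  rw [((ħ.restrictModel (stalkModel N₀)).ofIso e).isCoherent_iff]
  intro x
  exact (RMap.coh_restrict_iff ħ.germs ħ.rmap_eq_zero_iff).2 ((stalkModel N₀).isCoherent_iff.1 h x)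

lemma isCoherentOverQuotient_of_isCoherent (μ : Model N E) (hE : ∀ y (m : E.stalk y), ħ.germs.h y • m = 0)
    (h : IsCoherent N) : ħ.IsCoherentOverQuotient N := by
  have hE' := ħ.smul_eq_zero_of_rmap hE
  let E₀ := ħ.rmap.descend hE'
  refine ⟨E₀.sheaf, ?_, ⟨(ħ.restrictModel E₀.model).iso μ (fun y =>
    { toFun := id
      map_add' := fun _ _ => rfl
      map_smul' := fun a m => RMap.descend_smul _ _ hE' a m }) (fun y =>
    { toFun := id
      map_add' := fun _ _ => rfl
      map_smul' := fun a m => (RMap.descend_smul _ _ hE' a m).symm })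
      (fun _ => Eventually.of_forall fun _ _ h => h) (fun _ => Eventually.of_forall fun _ _ h => h)
      (fun _ _ => rfl) (fun _ _ => rfl)⟩⟩
  rw [E₀.model.isCoherent_iff]
  intro x
  exact (RMap.coh_descend_iff ħ.germs ħ.rmap_eq_zero_iff hE').2 (μ.isCoherent_iff.1 h x)

/-- For a module annihilated by `ħ`, coherence over `A` and over `A₀` agree, by restriction in one
direction and by descent of scalars in the other. -/
lemma isCoherentOverQuotient_gr_iff (μ : Model M E) (n : ℕ) : ħ.IsCoherentOverQuotient (ħ.gr M n) ↔
    ∀ x, Coh (ħ.germs.pow (n + 1) (⊤ : E.Fam)) (ħ.germs.pow n ⊤) x := by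
  have h1 : IsCoherent (ħ.gr M n) ↔ ∀ x, Coh (ħ.germs.pow (n + 1) (⊤ : E.Fam)) (ħ.germs.pow n ⊤) x :=
    (ħ.grModel μ n).isCoherent_iff.trans (forall_congr' fun x => ħ.coh_grGerms_iff n)
  rw [← h1]
  exact ⟨ħ.isCoherent_of_isCoherentOverQuotient,
    ħ.isCoherentOverQuotient_of_isCoherent (ħ.grModel μ n) (ħ.smul_grGerms n)⟩

end CentralSection

end Realization

/-! ### Sections of limits of sheaves of modules. -/

section Site

variable {C : Type u} [SmallCategory C] {J : GrothendieckTopology C} {R : Sheaf J RingCat.{u}}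

/-- Sections over an object, as a functor to sets, commute with limits. -/
def isLimitSections {D : Type} [SmallCategory.{0} D] (F : D ⥤ SheafOfModules.{u} R) (U : C) :
    IsLimit ((SheafOfModules.evaluation R (op U) ⋙ CategoryTheory.forget _).mapCone (limit.cone F)) :=
  isLimitOfPreserves _ (limit.isLimit F)

variable {D : Type} [SmallCategory.{0} D] {F : D ⥤ SheafOfModules.{u} R} {U : C}

lemma exists_limit_sec {z : ∀ n, (F.obj n).val.obj (op U)}
    (hz : ∀ n m (f : n ⟶ m), mapSec (F.map f) U (z n) = z m) :
    ∃ w : (limit F).val.obj (op U), ∀ n, mapSec (limit.π F n) U w = z n := by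
  let s : (F ⋙ SheafOfModules.evaluation R (op U) ⋙ CategoryTheory.forget _).sections :=
    ⟨z, fun {n m} f => hz n m f⟩
  exact ⟨(Types.isLimitEquivSections (isLimitSections F U)).symm s, fun n =>
    Types.isLimitEquivSections_symm_apply (isLimitSections F U) s n⟩

lemma limit_sec_ext {w w' : (limit F).val.obj (op U)}
    (h : ∀ n, mapSec (limit.π F n) U w = mapSec (limit.π F n) U w') : w = w' :=
  (Types.isLimitEquivSections (isLimitSections F U)).injective (Subtype.ext (funext h))

end Site

/-! ### Completeness in terms of germs. -/

section Realization

open Topology Filter MGerms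

variable {X : TopCat.{u}} {A : Sheaf (Opens.grothendieckTopology X) RingCat.{u}}
  {M N : SheafOfModules.{u} A} {E F : MGerms (ringGerms A)}

namespace CentralSection

variable (ħ : CentralSection A)

/-- The transition morphisms `ℕᵒᵖ` of the projective system. -/
abbrev systemMap (M : SheafOfModules.{u} A) {m n : ℕ} (h : m ≤ n) :
    cokernel (ħ.powSub M n).arrow ⟶ cokernel (ħ.powSub M m).arrow :=
  (ħ.quotientSystem M).map (homOfLE h).op

lemma π_systemMap {m n : ℕ} (h : m ≤ n) :
    cokernel.π (ħ.powSub M n).arrow ≫ ħ.systemMap M h = cokernel.π (ħ.powSub M m).arrow :=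
  cokernel.π_desc _ _ _

/-- The projections of the completion. -/
def completionπ (M : SheafOfModules.{u} A) (n : ℕ) :
    ħ.completion M ⟶ cokernel (ħ.powSub M n).arrow := limit.π (ħ.quotientSystem M) (op n)

lemma toCompletion_π (n : ℕ) :
    ħ.toCompletion M ≫ ħ.completionπ M n = cokernel.π (ħ.powSub M n).arrow := limit.lift_π _ _

lemma completionπ_systemMap {m n : ℕ} (h : m ≤ n) :
    ħ.completionπ M n ≫ ħ.systemMap M h = ħ.completionπ M m :=
  limit.w (ħ.quotientSystem M) (homOfLE h).op

lemma systemMap_self (n : ℕ) : ħ.systemMap M (le_refl n) = 𝟙 _ := by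
  rw [← cancel_epi (cokernel.π (ħ.powSub M n).arrow), π_systemMap, Category.comp_id]

lemma systemMap_comp {m n k : ℕ} (h : m ≤ n) (h' : n ≤ k) :
    ħ.systemMap M h' ≫ ħ.systemMap M h = ħ.systemMap M (h.trans h') := by
  rw [← cancel_epi (cokernel.π (ħ.powSub M k).arrow), ← Category.assoc, π_systemMap, π_systemMap,
    π_systemMap]

lemma completion_ext {U : Opens X} {w w' : (ħ.completion M).val.obj (op U)}
    (h : ∀ n, mapSec (ħ.completionπ M n) U w = mapSec (ħ.completionπ M n) U w') : w = w' :=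
  limit_sec_ext (F := ħ.quotientSystem M) fun n => h n.unop

lemma exists_completion_sec {U : Opens X}
    {z : ∀ n, (cokernel (ħ.powSub M n).arrow).val.obj (op U)}
    (hz : ∀ n, mapSec (ħ.systemMap M n.le_succ) U (z (n + 1)) = z n) :
    ∃ w, ∀ n, mapSec (ħ.completionπ M n) U w = z n := by
  have hz' (m n : ℕ) (h : m ≤ n) : mapSec (ħ.systemMap M h) U (z n) = z m := by
    induction n, h using Nat.le_induction with
    | base => rw [systemMap_self, mapSec_id]
    | succ n h ih => rw [← ħ.systemMap_comp h n.le_succ, mapSec_comp, hz, ih]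
  obtain ⟨w, hw⟩ := exists_limit_sec (F := ħ.quotientSystem M) (U := U) (z := fun n => z n.unop)
    (fun n m f => hz' m.unop n.unop (leOfHom f.unop))
  exact ⟨w, fun n => hw (op n)⟩

lemma isComplete_iff_sections : ħ.IsComplete M ↔
    (∀ (U : Opens X) (m : M.val.obj (op U)),
      (∀ n, mapSec (cokernel.π (ħ.powSub M n).arrow) U m = 0) → m = 0) ∧
    (∀ (U : Opens X) (z : ∀ n, (cokernel (ħ.powSub M n).arrow).val.obj (op U)),
      (∀ n, mapSec (ħ.systemMap M n.le_succ) U (z (n + 1)) = z n) →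
      ∃ m, ∀ n, mapSec (cokernel.π (ħ.powSub M n).arrow) U m = z n) := by
  constructor
  · intro (h : IsIso _)
    refine ⟨fun U m hm => injective_of_mono (ħ.toCompletion M) U ?_, fun U z hz => ?_⟩
    · refine ħ.completion_ext fun n => ?_
      rw [← mapSec_comp, toCompletion_π, hm, map_zero, map_zero]
    · obtain ⟨w, hw⟩ := ħ.exists_completion_sec hz
      obtain ⟨m, rfl⟩ := surjective_of_isIso (ħ.toCompletion M) U w
      refine ⟨m, fun n => ?_⟩
      rw [← toCompletion_π, mapSec_comp]
      exact hw n
  · rintro ⟨h1, h2⟩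
    have : Mono (ħ.toCompletion M) := mono_of_sec _ fun U m hm => h1 U m fun n => by
      rw [← toCompletion_π, mapSec_comp, hm, map_zero]
    have : Epi (ħ.toCompletion M) := epi_of_locally _ fun U w => by
      obtain ⟨m, hm⟩ := h2 U (fun n => mapSec (ħ.completionπ M n) U w) (fun n => by
        rw [← mapSec_comp, completionπ_systemMap])
      refine ⟨⊤, GrothendieckTopology.top_mem _ _, fun V f _ => ⟨FormalDeformation.res f m, ?_⟩⟩
      rw [mapSec_res]
      refine congrArg _ (ħ.completion_ext fun n => ?_)
      rw [← mapSec_comp, toCompletion_π, hm]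
    exact isIso_of_mono_of_epi (ħ.toCompletion M)

variable (μ : Model M E)

lemma mapSec_π_eq_zero_iff (n : ℕ) {U : Opens X} (m : M.val.obj (op U)) :
    mapSec (cokernel.π (ħ.powSub M n).arrow) U m = 0 ↔ ∀ y ∈ U, μ.ev m y ∈ ħ.germs.pow n (⊤ : E.Fam) y := by
  have h (y) (hy : y ∈ U) := (μ.ev_quot (ħ.powSub M n).arrow (ħ.openAt_pow (E := E) n)
    (ħ.exists_powSub_arrow μ n) m hy)
  constructor
  · intro h0 y hy
    have h1 := h y hy
    rw [h0, map_zero] at h1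
    exact (Submodule.Quotient.mk_eq_zero _).1 h1.symm
  · intro h0
    refine (ħ.quotModel μ n).inj _ fun y hy => (h y hy).trans ?_
    exact (Submodule.Quotient.mk_eq_zero _).2 (h0 y hy)

lemma ev_systemMap {m n : ℕ} (h : m ≤ n) {U : Opens X} (z : (cokernel (ħ.powSub M n).arrow).val.obj (op U))
    {y : X} (hy : y ∈ U) {a : E.stalk y} (ha : (ħ.quotModel μ n).ev z y = Submodule.mkQ _ a) :
    (ħ.quotModel μ m).ev (mapSec (ħ.systemMap M h) U z) y = Submodule.mkQ _ a := by
  obtain ⟨S, hS, hz⟩ := exists_of_epi (cokernel.π (ħ.powSub M n).arrow) z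
  obtain ⟨V, f, hf, hV⟩ := hS y hy
  obtain ⟨x, hx⟩ := hz f hf
  have h1 := μ.ev_quot (ħ.powSub M n).arrow (ħ.openAt_pow (E := E) n) (ħ.exists_powSub_arrow μ n) x hV
  have h2 := μ.ev_quot (ħ.powSub M m).arrow (ħ.openAt_pow (E := E) m) (ħ.exists_powSub_arrow μ m) x hV
  have h3 := (ħ.quotModel μ n).ev_res f z y hV
  have h4 := (ħ.quotModel μ m).ev_res f (mapSec (ħ.systemMap M h) U z) y hV
  rw [← mapSec_res, ← hx, ← mapSec_comp, π_systemMap] at h4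
  rw [← hx, ha] at h3
  refine h4.symm.trans (h2.trans ?_)
  refine (Submodule.Quotient.eq _).2 (ħ.germs.pow_antitone h ⊤ y ?_)
  exact (Submodule.Quotient.eq _).1 (h1.symm.trans h3)

/-- A section of the completion is a compatible system of sections of the `M / ħⁿ M`. It is encoded
by arbitrary stalkwise representatives `t n`, which need only be sections modulo `ħⁿ M`; no global
lift of each section to `M` has to exist beforehand. -/
lemma isComplete_iff : ħ.IsComplete M ↔
    (∀ (U : Opens X) (m : M.val.obj (op U)),
      (∀ n, ∀ y ∈ U, μ.ev m y ∈ ħ.germs.pow n (⊤ : E.Fam) y) → m = 0) ∧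
    (∀ (U : Opens X) (t : ℕ → ∀ y, E.stalk y),
      (∀ n, ∀ y ∈ U, GermMod (ħ.germs.pow n ⊤) y (t n)) →
      (∀ n, ∀ y ∈ U, t (n + 1) y - t n y ∈ ħ.germs.pow n ⊤ y) →
      ∃ m : M.val.obj (op U), ∀ n, ∀ y ∈ U, μ.ev m y - t n y ∈ ħ.germs.pow n ⊤ y) := by
  rw [isComplete_iff_sections]
  refine and_congr (forall₂_congr fun U m => ?_) (forall_congr' fun U => ?_)
  · simp only [ħ.mapSec_π_eq_zero_iff μ]
  have hev (n : ℕ) (m : M.val.obj (op U)) (y) (hy : y ∈ U) := (μ.ev_quot (ħ.powSub M n).arrow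
    (ħ.openAt_pow (E := E) n) (ħ.exists_powSub_arrow μ n) m hy)
  constructor
  · intro h t ht ht'
    have hg (n : ℕ) : ∀ y ∈ U, (quotGerms _ (ħ.openAt_pow (E := E) n)).IsGerm y
        fun y => Submodule.mkQ _ (t n y) := fun y hy => by
      obtain ⟨s, hs, h⟩ := ht n y hy
      exact ⟨s, hs, h.mono fun z hz => (Submodule.Quotient.eq _).2 hz⟩
    choose z hz using fun n => (ħ.quotModel μ n).glue (U := U) _ (hg n)
    obtain ⟨m, hm⟩ := h z (fun n => (ħ.quotModel μ n).ext fun y hy => by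
      rw [ħ.ev_systemMap μ n.le_succ (z (n + 1)) hy (hz (n + 1) y hy), hz n y hy]
      exact (Submodule.Quotient.eq _).2 (ht' n y hy))
    refine ⟨m, fun n y hy => (Submodule.Quotient.eq _).1 ?_⟩
    refine (hev n m y hy).symm.trans ?_
    rw [hm n]
    exact hz n y hy
  · intro h z hz
    choose t ht using fun n y => Submodule.mkQ_surjective _ ((ħ.quotModel μ n).ev (z n) y)
    obtain ⟨m, hm⟩ := h t (fun n y hy => by
      obtain ⟨s, hs, h⟩ := (ħ.quotModel μ n).isGerm (z n) y hy
      refine ⟨s, hs, h.mono fun x hx => (Submodule.Quotient.eq _).1 ((ht n x).trans hx)⟩)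
      (fun n y hy => (Submodule.Quotient.eq _).1 (by
        refine Eq.trans ?_ (ht n y).symm
        have := ħ.ev_systemMap μ n.le_succ (z (n + 1)) hy (ht (n + 1) y).symm
        rw [hz n] at this
        exact this.symm))
    refine ⟨m, fun n => (ħ.quotModel μ n).ext fun y hy => ?_⟩
    refine (hev n m y hy).trans (Eq.trans ?_ (ht n y))
    exact (Submodule.Quotient.eq _).2 (hm n y hy)

end CentralSection

end Realization

/-! ### Finiteness properties lifted along a quotient by `ħ`. -/

section Germs

open Topology Filter MGerms

variable {X : Type u} [TopologicalSpace X] {R R₀ : RGerms X}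

/-- The unit of a morphism of sheaves of rings, as a morphism of modules. -/
def RMap.unit (f : RMap R R₀) (y : X) :
    R.unit.stalk y →ₗ[R.stalk y] (f.restrict R₀.unit).stalk y where
  toFun := f.φ y
  map_add' := map_add _
  map_smul' := map_mul (f.φ y)

lemma RMap.germMap_unit (f : RMap R R₀) (x : X) : GermMap f.unit x :=
  Eventually.of_forall fun _ _ hs => f.germ hs

variable (f : RMap R R₀) (D : CentralGerm R) (hf : ∀ y a, f.φ y a = 0 ↔ ∃ b, a = b * D.h y)

include hf

lemma RMap.mem_pow_one {y : X} {a : R.stalk y} :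
    a ∈ D.pow (E := R.unit) 1 ⊤ y ↔ f.φ y a = 0 := by
  rw [hf, CentralGerm.mem_pow]
  constructor
  · rintro ⟨b, -, rfl⟩
    refine ⟨b, ?_⟩
    rw [← (D.central y b).eq, pow_one]
    rfl
  · rintro ⟨b, rfl⟩
    refine ⟨b, trivial, ?_⟩
    rw [← (D.central y b).eq, pow_one]
    rfl

lemma RMap.coh_pow_one (x : X) (h : Coh (⊥ : R₀.unit.Fam) ⊤ x) :
    Coh (E := R.unit) (D.pow 1 ⊤) ⊤ x := by
  refine ((RMap.coh_restrict_iff D hf).2 h).of_iso (f.germMap_unit x) (Eventually.of_forall openAt_top)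
    (Eventually.of_forall fun y => ?_) (Eventually.of_forall fun y => ?_)
  · ext a
    refine (f.mem_pow_one D hf).trans ⟨fun h => ⟨trivial, h⟩, fun h => h.2⟩
  · refine (eq_top_iff.2 fun m _ => Submodule.mem_sup_left ?_).symm
    obtain ⟨a, ha⟩ := f.surjective y m
    exact ⟨a, trivial, ha⟩

/-- The image of `J` in the Noetherian stalk is finitely generated, and as `J` contains `ħ`, its
intersection with the kernel is the whole kernel, a principal ideal. -/
lemma RMap.fg_of_isNoetherianRing (x : X) [IsNoetherianRing (R₀.stalk x)]
    (J : Submodule (R.stalk x) (R.unit.stalk x)) (hJ : D.pow (E := R.unit) 1 ⊤ x ≤ J) : J.FG := by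
  refine Submodule.fg_of_fg_map_of_fg_inf_ker (f.unit x) ?_ ?_
  · have : RingHomSurjective (f.φ x) := ⟨f.surjective x⟩
    -- The identity, semilinear over a surjection of rings, preserves the lattice of submodules and
    -- transfers the Noetherian property.
    let l : (f.restrict R₀.unit).stalk x →ₛₗ[f.φ x] R₀.stalk x :=
      { toFun := id
        map_add' := fun _ _ => rfl
        map_smul' := fun _ _ => rfl }
    have := (l.isNoetherian_iff_of_bijective Function.bijective_id).2 ‹IsNoetherianRing (R₀.stalk x)›
    exact IsNoetherian.noetherian _
  · have : J ⊓ LinearMap.ker (f.unit x) = Submodule.span (R.stalk x) {(D.h x : R.unit.stalk x)} := by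
      ext a
      rw [Submodule.mem_span_singleton, Submodule.mem_inf]
      refine Iff.trans ⟨fun h => h.2, fun h => ⟨hJ ((f.mem_pow_one D hf).2 h), h⟩⟩ ((hf x a).trans ?_)
      exact exists_congr fun b => eq_comm
    rw [this]
    exact Submodule.fg_span_singleton _

end Germs

/-! ### Absence of torsion, separatedness and completeness of `A` on stalks. -/

section Realization

open Topology Filter MGerms

variable {X : TopCat.{u}} {A : Sheaf (Opens.grothendieckTopology X) RingCat.{u}}
  {M N : SheafOfModules.{u} A} {E F : MGerms (ringGerms A)}

namespace CentralSection

variable (ħ : CentralSection A)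

lemma germs_torsion (h : ħ.HasNoTorsion (SheafOfModules.unit A)) (x : X) (a : (ringGerms A).stalk x)
    (ha : ħ.germs.h x * a = 0) : a = 0 := by
  have : Mono (ħ.mulPow (SheafOfModules.unit A) 1) := h
  obtain ⟨U, hx, b, hb⟩ := exists_rsec x a
  let m : (SheafOfModules.unit A).val.obj (op U) := b
  have hm : (unitModel A).ev m x = a := hb
  obtain ⟨V, f, hV, e⟩ := (unitModel A).exists_res_eq (m := mapSec (ħ.mulPow _ 1) U m) (n := 0) hx (by
    rw [ħ.ev_mulPow _ _ _ hx, hm, pow_one, map_zero]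
    exact ha)
  rw [res_zero, ← mapSec_res] at e
  have := injective_of_mono (ħ.mulPow (SheafOfModules.unit A) 1) V (e.trans (map_zero _).symm)
  rw [← hm, ← (unitModel A).ev_res f m x hV, this, map_zero]
  rfl

lemma germs_separated (μ : Model M E) (h : ħ.IsComplete M) (x : X) :
    ħ.germs.cl (⊥ : E.Fam) x = ⊥ := by
  refine eq_bot_iff.2 fun a ha => ?_
  obtain ⟨s, hs, rfl, h'⟩ := ha
  obtain ⟨V, f, m, hV, hm⟩ := μ.exists_section (U := ⊤) trivial hs
  obtain ⟨W, g, hW, h'⟩ := exists_opens_of_eventually hV h'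
  have : FormalDeformation.res g m = 0 := ((ħ.isComplete_iff μ).1 h).1 W _ fun n y hy => by
    rw [μ.ev_res g m y hy, hm y (leOfHom g hy), ← ħ.germs.adic_bot]
    exact h' y hy n
  rw [← hm x hV, ← μ.ev_res g m x hW, this, map_zero]
  rfl

lemma germs_complete (μ : Model M E) (h : ħ.IsComplete M) (V : Set X) (hV : IsOpen V)
    (t : ℕ → ∀ y, E.stalk y) (ht : ∀ n, ∀ y ∈ V, GermMod (ħ.germs.pow n ⊤) y (t n))
    (ht' : ∀ n, ∀ y ∈ V, t (n + 1) y - t n y ∈ ħ.germs.pow n ⊤ y) :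
    ∃ s, ∀ y ∈ V, E.IsGerm y s ∧ ∀ n, s y - t n y ∈ ħ.germs.pow n ⊤ y := by
  obtain ⟨m, hm⟩ := ((ħ.isComplete_iff μ).1 h).2 ⟨V, hV⟩ t ht ht'
  exact ⟨μ.ev m, fun y hy => ⟨μ.isGerm m y hy, fun n => hm n y hy⟩⟩

lemma coh_germs_pow_one (h : IsCoherent (SheafOfModules.unit ħ.quotientSheaf)) (x : X) :
    Coh (E := (ringGerms A).unit) (ħ.germs.pow 1 ⊤) ⊤ x :=
  ħ.rmap.coh_pow_one ħ.germs ħ.rmap_eq_zero_iff x ((unitModel _).isCoherent_iff.1 h x)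

end CentralSection

end Realization

/-! ### Invariance under isomorphism, and restriction of subobjects. -/

section Site

variable {C : Type u} [SmallCategory C] {J : GrothendieckTopology C} {R : Sheaf J RingCat.{u}}
  {M N : SheafOfModules.{u} R} {U : C}

lemma Spans.map {k : ℕ} {s : Fin k → M.val.obj (op U)} (h : Spans s) (e : M ≅ N) :
    Spans fun i => mapSec e.hom U (s i) := by
  intro V f m
  refine (h f (mapSec e.inv V m)).mono fun W g h => ?_
  have h1 := Submodule.mem_map_of_mem (f := mapSec e.hom W) h
  rw [Submodule.map_span, ← Set.range_comp, mapSec_res, ← mapSec_comp, e.inv_hom_id, mapSec_id] at h1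
  have h2 : (mapSec e.hom W ∘ fun i => FormalDeformation.res (g ≫ f) (s i)) =
    fun i => FormalDeformation.res (g ≫ f) (mapSec e.hom U (s i)) := funext fun i => mapSec_res ..
  rwa [h2] at h1

lemma SpansRel.map {k l : ℕ} {s : Fin k → M.val.obj (op U)} {r : Fin l → Fin k → R.obj.obj (op U)}
    (h : SpansRel s r) (e : M ≅ N) : SpansRel (fun i => mapSec e.hom U (s i)) r where
  rel j := by
    have := congrArg (mapSec e.hom U) (h.rel j)
    simpa only [map_sum, map_smul, map_zero] using this
  span V f c hc := h.span f c (injective_of_mono e.hom V (by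
    rw [map_sum, map_zero, ← hc]
    exact Finset.sum_congr rfl fun i _ => by rw [map_smul, mapSec_res]))

lemma IsCoherent.of_iso (h : IsCoherent M) (e : M ≅ N) : IsCoherent N := by
  rw [isCoherent_iff] at h ⊢
  refine ⟨fun U => (h.1 U).mono fun V _ => ?_, fun U k s => (h.2 U k fun i => mapSec e.inv U (s i)).mono
    fun V f => ?_⟩
  · rintro ⟨k, s, hs⟩
    exact ⟨k, _, hs.map e⟩
  · rintro ⟨l, r, hr⟩
    refine ⟨l, r, ?_⟩
    have h2 : (fun i => mapSec e.hom V (res f (mapSec e.inv U (s i)))) = fun i => res f (s i) :=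
      funext fun i => by rw [mapSec_res, ← mapSec_comp, e.inv_hom_id, mapSec_id]
    exact h2 ▸ hr.map e

lemma isIso_of_surjective (φ : M ⟶ N) [Mono φ] (h : ∀ U, Function.Surjective (mapSec φ U)) :
    IsIso φ := by
  have : Epi φ := epi_of_locally _ fun U m => ⟨⊤, J.top_mem _, fun V f _ => h V _⟩
  exact isIso_of_mono_of_epi φ

/-- An inclusion restricted to `W` remains mono, so it is an isomorphism as soon as it is surjective
on sections over objects of `W`; this is compared inside `M`. -/
lemma isIso_overMap_ofLE {M : SheafOfModules.{u} (R.over U)} {S T : Subobject M} (h : S ≤ T) {W : C}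
    (f : W ⟶ U) : IsIso ((SheafOfModules.overMap R f).map (Subobject.ofLE S T h)) ↔
      ∀ Z : Over W, (rangeSub T.arrow).obj (op ((Over.map f).obj Z)) ≤
        (rangeSub S.arrow).obj (op ((Over.map f).obj Z)) := by
  have hc : Subobject.ofLE S T h ≫ T.arrow = S.arrow := Subobject.ofLE_arrow h
  constructor
  · intro hi Z
    rintro _ ⟨t, rfl⟩
    obtain ⟨s, hs⟩ := surjective_of_isIso ((SheafOfModules.overMap R f).map (Subobject.ofLE S T h)) Z t
    have hs' : mapSec (Subobject.ofLE S T h) ((Over.map f).obj Z) s = t := hs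
    refine ⟨s, ?_⟩
    rw [← hs', ← hc]
    rfl
  · intro hle
    have : Mono ((SheafOfModules.overMap R f).map (Subobject.ofLE S T h)) := mono_of_sec _ fun Z m hm =>
      injective_of_mono (Subobject.ofLE S T h) ((Over.map f).obj Z) (hm.trans (map_zero _).symm)
    refine isIso_of_surjective _ fun Z t => ?_
    obtain ⟨s, hs⟩ := hle Z ⟨t, rfl⟩
    refine ⟨s, injective_of_mono T.arrow ((Over.map f).obj Z) (Eq.trans ?_ hs)⟩
    rw [← hc]
    rfl

lemma rangeSub_mk (φ : N ⟶ M) [Mono φ] : (rangeSub (Subobject.mk φ).arrow).obj (op U) =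
    (rangeSub φ).obj (op U) := by
  ext m
  constructor
  · rintro ⟨s, rfl⟩
    refine ⟨mapSec (Subobject.underlyingIso φ).hom U s, ?_⟩
    rw [← mapSec_comp, Subobject.underlyingIso_hom_comp_eq_mk]
  · rintro ⟨s, rfl⟩
    refine ⟨mapSec (Subobject.underlyingIso φ).inv U s, ?_⟩
    rw [← mapSec_comp, Subobject.underlyingIso_arrow]

instance mono_over (φ : M ⟶ N) [Mono φ] (U : C) : Mono (SheafOfModules.Hom.over φ U) :=
  mono_of_sec _ fun Z _ hm => injective_of_mono φ Z.left (hm.trans (map_zero _).symm)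

end Site

/-! ### Subobjects over an open set as families of submodules of stalks. -/

section Realization

open Topology Filter MGerms

variable {X : TopCat.{u}} {A : Sheaf (Opens.grothendieckTopology X) RingCat.{u}}
  {M N : SheafOfModules.{u} A} {E F : MGerms (ringGerms A)} {U : Opens X}

lemma Loc.exists_over_mem {Z : Over U} {P : ∀ ⦃V : Over U⦄, (V ⟶ Z) → Prop}
    (h : Loc ((Opens.grothendieckTopology X).over U) Z P) {x : X} (hx : x ∈ Z.left) :
    ∃ (V : Over U) (f : V ⟶ Z), x ∈ V.left ∧ P f := by
  obtain ⟨S, hS, h⟩ := h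
  obtain ⟨V, f, hf, hV⟩ := ((Opens.grothendieckTopology X).mem_over_iff S).1 hS x hx
  rw [Sieve.overEquiv_iff] at hf
  exact ⟨_, _, hV, h _ hf⟩

lemma loc_over_of_nhds {Z : Over U} {P : ∀ ⦃V : Over U⦄, (V ⟶ Z) → Prop}
    (h : ∀ x ∈ Z.left, ∃ (V : Over U) (f : V ⟶ Z), x ∈ V.left ∧ ∀ ⦃W⦄ (g : W ⟶ V), P (g ≫ f)) :
    Loc ((Opens.grothendieckTopology X).over U) Z P := by
  let S : Sieve Z :=
    { arrows := fun W f => ∀ ⦃W'⦄ (g : W' ⟶ W), P (g ≫ f)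
      downward_closed := fun {W W'} f hf g W'' g' => by
        rw [← Category.assoc]
        exact hf _ }
  refine ⟨S, ((Opens.grothendieckTopology X).mem_over_iff S).2 fun x hx => ?_, fun V f hf => ?_⟩
  · obtain ⟨V, f, hV, h⟩ := h x hx
    refine ⟨V.left, f.left, ?_, hV⟩
    rw [Sieve.overEquiv_iff]
    refine fun W g => ?_
    have e : Over.mk (f.left ≫ Z.hom) = V := by
      rw [Over.w]
      rfl
    have hg := h (g ≫ eqToHom e)
    rwa [Category.assoc, show eqToHom e ≫ f = Over.homMk f.left from Subsingleton.elim _ _] at hg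
  · exact Category.id_comp f ▸ hf (𝟙 V)

namespace Model

variable (μ : Model M E) (S T : Subobject (M.over U))

/-- The germs of the elements of a submodule of `M` over `U`. -/
def fam : E.Fam := fun y => Submodule.span _ {e | ∃ (Z : Over U) (m : (M.over U).val.obj (op Z)),
  m ∈ (rangeSub S.arrow).obj (op Z) ∧ y ∈ Z.left ∧ μ.ev (ofOver m) y = e}

variable {S T}

/-- The intersection of two open sets over `U`. -/
abbrev overInf (Z : Over U) (V : Opens X) : Over U := Over.mk (homOfLE inf_le_left ≫ Z.hom : Z.left ⊓ V ⟶ U)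

/-- The germs of sections of a subobject already form a submodule: two sections can be added on the
intersection of their domains, and a scalar in the stalk comes from a section on a neighbourhood. -/
lemma mem_fam {y : X} (hy : y ∈ U) {e : E.stalk y} : e ∈ μ.fam S y ↔
    ∃ (Z : Over U) (m : (M.over U).val.obj (op Z)),
      m ∈ (rangeSub S.arrow).obj (op Z) ∧ y ∈ Z.left ∧ μ.ev (ofOver m) y = e := by
  refine ⟨fun h => ?_, fun h => Submodule.subset_span h⟩
  induction h using Submodule.span_induction with
  | mem e h => exact h
  | zero => exact ⟨Over.mk (𝟙 U), 0, zero_mem _, hy, congrFun (map_zero (μ.ev (U := U))) y⟩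
  | add a b _ _ ha hb =>
    obtain ⟨Z, m, hm, hZ, rfl⟩ := ha
    obtain ⟨Z', m', hm', hZ', rfl⟩ := hb
    let f : overInf Z Z'.left ⟶ Z := Over.homMk (homOfLE inf_le_left)
    let f' : overInf Z Z'.left ⟶ Z' := Over.homMk (homOfLE inf_le_right)
    refine ⟨overInf Z Z'.left, res (M := M.over U) f m + res (M := M.over U) f' m',
      add_mem (res_mem _ f hm) (res_mem _ f' hm'), ⟨hZ, hZ'⟩, ?_⟩
    refine (congrFun (map_add (μ.ev (U := Z.left ⊓ Z'.left)) (res f.left (ofOver m))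
      (res f'.left (ofOver m'))) y).trans ?_
    exact congrArg₂ _ (μ.ev_res f.left (ofOver m) y ⟨hZ, hZ'⟩) (μ.ev_res f'.left (ofOver m') y ⟨hZ, hZ'⟩)
  | smul r a _ ha =>
    obtain ⟨Z, m, hm, hZ, rfl⟩ := ha
    obtain ⟨V, hV, b, hb⟩ := exists_rsec y r
    obtain rfl : asec b y = r := hb
    let f : overInf Z V ⟶ Z := Over.homMk (homOfLE inf_le_left)
    let g : Z.left ⊓ V ⟶ V := homOfLE inf_le_right
    let c := toOver (R := A) (U := U) (overInf Z V) (rres (R := A) g b)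
    refine ⟨overInf Z V, c • res (M := M.over U) f m,
      Submodule.smul_mem _ _ (res_mem _ f hm), ⟨hZ, hV⟩, ?_⟩
    refine (μ.smul (rres g b) (res f.left (ofOver m)) y ⟨hZ, hV⟩).trans ?_
    rw [asec_res g _ ⟨hZ, hV⟩, μ.ev_res f.left (ofOver m) y ⟨hZ, hV⟩]

/-- A subobject is recovered from its germs because the image of its inclusion is local. -/
lemma mem_rangeSub_iff {Z : Over U} (m : (M.over U).val.obj (op Z)) :
    m ∈ (rangeSub S.arrow).obj (op Z) ↔ ∀ y ∈ Z.left, μ.ev (ofOver m) y ∈ μ.fam S y := by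
  refine ⟨fun h y hy => (μ.mem_fam (leOfHom Z.hom hy)).2 ⟨Z, m, h, hy, rfl⟩, fun h => ?_⟩
  have hl : Loc ((Opens.grothendieckTopology X).over U) Z
      fun V f => res f m ∈ (rangeSub S.arrow).obj (op V) := loc_over_of_nhds fun x hx => by
    obtain ⟨Z', m', hm', hZ', e⟩ := (μ.mem_fam (leOfHom Z.hom hx)).1 (h x hx)
    let f : overInf Z Z'.left ⟶ Z := Over.homMk (homOfLE inf_le_left)
    let f' : overInf Z Z'.left ⟶ Z' := Over.homMk (homOfLE inf_le_right)
    have hx' : x ∈ Z.left ⊓ Z'.left := ⟨hx, hZ'⟩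
    obtain ⟨V, g, hV, e⟩ := μ.exists_res_eq (m := res f'.left (ofOver m')) (n := res f.left (ofOver m))
      hx' ((μ.ev_res f'.left (ofOver m') x hx').trans (e.trans (μ.ev_res f.left (ofOver m) x hx').symm))
    let g' : Over.mk (g ≫ (overInf Z Z'.left).hom) ⟶ overInf Z Z'.left := Over.homMk g
    refine ⟨Over.mk (g ≫ (overInf Z Z'.left).hom), g' ≫ f, hV, fun W k => ?_⟩
    rw [res_comp, res_comp]
    have e' : res (M := M.over U) g' (res f m) = res (M := M.over U) g' (res f' m') := e.symm
    rw [e']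
    exact res_mem _ _ (res_mem _ _ (res_mem _ _ hm'))
  obtain ⟨Q, hQ, hl⟩ := hl
  exact isLocalSub_rangeSub S.arrow m Q hQ hl

lemma fam_mono (h : S ≤ T) {y : X} : μ.fam S y ≤ μ.fam T y := by
  refine Submodule.span_mono ?_
  rintro e ⟨Z, m, ⟨s, rfl⟩, hy, rfl⟩
  refine ⟨Z, _, ⟨mapSec (Subobject.ofLE S T h) Z s, ?_⟩, hy, rfl⟩
  rw [← mapSec_comp, Subobject.ofLE_arrow]

lemma isIso_overMap_iff (h : S ≤ T) {W : Opens X} (hW : W ≤ U) :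
    IsIso ((SheafOfModules.overMap A (homOfLE hW)).map (Subobject.ofLE S T h)) ↔
      ∀ y ∈ W, μ.fam T y = μ.fam S y := by
  refine (isIso_overMap_ofLE h (homOfLE hW)).trans ⟨fun h1 y hy => ?_, fun h1 Z m hm => ?_⟩
  · refine le_antisymm (fun e he => ?_) (μ.fam_mono h)
    obtain ⟨Z, m, hm, hZ, rfl⟩ := (μ.mem_fam (hW hy)).1 he
    let V : Over W := Over.mk (homOfLE inf_le_right : Z.left ⊓ W ⟶ W)
    let f : (Over.map (homOfLE hW)).obj V ⟶ Z := Over.homMk (homOfLE inf_le_left)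
    refine (μ.mem_fam (hW hy)).2 ⟨_, _, h1 V (res_mem _ f hm), ⟨hZ, hy⟩, ?_⟩
    exact μ.ev_res f.left (ofOver m) y ⟨hZ, hy⟩
  · refine (μ.mem_rangeSub_iff m).2 fun y hy => ?_
    rw [← h1 y (leOfHom Z.hom hy)]
    exact (μ.mem_rangeSub_iff m).1 hm y hy

lemma ftm_fam (h : LocFG (S : SheafOfModules.{u} (A.over U))) {x : X} (hx : x ∈ U) :
    FTm ⊥ (μ.fam S) x := by
  obtain ⟨V, _, hV, k, s, hs⟩ := (h (Over.mk (𝟙 U))).exists_over_mem (x := x) hx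
  let t : Fin k → M.val.obj (op V.left) := fun i => ofOver (mapSec S.arrow V (s i))
  refine FTm.bot_iff.2 ⟨Fin k, inferInstance, fun i => μ.ev (t i), fun i => μ.isGerm _ _ hV, ?_⟩
  filter_upwards [eventually_mem hV] with y hy
  refine le_antisymm (fun e he => ?_) (Submodule.span_le.2 ?_)
  · obtain ⟨Z, m, ⟨n, rfl⟩, hZ, rfl⟩ := (μ.mem_fam (leOfHom V.hom hy)).1 he
    let f : overInf Z V.left ⟶ Z := Over.homMk (homOfLE inf_le_left)
    let g : overInf Z V.left ⟶ V := Over.homMk (homOfLE inf_le_right)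
    obtain ⟨W, p, hW, hp⟩ := (hs g (res f n)).exists_over_mem (x := y) ⟨hZ, hy⟩
    obtain ⟨c, hc⟩ := mem_span_range.1 hp
    have h1 := congrArg (mapSec S.arrow W) hc
    rw [map_sum] at h1
    simp only [map_smul, mapSec_res] at h1
    have h2 : μ.ev (res p.left (res f.left (ofOver (mapSec S.arrow Z n)))) y =
        μ.ev (∑ i, ofOverRing (c i) • res (p ≫ g).left (t i)) y := congrArg (fun z => μ.ev (U := W.left) z y) h1
    have hy' : y ∈ Z.left ⊓ V.left := ⟨hZ, hy⟩
    rw [μ.ev_res p.left _ y hW, μ.ev_comb _ _ hW] at h2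
    replace h2 := (μ.ev_res f.left (ofOver (mapSec S.arrow Z n)) y hy').symm.trans h2
    refine mem_span_range.2 ⟨fun i => asec (ofOverRing (c i)) y, h2.trans ?_⟩
    exact Finset.sum_congr rfl fun i _ => congrArg _ (μ.ev_res _ _ _ hW)
  · rintro _ ⟨i, rfl⟩
    exact (μ.mem_fam (leOfHom V.hom hy)).2 ⟨V, _, ⟨s i, rfl⟩, hy, rfl⟩

lemma fam_mk (φ : N ⟶ M) [Mono φ] {K : E.Fam} (hK : ∀ (V : Opens X) (m : M.val.obj (op V)),
    m ∈ (rangeSub φ).obj (op V) ↔ ∀ y ∈ V, μ.ev m y ∈ K y) (hKo : ∀ x, OpenAt K x) {x : X} (hx : x ∈ U) :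
    μ.fam (Subobject.mk (SheafOfModules.Hom.over φ U)) x = K x := by
  ext e
  rw [μ.mem_fam hx]
  constructor
  · rintro ⟨Z, m, hm, hZ, rfl⟩
    rw [rangeSub_mk] at hm
    exact (hK Z.left (ofOver m)).1 hm x hZ
  · intro he
    obtain ⟨s, hs, rfl⟩ := E.exists_germ x e
    obtain ⟨V, f, m, hV, hm⟩ := μ.exists_section hx hs
    obtain ⟨W, g, hW, h⟩ := exists_opens_of_eventually hV (hKo x s hs he)
    let Z : Over U := Over.mk (g ≫ f)
    let n : M.val.obj (op W) := res g m
    let m' : (M.over U).val.obj (op Z) := n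
    refine ⟨Z, m', ?_, hW, ?_⟩
    · rw [rangeSub_mk]
      refine (hK W (res g m)).2 fun y hy => ?_
      rw [μ.ev_res g m y hy, hm y (leOfHom g hy)]
      exact h y hy
    · exact (μ.ev_res g m x hW).trans (hm x hV)

end Model

end Realization

/-! ### Images of ideals in a quotient ring. -/

section Germs

open Topology Filter MGerms

variable {X : Type u} [TopologicalSpace X] {R R₀ : RGerms X}

open Classical in
/-- The images over `U` of ideals by a surjective morphism of sheaves of rings. -/
def RMap.map (f : RMap R R₀) (U : Set X) (J : R.unit.Fam) : R₀.unit.Fam := fun y =>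
  if y ∈ U then Ideal.map (f.φ y) (J y) else ⊥

variable (f : RMap R R₀) {U : Set X} {J J' : R.unit.Fam}

lemma RMap.mem_map {y : X} (hy : y ∈ U) {b : R₀.stalk y} :
    b ∈ f.map U J y ↔ ∃ a ∈ J y, f.φ y a = b := by
  rw [RMap.map, if_pos hy]
  exact Ideal.mem_map_iff_of_surjective _ (f.surjective y)

lemma RMap.map_of_notMem {y : X} (hy : y ∉ U) : f.map U J y = ⊥ := if_neg hy

lemma RMap.ftm_map (hU : IsOpen U) {x : X} (hx : x ∈ U) (h : FTm ⊥ J x) : FTm ⊥ (f.map U J) x := by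
  obtain ⟨ι, _, s, hs, h⟩ := FTm.bot_iff.1 h
  refine FTm.bot_iff.2 ⟨ι, ‹_›, fun i y => f.φ y (s i y), fun i => f.germ (hs i), ?_⟩
  filter_upwards [h, hU.mem_nhds hx] with y h hy
  rw [RMap.map, if_pos hy, h]
  refine (Ideal.map_span (f.φ y) _).trans ?_
  rw [← Set.range_comp]
  rfl

/-- The ideals are controlled only on `U`. Extension by zero keeps the family open at points outside
`U`, since a section vanishing at a point vanishes nearby. -/
lemma RMap.openAt_map (hU : IsOpen U) (h : ∀ y ∈ U, FTm ⊥ J y) (x : X) : OpenAt (f.map U J) x := by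
  by_cases hx : x ∈ U
  · exact (f.ftm_map hU hx (h x hx)).openAt (openAt_bot x)
  · intro s hs h
    rw [f.map_of_notMem hx] at h
    filter_upwards [openAt_bot x s hs h] with y hy
    rw [(Submodule.mem_bot _).1 hy]
    exact zero_mem _

lemma RMap.map_mono (h : ∀ y ∈ U, J y ≤ J' y) (x : X) : f.map U J x ≤ f.map U J' x := by
  by_cases hx : x ∈ U
  · intro b hb
    obtain ⟨a, ha, rfl⟩ := (f.mem_map hx).1 hb
    exact (f.mem_map hx).2 ⟨a, h x hx ha, rfl⟩
  · rw [f.map_of_notMem hx]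
    exact bot_le

end Germs

/-! ### Transfer of the Noetherian property from `A₀` to germs and back to `A`. -/

section Realization

open Topology Filter MGerms

variable {X : TopCat.{u}} {A : Sheaf (Opens.grothendieckTopology X) RingCat.{u}}
  {M N : SheafOfModules.{u} A} {E F : MGerms (ringGerms A)}

namespace Model

variable (μ : Model M E) {K K' : E.Fam} (hK : ∀ x, OpenAt K x) (hK' : ∀ x, OpenAt K' x)

/-- The inclusion of the sheaf defined by a family of submodules. -/
def subHom : (subGerms K hK).sheaf ⟶ M :=
  (subGerms K hK).model.hom μ (fun y => (K y).subtype) (germMap_subtype hK)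

lemma ev_subHom {U : Opens X} (m : (subGerms K hK).sheaf.val.obj (op U)) {y : X} (hy : y ∈ U) :
    μ.ev (mapSec (μ.subHom hK) U m) y = ((subGerms K hK).model.ev m y : K y).1 :=
  (subGerms K hK).model.ev_hom μ _ (germMap_subtype hK) m hy

instance : Mono (μ.subHom hK) := mono_of_sec _ fun U m hm => (subGerms K hK).model.inj m fun y hy => by
  refine Subtype.ext ((μ.ev_subHom hK m hy).symm.trans ?_)
  rw [hm, map_zero]
  rfl

lemma mem_rangeSub_subHom (U : Opens X) (m : M.val.obj (op U)) :
    m ∈ (rangeSub (μ.subHom hK)).obj (op U) ↔ ∀ y ∈ U, μ.ev m y ∈ K y := by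
  classical
  constructor
  · rintro ⟨n, rfl⟩ y hy
    rw [μ.ev_subHom hK n hy]
    exact ((subGerms K hK).model.ev n y : K y).2
  · intro h
    let s (y : X) : (subGerms K hK).stalk y := if hy : μ.ev m y ∈ K y then ⟨μ.ev m y, hy⟩ else 0
    have hs (y) (hy : y ∈ U) : (s y : K y).1 = μ.ev m y := by
      simp only [s, dif_pos (h y hy)]
    obtain ⟨n, hn⟩ := (subGerms K hK).model.glue (U := U) s fun y hy =>
      E.congr (μ.isGerm m y hy) (by filter_upwards [eventually_mem hy] with z hz using (hs z hz).symm)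
    exact ⟨n, μ.ext fun y hy => (μ.ev_subHom hK n hy).trans ((congrArg _ (hn y hy)).trans (hs y hy))⟩

variable {hK hK'} in
lemma exists_subHom (h : ∀ y, K y ≤ K' y) : ∃ i, i ≫ μ.subHom hK' = μ.subHom hK := by
  let f (y : X) : (subGerms K hK).stalk y →ₗ[(ringGerms A).stalk y] (subGerms K' hK').stalk y :=
    Submodule.inclusion (h y)
  have hf (x : X) : GermMap f x := Eventually.of_forall fun _ _ hs => hs
  refine ⟨(subGerms K hK).model.hom (subGerms K' hK').model f hf, hom_ext_sec fun U m => μ.ext fun y hy => ?_⟩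
  rw [mapSec_comp, μ.ev_subHom hK' _ hy, μ.ev_subHom hK _ hy,
    (subGerms K hK).model.ev_hom (subGerms K' hK').model f hf m hy]
  rfl

end Model

namespace CentralSection

variable (ħ : CentralSection A)

/-- The images of the ideals in `A₀` are finitely generated submodules of a coherent module, hence
coherent over `U`, and form a locally stationary family. Equality of images gives equality of the
ideals, since all of them contain the kernel `ħ A`. -/
lemma germs_noeth (h : IsLeftNoetherian ħ.quotientSheaf) (U : Set X) (hU : IsOpen U) (I : Type u)
    [Preorder I] [IsDirectedOrder I] [Nonempty I] (J : I → (ringGerms A).unit.Fam)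
    (hJ : ∀ i j, i ≤ j → ∀ y ∈ U, J i y ≤ J j y) (hJF : ∀ i, ∀ y ∈ U, FTm ⊥ (J i) y)
    (hJh : ∀ i, ∀ y ∈ U, ħ.germs.pow (E := (ringGerms A).unit) 1 ⊤ y ≤ J i y) (x : X) (hx : x ∈ U) :
    ∃ i₀, ∀ᶠ y in 𝓝 x, ∀ j, i₀ ≤ j → J j y = J i₀ y := by
  let V : Opens X := ⟨U, hU⟩
  let ν := unitModel ħ.quotientSheaf
  have hK (i : I) := ħ.rmap.openAt_map hU (hJF i)
  let φ (i : I) := ν.subHom (hK i)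
  let N : I →o Subobject ((SheafOfModules.unit ħ.quotientSheaf).over V) :=
    ⟨fun i => Subobject.mk (SheafOfModules.Hom.over (φ i) V), fun i j hij => by
      obtain ⟨k, hk⟩ := ν.exists_subHom (hK := hK i) (hK' := hK j) (ħ.rmap.map_mono (hJ i j hij))
      refine Subobject.mk_le_mk_of_comm (SheafOfModules.Hom.over k V) ?_
      exact ((SheafOfModules.overFunctor _ V).map_comp k (φ j)).symm.trans (congrArg _ hk)⟩
  have hN (i : I) : IsCoherent (N i : SheafOfModules.{u} (ħ.quotientSheaf.over V)) := by
    refine IsCoherent.of_iso ?_ (Subobject.underlyingIso _).symm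
    refine (subGerms _ (hK i)).model.isCoherent_over fun y hy => ?_
    have h1 : Coh ⊥ (ħ.rmap.map U (J i)) y := (ν.isCoherent_iff.1 h.isCoherent y).sub
      (ħ.rmap.ftm_map hU hy (hJF i y hy)) (Eventually.of_forall fun _ => le_top)
    refine ((coh_subGerms_iff openAt_bot (hK i) fun _ => bot_le).2 h1).congr
      (Eventually.of_forall fun z => ?_) (Eventually.of_forall fun _ => rfl)
    exact LinearMap.ker_eq_bot.2 Subtype.val_injective
  obtain ⟨W, hW, hxW, i₀, h⟩ := h.locally_stationary V I N hN x hx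
  refine ⟨i₀, ?_⟩
  filter_upwards [eventually_mem hxW] with y hy j hj
  refine le_antisymm (fun a ha => ?_) (hJ _ _ hj y (hW hy))
  have h1 := (ν.isIso_overMap_iff (N.monotone hj) hW).1 (h j hj) y hy
  have h2 (i : I) : ν.fam (N i) y = ħ.rmap.map U (J i) y :=
    ν.fam_mk (φ i) (ν.mem_rangeSub_subHom (hK i)) (hK i) (hW hy)
  rw [h2, h2] at h1
  have hyU : y ∈ U := hW hy
  have h3 := (ħ.rmap.mem_map hyU (J := J j)).2 ⟨a, ha, rfl⟩
  rw [h1] at h3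
  obtain ⟨b, hb, hab⟩ := (ħ.rmap.mem_map hyU).1 h3
  have h4 : a - b ∈ ħ.germs.pow (E := (ringGerms A).unit) 1 ⊤ y := by
    rw [ħ.rmap.mem_pow_one _ ħ.rmap_eq_zero_iff]
    exact (map_sub (ħ.rmap.φ y) a b).trans (sub_eq_zero.2 hab.symm)
  exact (Submodule.sub_mem_iff_left _ hb).1 (hJh i₀ y hyU h4)

lemma isLeftNoetherian_of_germs (D : Deformation (ringGerms A)) (hD : D.toCentralGerm = ħ.germs)
    (h : IsLeftNoetherian ħ.quotientSheaf) : IsLeftNoetherian A where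
  isCoherent := (unitModel A).isCoherent_iff.2 fun x => (D.good_unit x).coh
  isNoetherianRing_stalk x := by
    have h1 : IsNoetherianRing ((ringGerms ħ.quotientSheaf).stalk x) := h.isNoetherianRing_stalk x
    refine Deformation.isNoetherianRing_stalk D x fun J hJ => ?_
    rw [hD] at hJ
    exact ħ.rmap.fg_of_isNoetherianRing ħ.germs ħ.rmap_eq_zero_iff x J hJ
  locally_stationary U I _ _ _ N hN x hx := by
    let μ := unitModel A
    obtain ⟨i₀, h⟩ := Deformation.stationary_ideals D U.isOpen (fun i => μ.fam (N i))
      (fun i j hij y _ => μ.fam_mono (N.monotone hij))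
      (fun i y hy => μ.ftm_fam (FormalDeformation.isCoherent_iff.1 (hN i)).1 hy) hx
    obtain ⟨W, f, hW, h⟩ := exists_opens_of_eventually hx h
    exact ⟨W, leOfHom f, hW, i₀, fun j hj =>
      (μ.isIso_overMap_iff (N.monotone hj) (leOfHom f)).2 fun y hy => h y hy j hj⟩

end CentralSection

end Realization

/-! ### Short exact sequences of abelian sheaves and their cohomology. -/

section AbelianSheaves

open Abelian

variable {C : Type u} [SmallCategory C] {J : GrothendieckTopology C} {F G K : Sheaf J Ab.{u}}

/-- A short exact sequence of abelian sheaves, in terms of sections. -/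
structure SES (f : F ⟶ G) (g : G ⟶ K) : Prop where
  inj (U : C) (s : F.obj.obj (op U)) : f.hom.app (op U) s = 0 → s = 0
  exact (U : C) (s : G.obj.obj (op U)) : g.hom.app (op U) s = 0 ↔ ∃ t, f.hom.app (op U) t = s
  surj (U : C) (s : K.obj.obj (op U)) :
    Loc J U fun V i => ∃ t, g.hom.app (op V) t = K.obj.map i.op s

lemma mono_of_app (f : F ⟶ G) (h : ∀ (U : C) (s : F.obj.obj (op U)), f.hom.app (op U) s = 0 → s = 0) :
    Mono f := by
  refine Sheaf.mono_of_injective f fun U => ?_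
  exact (injective_iff_map_eq_zero (f.hom.app U).hom).2 (h U.unop)

lemma app_injective (f : F ⟶ G) [Mono f] (U : C) : Function.Injective (f.hom.app (op U)) := by
  have : Mono ((sheafToPresheaf J Ab.{u}).map f) := inferInstance
  have : Mono (f.hom.app (op U)) := inferInstanceAs (Mono (((sheafToPresheaf J Ab.{u}).map f).app (op U)))
  exact (AddCommGrpCat.mono_iff_injective _).1 this

lemma exists_app_of_epi (g : G ⟶ K) [Epi g] (U : C) (s : K.obj.obj (op U)) :
    Loc J U fun V i => ∃ t, g.hom.app (op V) t = K.obj.map i.op s := by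
  have : Sheaf.IsLocallySurjective g := (Sheaf.isLocallySurjective_iff_epi' Ab.{u} g).2 inferInstance
  exact ⟨_, Presheaf.imageSieve_mem J g.hom (U := op U) s, fun V i hi => hi⟩

lemma epi_of_app (g : G ⟶ K) (h : ∀ (U : C) (s : K.obj.obj (op U)),
    Loc J U fun V i => ∃ t, g.hom.app (op V) t = K.obj.map i.op s) : Epi g := by
  refine (Sheaf.isLocallySurjective_iff_epi' Ab.{u} g).1 ⟨fun {U} s => ?_⟩
  obtain ⟨S, hS, h⟩ := h U s
  exact J.superset_covering (fun V i hi => h i hi) hS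

namespace SES

variable {f : F ⟶ G} {g : G ⟶ K}

lemma zero (h : SES f g) : f ≫ g = 0 := by
  ext U s
  exact (h.exact U.unop _).2 ⟨s, rfl⟩

lemma shortExact (h : SES f g) : (ShortComplex.mk f g h.zero).ShortExact where
  exact := by
    rw [ShortComplex.exact_iff_exact_up_to_refinements]
    intro A x hx
    have h1 (U : C) (a : A.obj.obj (op U)) : ∃ t, f.hom.app (op U) t = x.hom.app (op U) a :=
      (h.exact U _).1 (congrArg (fun φ => φ.hom.app (op U) a) hx)
    choose l hl using h1
    have hi (U : C) {s t : F.obj.obj (op U)} (e : f.hom.app (op U) s = f.hom.app (op U) t) : s = t :=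
      sub_eq_zero.1 (h.inj U _ (by rw [map_sub, e, sub_self]))
    -- Preimages under `f` are unique, so choosing them section by section gives a morphism and no
    -- refinement is needed.
    let y : A ⟶ F := ⟨{
      app := fun U => AddCommGrpCat.ofHom (AddMonoidHom.mk' (l U.unop) fun a b => hi U.unop (by
        rw [map_add, hl, hl, hl, map_add]))
      naturality := fun U V i => by
        ext a
        refine hi V.unop ((hl V.unop (A.obj.map i a)).trans ?_)
        refine Eq.trans ?_ (NatTrans.naturality_apply f.hom i (l U.unop a)).symm
        exact (NatTrans.naturality_apply x.hom i a).trans (congrArg (G.obj.map i) (hl U.unop a).symm) }⟩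
    refine ⟨A, 𝟙 A, inferInstance, y, ?_⟩
    ext U a
    exact (hl U.unop a).symm
  mono_f := mono_of_app f h.inj
  epi_g := epi_of_app g h.surj

lemma of_shortExact {S : ShortComplex (Sheaf J Ab.{u})} (h : S.ShortExact) : SES S.f S.g where
  inj U s hs := by
    have := h.mono_f
    exact app_injective S.f U (hs.trans (map_zero (S.f.hom.app (op U)).hom).symm)
  exact U s := by
    have := h.mono_f
    have h1 := (h.exact.map_of_mono_of_preservesKernel (sheafToPresheaf J Ab.{u} ⋙ (evaluation _ _).obj (op U))
      inferInstance inferInstance)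
    rw [ShortComplex.ab_exact_iff] at h1
    refine ⟨h1 s, ?_⟩
    rintro ⟨t, rfl⟩
    exact congrArg (fun φ => φ.hom.app (op U) t) S.zero
  surj := by
    have := h.epi_g
    exact exists_app_of_epi S.g

variable {T : C} (hT : IsTerminal T)

lemma subsingleton_H₂ (h : SES f g) (n : ℕ) (h1 : Subsingleton (Sheaf.H F n))
    (h3 : Subsingleton (Sheaf.H K n)) : Subsingleton (Sheaf.H G n) := by
  refine subsingleton_of_forall_eq 0 fun x => ?_
  obtain ⟨y, rfl⟩ := Ext.covariant_sequence_exact₂ _ h.shortExact x (Subsingleton.elim (α := Sheaf.H K n) _ _)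
  rw [Subsingleton.elim (α := Sheaf.H F n) y 0, Ext.zero_comp]

lemma subsingleton_H₃ (h : SES f g) (n : ℕ) (h1 : Subsingleton (Sheaf.H F (n + 1)))
    (h2 : Subsingleton (Sheaf.H G n)) : Subsingleton (Sheaf.H K n) := by
  refine subsingleton_of_forall_eq 0 fun x => ?_
  obtain ⟨y, rfl⟩ := Ext.covariant_sequence_exact₃ _ h.shortExact x (rfl : n + 1 = n + 1)
    (Subsingleton.elim (α := Sheaf.H F (n + 1)) _ _)
  rw [Subsingleton.elim (α := Sheaf.H G n) y 0, Ext.zero_comp]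

lemma subsingleton_H₁ (h : SES f g) (n : ℕ) (h2 : Subsingleton (Sheaf.H G (n + 1)))
    (h3 : Subsingleton (Sheaf.H K n)) : Subsingleton (Sheaf.H F (n + 1)) := by
  refine subsingleton_of_forall_eq 0 fun x => ?_
  obtain ⟨y, rfl⟩ := Ext.covariant_sequence_exact₁ _ h.shortExact x
    (Subsingleton.elim (α := Sheaf.H G (n + 1)) _ _) (rfl : n + 1 = n + 1)
  rw [Subsingleton.elim (α := Sheaf.H K n) y 0, Ext.zero_comp]

include hT

lemma surjective_app (h : SES f g) (h1 : Subsingleton (Sheaf.H F 1)) (s : K.obj.obj (op T)) :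
    ∃ t, g.hom.app (op T) t = s := by
  obtain ⟨y, hy⟩ := Ext.covariant_sequence_exact₃ _ h.shortExact ((Sheaf.H.equiv₀ K hT).symm s)
    (rfl : 0 + 1 = 1) (Subsingleton.elim (α := Sheaf.H F 1) _ _)
  refine ⟨Sheaf.H.equiv₀ G hT y, ?_⟩
  rw [Sheaf.H.equiv₀_naturality, Sheaf.H.map_apply]
  exact (congrArg _ hy).trans ((Sheaf.H.equiv₀ K hT).apply_symm_apply s)

/-- A class in `H¹(F)` is the coboundary of a section of `K`, as `H¹(G)` vanishes; that section
lifts to `G`, so its coboundary is zero. -/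
lemma subsingleton_H_one (h : SES f g) (h2 : Subsingleton (Sheaf.H G 1))
    (hs : ∀ s : K.obj.obj (op T), ∃ t, g.hom.app (op T) t = s) : Subsingleton (Sheaf.H F 1) := by
  refine subsingleton_of_forall_eq 0 fun x => ?_
  obtain ⟨y, rfl⟩ := Ext.covariant_sequence_exact₁ _ h.shortExact x
    (Subsingleton.elim (α := Sheaf.H G 1) _ _) (rfl : 0 + 1 = 1)
  obtain ⟨t, ht⟩ := hs (Sheaf.H.equiv₀ K hT y)
  obtain ⟨z, rfl⟩ := (Sheaf.H.equiv₀ G hT).surjective t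
  rw [Sheaf.H.equiv₀_naturality] at ht
  have h4 := (Sheaf.H.equiv₀ K hT).injective ht
  rw [← h4, Sheaf.H.map_apply]
  have h5 := h.shortExact.comp_extClass
  refine (Ext.comp_assoc_of_second_deg_zero ..).trans ?_
  exact (congrArg (z.comp · _) h5).trans (Ext.comp_zero ..)

end SES

end AbelianSheaves

/-! ### Extension by zero, and injectivity of restrictions. -/

section AbelianSheaves

open Abelian

variable {X : TopCat.{u}} {F G K : Sheaf (Opens.grothendieckTopology X) Ab.{u}} {U V : Opens X}

/-- Restriction of morphisms of sheaves to an open set. -/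
abbrev overHom (f : F ⟶ G) (U : Opens X) : F.over U ⟶ G.over U :=
  ((Opens.grothendieckTopology X).overPullback Ab.{u} U).map f

lemma SES.over {f : F ⟶ G} {g : G ⟶ K} (h : SES f g) (U : Opens X) : SES (overHom f U) (overHom g U) where
  inj Z s := h.inj Z.left s
  exact Z s := h.exact Z.left s
  surj Z s := (loc_over (P := fun V i => ∃ t, g.hom.app (op V) t = K.obj.map i.op s)).2 (h.surj Z.left s)

section ExtensionByZero

variable (A A' : Sheaf ((Opens.grothendieckTopology X).over V) Ab.{u})

open Classical in
/-- The extension by zero of a sheaf on an open set, as a presheaf. -/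
def extZero : (Opens X)ᵒᵖ ⥤ Ab.{u} where
  -- Functions on the proofs of `U ≤ V`: the group is that of sections of `A` over `U` if `U ≤ V`,
  -- and trivial otherwise.
  obj U := AddCommGrpCat.of (∀ h : PLift (U.unop ≤ V), A.obj.obj (op (Over.mk (homOfLE h.down))))
  map {U U'} i := AddCommGrpCat.ofHom (AddMonoidHom.mk'
    (fun s h' => if h : U.unop ≤ V then A.obj.map (Over.homMk i.unop : Over.mk (homOfLE h'.down) ⟶
      Over.mk (homOfLE h)).op (s ⟨h⟩) else 0) fun s t => funext fun h' => by
        by_cases h : U.unop ≤ V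
        · simp only [h, dite_true, Pi.add_apply, map_add]
        · simp only [h, dite_false, Pi.add_apply, add_zero])
  map_id U := by
    refine AddCommGrpCat.hom_ext (AddMonoidHom.ext fun s => funext fun h => ?_)
    refine (dif_pos h.down).trans ?_
    exact congrArg (fun φ => φ (s h)) (A.obj.map_id (op (Over.mk (homOfLE h.down))))
  map_comp {U U' U''} i j := by
    refine AddCommGrpCat.hom_ext (AddMonoidHom.ext fun s => funext fun h => ?_)
    by_cases hU : U.unop ≤ V
    · have hU' : U'.unop ≤ V := (leOfHom i.unop).trans hU
      refine (dif_pos hU).trans (Eq.symm ((dif_pos hU').trans ?_))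
      refine (congrArg _ (dif_pos hU)).trans ?_
      exact (congrArg (fun φ => φ (s ⟨hU⟩)) (A.obj.map_comp
        (Over.homMk i.unop : Over.mk (homOfLE hU') ⟶ Over.mk (homOfLE hU)).op
        (Over.homMk j.unop : Over.mk (homOfLE h.down) ⟶ Over.mk (homOfLE hU')).op)).symm
    · refine (dif_neg hU).trans (Eq.symm ?_)
      by_cases hU' : U'.unop ≤ V
      · refine (dif_pos hU').trans ((congrArg _ (dif_neg hU)).trans (map_zero _))
      · exact dif_neg hU'

variable {A A'}

lemma extZero_map {U U' : (Opens X)ᵒᵖ} (i : U ⟶ U') (s : (extZero A).obj U) (hU : U.unop ≤ V)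
    (h : PLift (U'.unop ≤ V)) : (extZero A).map i s h =
      A.obj.map (Over.homMk i.unop : Over.mk (homOfLE h.down) ⟶ Over.mk (homOfLE hU)).op (s ⟨hU⟩) :=
  dif_pos hU

lemma extZero_map_of_not {U U' : (Opens X)ᵒᵖ} (i : U ⟶ U') (s : (extZero A).obj U) (hU : ¬U.unop ≤ V) :
    (extZero A).map i s = 0 := funext fun _ => dif_neg hU

/-- Functoriality of the extension by zero. -/
def extZeroMap (f : A ⟶ A') : extZero A ⟶ extZero A' where
  app U := AddCommGrpCat.ofHom (AddMonoidHom.mk' (fun s h => f.hom.app _ (s h)) fun s t =>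
    funext fun h => map_add _ _ _)
  naturality U U' i := by
    ext s
    funext h
    by_cases hU : U.unop ≤ V
    · refine (congrArg (f.hom.app _) (extZero_map i s hU h)).trans ?_
      refine Eq.trans ?_ (extZero_map i _ hU h).symm
      exact NatTrans.naturality_apply f.hom _ _
    · refine (congrArg (f.hom.app _) (congrFun (extZero_map_of_not i s hU) h)).trans ?_
      refine Eq.trans ?_ (congrFun (extZero_map_of_not i _ hU) h).symm
      exact map_zero _

instance mono_extZeroMap (f : A ⟶ A') [Mono f] : Mono (extZeroMap f) := by
  have (U : (Opens X)ᵒᵖ) : Mono ((extZeroMap f).app U) := by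
    rw [AddCommGrpCat.mono_iff_injective]
    intro s t h
    funext h'
    exact app_injective f _ (congrFun h h')
  exact NatTrans.mono_of_mono_app _

open Classical in
/-- Extension of a morphism. -/
def extZeroDesc (g : A ⟶ F.over V) : extZero A ⟶ F.obj where
  app U := AddCommGrpCat.ofHom (AddMonoidHom.mk' (fun s => if h : U.unop ≤ V then
      (g.hom.app (op (Over.mk (homOfLE h))) (s ⟨h⟩) : F.obj.obj U) else 0) fun s t => by
    by_cases h : U.unop ≤ V
    · refine (dif_pos h).trans (Eq.trans ?_ (congrArg₂ _ (dif_pos h) (dif_pos h)).symm)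
      exact map_add (g.hom.app (op (Over.mk (homOfLE h)))).hom _ _
    · refine (dif_neg h).trans (Eq.trans ?_ (congrArg₂ _ (dif_neg h) (dif_neg h)).symm)
      exact (add_zero _).symm)
  naturality U U' i := by
    ext s
    by_cases hU : U.unop ≤ V
    · have hU' : U'.unop ≤ V := (leOfHom i.unop).trans hU
      refine (dif_pos hU').trans ?_
      refine Eq.trans ?_ (congrArg (F.obj.map i) (dif_pos hU)).symm
      refine (congrArg (g.hom.app _) (extZero_map i s hU ⟨hU'⟩)).trans ?_
      exact NatTrans.naturality_apply g.hom _ _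
    · refine Eq.trans ?_ ((congrArg (F.obj.map i) (dif_neg hU)).trans (map_zero _)).symm
      by_cases hU' : U'.unop ≤ V
      · refine (dif_pos hU').trans ?_
        refine (congrArg (g.hom.app _) (congrFun (extZero_map_of_not i s hU) ⟨hU'⟩)).trans ?_
        exact map_zero (g.hom.app _).hom
      · exact dif_neg hU'

/-- Restriction of a morphism. -/
def extZeroRestrict (k : extZero A ⟶ F.obj) : A ⟶ F.over V := ⟨{
  app := fun Z => AddCommGrpCat.ofHom (AddMonoidHom.mk'
    (fun a => (k.app (op Z.unop.left) (fun h => A.obj.map (Over.homMk (𝟙 _)).op a) :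
      F.obj.obj (op Z.unop.left))) fun a b => by
        refine Eq.trans (congrArg _ ?_) (map_add (k.app (op Z.unop.left)).hom _ _)
        exact funext fun h => map_add (A.obj.map _).hom _ _)
  naturality := fun Z Z' i => by
    ext a
    refine Eq.trans (congrArg (k.app (op Z'.unop.left)) ?_) (NatTrans.naturality_apply k i.unop.left.op _)
    funext h
    refine Eq.trans ?_ (extZero_map i.unop.left.op _ (leOfHom Z.unop.hom) h).symm
    exact congrArg (fun φ => φ a) ((A.obj.map_comp i
      (Over.homMk (𝟙 _) : Over.mk (homOfLE h.down) ⟶ Z'.unop).op).symm.trans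
        (A.obj.map_comp (Over.homMk (𝟙 _) : Over.mk (homOfLE (leOfHom Z.unop.hom)) ⟶ Z.unop).op
          (Over.homMk i.unop.left : Over.mk (homOfLE h.down) ⟶ Over.mk (homOfLE (leOfHom Z.unop.hom))).op)) }⟩

/-- The restriction of an injective sheaf to an open set is injective. -/
instance injective_over (I : Sheaf (Opens.grothendieckTopology X) Ab.{u}) [Injective I] (V : Opens X) :
    Injective (I.over V) where
  factors {A A'} g f hf := by
    let J := Opens.grothendieckTopology X
    let adj := sheafificationAdjunction J Ab.{u}
    -- Sheafification preserves the monomorphism `extZeroMap f`, so injectivity of `I` extends the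
    -- morphism adjoint to `g`; restricting the extension to `V` factors `g` through `f`.
    let k := Injective.factorThru ((adj.homEquiv _ _).symm (extZeroDesc g))
      ((presheafToSheaf J Ab.{u}).map (extZeroMap f))
    have hk : (presheafToSheaf J Ab.{u}).map (extZeroMap f) ≫ k = (adj.homEquiv _ _).symm (extZeroDesc g) :=
      Injective.comp_factorThru _ _
    have hk' : extZeroMap f ≫ adj.homEquiv _ _ k = extZeroDesc g := by
      rw [← adj.homEquiv_naturality_left, hk, Equiv.apply_symm_apply]
    refine ⟨extZeroRestrict (adj.homEquiv _ _ k), ?_⟩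
    ext Z a
    have h1 := congrArg (fun φ => φ.app (op Z.unop.left)
      (fun h => A.obj.map (Over.homMk (𝟙 _) : Over.mk (homOfLE h.down) ⟶ Z.unop).op a)) hk'
    refine Eq.trans ?_ (h1.trans ((dif_pos (leOfHom Z.unop.hom)).trans ?_))
    · refine congrArg ((adj.homEquiv _ _ k).app (op Z.unop.left)) (funext fun h => ?_)
      exact (NatTrans.naturality_apply f.hom _ _).symm
    · refine (NatTrans.naturality_apply g.hom _ _).trans ?_
      exact congrArg (fun φ => φ (g.hom.app Z a)) (I.obj.map_id (op Z.unop.left))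

end ExtensionByZero

end AbelianSheaves

/-! ### Sections of countable products. -/

section Products

variable {C : Type u} [SmallCategory C] {J : GrothendieckTopology C} {Q : ℕ → Sheaf J Ab.{u}} {U : C}

/-- Sections over an object, as a functor to sets, commute with products. -/
def isLimitPiSections (Q : ℕ → Sheaf J Ab.{u}) (U : C) :
    IsLimit ((sheafToPresheaf J Ab.{u} ⋙ (evaluation _ _).obj (op U) ⋙
      CategoryTheory.forget Ab.{u}).mapCone (limit.cone (Discrete.functor Q))) :=
  isLimitOfPreserves _ (limit.isLimit _)

lemma exists_pi_section (z : ∀ n, (Q n).obj.obj (op U)) :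
    ∃ w : (∏ᶜ Q).obj.obj (op U), ∀ n, (Pi.π Q n).hom.app (op U) w = z n := by
  let s : (Discrete.functor Q ⋙ sheafToPresheaf J Ab.{u} ⋙ (evaluation _ _).obj (op U) ⋙
      CategoryTheory.forget Ab.{u}).sections :=
    ⟨fun n => z n.as, by
      rintro ⟨n⟩ ⟨m⟩ ⟨⟨h : n = m⟩⟩
      subst h
      exact congrArg (fun φ => φ.hom.app (op U) (z n)) ((Discrete.functor Q).map_id ⟨n⟩)⟩
  exact ⟨(Types.isLimitEquivSections (isLimitPiSections Q U)).symm s, fun n =>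
    Types.isLimitEquivSections_symm_apply (isLimitPiSections Q U) s ⟨n⟩⟩

lemma pi_section_ext {w w' : (∏ᶜ Q).obj.obj (op U)}
    (h : ∀ n, (Pi.π Q n).hom.app (op U) w = (Pi.π Q n).hom.app (op U) w') : w = w' :=
  (Types.isLimitEquivSections (isLimitPiSections Q U)).injective (Subtype.ext (funext fun n => h n.as))

lemma π_map_apply {Q' : ℕ → Sheaf J Ab.{u}} (f : ∀ n, Q n ⟶ Q' n) (w : (∏ᶜ Q).obj.obj (op U)) (n : ℕ) :
    (Pi.π Q' n).hom.app (op U) ((Limits.Pi.map f).hom.app (op U) w) =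
      (f n).hom.app (op U) ((Pi.π Q n).hom.app (op U) w) :=
  congrArg (fun φ => φ.hom.app (op U) w) (Pi.map_π f n)

lemma π_lift_apply {M : Sheaf J Ab.{u}} (f : ∀ n, M ⟶ Q n) (w : M.obj.obj (op U)) (n : ℕ) :
    (Pi.π Q n).hom.app (op U) ((Limits.Pi.lift f).hom.app (op U) w) = (f n).hom.app (op U) w :=
  congrArg (fun φ => φ.hom.app (op U) w) (Pi.lift_π f n)

end Products

/-! ### Acyclicity on a base for countable products and for limits of towers. -/

section Acyclicity

variable {X : TopCat.{u}} {F G K : Sheaf (Opens.grothendieckTopology X) Ab.{u}} {U : Opens X}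
  {B : Set (Opens X)}

/-- The cohomology of the sheaf on the open set vanishes in positive degrees. -/
def Acyclic (F : Sheaf (Opens.grothendieckTopology X) Ab.{u}) (U : Opens X) : Prop :=
  ∀ n, Subsingleton (Sheaf.H (F.over U) (n + 1))

lemma acyclic_of_injective (F : Sheaf (Opens.grothendieckTopology X) Ab.{u}) [Injective F] (U : Opens X) :
    Acyclic F U := fun n => inferInstanceAs (Subsingleton (Sheaf.H (F.over U) (n + 1)))

namespace SES

variable {f : F ⟶ G} {g : G ⟶ K}

lemma exists_section (h : SES f g) (h1 : Acyclic F U) (s : K.obj.obj (op U)) :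
    ∃ t, g.hom.app (op U) t = s :=
  (h.over U).surjective_app Over.mkIdTerminal (h1 0) s

lemma acyclic₂ (h : SES f g) (h1 : Acyclic F U) (h3 : Acyclic K U) : Acyclic G U := fun n =>
  (h.over U).subsingleton_H₂ _ (h1 n) (h3 n)

lemma acyclic₃ (h : SES f g) (h1 : Acyclic F U) (h2 : Acyclic G U) : Acyclic K U := fun n =>
  (h.over U).subsingleton_H₃ _ (h1 (n + 1)) (h2 n)

lemma subsingleton_one (h : SES f g) (h2 : Acyclic G U)
    (hs : ∀ s : K.obj.obj (op U), ∃ t, g.hom.app (op U) t = s) : Subsingleton (Sheaf.H (F.over U) 1) :=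
  (h.over U).subsingleton_H_one Over.mkIdTerminal (h2 0) hs

lemma acyclic₁ (h : SES f g) (h2 : Acyclic G U) (h3 : Acyclic K U)
    (hs : ∀ s : K.obj.obj (op U), ∃ t, g.hom.app (op U) t = s) : Acyclic F U
  | 0 => h.subsingleton_one h2 hs
  | n + 1 => (h.over U).subsingleton_H₁ _ (h2 (n + 1)) (h3 n)

lemma of_basis (hB : Opens.IsBasis B) (inj : ∀ (U : Opens X) (s : F.obj.obj (op U)),
      f.hom.app (op U) s = 0 → s = 0)
    (exact : ∀ (U : Opens X) (s : G.obj.obj (op U)), g.hom.app (op U) s = 0 ↔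
      ∃ t, f.hom.app (op U) t = s)
    (surj : ∀ U ∈ B, ∀ s : K.obj.obj (op U), ∃ t, g.hom.app (op U) t = s) : SES f g where
  inj := inj
  exact := exact
  surj U s := loc_of_nhds fun x hx => by
    obtain ⟨V, hV, hx, hVU⟩ := Opens.isBasis_iff_nbhd.1 hB hx
    obtain ⟨t, ht⟩ := surj V hV (K.obj.map (homOfLE hVU).op s)
    refine ⟨V, homOfLE hVU, hx, fun W i => ⟨G.obj.map i.op t, ?_⟩⟩
    rw [NatTrans.naturality_apply, ht, op_comp, Functor.map_comp]
    rfl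

end SES

section pi

variable {F G K : ℕ → Sheaf (Opens.grothendieckTopology X) Ab.{u}} {f : ∀ n, F n ⟶ G n} {g : ∀ n, G n ⟶ K n}

lemma SES.exists_pi_section (h : ∀ n, SES (f n) (g n)) (hF : ∀ n, Acyclic (F n) U)
    (s : (∏ᶜ K).obj.obj (op U)) : ∃ t, (Limits.Pi.map g).hom.app (op U) t = s := by
  choose t ht using fun n => (h n).exists_section (hF n) ((Pi.π K n).hom.app (op U) s)
  obtain ⟨w, hw⟩ := FormalDeformation.exists_pi_section t
  refine ⟨w, pi_section_ext fun n => ?_⟩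
  rw [π_map_apply, hw, ht]

/-- Products may fail to be exact on the right. Here sections of each `K n` lift over the same
members of the base, so they can be lifted in all factors at once. -/
lemma SES.pi (hB : Opens.IsBasis B) (h : ∀ n, SES (f n) (g n)) (hF : ∀ n, ∀ U ∈ B, Acyclic (F n) U) :
    SES (Limits.Pi.map f) (Limits.Pi.map g) := by
  refine SES.of_basis hB (fun U s hs => pi_section_ext fun n => ?_) (fun U s => ⟨fun hs => ?_, ?_⟩)
    fun U hU => SES.exists_pi_section h fun n => hF n U hU
  · refine ((h n).inj U _ ?_).trans (map_zero ((Pi.π F n).hom.app (op U)).hom).symm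
    rw [← π_map_apply f, hs, map_zero]
  · choose t ht using fun n => ((h n).exact U ((Pi.π G n).hom.app (op U) s)).1 (by
      rw [← π_map_apply g, hs, map_zero])
    obtain ⟨w, hw⟩ := FormalDeformation.exists_pi_section t
    refine ⟨w, pi_section_ext fun n => ?_⟩
    rw [π_map_apply, hw, ht]
  · rintro ⟨w, rfl⟩
    refine pi_section_ext fun n => ?_
    rw [π_map_apply, π_map_apply, map_zero]
    exact ((h n).exact U _).2 ⟨_, rfl⟩

end pi

lemma SES.exists_injective (F : Sheaf (Opens.grothendieckTopology X) Ab.{u}) :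
    ∃ (I K : Sheaf (Opens.grothendieckTopology X) Ab.{u}) (f : F ⟶ I) (g : I ⟶ K),
      Injective I ∧ SES f g :=
  ⟨_, _, Injective.ι F, cokernel.π (Injective.ι F), inferInstance,
    SES.of_shortExact (S := ShortComplex.mk _ _ (cokernel.condition (Injective.ι F)))
      { exact := ShortComplex.exact_cokernel (Injective.ι F) }⟩

/-- A countable product of sheaves which are acyclic on a base of open sets. -/
lemma acyclic_pi (hB : Opens.IsBasis B) (Q : ℕ → Sheaf (Opens.grothendieckTopology X) Ab.{u})
    (hQ : ∀ n, ∀ U ∈ B, Acyclic (Q n) U) : ∀ U ∈ B, Acyclic (∏ᶜ Q) U := by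
  intro U hU k
  induction k generalizing Q with
  -- In degree one, sections of the product of cokernels lift to the product of injectives, which is
  -- injective.
  | zero =>
    choose I K f g hI h using fun n => SES.exists_injective (Q n)
    exact (SES.pi hB h hQ).subsingleton_one (acyclic_of_injective _ U)
      (SES.exists_pi_section h fun n => hQ n U hU)
  -- Dimension shifting: the cokernels are again acyclic on the base, so the induction hypothesis
  -- applies to them.
  | succ k ih =>
    choose I K f g hI h using fun n => SES.exists_injective (Q n)
    exact ((SES.pi hB h hQ).over U).subsingleton_H₁ _ (acyclic_of_injective (∏ᶜ I) U (k + 1))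
      (ih K fun n V hV => (h n).acyclic₃ (hQ n V hV) (acyclic_of_injective _ V))

/-- A limit of a sequence of sheaves which are acyclic on a base of open sets. -/
lemma acyclic_of_tower (hB : Opens.IsBasis B) {M : Sheaf (Opens.grothendieckTopology X) Ab.{u}}
    {Q : ℕ → Sheaf (Opens.grothendieckTopology X) Ab.{u}} (τ : ∀ n, Q (n + 1) ⟶ Q n) (π : ∀ n, M ⟶ Q n)
    (hπ : ∀ n, π (n + 1) ≫ τ n = π n)
    (hsep : ∀ (U : Opens X) (s : M.obj.obj (op U)), (∀ n, (π n).hom.app (op U) s = 0) → s = 0)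
    (hcomp : ∀ (U : Opens X) (t : ∀ n, (Q n).obj.obj (op U)),
      (∀ n, (τ n).hom.app (op U) (t (n + 1)) = t n) → ∃ s, ∀ n, (π n).hom.app (op U) s = t n)
    (hτ : ∀ n, ∀ U ∈ B, ∀ t : (Q n).obj.obj (op U), ∃ s, (τ n).hom.app (op U) s = t)
    (hQ : ∀ n, ∀ U ∈ B, Acyclic (Q n) U) : ∀ U ∈ B, Acyclic M U := by
  -- The map `(wₙ) ↦ (τ wₙ₊₁ - wₙ)`, whose kernel is the limit of the tower, that is, `M`.
  let d : ∏ᶜ Q ⟶ ∏ᶜ Q := Pi.lift fun n => Pi.π Q (n + 1) ≫ τ n - Pi.π Q n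
  have hd (U : Opens X) (w : (∏ᶜ Q).obj.obj (op U)) (n : ℕ) : (Pi.π Q n).hom.app (op U) (d.hom.app (op U) w) =
      (τ n).hom.app (op U) ((Pi.π Q (n + 1)).hom.app (op U) w) - (Pi.π Q n).hom.app (op U) w :=
    π_lift_apply _ _ _
  have hs : ∀ U ∈ B, ∀ s : (∏ᶜ Q).obj.obj (op U), ∃ t, d.hom.app (op U) t = s := fun U hU s => by
    choose l hl using fun n => hτ n U hU
    -- Surjectivity of `d` on sections: starting from `0`, each term lifts the sum of the preceding
    -- term and `s n` along `τ n`.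
    let t : ∀ n, (Q n).obj.obj (op U) := fun n => Nat.rec 0
      (fun n t => l n ((Pi.π Q n).hom.app (op U) s + t)) n
    obtain ⟨w, hw⟩ := exists_pi_section t
    refine ⟨w, pi_section_ext fun n => ?_⟩
    rw [hd, hw, hw, sub_eq_iff_eq_add]
    exact hl n _
  have h : SES (Pi.lift π) d := by
    refine SES.of_basis hB (fun U s hs => hsep U s fun n => ?_) (fun U s => ⟨fun hs => ?_, ?_⟩) hs
    · rw [← π_lift_apply, hs, map_zero]
    · obtain ⟨m, hm⟩ := hcomp U (fun n => (Pi.π Q n).hom.app (op U) s) fun n => by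
        rw [← sub_eq_zero, ← hd, hs, map_zero]
      exact ⟨m, pi_section_ext fun n => (π_lift_apply _ _ _).trans (hm n)⟩
    · rintro ⟨m, rfl⟩
      refine pi_section_ext fun n => ?_
      rw [hd, π_lift_apply, π_lift_apply, map_zero, sub_eq_zero]
      exact congrArg (fun φ => φ.hom.app (op U) m) (hπ n)
  exact fun U hU => h.acyclic₁ (acyclic_pi hB Q hQ U hU) (acyclic_pi hB Q hQ U hU) (hs U hU)

end Acyclicity

/-! ### Subquotients as sheaves. -/

section Germs

open Topology Filter MGerms

variable {X : Type u} [TopologicalSpace X] {R R₀ : RGerms X} {E : MGerms R} {K₀ K : E.Fam}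

namespace MGerms

lemma openAt_map_mkQ (hK₀ : ∀ x, OpenAt K₀ x) (hK : ∀ x, OpenAt K x) (hle : ∀ x, K₀ x ≤ K x) (x : X) :
    OpenAt (E := quotGerms K₀ hK₀) (fun y => (K y).map (K₀ y).mkQ) x := by
  rintro s ⟨a, ha, h⟩ ⟨k, hk, e⟩
  rw [h.self_of_nhds] at e
  have hax : a x ∈ K x := (Submodule.sub_mem_iff_right _ hk).1 (hle x ((Submodule.Quotient.eq _).1 e))
  filter_upwards [h, hK x a ha hax] with y h1 h2
  exact ⟨a y, h2, h1.symm⟩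

/-- The subquotient `K / K₀`. -/
abbrev subquotGerms (hK₀ : ∀ x, OpenAt K₀ x) (hK : ∀ x, OpenAt K x) (hle : ∀ x, K₀ x ≤ K x) : MGerms R :=
  subGerms (E := quotGerms K₀ hK₀) _ (openAt_map_mkQ hK₀ hK hle)

variable (hK₀ : ∀ x, OpenAt K₀ x) (hK : ∀ x, OpenAt K x) (hle : ∀ x, K₀ x ≤ K x)

lemma coh_subquotGerms {x : X} (h : Coh K₀ K x) : Coh (⊥ : (subquotGerms hK₀ hK hle).Fam) ⊤ x := by
  have h1 : Coh (E := quotGerms K₀ hK₀) ⊥ (fun y => (K y).map (K₀ y).mkQ) x :=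
    h.iso (germMap_mkQ hK₀ x) (Eventually.of_forall hK) (Eventually.of_forall openAt_bot)
      (Eventually.of_forall fun y => by
        change K₀ y = K y ⊓ LinearMap.ker (K₀ y).mkQ
        rw [Submodule.ker_mkQ, inf_eq_right.2 (hle y)])
      (Eventually.of_forall fun y => (sup_bot_eq _).symm)
  refine ((coh_subGerms_iff (E := quotGerms K₀ hK₀) openAt_bot (openAt_map_mkQ hK₀ hK hle)
    fun _ => bot_le).2 h1).congr (Eventually.of_forall fun z => ?_) (Eventually.of_forall fun _ => rfl)
  exact LinearMap.ker_eq_bot.2 Subtype.val_injective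

lemma smul_subquotGerms (D : CentralGerm R) (h : ∀ y, D.pow 1 K y ≤ K₀ y) (y : X)
    (m : (subquotGerms hK₀ hK hle).stalk y) : D.h y • m = 0 := by
  obtain ⟨_, k, hk, rfl⟩ := m
  refine Subtype.ext ?_
  refine (map_smul (K₀ y).mkQ (D.h y) k).symm.trans ((Submodule.Quotient.mk_eq_zero _).2 (h y ?_))
  exact ⟨k, hk, by rw [D.mul_apply, pow_one]⟩

lemma germMap_factor (x : X) : GermMap (E := quotGerms K₀ hK₀) (F := quotGerms K hK)
    (fun y => Submodule.factor (hle y)) x := by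
  refine Eventually.of_forall fun z s => ?_
  rintro ⟨a, ha, h⟩
  refine ⟨a, ha, h.mono fun y hy => ?_⟩
  dsimp only
  rw [hy]
  rfl

end MGerms

end Germs

/-! ### The exact sequence of a subquotient and acyclicity of coherent modules killed by `ħ`. -/

section Realization

open Topology Filter MGerms

variable {X : TopCat.{u}} {A : Sheaf (Opens.grothendieckTopology X) RingCat.{u}}
  {M N : SheafOfModules.{u} A} {E F : MGerms (ringGerms A)} {K₀ K : E.Fam} {V : Opens X}

/-- The sheaf of abelian groups of sections. -/
abbrev MGerms.absheaf (E : MGerms (ringGerms A)) : Sheaf (Opens.grothendieckTopology X) Ab.{u} :=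
  (SheafOfModules.toSheaf A).obj E.sheaf

section

variable (hK₀ : ∀ x, OpenAt K₀ x) (hK : ∀ x, OpenAt K x) (hle : ∀ x, K₀ x ≤ K x)

/-- The projection `E / K₀ ⟶ E / K`. -/
def factorHom : (quotGerms K₀ hK₀).sheaf ⟶ (quotGerms K hK).sheaf :=
  (quotGerms K₀ hK₀).model.hom (quotGerms K hK).model _ (germMap_factor hK₀ hK hle)

lemma ev_factorHom {U : Opens X} (s : (quotGerms K₀ hK₀).sheaf.val.obj (op U)) {y : X} (hy : y ∈ U) :
    (quotGerms K hK).model.ev (mapSec (factorHom hK₀ hK hle) U s) y =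
      Submodule.factor (hle y) ((quotGerms K₀ hK₀).model.ev s y) :=
  (quotGerms K₀ hK₀).model.ev_hom _ _ (germMap_factor hK₀ hK hle) s hy

lemma factor_eq_zero_iff (y : X) (a : E.stalk y ⧸ K₀ y) :
    Submodule.factor (hle y) a = 0 ↔ a ∈ (K y).map (K₀ y).mkQ := by
  obtain ⟨a, rfl⟩ := (K₀ y).mkQ_surjective a
  constructor
  · exact fun h => ⟨a, (Submodule.Quotient.mk_eq_zero _).1 h, rfl⟩
  · rintro ⟨b, hb, e⟩
    rw [← e]
    exact (Submodule.Quotient.mk_eq_zero _).2 hb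

/-- This is `0 ⟶ K / K₀ ⟶ E / K₀ ⟶ E / K ⟶ 0`, through which vanishing of `H¹` yields lifting of
sections. -/
lemma ses_subquot : SES
    ((SheafOfModules.toSheaf A).map ((quotGerms K₀ hK₀).model.subHom (openAt_map_mkQ hK₀ hK hle)))
    ((SheafOfModules.toSheaf A).map (factorHom hK₀ hK hle)) where
  inj U s hs := injective_of_mono ((quotGerms K₀ hK₀).model.subHom (openAt_map_mkQ hK₀ hK hle)) U
    (hs.trans (map_zero _).symm)
  exact U s := by
    refine Iff.trans ?_ ((quotGerms K₀ hK₀).model.mem_rangeSub_subHom (openAt_map_mkQ hK₀ hK hle) U s).symm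
    refine Iff.trans (b := ∀ y ∈ U, (quotGerms K hK).model.ev (mapSec (factorHom hK₀ hK hle) U s) y = 0) ?_ ?_
    · refine ⟨fun h y hy => ?_, fun h => (quotGerms K hK).model.inj _ h⟩
      have h' : mapSec (factorHom hK₀ hK hle) U s = 0 := h
      rw [h', map_zero]
      rfl
    · refine forall₂_congr fun y hy => ?_
      refine Iff.trans (Eq.congr_left ?_) (factor_eq_zero_iff hle y ((quotGerms K₀ hK₀).model.ev (U := U) s y))
      exact ev_factorHom hK₀ hK hle (U := U) s hy
  surj U s := loc_of_nhds fun x hx => by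
    obtain ⟨a, ha, h⟩ := (quotGerms K hK).model.isGerm s x hx
    obtain ⟨W, f, hW, hs⟩ := exists_opens_of_eventually hx h
    obtain ⟨W', g, t, hW', ht⟩ := (quotGerms K₀ hK₀).model.exists_section (s := fun y => (K₀ y).mkQ (a y)) hW
      ⟨a, ha, Eventually.of_forall fun _ => rfl⟩
    refine ⟨W', g ≫ f, hW', fun W'' i => ⟨res i t, (quotGerms K hK).model.ext (U := W'') fun y hy => ?_⟩⟩
    have hy' := leOfHom i hy
    refine (ev_factorHom hK₀ hK hle (res i t) hy).trans ?_
    rw [(quotGerms K₀ hK₀).model.ev_res i t y hy, ht y hy']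
    exact ((hs y (leOfHom g hy')).symm.trans ((quotGerms K hK).model.ev_res (i ≫ g ≫ f) s y hy).symm)

end

namespace CentralSection

variable (ħ : CentralSection A)

/-- Coherent modules over the quotient are acyclic. -/
lemma acyclic_of_coh (h_acyclic : ∀ F : SheafOfModules.{u} (ħ.quotientSheaf.over V),
      IsCoherent F → ∀ n : ℕ, 0 < n → Subsingleton (cohomology F n))
    (hE : ∀ y (m : E.stalk y), ħ.germs.h y • m = 0) (h : ∀ y ∈ V, Coh (⊥ : E.Fam) ⊤ y) :
    Acyclic E.absheaf V := fun n =>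
  -- Descent of scalars to `A₀` keeps stalks and germs, so the underlying abelian sheaf, and with it
  -- the cohomology, is unchanged.
  h_acyclic ((ħ.rmap.descend (ħ.smul_eq_zero_of_rmap hE)).sheaf.over V)
    ((ħ.rmap.descend (ħ.smul_eq_zero_of_rmap hE)).model.isCoherent_over fun y hy =>
      (RMap.coh_descend_iff ħ.germs ħ.rmap_eq_zero_iff (ħ.smul_eq_zero_of_rmap hE)).2 (h y hy))
    (n + 1) n.succ_pos

end CentralSection

end Realization

/-! ### Extension by zero of families of submodules. -/

section Germs

open Topology Filter MGerms

variable {X : Type u} [TopologicalSpace X] {R : RGerms X} {E : MGerms R}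

open Classical in
/-- The extension by zero of a family of submodules on an open set. -/
def MGerms.extFam (V : Set X) (K : E.Fam) : E.Fam := fun y => if y ∈ V then K y else ⊥

variable {V : Set X} {K K' : E.Fam}

lemma MGerms.extFam_of_mem {y : X} (hy : y ∈ V) : extFam V K y = K y := if_pos hy

lemma MGerms.extFam_of_notMem {y : X} (hy : y ∉ V) : extFam V K y = ⊥ := if_neg hy

lemma MGerms.openAt_extFam (hV : IsOpen V) (hK : ∀ y ∈ V, OpenAt K y) (x : X) : OpenAt (extFam V K) x := by
  by_cases hx : x ∈ V
  · refine (hK x hx).congr ?_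
    filter_upwards [hV.mem_nhds hx] with y hy using (extFam_of_mem hy).symm
  · intro s hs h
    rw [extFam_of_notMem hx] at h
    filter_upwards [openAt_bot x s hs h] with y hy
    rw [(Submodule.mem_bot _).1 hy]
    exact zero_mem _

lemma MGerms.extFam_mono (h : ∀ y ∈ V, K y ≤ K' y) (x : X) : extFam V K x ≤ extFam V K' x := by
  by_cases hx : x ∈ V
  · rw [extFam_of_mem hx, extFam_of_mem hx]
    exact h x hx
  · rw [extFam_of_notMem hx]
    exact bot_le

end Germs

/-! ### Construction of the deformation and the criteria for coherence. -/

section Realization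

open Topology Filter MGerms

variable {X : TopCat.{u}} {A : Sheaf (Opens.grothendieckTopology X) RingCat.{u}}
  {M N : SheafOfModules.{u} A} {E F : MGerms (ringGerms A)} {K₀ K : E.Fam} {V : Opens X}
  (ħ : CentralSection A) {B : Set (Opens X)}

namespace CentralSection

/-- Since `K₀` and `K` are controlled only over `V`, they are first extended by zero. The
subquotient is then a sheaf on `X`, killed by `ħ` and coherent on `V`, hence acyclic there, and
sections of `E / K` over `V` lift to `E / K₀`. -/
lemma exists_lift (h_acyclic : ∀ F : SheafOfModules.{u} (ħ.quotientSheaf.over V),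
      IsCoherent F → ∀ n : ℕ, 0 < n → Subsingleton (cohomology F n))
    (hK : ∀ y ∈ V, Coh K₀ K y) (hK' : ∀ y ∈ V, ħ.germs.pow 1 K y ≤ K₀ y) (t : ∀ y, E.stalk y)
    (ht : ∀ y ∈ V, GermMod K y t) : ∃ t', ∀ y ∈ V, GermMod K₀ y t' ∧ t' y - t y ∈ K y := by
  have ho₀ := openAt_extFam V.isOpen fun y hy => (hK y hy).openAt
  have ho := openAt_extFam V.isOpen fun y hy => (hK y hy).1.openAt (hK y hy).openAt
  have hle : ∀ x, extFam V K₀ x ≤ extFam V K x := extFam_mono fun y hy => (hK y hy).le.self_of_nhds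
  have hV {y : X} (hy : y ∈ V) (K : E.Fam) : ∀ᶠ z in 𝓝 y, K z = extFam V K z := by
    filter_upwards [eventually_mem hy] with z hz using (extFam_of_mem hz).symm
  have hac : Acyclic (subquotGerms ho₀ ho hle).absheaf V := by
    refine ħ.acyclic_of_coh h_acyclic (smul_subquotGerms ho₀ ho hle ħ.germs fun y => ?_) fun y hy =>
      coh_subquotGerms ho₀ ho hle ((hK y hy).congr (hV hy _) (hV hy _))
    by_cases hy : y ∈ V
    · rw [extFam_of_mem hy]
      refine le_trans (ħ.germs.pow_mono 1 ?_) (hK' y hy)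
      rw [extFam_of_mem hy]
    · refine (ħ.germs.pow_le 1 _ y).trans ?_
      rw [extFam_of_notMem hy]
      exact bot_le
  obtain ⟨s, hs⟩ := (quotGerms _ ho).model.glue (U := V) (fun y => (extFam V K y).mkQ (t y)) fun y hy => by
    obtain ⟨a, ha, h⟩ := ht y hy
    refine ⟨a, ha, ?_⟩
    filter_upwards [h, hV hy K] with z hz e
    exact (Submodule.Quotient.eq _).2 (e ▸ hz)
  obtain ⟨w, hw⟩ := (ses_subquot ho₀ ho hle).exists_section hac s
  choose t' ht' using fun y => (extFam V K₀ y).mkQ_surjective ((quotGerms _ ho₀).model.ev (U := V) w y)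
  refine ⟨t', fun y hy => ⟨?_, ?_⟩⟩
  · obtain ⟨a, ha, h⟩ := (quotGerms _ ho₀).model.isGerm (U := V) w y hy
    refine ⟨a, ha, ?_⟩
    filter_upwards [h, hV hy K₀] with z hz e
    rw [e]
    exact (Submodule.Quotient.eq _).1 ((ht' z).trans hz)
  · have h1 := ev_factorHom ho₀ ho hle (U := V) w hy
    have h2 : mapSec (factorHom ho₀ ho hle) V w = s := hw
    rw [h2, hs y hy, ← ht' y] at h1
    have h3 := (Submodule.Quotient.eq _).1 h1.symm
    rwa [extFam_of_mem hy] at h3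

/-- The deformation defined by a sheaf of rings with a central section. -/
def deformation (h_torsion : ħ.HasNoTorsion (SheafOfModules.unit A))
    (h_complete : ħ.IsComplete (SheafOfModules.unit A)) (h_noetherian : IsLeftNoetherian ħ.quotientSheaf)
    (hB : Opens.IsBasis B)
    (h_acyclic : ∀ U ∈ B, ∀ F : SheafOfModules.{u} (ħ.quotientSheaf.over U),
      IsCoherent F → ∀ n : ℕ, 0 < n → Subsingleton (cohomology F n)) :
    Deformation (ringGerms A) where
  toCentralGerm := ħ.germs
  torsion := ħ.germs_torsion h_torsion
  complete := ħ.germs_complete (unitModel A) h_complete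
  separated := ħ.germs_separated (unitModel A) h_complete
  coh := ħ.coh_germs_pow_one h_noetherian.isCoherent
  noeth := ħ.germs_noeth h_noetherian
  B := {V | ∃ U ∈ B, (U : Set X) = V}
  basis x U hU := by
    obtain ⟨W, hW, hWo, hxW⟩ := mem_nhds_iff.1 hU
    obtain ⟨V, hV, hx, hVW⟩ := Opens.isBasis_iff_nbhd.1 hB (U := ⟨W, hWo⟩) hxW
    exact ⟨V, ⟨V, hV, rfl⟩, V.isOpen, hx, subset_trans hVW hW⟩
  lift E K₀ K V hV hK hK' t ht := by
    obtain ⟨U, hU, rfl⟩ := hV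
    exact ħ.exists_lift (V := U) (h_acyclic U hU) hK hK' t ht

end CentralSection

section Consequences

variable {ħ} (D : Deformation (ringGerms A)) (hD : D.toCentralGerm = ħ.germs)

include hD

lemma qc_iff_gr (μ : Model M E) : (∀ x, D.QC (⊥ : E.Fam) x) ↔ ∀ n, ħ.IsCoherentOverQuotient (ħ.gr M n) := by
  rw [Deformation.qc_bot_iff, hD]
  exact forall_congr' fun n => (ħ.isCoherentOverQuotient_gr_iff μ n).symm

lemma isComplete_of_isCoherent (h : IsCoherent M) : ħ.IsComplete M := by
  let μ := stalkModel M
  have hg (x : X) := (Deformation.coh_iff_good D).1 (μ.isCoherent_iff.1 h x)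
  have hcl (x : X) : D.cl (⊥ : (modGerms M).Fam) x = ⊥ := (hg x).2.self_of_nhds
  refine (ħ.isComplete_iff μ).2 ⟨fun U m hm => μ.inj m fun y hy => ?_, fun U t ht ht' => ?_⟩
  · rw [← Submodule.mem_bot ((ringGerms A).stalk y)]
    refine (hcl y).le (D.mem_cl (μ.isGerm m y hy) ?_)
    filter_upwards [eventually_mem hy] with z hz n
    rw [D.adic_bot, hD]
    exact hm n z hz
  · obtain ⟨s, hs⟩ := Deformation.complete_of_coh D U.isOpen (fun y _ => hcl y) (fun y _ => (hg y).1)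
      (t := t) (by rwa [hD]) (by rwa [hD])
    obtain ⟨m, hm⟩ := μ.glue s fun y hy => (hs y hy).1
    refine ⟨m, fun n y hy => ?_⟩
    rw [hm y hy, ← hD]
    exact (hs y hy).2 n

lemma isCoherent_of_isComplete (h : ħ.IsComplete M) (h' : ∀ n, ħ.IsCoherentOverQuotient (ħ.gr M n)) :
    IsCoherent M := by
  let μ := stalkModel M
  have hq := (qc_iff_gr D hD μ).2 h'
  have hc (x : X) : D.Closed (⊥ : (modGerms M).Fam) x := Eventually.of_forall fun y => by
    rw [hD]
    exact ħ.germs_separated μ h y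
  exact μ.isCoherent_iff.2 fun x => (Deformation.coh_iff_good D).2 ⟨hq x, hc x⟩

lemma isCoherent_iff_gr (hM : M.IsFiniteType) :
    IsCoherent M ↔ ∀ n, ħ.IsCoherentOverQuotient (ħ.gr M n) := by
  let μ := stalkModel M
  rw [← qc_iff_gr D hD μ, μ.isCoherent_iff]
  exact ⟨fun h x => ((Deformation.coh_iff_good D).1 (h x)).1, fun h x =>
    (Deformation.coh_iff_good D).2 (Deformation.Good.of_ftm D (μ.isFiniteType_iff.1 hM x) (h x))⟩

end Consequences

end Realization

/-! ### Vanishing of cohomology of coherent modules. -/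

section Realization

open Topology Filter MGerms

variable {X : TopCat.{u}} {A : Sheaf (Opens.grothendieckTopology X) RingCat.{u}}
  {M N : SheafOfModules.{u} A} {E F : MGerms (ringGerms A)} {V : Opens X}
  {ħ : CentralSection A} {B : Set (Opens X)}

lemma acyclic_of_subsingleton (h : ∀ y, Subsingleton (E.stalk y)) : Acyclic E.absheaf V := fun n => by
  refine Sheaf.subsingleton_H_of_isZero ((IsZero.iff_id_eq_zero _).2 ?_) _
  ext Z s
  exact Subtype.ext (funext fun y => Subsingleton.elim _ _)

/-- A complete module whose graded pieces are coherent is acyclic on the base. -/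
lemma acyclic_of_isComplete (hB : Opens.IsBasis B)
    (h_acyclic : ∀ U ∈ B, ∀ F : SheafOfModules.{u} (ħ.quotientSheaf.over U),
      IsCoherent F → ∀ n : ℕ, 0 < n → Subsingleton (cohomology F n))
    (μ : Model M E) (h : ħ.IsComplete M)
    (hE : ∀ n x, Coh (ħ.germs.pow (n + 1) (⊤ : E.Fam)) (ħ.germs.pow n ⊤) x) :
    ∀ U ∈ B, Acyclic ((SheafOfModules.toSheaf A).obj M) U := by
  have ho (n : ℕ) (x : X) := ħ.openAt_pow (E := E) n x
  have hle (n : ℕ) (x : X) : ħ.germs.pow (n + 1) (⊤ : E.Fam) x ≤ ħ.germs.pow n ⊤ x :=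
    ħ.germs.pow_antitone n.le_succ ⊤ x
  let Q (n : ℕ) := quotGerms _ (ho n)
  let τ (n : ℕ) : (Q (n + 1)).sheaf ⟶ (Q n).sheaf := factorHom (ho (n + 1)) (ho n) (hle n)
  let π (n : ℕ) : M ⟶ (Q n).sheaf := μ.hom (Q n).model _ (germMap_mkQ (ho n))
  have hπ (n : ℕ) {U : Opens X} (m : M.val.obj (op U)) {y : X} (hy : y ∈ U) :
      (Q n).model.ev (mapSec (π n) U m) y = Submodule.mkQ _ (μ.ev m y) :=
    μ.ev_hom (Q n).model _ (germMap_mkQ (ho n)) m hy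
  have hτ (n : ℕ) {U : Opens X} (s : (Q (n + 1)).sheaf.val.obj (op U)) {y : X} (hy : y ∈ U) :=
    ev_factorHom (ho (n + 1)) (ho n) (hle n) s hy
  have hG (n : ℕ) (U) (hU : U ∈ B) : Acyclic (subquotGerms (ho (n + 1)) (ho n) (hle n)).absheaf U :=
    ħ.acyclic_of_coh (h_acyclic U hU) (smul_subquotGerms _ _ (hle n) ħ.germs fun y => by
      rw [ħ.germs.pow_pow, add_comm]) fun y _ => coh_subquotGerms _ _ (hle n) (hE n y)
  -- The quotients `M / ħⁿ M` are acyclic by induction on `n`, from the zero sheaf and the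
  -- extensions by the graded pieces.
  have hQ (n : ℕ) (U) (hU : U ∈ B) : Acyclic (Q n).absheaf U := by
    induction n with
    | zero =>
      refine acyclic_of_subsingleton fun y => Submodule.Quotient.subsingleton_iff.2 ?_
      rw [ħ.germs.pow_zero]
      rfl
    | succ n ih => exact (ses_subquot (ho (n + 1)) (ho n) (hle n)).acyclic₂ (hG n U hU) ih
  -- Completeness presents `M` as the limit of the tower; the transition maps are surjective on
  -- sections over the base because the graded pieces have no `H¹` there.
  refine acyclic_of_tower hB (Q := fun n => (Q n).absheaf) (fun n => (SheafOfModules.toSheaf A).map (τ n))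
    (fun n => (SheafOfModules.toSheaf A).map (π n)) (fun n => ?_) (fun U m hm => ?_) (fun U t ht => ?_)
    (fun n U hU t => (ses_subquot (ho (n + 1)) (ho n) (hle n)).exists_section (hG n U hU) t) hQ
  · refine ((SheafOfModules.toSheaf A).map_comp _ _).symm.trans (congrArg _ ?_)
    refine hom_ext_sec fun U m => (Q n).model.ext fun y hy => ?_
    rw [mapSec_comp, hτ n _ hy, hπ _ m hy, hπ _ m hy]
    rfl
  · refine ((ħ.isComplete_iff μ).1 h).1 U m fun n y hy => (Submodule.Quotient.mk_eq_zero _).1 ?_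
    refine (hπ n (U := U) m hy).symm.trans ?_
    have : mapSec (π n) U m = 0 := hm n
    rw [this, map_zero]
    rfl
  · choose r hr using fun n y => Submodule.mkQ_surjective _ ((Q n).model.ev (U := U) (t n) y)
    obtain ⟨m, hm⟩ := ((ħ.isComplete_iff μ).1 h).2 U r (fun n y hy => by
      obtain ⟨s, hs, h⟩ := (Q n).model.isGerm (U := U) (t n) y hy
      exact ⟨s, hs, h.mono fun x hx => (Submodule.Quotient.eq _).1 ((hr n x).trans hx)⟩)
      (fun n y hy => (Submodule.Quotient.eq _).1 (by
        have h1 := hτ n (U := U) (t (n + 1)) hy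
        have h2 : mapSec (τ n) U (t (n + 1)) = t n := ht n
        have h3 : (Q n).model.ev (U := U) (t n) y =
          Submodule.factor (hle n y) ((Q (n + 1)).model.ev (U := U) (t (n + 1)) y) := h2 ▸ h1
        rw [← hr, ← hr] at h3
        exact h3.symm))
    refine ⟨m, fun n => (Q n).model.ext (U := U) fun y hy => ?_⟩
    refine (hπ n (U := U) m hy).trans (Eq.trans ?_ (hr n y))
    exact (Submodule.Quotient.eq _).2 (hm n y hy)

end Realization

end FormalDeformation

end

theorem mainTheorem5 {X : TopCat.{u}} (A : Sheaf (Opens.grothendieckTopology X) RingCat.{u})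
    (ħ : FormalDeformation.CentralSection A)
    (h_torsion : ħ.HasNoTorsion (SheafOfModules.unit A))
    (h_complete : ħ.IsComplete (SheafOfModules.unit A))
    (h_noetherian : FormalDeformation.IsLeftNoetherian ħ.quotientSheaf)
    (B : Set (Opens X)) (hB : Opens.IsBasis B)
    (h_acyclic : ∀ U ∈ B, ∀ F : SheafOfModules.{u} (ħ.quotientSheaf.over U),
      FormalDeformation.IsCoherent F →
        ∀ n : ℕ, 0 < n → Subsingleton (FormalDeformation.cohomology F n)) :
    FormalDeformation.IsLeftNoetherian A ∧
    (∀ M : SheafOfModules.{u} A, M.IsFiniteType →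
      (FormalDeformation.IsCoherent M ↔ ∀ n : ℕ, ħ.IsCoherentOverQuotient (ħ.gr M n))) ∧
    (∀ M : SheafOfModules.{u} A, FormalDeformation.IsCoherent M → ħ.IsComplete M) ∧
    (∀ M : SheafOfModules.{u} A, FormalDeformation.IsCoherent M ↔
      (ħ.IsComplete M ∧ ∀ n : ℕ, ħ.IsCoherentOverQuotient (ħ.gr M n))) ∧
    (∀ M : SheafOfModules.{u} A, FormalDeformation.IsCoherent M →
      ∀ U ∈ B, ∀ n : ℕ, 0 < n →
        Subsingleton (FormalDeformation.cohomology (M.over U) n)) := by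
  let D := ħ.deformation h_torsion h_complete h_noetherian hB h_acyclic
  have hD : D.toCentralGerm = ħ.germs := rfl
  have h3 (M : SheafOfModules.{u} A) (h : FormalDeformation.IsCoherent M) : ħ.IsComplete M :=
    FormalDeformation.isComplete_of_isCoherent D hD h
  have h2 (M : SheafOfModules.{u} A) (h : FormalDeformation.IsCoherent M) (n : ℕ) :
      ħ.IsCoherentOverQuotient (ħ.gr M n) :=
    (FormalDeformation.isCoherent_iff_gr D hD h.isFiniteType).1 h n
  refine ⟨ħ.isLeftNoetherian_of_germs D hD h_noetherian,
    fun M hM => FormalDeformation.isCoherent_iff_gr D hD hM, h3, fun M => ⟨fun h => ⟨h3 M h, h2 M h⟩,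
      fun h => FormalDeformation.isCoherent_of_isComplete D hD h.1 h.2⟩, fun M hM U hU n hn => ?_⟩
  obtain ⟨n, rfl⟩ := Nat.exists_eq_succ_of_ne_zero hn.ne'
  exact FormalDeformation.acyclic_of_isComplete hB h_acyclic (FormalDeformation.stalkModel M) (h3 M hM)
    (fun n => (ħ.isCoherentOverQuotient_gr_iff (FormalDeformation.stalkModel M) n).1 (h2 M hM n)) U hU n
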